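/- Theorem 1.2. For real constants $\alpha,\beta$ with $\beta\neq 0$ put $p(\xi)=-\beta\xi^5+\alpha\xi^3$ and $\langle a\rangle=1+|a|$. For $s,b\in\mathbb R$ let $X_{s,b}$ be the Bourgain space of tempered distributions $f$ on $\mathbb R_x\times\mathbb R_t$ whose Fourier transform is a locally integrable function with $$\|f\|_{X_{s,b}}^2=\int\!\!\int\langle\xi\rangle^{2s}\langle\tau-p(\xi)\rangle^{2b}|\widehat f(\xi,\tau)|^2\,d\xi\,d\tau<\infty ,$$ and for $T>0$ let $\|u\|_{X_{s,b}^T}$ be the infimum of $\|f\|_{X_{s,b}}$ over all $f\in X_{s,b}$ that agree with $u$ for $0<t<T$ ($u\in X_{s,b}^T$ if there is such an $f$). Consider the initial-value problem $$u_t+u^2u_x+\alpha u_{xxx}+\beta u_{xxxxx}=0,\qquad u(x,0)=u_0(x),\qquad x\in\mathbb R. \tag{1}$$ By a solution of (1) on $[0,T]$ in the class $C([0,T];H^s(\mathbb R))\cap X_{s,b}$ we mean a (complex-valued) $u\in C([0,T];H^s(\mathbb R))\cap X^T_{s,b}$ with $u(0)=u_0$ that is on $\mathbb R\times(0,T)$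 a function in $L^3_{\rm loc}$ and satisfies the equation there in the sense of distributions, with $u^2u_x=\partial_x(u^3/3)$. Let $s\ge-\frac14$. Then there is $b=b(s)\in(\frac12,1)$ such that for all real $\alpha$ and $\beta\neq0$ and every $R\ge 0$ there are $T>0$ and $C\geq 0$ with the following properties. (i) For every $u_0\in H^s(\mathbb R)$ with $\|u_0\|_{H^s}\le R$ the problem (1) has a solution on $[0,T]$ in the class $C([0,T];H^s(\mathbb R))\cap X_{s,b}$, and this solution is unique in that class. (In particular the time of existence depends on the data only through $\|u_0\|_{H^s}$.) (ii) The dependence of the solution on the data is Lipschitz: if $u,v$ are the solutions on $[0,T]$ with data $u_0,v_0$, where $\|u_0\|_{H^s},\|v_0\|_{H^s}\le R$, then $$\sup_{t\in[0,T]}\|u(t)-v(t)\|_{H^s}\le C\|u_0-v_0\|_{H^s}\quad\text{and}\quad\|u-v\|_{X^T_{s,b}}\le C\|u_0-v_0\|_{H^s}.$$ -/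

import Mathlib

open MeasureTheory Set Filter Topology
open scoped SchwartzMap FourierTransform LineDeriv ENNReal NNReal

noncomputable section

namespace Kawahara

/-- The plane `ℝ_x × ℝ_t` with coordinates `p 0 = x` and `p 1 = t`.  The same plane carries the dual
variables: coordinate `0` is the spatial frequency, coordinate `1` the temporal frequency. -/
abbrev SpaceTime : Type := EuclideanSpace ℝ (Fin 2)

/-! ### Sobolev spaces -/

/-- The norm of `H^s(ℝ)` (with values in `[0, ∞]`): the `L²` norm of the function that represents
`𝓕⁻¹ (1 + |ξ|²)^{s/2} 𝓕 f`; it is `∞` when there is no such function, that is, off `H^s(ℝ)`. -/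
def hsNorm (s : ℝ) (f : 𝓢'(ℝ, ℂ)) : ℝ≥0∞ :=
  ⨅ (g : Lp ℂ 2 (volume : Measure ℝ))
    (_ : TemperedDistribution.besselPotential ℝ ℂ s f = (g : 𝓢'(ℝ, ℂ))), ‖g‖ₑ

/-- `hsNorm s` is finite exactly on `H^s(ℝ)`. -/
theorem hsNorm_lt_top_iff (s : ℝ) (f : 𝓢'(ℝ, ℂ)) :
    hsNorm s f < ∞ ↔ TemperedDistribution.MemSobolev s 2 f := by
  simp [hsNorm, iInf_lt_iff, TemperedDistribution.MemSobolev]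

/-! ### Bourgain spaces -/

/-- The phase function `p(ξ) = -β ξ⁵ + α ξ³` of the linear equation
`v_t + α v_xxx + β v_xxxxx = 0`. -/
def phase (α β ξ : ℝ) : ℝ := -β * ξ ^ 5 + α * ξ ^ 3

/-- The weight `⟨ξ⟩^{2s} ⟨τ - p(ξ)⟩^{2b}` with `⟨a⟩ = 1 + |a|`, for the angular frequencies
`ξ = 2π η₀`, `τ = 2π η₁` (Mathlib's Fourier transform has the kernel `e^{-2πi⟨p, η⟩}`). -/
def xsbWeight (α β s b : ℝ) (η : SpaceTime) : ℝ :=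
  (1 + |2 * Real.pi * η 0|) ^ (2 * s) *
    (1 + |2 * Real.pi * η 1 - phase α β (2 * Real.pi * η 0)|) ^ (2 * b)

/-- The Fourier transform of the tempered distribution `U` is the locally integrable
function `g`. -/
def HasFourierDensity (U : 𝓢'(SpaceTime, ℂ)) (g : SpaceTime → ℂ) : Prop :=
  LocallyIntegrable g ∧
    ∀ φ : 𝓢(SpaceTime, ℂ), HasCompactSupport φ → (𝓕 U) φ = ∫ η, g η * φ η

/-- The norm of the Bourgain space `X_{s,b}` (with values in `[0, ∞]`):
`‖U‖² = ∫ ⟨ξ⟩^{2s} ⟨τ - p(ξ)⟩^{2b} |Û(ξ, τ)|² dξ dτ`.  The space `X_{s,b}` consists of the tempered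
distributions of finite norm. -/
def xsbNorm (α β s b : ℝ) (U : 𝓢'(SpaceTime, ℂ)) : ℝ≥0∞ :=
  ⨅ (g : SpaceTime → ℂ) (_ : HasFourierDensity U g),
    (∫⁻ η, ENNReal.ofReal (xsbWeight α β s b η) * ‖g η‖ₑ ^ 2) ^ (1 / 2 : ℝ)

/-! ### Curves of distributions and distributions on the slab `0 < t < T` -/

/-- `Φ` is a test function on the open slab `{(x, t) : 0 < t < T}`. -/
def IsTest (T : ℝ) (Φ : 𝓢(SpaceTime, ℂ)) : Prop :=
  HasCompactSupport Φ ∧ tsupport Φ ⊆ {p : SpaceTime | p 1 ∈ Ioo 0 T}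

/-- The isometric embedding of the line at time `t`, namely `x ↦ (x, t)`. -/
def atTime (t x : ℝ) : SpaceTime := !₂[x, t]

theorem atTime_eq (t : ℝ) :
    atTime t = fun x ↦ ContinuousLinearMap.toSpanSingleton ℝ (!₂[1, 0] : SpaceTime) x
      + !₂[0, t] := by
  funext x
  ext i
  fin_cases i <;> simp [atTime]

theorem hasTemperateGrowth_atTime (t : ℝ) : (atTime t).HasTemperateGrowth := by
  rw [atTime_eq]
  fun_prop

theorem isometry_atTime (t : ℝ) : Isometry (atTime t) :=
  Isometry.of_dist_eq fun x y ↦ by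
    simp [atTime, EuclideanSpace.dist_eq, Real.dist_eq, Real.sqrt_sq_eq_abs]

/-- The slice `x ↦ Φ(x, t)` of a Schwartz function of `(x, t)`. -/
def slice (t : ℝ) (Φ : 𝓢(SpaceTime, ℂ)) : 𝓢(ℝ, ℂ) :=
  SchwartzMap.compCLMOfAntilipschitz ℂ (hasTemperateGrowth_atTime t)
    (isometry_atTime t).antilipschitz Φ

theorem slice_apply (t : ℝ) (Φ : 𝓢(SpaceTime, ℂ)) (x : ℝ) : slice t Φ x = Φ !₂[x, t] := rfl

/-- The distribution `Φ ↦ ∫₀ᵀ ⟨u(t), Φ(·, t)⟩ dt` on the slab given by a curve `t ↦ u(t)`. -/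
def curvePairing (T : ℝ) (u : ℝ → 𝓢'(ℝ, ℂ)) (Φ : 𝓢(SpaceTime, ℂ)) : ℂ :=
  ∫ t in Ioo 0 T, u t (slice t Φ)

/-- The norm of the restriction space `X_{s,b}` on the time interval `[0, T]`: the infimum of
`‖U‖_{X_{s,b}}` over all `U` that agree with the curve `u` for `0 < t < T` (so `∞` if `u` has no
extension in `X_{s,b}`). -/
def xsbNormOn (α β s b T : ℝ) (u : ℝ → 𝓢'(ℝ, ℂ)) : ℝ≥0∞ :=
  ⨅ (U : 𝓢'(SpaceTime, ℂ)) (_ : ∀ Φ, IsTest T Φ → U Φ = curvePairing T u Φ), xsbNorm α β s b U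

/-- `u ∈ C([0, T]; H^s(ℝ))`. -/
def ContinuousInHs (s T : ℝ) (u : ℝ → 𝓢'(ℝ, ℂ)) : Prop :=
  ∀ t ∈ Icc 0 T, TemperedDistribution.MemSobolev s 2 (u t) ∧
    Tendsto (fun r ↦ hsNorm s (u r - u t)) (𝓝[Icc 0 T] t) (𝓝 0)

/-! ### Solutions of the modified Kawahara equation -/

/-- The unit vector in the direction of `x`. -/
def dirX : SpaceTime := !₂[1, 0]

/-- The unit vector in the direction of `t`. -/
def dirT : SpaceTime := !₂[0, 1]

/-- The curve `u` satisfies `u_t + u² u_x + α u_xxx + β u_xxxxx = 0` in the sense of distributions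
on `0 < t < T`: on the slab it is a function `w`, locally in `L³`, and `u² u_x` is read as
`∂_x (w³ / 3)`. -/
def SolvesEquation (α β T : ℝ) (u : ℝ → 𝓢'(ℝ, ℂ)) : Prop :=
  ∃ w : SpaceTime → ℂ,
    (∀ K : Set SpaceTime, IsCompact K → K ⊆ {p | p 1 ∈ Ioo 0 T} → MemLp w 3 (volume.restrict K)) ∧
    (∀ Φ, IsTest T Φ → curvePairing T u Φ = ∫ p, w p * Φ p) ∧
    ∀ Φ : 𝓢(SpaceTime, ℂ), IsTest T Φ →
      ∫ p, (w p * ((∂_{dirT} Φ) p + α * (∂^{fun _ : Fin 3 ↦ dirX} Φ) p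
          + β * (∂^{fun _ : Fin 5 ↦ dirX} Φ) p)
        + w p ^ 3 / 3 * (∂_{dirX} Φ) p) = 0

/-- `u` is a solution on `[0, T]`, in `C([0, T]; H^s(ℝ)) ∩ X_{s,b}`, of the initial-value problem for
the modified Kawahara equation with the data `u₀`. -/
structure IsSolution (α β s b T : ℝ) (u₀ : 𝓢'(ℝ, ℂ)) (u : ℝ → 𝓢'(ℝ, ℂ)) : Prop where
  continuousInHs : ContinuousInHs s T u
  mem_xsb : xsbNormOn α β s b T u < ∞
  initial : u 0 = u₀
  equation : SolvesEquation α β T u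

end Kawahara

end

open MeasureTheory Set Filter Topology
open scoped SchwartzMap FourierTransform LineDeriv ENNReal NNReal

noncomputable section

namespace Kawahara

/-! ### The Fourier transform of functions in `L¹ ∩ L²` of the line -/

/-! The equation is solved by contraction in `X_{s,3/4}`. Divided by its weights this space is `L²`
of the plane: a coefficient `f` stands for the function whose Fourier transform is `den s Q f`,
where `Q` is the phase in the frequency units of the kernel `e^{-2πi⟨x, ξ⟩}`. The core is that
`∂ₓ(uvw)` belongs to `X_{s,0}` when `u, v, w` belong to `X_{s,3/4}`
(`exists_lintegral_conv_den_le`).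

By Plancherel and Cauchy–Schwarz for threefold convolutions (`lintegral_trilinear_sq_le`,
`lintegral_modulation`), a trilinear bound with symbol `Λ` holds as soon as `∫∫ Λ² kk(τ - Q(a) -
Q(b) - Q(c)) da db`, with `c = ξ - a - b`, is bounded in `(ξ, τ)`; here `kk` is bounded and
integrable. Two mechanisms give such a bound. If `a, b, c` are large and of one sign, then in polar
coordinates about their common mean the radial derivative of the phase sum dominates `|A| r abc`, so
`Λ² = abc` is admissible (`lintegral_high_le`). With a crude bound for low frequencies, and a
splitting of the function by the sign of its frequency, this puts `X_{-1/2,3/4}` into `L⁶`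
(`exists_eLpNorm_wave_half_le`). If instead the smallest frequency is at most half of the largest,
which is large, their group velocities differ by a multiple of the fourth power of the largest; with
the third frequency frozen, a change of variables pays for the difference of velocities
(`lintegral_pair_le`), and the weight `ww` makes the integral over the third frequency converge.

For `s ≥ -1/4` the symbol `|ξ|⟨ξ⟩ˢ ∏⟨ξᵢ⟩⁻ˢ` is at most a constant times `|ξ|^{3/4} ∏⟨ξᵢ⟩^{1/4}`.
Where `|ξ|³ ≲ ∏⟨ξᵢ⟩` this is `≲ ∏⟨ξᵢ⟩^{1/2}`, and Hölder with three `L⁶` factors suffices; elsewhere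
the frequencies are transversal and the second mechanism applies (`exists_mult_le`).

In time the argument is elementary. Once the linear flow is factored out, a source in `X_{s,0}` is
an `L²` function of frequency and time, and Duhamel's integral is its primitive, which has a whole
derivative in time while the space asks for `3/4` of one. Hence solutions of the linear equation on
a short interval extend to elements of `X_{s,3/4}` with an arbitrarily small constant in front of
the source (`exists_extension`). The nonlinear term is local in time (`Par.src_sub_src_ae`), so the
difference of two sources on an interval can be estimated through any extension of the difference of
the solutions. This device gives existence (`Par.exists_mild`), Lipschitz dependence
(`Par.exists_mild_sub`) and, by repeated restarting, uniqueness (`Par.mild_unique`) for the integral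
equation `Mild`.

It remains to match `Mild` with the distributional solutions of the theorem (`Mild.isSolution`,
`exists_mild_of_isSolution`). The main point is uniqueness for the weak linear equation among
continuous curves in `H^s` (`eqOn_zero_of_integral_slice_lin`): the time primitive `Z` of a solution
`A` with zero data satisfies `A = 2πi Q Z`, so `‖Z‖` is constant, and it starts at zero. -/

theorem integral_fourier_mul_eq {f g : ℝ → ℂ} (hf : Integrable f) (hg : Integrable g) :
    ∫ ξ, 𝓕 f ξ * g ξ = ∫ x, f x * 𝓕 g x := by
  have := VectorFourier.integral_fourierIntegral_smul_eq_flip (μ := volume) (ν := volume)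
    (L := innerₗ ℝ) Real.continuous_fourierChar continuous_inner hf hg
  rw [flip_innerₗ] at this
  exact this

theorem integral_fourierInv_mul_eq {f g : ℝ → ℂ} (hf : Integrable f) (hg : Integrable g) :
    ∫ ξ, 𝓕⁻ f ξ * g ξ = ∫ x, f x * 𝓕⁻ g x := by
  have h := integral_fourier_mul_eq hf hg.comp_neg
  have h1 : ∀ x, 𝓕 (fun y ↦ g (-y)) x = 𝓕⁻ g x := fun x ↦ by
    rw [Real.fourierInv_eq_fourier_comp_neg]
  rw [← integral_neg_eq_self]
  simp_rw [h1] at h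
  rw [← h]
  refine integral_congr_ae (ae_of_all _ fun x ↦ ?_)
  simp [Real.fourierInv_eq_fourier_neg]

theorem continuous_fourier {f : ℝ → ℂ} (hf : Integrable f) : Continuous (𝓕 f) :=
  VectorFourier.fourierIntegral_continuous Real.continuous_fourierChar continuous_inner hf

theorem continuous_fourierInv {f : ℝ → ℂ} (hf : Integrable f) : Continuous (𝓕⁻ f) := by
  have : 𝓕⁻ f = fun x ↦ 𝓕 f (-x) := funext fun x ↦ Real.fourierInv_eq_fourier_neg f x
  rw [this]
  exact (continuous_fourier hf).comp continuous_neg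

theorem norm_fourierInv_le (f : ℝ → ℂ) (x : ℝ) : ‖𝓕⁻ f x‖ ≤ ∫ y, ‖f y‖ := by
  rw [Real.fourierInv_eq_fourier_neg]
  exact VectorFourier.norm_fourierIntegral_le_integral_norm _ _ _ _ _

/-- The `L²` transform is an abstract extension and the other one an integral. Both define the same
tempered distribution, so testing against smooth compactly supported functions identifies them
almost everywhere. -/
theorem fourier_toLp_ae {f : ℝ → ℂ} (hf : Integrable f) (hf2 : MemLp f 2) :
    (𝓕 (hf2.toLp f) : Lp ℂ 2 (volume : Measure ℝ)) =ᵐ[volume] 𝓕 f := by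
  have h1 : LocallyIntegrable
      (fun x ↦ (𝓕 (hf2.toLp f) : Lp ℂ 2 (volume : Measure ℝ)) x) volume :=
    (Lp.memLp _).locallyIntegrable (by norm_num)
  refine ae_eq_of_integral_contDiff_smul_eq h1
    (continuous_fourier hf).locallyIntegrable fun g hg hgc ↦ ?_
  have hgc' : HasCompactSupport (fun x ↦ (g x : ℂ)) := hgc.comp_left (g := Complex.ofReal) rfl
  let φ : 𝓢(ℝ, ℂ) := hgc'.toSchwartzMap (Complex.ofRealCLM.contDiff.comp hg)
  have hφ : ∀ x, φ x = g x := fun x ↦ rfl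
  have h2 := congrArg (fun F : 𝓢'(ℝ, ℂ) ↦ F φ)
    (Lp.fourier_toTemperedDistribution_eq (hf2.toLp f))
  simp only [TemperedDistribution.fourier_apply, Lp.toTemperedDistribution_apply, hφ] at h2
  simp only [Complex.real_smul, smul_eq_mul] at h2 ⊢
  rw [← h2]
  have h3 := integral_fourier_mul_eq hf φ.integrable
  simp only [hφ] at h3
  simp_rw [mul_comm (g _ : ℂ)]
  rw [h3]
  refine integral_congr_ae ?_
  filter_upwards [hf2.coeFn_toLp] with x hx
  rw [hx, mul_comm, SchwartzMap.fourier_coe]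

theorem eLpNorm_fourier {f : ℝ → ℂ} (hf : Integrable f) (hf2 : MemLp f 2) :
    eLpNorm (𝓕 f) 2 volume = eLpNorm f 2 volume := by
  rw [← eLpNorm_congr_ae (fourier_toLp_ae hf hf2), ← eLpNorm_congr_ae hf2.coeFn_toLp,
    ← Lp.enorm_def, ← Lp.enorm_def, ← ofReal_norm, ← ofReal_norm, Lp.norm_fourier_eq]

theorem eLpNorm_two_sq {X : Type*} [MeasurableSpace X] {μ : Measure X} (f : X → ℂ) :
    eLpNorm f 2 μ ^ 2 = ∫⁻ x, ‖f x‖ₑ ^ 2 ∂μ := by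
  rw [eLpNorm_eq_lintegral_rpow_enorm_toReal (by norm_num) (by norm_num)]
  simp only [ENNReal.toReal_ofNat, ENNReal.rpow_ofNat]
  rw [← ENNReal.rpow_natCast, ← ENNReal.rpow_mul]
  norm_num

/-- Plancherel's identity on `L¹ ∩ L²`. -/
theorem lintegral_fourier_sq {f : ℝ → ℂ} (hf : Integrable f) (hf2 : MemLp f 2) :
    ∫⁻ x, ‖𝓕 f x‖ₑ ^ 2 = ∫⁻ x, ‖f x‖ₑ ^ 2 := by
  rw [← eLpNorm_two_sq, ← eLpNorm_two_sq, eLpNorm_fourier hf hf2]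

theorem lintegral_fourierInv_sq {f : ℝ → ℂ} (hf : Integrable f) (hf2 : MemLp f 2) :
    ∫⁻ x, ‖𝓕⁻ f x‖ₑ ^ 2 = ∫⁻ x, ‖f x‖ₑ ^ 2 := by
  rw [← lintegral_fourier_sq hf hf2]
  simp_rw [Real.fourierInv_eq_fourier_neg]
  exact (Measure.measurePreserving_neg volume).lintegral_comp_emb
    (MeasurableEquiv.neg ℝ).measurableEmbedding (fun x ↦ ‖𝓕 f x‖ₑ ^ 2)

theorem fourierInv_fourier_ae {f : ℝ → ℂ} (hf : Integrable f) (hf2 : MemLp f 2)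
    (h : Integrable (𝓕 f)) : 𝓕⁻ (𝓕 f) =ᵐ[volume] f := by
  -- both sides define the same tempered distribution
  refine ae_eq_of_integral_contDiff_smul_eq (continuous_fourierInv h).locallyIntegrable
    (hf2.locallyIntegrable (by norm_num)) fun g hg hgc ↦ ?_
  have hgc' : HasCompactSupport (fun x ↦ (g x : ℂ)) := hgc.comp_left (g := Complex.ofReal) rfl
  let φ : 𝓢(ℝ, ℂ) := hgc'.toSchwartzMap (Complex.ofRealCLM.contDiff.comp hg)
  have hφ : ∀ x, φ x = g x := fun x ↦ rfl
  simp only [Complex.real_smul]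
  simp_rw [mul_comm (g _ : ℂ), ← hφ]
  rw [integral_fourierInv_mul_eq h φ.integrable]
  rw [← SchwartzMap.fourierInv_coe, integral_fourier_mul_eq hf (𝓕⁻ φ).integrable,
    ← SchwartzMap.fourier_coe, FourierTransform.fourier_fourierInv_eq]

theorem fourier_fourierInv_ae {f : ℝ → ℂ} (hf : Integrable f) (hf2 : MemLp f 2)
    (h : Integrable (𝓕⁻ f)) : 𝓕 (𝓕⁻ f) =ᵐ[volume] f := by
  have h1 : 𝓕 f = fun x ↦ 𝓕⁻ f (-x) := by
    funext x
    rw [Real.fourierInv_eq_fourier_neg, neg_neg]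
  have h2 : 𝓕 (𝓕⁻ f) = 𝓕⁻ (𝓕 f) := by
    funext x
    rw [Real.fourierInv_eq_fourier_comp_neg (𝓕 f), h1]
    simp only [neg_neg]
  rw [h2]
  exact fourierInv_fourier_ae hf hf2 (h1 ▸ h.comp_neg)

/-! ### Bounded functions of bounded support -/

/-- Bounded measurable functions on the plane with bounded support. -/
structure Nice (f : ℝ × ℝ → ℂ) : Prop where
  meas : Measurable f
  bdd : ∃ C, ∀ p, ‖f p‖ ≤ C
  supp : ∃ R, ∀ p, R < ‖p‖ → f p = 0

namespace Nice

variable {f g : ℝ × ℝ → ℂ}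

theorem exists_bound (hf : Nice f) : ∃ C R : ℝ, 0 ≤ C ∧
    ∀ p, ‖f p‖ ≤ (Metric.closedBall (0 : ℝ × ℝ) R).indicator (fun _ ↦ C) p := by
  obtain ⟨C, hC⟩ := hf.bdd
  obtain ⟨R, hR⟩ := hf.supp
  refine ⟨C, R, (norm_nonneg _).trans (hC 0), fun p ↦ ?_⟩
  by_cases h : p ∈ Metric.closedBall (0 : ℝ × ℝ) R
  · rw [indicator_of_mem h]
    exact hC p
  · rw [indicator_of_notMem h, hR p (by simpa using h), norm_zero]

theorem memLp (hf : Nice f) (q : ℝ≥0∞) : MemLp f q := by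
  obtain ⟨C, R, hC, h⟩ := hf.exists_bound
  have h1 : MemLp ((Metric.closedBall (0 : ℝ × ℝ) R).indicator (fun _ ↦ C)) q :=
    memLp_indicator_const q Metric.isClosed_closedBall.measurableSet C
      (Or.inr measure_closedBall_lt_top.ne)
  refine h1.mono hf.meas.aestronglyMeasurable (ae_of_all _ fun p ↦ (h p).trans (le_abs_self _))

theorem integrable (hf : Nice f) : Integrable f := memLp_one_iff_integrable.1 (hf.memLp 1)

theorem mul_of_bddOn (hf : Nice f) {m : ℝ × ℝ → ℂ} (hm : Measurable m)
    (h : ∀ R : ℝ, ∃ C, ∀ p, ‖p‖ ≤ R → ‖m p‖ ≤ C) : Nice (fun p ↦ m p * f p) := by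
  obtain ⟨C, hC⟩ := hf.bdd
  obtain ⟨R, hR⟩ := hf.supp
  obtain ⟨M, hM⟩ := h R
  refine ⟨hm.mul hf.meas, ⟨max M 0 * C, fun p ↦ ?_⟩, R, fun p hp ↦ by simp [hR p hp]⟩
  rw [norm_mul]
  rcases le_or_gt ‖p‖ R with hp | hp
  · exact mul_le_mul ((hM p hp).trans (le_max_left _ _)) (hC p) (norm_nonneg _)
      (le_max_right _ _)
  · rw [hR p hp, norm_zero, mul_zero]
    exact mul_nonneg (le_max_right _ _) ((norm_nonneg _).trans (hC 0))

theorem continuous_mul (hf : Nice f) {m : ℝ × ℝ → ℂ} (hm : Continuous m) :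
    Nice (fun p ↦ m p * f p) := by
  refine hf.mul_of_bddOn hm.measurable fun R ↦ ?_
  obtain ⟨C, hC⟩ := (isCompact_closedBall (0 : ℝ × ℝ) R).exists_bound_of_continuousOn
    hm.continuousOn
  exact ⟨C, fun p hp ↦ hC p (by simpa using hp)⟩

theorem indicator (hf : Nice f) {S : Set (ℝ × ℝ)} (hS : MeasurableSet S) :
    Nice (S.indicator f) := by
  obtain ⟨C, hC⟩ := hf.bdd
  obtain ⟨R, hR⟩ := hf.supp
  refine ⟨hf.meas.indicator hS, ⟨C, fun p ↦ (norm_indicator_le_norm_self _ _).trans (hC p)⟩, R,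
    fun p hp ↦ ?_⟩
  simp [hR p hp]

theorem ofReal_norm (hf : Nice f) : Nice (fun p ↦ (‖f p‖ : ℂ)) := by
  obtain ⟨C, hC⟩ := hf.bdd
  obtain ⟨R, hR⟩ := hf.supp
  exact ⟨hf.meas.norm.complex_ofReal, ⟨C, fun p ↦ by simpa using hC p⟩, R,
    fun p hp ↦ by simp [hR p hp]⟩

theorem add (hf : Nice f) (hg : Nice g) : Nice (f + g) := by
  obtain ⟨C, hC⟩ := hf.bdd
  obtain ⟨R, hR⟩ := hf.supp
  obtain ⟨C', hC'⟩ := hg.bdd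
  obtain ⟨R', hR'⟩ := hg.supp
  refine ⟨hf.meas.add hg.meas, ⟨C + C', fun p ↦ (norm_add_le _ _).trans
    (add_le_add (hC p) (hC' p))⟩, max R R', fun p hp ↦ ?_⟩
  simp [hR p ((le_max_left _ _).trans_lt hp), hR' p ((le_max_right _ _).trans_lt hp)]

theorem const_smul (hf : Nice f) (c : ℂ) : Nice (c • f) :=
  hf.continuous_mul (m := fun _ ↦ c) continuous_const

theorem zero : Nice 0 := ⟨measurable_const, ⟨0, by simp⟩, 0, by simp⟩

theorem of_continuous (hf : Continuous f) (h : HasCompactSupport f) : Nice f := by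
  obtain ⟨C, hC⟩ := h.exists_bound_of_continuous hf
  obtain ⟨R, hR⟩ := h.isCompact.isBounded.subset_closedBall 0
  refine ⟨hf.measurable, ⟨C, hC⟩, R, fun p hp ↦ ?_⟩
  by_contra hne
  have := hR (subset_tsupport f hne)
  simp at this
  exact absurd hp (not_lt.2 (by simpa using this))

end Nice

theorem exists_nice_near {p : ℝ≥0∞} (hp : p ≠ ∞)
    (f : Lp ℂ p (volume : Measure (ℝ × ℝ))) {ε : ℝ} (hε : 0 < ε) :
    ∃ (g : ℝ × ℝ → ℂ) (hg : Nice g), ‖f - (hg.memLp p).toLp g‖ ≤ ε := by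
  obtain ⟨g, hgc, hg, hgcont, hgm⟩ := (Lp.memLp f).exists_hasCompactSupport_eLpNorm_sub_le hp
    (ε := ENNReal.ofReal ε) (by simpa using hε)
  refine ⟨g, Nice.of_continuous hgcont hgc, ?_⟩
  rw [← Lp.toLp_coeFn f (Lp.memLp f), ← MemLp.toLp_sub, Lp.norm_toLp]
  exact ENNReal.toReal_le_of_le_ofReal hε.le hg

/-- The subspace of `Lᵖ` of the classes of bounded functions with bounded support. -/
def niceSubmodule (p : ℝ≥0∞) : Submodule ℂ (Lp ℂ p (volume : Measure (ℝ × ℝ))) where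
  carrier := {f | ∃ g, Nice g ∧ f =ᵐ[volume] g}
  add_mem' := by
    rintro a b ⟨f, hf, haf⟩ ⟨g, hg, hbg⟩
    exact ⟨f + g, hf.add hg, (Lp.coeFn_add a b).trans (haf.add hbg)⟩
  zero_mem' := ⟨0, Nice.zero, Lp.coeFn_zero _ _ _⟩
  smul_mem' := by
    rintro c a ⟨f, hf, haf⟩
    exact ⟨c • f, hf.const_smul c, (Lp.coeFn_smul c a).trans (haf.const_smul c)⟩

theorem toLp_mem_niceSubmodule {p : ℝ≥0∞} {g : ℝ × ℝ → ℂ} (hg : Nice g) :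
    (hg.memLp p).toLp g ∈ niceSubmodule p := ⟨g, hg, (hg.memLp p).coeFn_toLp⟩

theorem denseRange_niceSubmodule {p : ℝ≥0∞} [Fact (1 ≤ p)] (hp : p ≠ ∞) :
    DenseRange (niceSubmodule p).subtype := by
  intro f
  rw [Metric.mem_closure_iff]
  intro ε hε
  obtain ⟨g, hg, h⟩ := exists_nice_near hp f (half_pos hε)
  refine ⟨_, ⟨⟨_, toLp_mem_niceSubmodule hg⟩, rfl⟩, ?_⟩
  rw [dist_eq_norm]
  exact h.trans_lt (half_lt_self hε)

theorem exists_nice_seq {p : ℝ≥0∞} [Fact (1 ≤ p)] (hp : p ≠ ∞)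
    (f : Lp ℂ p (volume : Measure (ℝ × ℝ))) :
    ∃ (g : ℕ → ℝ × ℝ → ℂ) (hg : ∀ n, Nice (g n)),
      Tendsto (fun n ↦ ((hg n).memLp p).toLp (g n)) atTop (𝓝 f) := by
  choose g hg h using fun n : ℕ ↦ exists_nice_near hp f (ε := 1 / ((n : ℝ) + 1)) (by positivity)
  refine ⟨g, hg, ?_⟩
  rw [tendsto_iff_norm_sub_tendsto_zero]
  refine squeeze_zero (fun _ ↦ norm_nonneg _) (fun n ↦ ?_)
    tendsto_one_div_add_atTop_nhds_zero_nat
  rw [norm_sub_rev]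
  exact h n

/-! ### Fibers of functions on the plane -/

section Fibers

variable {f : ℝ × ℝ → ℂ}

theorem ae_fiber (hf : Integrable f) (hf2 : MemLp f 2) :
    ∀ᵐ x, Integrable (fun y ↦ f (x, y)) ∧ MemLp (fun y ↦ f (x, y)) 2 := by
  rw [Measure.volume_eq_prod] at hf hf2
  filter_upwards [hf.prod_right_ae, (hf2.integrable_norm_pow (by norm_num)).prod_right_ae]
    with x h1 h2
  refine ⟨h1, (memLp_two_iff_integrable_sq_norm h1.aestronglyMeasurable).2 h2⟩

theorem ae_fiber_left (hf : Integrable f) (hf2 : MemLp f 2) :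
    ∀ᵐ y, Integrable (fun x ↦ f (x, y)) ∧ MemLp (fun x ↦ f (x, y)) 2 := by
  rw [Measure.volume_eq_prod] at hf hf2
  filter_upwards [hf.prod_left_ae, (hf2.integrable_norm_pow (by norm_num)).prod_left_ae]
    with x h1 h2
  refine ⟨h1, (memLp_two_iff_integrable_sq_norm h1.aestronglyMeasurable).2 h2⟩

theorem stronglyMeasurable_fourierInv_fiber (hf : Measurable f) :
    StronglyMeasurable (fun p : ℝ × ℝ ↦ 𝓕⁻ (fun τ ↦ f (p.1, τ)) p.2) := by
  simp_rw [Real.fourierInv_eq']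
  refine StronglyMeasurable.integral_prod_right
    (f := fun (p : ℝ × ℝ) (τ : ℝ) ↦ Complex.exp (↑(2 * Real.pi * inner ℝ τ p.2) * Complex.I) • f (p.1, τ)) ?_
  refine Measurable.stronglyMeasurable ?_
  have h1 : Measurable (fun z : (ℝ × ℝ) × ℝ ↦ f (z.1.1, z.2)) := hf.comp (by fun_prop)
  have h2 : Continuous (fun z : (ℝ × ℝ) × ℝ ↦
    Complex.exp (↑(2 * Real.pi * inner ℝ z.2 z.1.2) * Complex.I)) := by fun_prop
  exact h2.measurable.smul h1

theorem stronglyMeasurable_fourier_fiber (hf : Measurable f) :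
    StronglyMeasurable (fun p : ℝ × ℝ ↦ 𝓕 (fun x ↦ f (x, p.2)) p.1) := by
  simp_rw [Real.fourier_eq']
  refine StronglyMeasurable.integral_prod_right
    (f := fun (p : ℝ × ℝ) (x : ℝ) ↦ Complex.exp (↑(-2 * Real.pi * inner ℝ x p.1) * Complex.I) • f (x, p.2)) ?_
  refine Measurable.stronglyMeasurable ?_
  have h1 : Measurable (fun z : (ℝ × ℝ) × ℝ ↦ f (z.2, z.1.2)) := hf.comp (by fun_prop)
  have h2 : Continuous (fun z : (ℝ × ℝ) × ℝ ↦
    Complex.exp (↑(-2 * Real.pi * inner ℝ z.2 z.1.1) * Complex.I)) := by fun_prop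
  exact h2.measurable.smul h1

/-- Plancherel's identity for the transform in the second variable, with a weight in the first. -/
theorem lintegral_fourierInv_fiber_sq (hfm : Measurable f) (hf : Integrable f) (hf2 : MemLp f 2)
    {m : ℝ → ℝ≥0∞} (hm : Measurable m) :
    ∫⁻ p : ℝ × ℝ, m p.1 * ‖𝓕⁻ (fun τ ↦ f (p.1, τ)) p.2‖ₑ ^ 2 =
      ∫⁻ p : ℝ × ℝ, m p.1 * ‖f p‖ₑ ^ 2 := by
  have h1 : Measurable fun p : ℝ × ℝ ↦ m p.1 * ‖𝓕⁻ (fun τ ↦ f (p.1, τ)) p.2‖ₑ ^ 2 :=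
    (hm.comp measurable_fst).mul
      ((stronglyMeasurable_fourierInv_fiber hfm).measurable.enorm.pow_const 2)
  have h2 : Measurable fun p : ℝ × ℝ ↦ m p.1 * ‖f p‖ₑ ^ 2 :=
    (hm.comp measurable_fst).mul (hfm.enorm.pow_const 2)
  rw [Measure.volume_eq_prod, lintegral_prod _ h1.aemeasurable, lintegral_prod _ h2.aemeasurable]
  refine lintegral_congr_ae ?_
  filter_upwards [ae_fiber hf hf2] with x hx
  rw [lintegral_const_mul _ ((continuous_fourierInv hx.1).measurable.enorm.pow_const 2),
    lintegral_fourierInv_sq hx.1 hx.2, lintegral_const_mul]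
  exact (hfm.comp measurable_prodMk_left).enorm.pow_const 2

theorem lintegral_fourier_fiber_sq (hfm : Measurable f) (hf : Integrable f) (hf2 : MemLp f 2) :
    ∫⁻ p : ℝ × ℝ, ‖𝓕 (fun x ↦ f (x, p.2)) p.1‖ₑ ^ 2 = ∫⁻ p : ℝ × ℝ, ‖f p‖ₑ ^ 2 := by
  rw [Measure.volume_eq_prod, lintegral_prod_symm _
    ((stronglyMeasurable_fourier_fiber hfm).measurable.enorm.pow_const 2).aemeasurable,
    lintegral_prod_symm _ (hfm.enorm.pow_const 2).aemeasurable]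
  refine lintegral_congr_ae ?_
  filter_upwards [ae_fiber_left hf hf2] with x hx
  exact lintegral_fourier_sq hx.1 hx.2

end Fibers

/-! ### Superpositions of plane waves -/

/-- The character `(x, t) ↦ e^{2πi(xξ + tτ)}` as a function of `(ξ, τ)`. -/
def expChar (q p : ℝ × ℝ) : ℂ :=
  Complex.exp (((2 * Real.pi * (p.1 * q.1 + p.2 * q.2) : ℝ) : ℂ) * Complex.I)

theorem norm_expChar (q p : ℝ × ℝ) : ‖expChar q p‖ = 1 := Complex.norm_exp_ofReal_mul_I _

theorem expChar_add (q p p' : ℝ × ℝ) : expChar q (p + p') = expChar q p * expChar q p' := by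
  rw [expChar, expChar, expChar, ← Complex.exp_add]
  congr 1
  simp only [Prod.fst_add, Prod.snd_add]
  push_cast
  ring

theorem continuous_expChar : Continuous (fun z : (ℝ × ℝ) × (ℝ × ℝ) ↦ expChar z.1 z.2) := by
  unfold expChar
  fun_prop

/-- The inverse Fourier transform of an integrable function on the plane. -/
def wave (g : ℝ × ℝ → ℂ) (q : ℝ × ℝ) : ℂ := ∫ p, expChar q p * g p

theorem integrable_expChar_mul {g : ℝ × ℝ → ℂ} (hg : Integrable g) (q : ℝ × ℝ) :
    Integrable (fun p ↦ expChar q p * g p) := by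
  refine hg.bdd_mul (c := 1) ?_ (ae_of_all _ fun p ↦ (norm_expChar q p).le)
  exact (continuous_expChar.comp (by fun_prop : Continuous fun p ↦ (q, p))).aestronglyMeasurable

theorem continuous_wave {g : ℝ × ℝ → ℂ} (hg : Integrable g) : Continuous (wave g) := by
  refine continuous_of_dominated (bound := fun p ↦ ‖g p‖)
    (fun q ↦ (integrable_expChar_mul hg q).aestronglyMeasurable)
    (fun q ↦ ae_of_all _ fun p ↦ by simp [norm_expChar]) hg.norm (ae_of_all _ fun p ↦ ?_)
  exact (continuous_expChar.comp (by fun_prop : Continuous fun q ↦ (q, p))).mul continuous_const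

theorem wave_add {g h : ℝ × ℝ → ℂ} (hg : Integrable g) (hh : Integrable h) :
    wave (g + h) = wave g + wave h := by
  funext q
  simp only [wave, Pi.add_apply, mul_add]
  exact integral_add (integrable_expChar_mul hg q) (integrable_expChar_mul hh q)

theorem wave_const_smul (c : ℂ) (g : ℝ × ℝ → ℂ) : wave (c • g) = c • wave g := by
  funext q
  simp only [wave, Pi.smul_apply, smul_eq_mul, ← integral_const_mul]
  congr 1
  funext p
  ring

theorem wave_congr {g h : ℝ × ℝ → ℂ} (hgh : g =ᵐ[volume] h) : wave g = wave h := by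
  funext q
  refine integral_congr_ae ?_
  filter_upwards [hgh] with p hp
  rw [hp]

theorem wave_eq {g : ℝ × ℝ → ℂ} (hg : Integrable g) (x t : ℝ) :
    wave g (x, t) = 𝓕⁻ (fun ξ ↦ 𝓕⁻ (fun τ ↦ g (ξ, τ)) t) x := by
  have h := integrable_expChar_mul hg (x, t)
  rw [wave, Measure.volume_eq_prod, integral_prod _ h, Real.fourierInv_eq']
  refine integral_congr_ae (ae_of_all _ fun ξ ↦ ?_)
  simp only
  rw [Real.fourierInv_eq', ← integral_smul]
  refine integral_congr_ae (ae_of_all _ fun τ ↦ ?_)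
  simp only [expChar, smul_eq_mul, RCLike.inner_apply, conj_trivial]
  rw [← mul_assoc, ← Complex.exp_add]
  congr 2
  push_cast
  ring

theorem integrable_fourierInv_fiber {g : ℝ × ℝ → ℂ} (hgm : Measurable g) (hg : Integrable g)
    (t : ℝ) : Integrable (fun ξ ↦ 𝓕⁻ (fun τ ↦ g (ξ, τ)) t) := by
  have h : Integrable (fun ξ ↦ ∫ τ, ‖g (ξ, τ)‖) := by
    rw [Measure.volume_eq_prod] at hg
    exact hg.norm.integral_prod_left
  refine h.mono' ?_ (ae_of_all _ fun ξ ↦ norm_fourierInv_le _ _)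
  exact ((stronglyMeasurable_fourierInv_fiber hgm).comp_measurable
    (by fun_prop : Measurable fun ξ : ℝ ↦ (ξ, t))).aestronglyMeasurable

theorem ae_memLp_fourierInv_fiber {g : ℝ × ℝ → ℂ} (hgm : Measurable g) (hg : Integrable g)
    (hg2 : MemLp g 2) : ∀ᵐ t, MemLp (fun ξ ↦ 𝓕⁻ (fun τ ↦ g (ξ, τ)) t) 2 := by
  have h := lintegral_fourierInv_fiber_sq hgm hg hg2 (m := fun _ ↦ 1) measurable_const
  simp only [one_mul] at h
  have hm : MemLp (fun p : ℝ × ℝ ↦ 𝓕⁻ (fun τ ↦ g (p.1, τ)) p.2) 2 := by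
    refine ⟨(stronglyMeasurable_fourierInv_fiber hgm).aestronglyMeasurable, ?_⟩
    have h2 : eLpNorm (fun p : ℝ × ℝ ↦ 𝓕⁻ (fun τ ↦ g (p.1, τ)) p.2) 2 volume ^ 2 < ∞ := by
      rw [eLpNorm_two_sq, h, ← eLpNorm_two_sq]
      exact ENNReal.pow_lt_top hg2.2
    simpa using h2
  rw [Measure.volume_eq_prod] at hm
  filter_upwards [(hm.integrable_norm_pow (by norm_num)).prod_left_ae] with t ht
  exact (memLp_two_iff_integrable_sq_norm
    (integrable_fourierInv_fiber hgm hg t).aestronglyMeasurable).2 ht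

/-- Two one-dimensional Plancherel identities, one in time and one in space, iterated through
`wave_eq`. -/
theorem lintegral_wave_sq {g : ℝ × ℝ → ℂ} (hgm : Measurable g) (hg : Integrable g)
    (hg2 : MemLp g 2) : ∫⁻ q, ‖wave g q‖ₑ ^ 2 = ∫⁻ p, ‖g p‖ₑ ^ 2 := by
  have h := lintegral_fourierInv_fiber_sq hgm hg hg2 (m := fun _ ↦ 1) measurable_const
  simp only [one_mul] at h
  rw [← h, Measure.volume_eq_prod, lintegral_prod_symm _
    ((continuous_wave hg).measurable.enorm.pow_const 2).aemeasurable, lintegral_prod_symm _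
    ((stronglyMeasurable_fourierInv_fiber hgm).measurable.enorm.pow_const 2).aemeasurable]
  refine lintegral_congr_ae ?_
  filter_upwards [ae_memLp_fourierInv_fiber hgm hg hg2] with t ht
  simp only [wave_eq hg]
  exact lintegral_fourierInv_sq (integrable_fourierInv_fiber hgm hg t) ht

open scoped Convolution in
/-- Convolution of functions on the plane. -/
def conv (f g : ℝ × ℝ → ℂ) : ℝ × ℝ → ℂ := f ⋆[ContinuousLinearMap.mul ℂ ℂ, volume] g

theorem conv_apply (f g : ℝ × ℝ → ℂ) (p : ℝ × ℝ) : conv f g p = ∫ q, f q * g (p - q) := rfl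

theorem wave_conv {f g : ℝ × ℝ → ℂ} (hf : Integrable f) (hg : Integrable g) :
    wave (conv f g) = fun q ↦ wave f q * wave g q := by
  funext q
  have h := integral_convolution (ContinuousLinearMap.mul ℂ ℂ)
    (integrable_expChar_mul hf q) (integrable_expChar_mul hg q)
  simp only [ContinuousLinearMap.mul_apply'] at h
  rw [wave, wave, wave, ← h]
  refine integral_congr_ae (ae_of_all _ fun p ↦ ?_)
  simp only [conv_apply, convolution, ContinuousLinearMap.mul_apply']
  rw [← integral_const_mul]
  refine integral_congr_ae (ae_of_all _ fun z ↦ ?_)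
  simp only
  rw [show expChar q p = expChar q z * expChar q (p - z) by rw [← expChar_add]; simp]
  ring

theorem Nice.conv {f g : ℝ × ℝ → ℂ} (hf : Nice f) (hg : Nice g) : Nice (conv f g) := by
  obtain ⟨C, hC⟩ := hg.bdd
  obtain ⟨R, hR⟩ := hf.supp
  obtain ⟨R', hR'⟩ := hg.supp
  refine ⟨?_, ⟨∫ q, ‖f q‖ * C, fun p ↦ ?_⟩, R + R', fun p hp ↦ ?_⟩
  · refine (StronglyMeasurable.integral_prod_right
      (f := fun p q : ℝ × ℝ ↦ f q * g (p - q)) ?_).measurable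
    refine Measurable.stronglyMeasurable ?_
    exact (hf.meas.comp measurable_snd).mul (hg.meas.comp (measurable_fst.sub measurable_snd))
  · refine norm_integral_le_of_norm_le (hf.integrable.norm.mul_const C) (ae_of_all _ fun q ↦ ?_)
    exact (norm_mul_le (f q) (g (p - q))).trans
      (mul_le_mul_of_nonneg_left (hC _) (norm_nonneg _))
  · rw [conv_apply]
    refine integral_eq_zero_of_ae (ae_of_all _ fun q ↦ ?_)
    rcases le_or_gt ‖q‖ R with h | h
    · have : R' < ‖p - q‖ := by linarith [norm_sub_norm_le p q]
      simp [hR' _ this]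
    · simp [hR q h]

theorem enorm_conv_le (f g : ℝ × ℝ → ℂ) (p : ℝ × ℝ) :
    ‖conv f g p‖ₑ ≤ ∫⁻ q, ‖f q‖ₑ * ‖g (p - q)‖ₑ := by
  rw [conv_apply]
  refine (enorm_integral_le_lintegral_enorm _).trans (le_of_eq ?_)
  simp [enorm_mul]

theorem enorm_conv_conv_le {f g h : ℝ × ℝ → ℂ} (hg : Nice g) (hh : Nice h)
    (p : ℝ × ℝ) : ‖conv f (conv g h) p‖ₑ ≤
      ∫⁻ q, ∫⁻ r, ‖f q‖ₑ * (‖g r‖ₑ * ‖h (p - q - r)‖ₑ) := by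
  refine (enorm_conv_le _ _ _).trans (lintegral_mono fun q ↦ ?_)
  rw [lintegral_const_mul]
  · exact mul_le_mul_right (enorm_conv_le _ _ _) _
  · exact hg.meas.enorm.mul (hh.meas.enorm.comp (measurable_const.sub measurable_id))

/-- For nonnegative functions the convolution is the integral with values in `[0, ∞]`. -/
theorem enorm_conv_conv_ofReal_norm {f g h : ℝ × ℝ → ℂ} (hf : Nice f) (hg : Nice g) (hh : Nice h)
    (p : ℝ × ℝ) : ‖conv (fun q ↦ (‖f q‖ : ℂ)) (conv (fun q ↦ (‖g q‖ : ℂ)) (fun q ↦ (‖h q‖ : ℂ))) p‖ₑ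
      = ∫⁻ q, ∫⁻ r, ‖f q‖ₑ * (‖g r‖ₑ * ‖h (p - q - r)‖ₑ) := by
  have key : ∀ (a b : ℝ × ℝ → ℝ), (∀ q, 0 ≤ a q) → (∀ q, 0 ≤ b q) →
      Nice (fun q ↦ (a q : ℂ)) → Nice (fun q ↦ (b q : ℂ)) → ∀ p,
      conv (fun q ↦ (a q : ℂ)) (fun q ↦ (b q : ℂ)) p = ((∫ q, a q * b (p - q) : ℝ) : ℂ) ∧
      ENNReal.ofReal (∫ q, a q * b (p - q)) =
        ∫⁻ q, ENNReal.ofReal (a q) * ENNReal.ofReal (b (p - q)) := by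
    intro a b ha hb hna hnb p
    constructor
    · rw [conv_apply, ← integral_complex_ofReal]
      simp
    · have h1 : Integrable (fun q ↦ a q * b (p - q)) := by
        obtain ⟨C, hC⟩ := hnb.bdd
        have h2 : Measurable b := by
          have := Complex.measurable_re.comp hnb.meas
          exact this
        have h3 : Integrable a := by
          have := hna.integrable.re
          exact this
        refine h3.mul_bdd (c := C)
          (h2.comp (measurable_const.sub measurable_id)).aestronglyMeasurable
          (ae_of_all _ fun q ↦ ?_)
        simpa using hC (p - q)
      rw [ofReal_integral_eq_lintegral_ofReal h1 (ae_of_all _ fun q ↦ mul_nonneg (ha _) (hb _))]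
      simp_rw [ENNReal.ofReal_mul (ha _)]
  have h1 := key (fun q ↦ ‖g q‖) (fun q ↦ ‖h q‖) (fun _ ↦ norm_nonneg _)
    (fun _ ↦ norm_nonneg _) hg.ofReal_norm hh.ofReal_norm
  have h2 : conv (fun q ↦ (‖g q‖ : ℂ)) (fun q ↦ (‖h q‖ : ℂ)) =
      fun p ↦ ((∫ q, ‖g q‖ * ‖h (p - q)‖ : ℝ) : ℂ) := funext fun p ↦ (h1 p).1
  have h3 := key (fun q ↦ ‖f q‖) (fun p ↦ ∫ q, ‖g q‖ * ‖h (p - q)‖) (fun _ ↦ norm_nonneg _)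
    (fun _ ↦ integral_nonneg fun q ↦ by positivity) hf.ofReal_norm
    (h2 ▸ hg.ofReal_norm.conv hh.ofReal_norm) p
  rw [h2, h3.1, ← ofReal_norm, Complex.norm_real, Real.norm_of_nonneg
    (integral_nonneg fun q ↦ mul_nonneg (norm_nonneg _) (integral_nonneg fun q ↦ by positivity)),
    h3.2]
  refine lintegral_congr fun q ↦ ?_
  rw [(h1 _).2, ← lintegral_const_mul]
  · simp only [ofReal_norm]
  · simp only [ofReal_norm]
    exact hg.meas.enorm.mul (hh.meas.enorm.comp (measurable_const.sub measurable_id))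

/-! ### Weights -/

/-- The weight `(1 + ξ²)^{s/2}`. -/
def wt (s ξ : ℝ) : ℝ := (1 + ξ ^ 2) ^ (s / 2)

theorem wt_pos (s ξ : ℝ) : 0 < wt s ξ := by unfold wt; positivity

theorem wt_ne_zero (s ξ : ℝ) : (wt s ξ : ℂ) ≠ 0 := by exact_mod_cast (wt_pos s ξ).ne'

theorem continuous_wt (s : ℝ) : Continuous (wt s) :=
  (by fun_prop : Continuous fun ξ : ℝ ↦ 1 + ξ ^ 2).rpow_const fun ξ ↦ Or.inl (by positivity)

theorem wt_mul (s s' ξ : ℝ) : wt s ξ * wt s' ξ = wt (s + s') ξ := by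
  rw [wt, wt, wt, ← Real.rpow_add (by positivity)]
  ring_nf

theorem wt_zero (ξ : ℝ) : wt 0 ξ = 1 := by simp [wt]

theorem wt_neg_mul (s ξ : ℝ) : wt (-s) ξ * wt s ξ = 1 := by rw [wt_mul]; simp [wt_zero]

theorem wt_le_one {s : ℝ} (hs : s ≤ 0) (ξ : ℝ) : wt s ξ ≤ 1 :=
  Real.rpow_le_one_of_one_le_of_nonpos (by nlinarith [sq_nonneg ξ]) (by linarith)

/-- The modulation weight `(1 + 2π|y|)^{-3/4}`. -/
def md (y : ℝ) : ℝ := (1 + |2 * Real.pi * y|) ^ (-(3 / 4) : ℝ)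

theorem md_pos (y : ℝ) : 0 < md y := by unfold md; positivity

theorem md_le_one (y : ℝ) : md y ≤ 1 :=
  Real.rpow_le_one_of_one_le_of_nonpos (by linarith [abs_nonneg (2 * Real.pi * y)]) (by norm_num)

theorem continuous_md : Continuous md :=
  (by fun_prop : Continuous fun y : ℝ ↦ 1 + |2 * Real.pi * y|).rpow_const
    fun ξ ↦ Or.inl (by positivity)

/-- The square of the modulation weight. -/
def jj (y : ℝ) : ℝ≥0∞ := ENNReal.ofReal (md y ^ 2)

theorem measurable_jj : Measurable jj := (continuous_md.pow 2).measurable.ennreal_ofReal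

theorem jj_le_one (y : ℝ) : jj y ≤ 1 :=
  ENNReal.ofReal_le_one.2 (pow_le_one₀ (md_pos y).le (md_le_one y))

theorem md_sq (y : ℝ) : md y ^ 2 = (1 + |2 * Real.pi * y|) ^ (-(3 / 2) : ℝ) := by
  rw [md, ← Real.rpow_natCast, ← Real.rpow_mul (by positivity)]
  norm_num

theorem integrable_md_sq : Integrable (fun y ↦ md y ^ 2) := by
  have h : Integrable (fun y : ℝ ↦ (1 + ‖y‖) ^ (-(3 / 2) : ℝ)) :=
    integrable_one_add_norm (by norm_num)
  have := h.comp_mul_left' (R := 2 * Real.pi) (by positivity)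
  simpa only [md_sq, Real.norm_eq_abs] using this

theorem lintegral_jj_lt_top : ∫⁻ y, jj y < ∞ := by
  have := integrable_md_sq.lintegral_lt_top
  exact this

/-- The threefold convolution of `jj`. -/
def kk (y : ℝ) : ℝ≥0∞ := ∫⁻ a, ∫⁻ b, jj a * (jj b * jj (y - a - b))

theorem measurable_kk : Measurable kk := by
  unfold kk
  refine Measurable.lintegral_prod_right' (f := fun z : ℝ × ℝ ↦
    ∫⁻ b, jj z.2 * (jj b * jj (z.1 - z.2 - b))) ?_
  refine Measurable.lintegral_prod_right' (f := fun z : (ℝ × ℝ) × ℝ ↦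
    jj z.1.2 * (jj z.2 * jj (z.1.1 - z.1.2 - z.2))) ?_
  exact (measurable_jj.comp (by fun_prop)).mul ((measurable_jj.comp (by fun_prop)).mul
    (measurable_jj.comp (by fun_prop)))

/-- Boundedness of `kk` serves the low frequencies; its integrability, `lintegral_kk_lt_top`, serves
the changes of variables. -/
theorem kk_le (y : ℝ) : kk y ≤ (∫⁻ y, jj y) ^ 2 := by
  calc kk y ≤ ∫⁻ a, ∫⁻ b, jj a * jj b := by
        refine lintegral_mono fun a ↦ lintegral_mono fun b ↦ ?_
        exact mul_le_mul_right (mul_le_of_le_one_right' (jj_le_one _)) _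
    _ = _ := by
        simp_rw [lintegral_const_mul _ measurable_jj]
        rw [lintegral_mul_const _ measurable_jj, sq]

theorem lintegral_kk_lt_top : ∫⁻ y, kk y < ∞ := by
  have h1 : ∫⁻ y, kk y = ∫⁻ a, ∫⁻ b, ∫⁻ y, jj a * (jj b * jj (y - a - b)) := by
    unfold kk
    rw [lintegral_lintegral_swap]
    · refine lintegral_congr fun a ↦ ?_
      rw [lintegral_lintegral_swap]
      refine Measurable.aemeasurable ?_
      exact (measurable_const).mul ((measurable_jj.comp (by fun_prop)).mul
        (measurable_jj.comp (by fun_prop)))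
    · refine Measurable.aemeasurable ?_
      refine Measurable.lintegral_prod_right' (f := fun z : (ℝ × ℝ) × ℝ ↦
        jj z.1.2 * (jj z.2 * jj (z.1.1 - z.1.2 - z.2))) ?_
      exact (measurable_jj.comp (by fun_prop)).mul ((measurable_jj.comp (by fun_prop)).mul
        (measurable_jj.comp (by fun_prop)))
  have h2 : ∀ a b, ∫⁻ y, jj a * (jj b * jj (y - a - b)) = jj a * (jj b * ∫⁻ y, jj y) := by
    intro a b
    have h3 : Measurable fun y ↦ jj (y - a - b) := measurable_jj.comp (by fun_prop)
    rw [lintegral_const_mul _ (measurable_const.fun_mul h3), lintegral_const_mul _ h3]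
    simp_rw [sub_sub]
    rw [lintegral_sub_right_eq_self jj (a + b)]
  rw [h1]
  simp_rw [h2]
  simp_rw [lintegral_const_mul _ (measurable_jj.mul_const _),
    lintegral_mul_const _ measurable_jj]
  exact ENNReal.mul_lt_top lintegral_jj_lt_top
    (ENNReal.mul_lt_top lintegral_jj_lt_top lintegral_jj_lt_top)

/-! ### The Cauchy–Schwarz inequality for threefold convolutions -/

theorem lintegral_mul_sq_le {X : Type*} [MeasurableSpace X] (μ : Measure X) {f g : X → ℝ≥0∞}
    (hf : AEMeasurable f μ) (hg : AEMeasurable g μ) :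
    (∫⁻ x, f x * g x ∂μ) ^ 2 ≤ (∫⁻ x, f x ^ 2 ∂μ) * ∫⁻ x, g x ^ 2 ∂μ := by
  have h := ENNReal.lintegral_mul_le_Lp_mul_Lq μ Real.HolderConjugate.two_two hf hg
  simp only [Pi.mul_apply, ENNReal.rpow_ofNat] at h
  refine (pow_le_pow_left' h 2).trans (le_of_eq ?_)
  rw [mul_pow, ← ENNReal.rpow_natCast, ← ENNReal.rpow_natCast, ← ENNReal.rpow_mul,
    ← ENNReal.rpow_mul]
  norm_num

/-- Cauchy–Schwarz in `(q, r)` at fixed `p` sends the kernel into the supremum `M`. What remains is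
the threefold convolution of the squares, whose integral is the product of the three integrals. -/
theorem lintegral_trilinear_sq_le {κ : (ℝ × ℝ) → (ℝ × ℝ) → (ℝ × ℝ) → ℝ≥0∞}
    (hκ : Measurable fun z : (ℝ × ℝ) × (ℝ × ℝ) × (ℝ × ℝ) ↦ κ z.1 z.2.1 z.2.2)
    {f g h : ℝ × ℝ → ℝ≥0∞} (hf : Measurable f) (hg : Measurable g) (hh : Measurable h)
    {M : ℝ≥0∞} (hM : ∀ p, ∫⁻ q, ∫⁻ r, κ p q r ^ 2 ≤ M) :
    ∫⁻ p, (∫⁻ q, ∫⁻ r, κ p q r * (f q * (g r * h (p - q - r)))) ^ 2 ≤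
      M * ((∫⁻ p, f p ^ 2) * ((∫⁻ p, g p ^ 2) * ∫⁻ p, h p ^ 2)) := by
  have hF : Measurable fun z : (ℝ × ℝ) × (ℝ × ℝ) × (ℝ × ℝ) ↦
      f z.2.1 * (g z.2.2 * h (z.1 - z.2.1 - z.2.2)) :=
    (hf.comp (by fun_prop)).mul ((hg.comp (by fun_prop)).mul (hh.comp (by fun_prop)))
  have h1 : ∀ p, (∫⁻ q, ∫⁻ r, κ p q r * (f q * (g r * h (p - q - r)))) ^ 2 ≤
      M * ∫⁻ q, ∫⁻ r, f q ^ 2 * (g r ^ 2 * h (p - q - r) ^ 2) := by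
    intro p
    have m1 : Measurable fun z : (ℝ × ℝ) × (ℝ × ℝ) ↦ κ p z.1 z.2 :=
      hκ.comp (by fun_prop : Measurable fun z : (ℝ × ℝ) × (ℝ × ℝ) ↦ (p, z))
    have m2 : Measurable fun z : (ℝ × ℝ) × (ℝ × ℝ) ↦ f z.1 * (g z.2 * h (p - z.1 - z.2)) :=
      hF.comp (by fun_prop : Measurable fun z : (ℝ × ℝ) × (ℝ × ℝ) ↦ (p, z))
    have := lintegral_mul_sq_le (volume.prod volume) m1.aemeasurable m2.aemeasurable
    rw [lintegral_prod _ (m1.fun_mul m2).aemeasurable, lintegral_prod _ (m1.pow_const 2).aemeasurable,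
      lintegral_prod _ (m2.pow_const 2).aemeasurable] at this
    refine this.trans (mul_le_mul' (hM p) (le_of_eq ?_))
    simp_rw [mul_pow]
  refine (lintegral_mono h1).trans ?_
  have m3 : Measurable fun z : (ℝ × ℝ) × (ℝ × ℝ) × (ℝ × ℝ) ↦
      f z.2.1 ^ 2 * (g z.2.2 ^ 2 * h (z.1 - z.2.1 - z.2.2) ^ 2) :=
    ((hf.comp (by fun_prop)).pow_const 2).mul (((hg.comp (by fun_prop)).pow_const 2).mul
      ((hh.comp (by fun_prop)).pow_const 2))
  have m4 : Measurable fun z : ((ℝ × ℝ) × (ℝ × ℝ)) × (ℝ × ℝ) ↦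
      f z.1.2 ^ 2 * (g z.2 ^ 2 * h (z.1.1 - z.1.2 - z.2) ^ 2) :=
    m3.comp (by fun_prop : Measurable fun z : ((ℝ × ℝ) × (ℝ × ℝ)) × (ℝ × ℝ) ↦
      (z.1.1, z.1.2, z.2))
  rw [lintegral_const_mul _ (Measurable.lintegral_prod_right' (f := fun z : (ℝ × ℝ) × (ℝ × ℝ) ↦
    ∫⁻ r, f z.2 ^ 2 * (g r ^ 2 * h (z.1 - z.2 - r) ^ 2)) (Measurable.lintegral_prod_right' m4))]
  refine mul_le_mul_right (le_of_eq ?_) M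
  rw [lintegral_lintegral_swap (Measurable.lintegral_prod_right' m4).aemeasurable]
  have h2 : ∀ q, ∫⁻ p, ∫⁻ r, f q ^ 2 * (g r ^ 2 * h (p - q - r) ^ 2) =
      f q ^ 2 * ((∫⁻ p, g p ^ 2) * ∫⁻ p, h p ^ 2) := by
    intro q
    rw [lintegral_lintegral_swap]
    · have h3 : ∀ r, ∫⁻ p, f q ^ 2 * (g r ^ 2 * h (p - q - r) ^ 2) =
          f q ^ 2 * (g r ^ 2 * ∫⁻ p, h p ^ 2) := by
        intro r
        have h4 : Measurable fun p ↦ h (p - q - r) ^ 2 :=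
          (hh.comp (by fun_prop)).pow_const 2
        rw [lintegral_const_mul _ (measurable_const.fun_mul h4), lintegral_const_mul _ h4]
        simp_rw [sub_sub]
        rw [lintegral_sub_right_eq_self (fun p ↦ h p ^ 2) (q + r)]
      simp_rw [h3]
      rw [lintegral_const_mul _ ((hg.pow_const 2).mul_const _),
        lintegral_mul_const _ (hg.pow_const 2)]
    · refine Measurable.aemeasurable ?_
      exact measurable_const.mul (((hg.comp (by fun_prop)).pow_const 2).mul
        ((hh.comp (by fun_prop)).pow_const 2))
  simp_rw [h2]
  rw [lintegral_mul_const _ (hf.pow_const 2)]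

/-- Integration of the modulation weights over the temporal frequencies. -/
theorem lintegral_modulation {Q : ℝ → ℝ} (hQ : Measurable Q) {Λ : ℝ → ℝ → ℝ≥0∞}
    (hΛ : Measurable fun z : ℝ × ℝ ↦ Λ z.1 z.2) (ξ τ : ℝ) :
    ∫⁻ q : ℝ × ℝ, ∫⁻ r : ℝ × ℝ, Λ q.1 r.1 * (jj (q.2 - Q q.1) * (jj (r.2 - Q r.1) *
        jj (τ - q.2 - r.2 - Q (ξ - q.1 - r.1)))) =
      ∫⁻ a, ∫⁻ b, Λ a b * kk (τ - Q a - Q b - Q (ξ - a - b)) := by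
  have hmeas : Measurable fun z : (ℝ × ℝ) × (ℝ × ℝ) ↦ Λ z.1.1 z.2.1 *
      (jj (z.1.2 - Q z.1.1) * (jj (z.2.2 - Q z.2.1) *
        jj (τ - z.1.2 - z.2.2 - Q (ξ - z.1.1 - z.2.1)))) := by
    refine (hΛ.comp (by fun_prop : Measurable fun z : (ℝ × ℝ) × (ℝ × ℝ) ↦ (z.1.1, z.2.1))).mul ?_
    exact (measurable_jj.comp (by fun_prop)).mul ((measurable_jj.comp (by fun_prop)).mul
      (measurable_jj.comp (by fun_prop)))
  rw [Measure.volume_eq_prod, lintegral_prod _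
    (Measurable.lintegral_prod_right' hmeas).aemeasurable]
  refine lintegral_congr fun a ↦ ?_
  have h1 : ∀ c, ∫⁻ r : ℝ × ℝ, Λ a r.1 * (jj (c - Q a) * (jj (r.2 - Q r.1) *
      jj (τ - c - r.2 - Q (ξ - a - r.1)))) ∂(volume.prod volume) = ∫⁻ b, ∫⁻ d,
      Λ a b * (jj (c - Q a) * (jj (d - Q b) * jj (τ - c - d - Q (ξ - a - b)))) := by
    intro c
    rw [lintegral_prod]
    exact (hmeas.comp (by fun_prop : Measurable fun r : ℝ × ℝ ↦ ((a, c), r))).aemeasurable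
  simp only [h1]
  rw [lintegral_lintegral_swap]
  · refine lintegral_congr fun b ↦ ?_
    have hm2 : ∀ c, Measurable fun d ↦ jj (d - Q b) * jj (τ - c - d - Q (ξ - a - b)) := fun c ↦
      (measurable_jj.comp (by fun_prop)).mul (measurable_jj.comp (by fun_prop))
    have h2 : ∀ c, ∫⁻ d, Λ a b * (jj (c - Q a) * (jj (d - Q b) * jj (τ - c - d - Q (ξ - a - b))))
        = Λ a b * ∫⁻ d, jj (c - Q a) * (jj (d - Q b) * jj (τ - c - d - Q (ξ - a - b))) := fun c ↦
      lintegral_const_mul _ (measurable_const.mul (hm2 c))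
    simp_rw [h2]
    rw [lintegral_const_mul]
    · congr 1
      symm
      -- Translating the two temporal frequencies by `Q a` and `Q b` centres their modulations at
      -- zero and moves all phases into the argument of the third one.
      rw [kk, ← lintegral_sub_right_eq_self _ (Q a)]
      refine lintegral_congr fun c ↦ ?_
      rw [← lintegral_sub_right_eq_self _ (Q b)]
      refine lintegral_congr fun d ↦ ?_
      congr 3
      ring
    · refine Measurable.lintegral_prod_right' (f := fun z : ℝ × ℝ ↦
        jj (z.1 - Q a) * (jj (z.2 - Q b) * jj (τ - z.1 - z.2 - Q (ξ - a - b)))) ?_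
      exact (measurable_jj.comp (by fun_prop)).mul ((measurable_jj.comp (by fun_prop)).mul
        (measurable_jj.comp (by fun_prop)))
  · refine Measurable.aemeasurable ?_
    exact Measurable.lintegral_prod_right' (f := fun z : (ℝ × ℝ) × ℝ ↦
      Λ a z.1.2 * (jj (z.1.1 - Q a) * (jj (z.2 - Q z.1.2) *
        jj (τ - z.1.1 - z.2 - Q (ξ - a - z.1.2)))))
      (hmeas.comp (by fun_prop : Measurable fun z : (ℝ × ℝ) × ℝ ↦ ((a, z.1.1), (z.1.2, z.2))))

/-! ### Integrals over the level sets of the phase -/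

/-- The phase in the frequency units of the Fourier transform. -/
def ph (A B x : ℝ) : ℝ := A * x ^ 5 + B * x ^ 3

/-- The derivative of the phase. -/
def ph' (A B x : ℝ) : ℝ := 5 * A * x ^ 4 + 3 * B * x ^ 2

theorem continuous_ph (A B : ℝ) : Continuous (ph A B) := by unfold ph; fun_prop

theorem continuous_ph' (A B : ℝ) : Continuous (ph' A B) := by unfold ph'; fun_prop

theorem hasDerivAt_ph (A B x : ℝ) : HasDerivAt (ph A B) (ph' A B x) x := by
  have h := ((hasDerivAt_pow 5 x).const_mul A).add ((hasDerivAt_pow 3 x).const_mul B)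
  refine (h.congr_deriv ?_).congr_of_eventuallyEq (Eventually.of_forall fun y ↦ rfl)
  simp only [ph', Nat.cast_ofNat]
  ring

/-- The substitution `y = h x` uses up the factor `|h'|` as a Jacobian and leaves the total mass of
`kk`, whatever `h` is. Both dispersive mechanisms end here. -/
theorem lintegral_abs_deriv_mul_kk_le {h h' : ℝ → ℝ} {I : Set ℝ} (hI : MeasurableSet I)
    (hd : ∀ x ∈ I, HasDerivAt h (h' x) x) (hinj : InjOn h I) (τ : ℝ) :
    ∫⁻ x in I, ENNReal.ofReal |h' x| * kk (τ - h x) ≤ ∫⁻ y, kk y := by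
  rw [← lintegral_image_eq_lintegral_abs_deriv_mul hI (fun x hx ↦ (hd x hx).hasDerivWithinAt) hinj
    (fun y ↦ kk (τ - y))]
  exact (setLIntegral_le_lintegral _ _).trans (lintegral_sub_left_eq_self kk τ).le

/-! ### Three high frequencies of equal sign -/

section High

variable {A B N : ℝ}

/-- The left factor splits as `(x - m)² (x + m) (5A²(x² + m²) + 3AB)`, and above `N` the quintic
part of the phase absorbs the cubic one by `hAB`. Multiplication by `A` makes the statement
insensitive to the sign of `A`. -/
theorem ph'_sub_mul_le (hAB : |B| ≤ |A| * N ^ 2) (hN : 0 ≤ N) {x m : ℝ} (hx : N ≤ x)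
    (hm : N ≤ m) : A ^ 2 * m ^ 3 * (x - m) ^ 2 ≤ A * (ph' A B x - ph' A B m) * (x - m) := by
  have h1 : -(A * B) ≤ A ^ 2 * N ^ 2 := by
    calc -(A * B) ≤ |A| * |B| := by rw [← abs_mul]; exact neg_le_abs _
      _ ≤ |A| * (|A| * N ^ 2) := by gcongr
      _ = A ^ 2 * N ^ 2 := by rw [← mul_assoc, ← sq, sq_abs]
  have hm0 : 0 ≤ m := hN.trans hm
  have hx0 : 0 ≤ x := hN.trans hx
  have h2 : A ^ 2 * N ^ 2 ≤ A ^ 2 * m ^ 2 := by gcongr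
  have h3 : A * (ph' A B x - ph' A B m) * (x - m) =
      (x - m) ^ 2 * ((x + m) * (5 * (A ^ 2 * (x ^ 2 + m ^ 2)) + 3 * (A * B))) := by
    simp only [ph']; ring
  rw [h3, mul_comm]
  refine mul_le_mul_of_nonneg_left ?_ (sq_nonneg _)
  have h4 : A ^ 2 * m ^ 2 ≤ 5 * (A ^ 2 * (x ^ 2 + m ^ 2)) + 3 * (A * B) := by
    nlinarith [mul_nonneg (sq_nonneg A) (sq_nonneg x), mul_nonneg (sq_nonneg A) (sq_nonneg m)]
  have h5 : 0 ≤ A ^ 2 * m ^ 2 := by positivity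
  calc A ^ 2 * m ^ 3 = m * (A ^ 2 * m ^ 2) := by ring
    _ ≤ (x + m) * (5 * (A ^ 2 * (x ^ 2 + m ^ 2)) + 3 * (A * B)) :=
      mul_le_mul (by linarith) h4 h5 (by linarith)

/-- The direction `(e₁, e₂, -e₁ - e₂)` sums to zero, so `ph' m` may be subtracted from each of the
three derivatives. By the previous monotonicity the first two terms contribute `e₁² + e₂² = 1`, and
the third is nonnegative and dropped. -/
theorem radial_deriv_ge (hAB : |B| ≤ |A| * N ^ 2) (hN : 0 ≤ N) {m r e₁ e₂ : ℝ}
    (hr : 0 < r) (he : e₁ ^ 2 + e₂ ^ 2 = 1) (h₁ : N ≤ m + r * e₁) (h₂ : N ≤ m + r * e₂)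
    (h₃ : N ≤ m - r * e₁ - r * e₂) :
    A ^ 2 * m ^ 3 * r ≤ A * (ph' A B (m + r * e₁) * e₁ + ph' A B (m + r * e₂) * e₂ +
      ph' A B (m - r * e₁ - r * e₂) * (-e₁ - e₂)) := by
  have hm : N ≤ m := by linarith
  have hm0 : 0 ≤ m := hN.trans hm
  have k1 := ph'_sub_mul_le hAB hN h₁ hm
  have k2 := ph'_sub_mul_le hAB hN h₂ hm
  have k3 := ph'_sub_mul_le hAB hN h₃ hm
  have k4 : 0 ≤ A ^ 2 * m ^ 3 * (m - r * e₁ - r * e₂ - m) ^ 2 := by positivity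
  refine le_of_mul_le_mul_right (a := r) ?_ hr
  have e1 : A ^ 2 * m ^ 3 * r * r = A ^ 2 * m ^ 3 * (m + r * e₁ - m) ^ 2 +
      A ^ 2 * m ^ 3 * (m + r * e₂ - m) ^ 2 := by
    linear_combination (-(A ^ 2 * m ^ 3 * r ^ 2)) * he
  rw [e1]
  generalize ph' A B (m + r * e₁) = d1 at *
  generalize ph' A B (m + r * e₂) = d2 at *
  generalize ph' A B (m - r * e₁ - r * e₂) = d3 at *
  generalize ph' A B m = d0 at *
  have e2 : A * (d1 * e₁ + d2 * e₂ + d3 * (-e₁ - e₂)) * r = A * (d1 - d0) * (m + r * e₁ - m) +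
      A * (d2 - d0) * (m + r * e₂ - m) + A * (d3 - d0) * (m - r * e₁ - r * e₂ - m) := by ring
  linarith

theorem mul_mul_le_mean_pow {a b c : ℝ} (ha : 0 ≤ a) (hb : 0 ≤ b) (hc : 0 ≤ c) :
    a * b * c ≤ ((a + b + c) / 3) ^ 3 := by
  nlinarith [mul_nonneg ha (sq_nonneg (b - c)), mul_nonneg hb (sq_nonneg (a - c)),
    mul_nonneg hc (sq_nonneg (a - b)), mul_nonneg (add_nonneg (add_nonneg ha hb) hc)
    (add_nonneg (add_nonneg (sq_nonneg (a - b)) (sq_nonneg (b - c))) (sq_nonneg (a - c)))]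

/-- Along a ray the phase sum has derivative at least `|A| m³ r` in absolute value, while the
product of the three frequencies is at most `m³` by the inequality of the means. So the weight times
`r` is at most `|A|⁻¹ |h'|`. The admissible part of the ray is convex, so the sign of the derivative
gives injectivity. -/
theorem lintegral_radial_le (hA : A ≠ 0) (hAB : |B| ≤ |A| * N ^ 2) (hN : 0 < N) {m e₁ e₂ τ : ℝ}
    (he : e₁ ^ 2 + e₂ ^ 2 = 1) :
    ∫⁻ r in {r : ℝ | 0 < r ∧ N ≤ m + r * e₁ ∧ N ≤ m + r * e₂ ∧ N ≤ m - r * e₁ - r * e₂},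
      ENNReal.ofReal r * (ENNReal.ofReal ((m + r * e₁) * (m + r * e₂) * (m - r * e₁ - r * e₂)) *
        kk (τ - ph A B (m + r * e₁) - ph A B (m + r * e₂) - ph A B (m - r * e₁ - r * e₂))) ≤
      ENNReal.ofReal |A|⁻¹ * ∫⁻ y, kk y := by
  set I := {r : ℝ | 0 < r ∧ N ≤ m + r * e₁ ∧ N ≤ m + r * e₂ ∧ N ≤ m - r * e₁ - r * e₂} with hI
  have hIm : MeasurableSet I := by
    simp only [hI, ofPred_and]
    exact MeasurableSet.inter (measurableSet_lt (by fun_prop) (by fun_prop))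
      (MeasurableSet.inter (measurableSet_le (by fun_prop) (by fun_prop))
      (MeasurableSet.inter (measurableSet_le (by fun_prop) (by fun_prop))
      (measurableSet_le (by fun_prop) (by fun_prop))))
  let h : ℝ → ℝ := fun r ↦ ph A B (m + r * e₁) + ph A B (m + r * e₂) +
    ph A B (m - r * e₁ - r * e₂)
  let h' : ℝ → ℝ := fun r ↦ ph' A B (m + r * e₁) * e₁ + ph' A B (m + r * e₂) * e₂ +
      ph' A B (m - r * e₁ - r * e₂) * (-e₁ - e₂)
  have hd : ∀ r, HasDerivAt h (h' r) r := by
    intro r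
    have l1 : ∀ e, HasDerivAt (fun r ↦ m + r * e) e r := fun e ↦ by
      simpa using ((hasDerivAt_id r).mul_const e).const_add m
    have l2 : HasDerivAt (fun r ↦ m - r * e₁ - r * e₂) (-e₁ - e₂) r := by
      simpa using! (((hasDerivAt_id r).mul_const e₁).const_sub m).sub
        ((hasDerivAt_id r).mul_const e₂)
    exact (((hasDerivAt_ph A B _).comp r (l1 e₁)).add
      ((hasDerivAt_ph A B _).comp r (l1 e₂))).add ((hasDerivAt_ph A B _).comp r l2)
  have hconv : Convex ℝ I := by
    intro x hx y hy a b ha hb hab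
    obtain ⟨x0, x1, x2, x3⟩ := hx
    obtain ⟨y0, y1, y2, y3⟩ := hy
    have hb' : b = 1 - a := by linarith
    refine ⟨?_, ?_, ?_, ?_⟩ <;> simp only [smul_eq_mul]
    · rcases ha.eq_or_lt with rfl | ha'
      · simp_all
      · positivity
    all_goals subst hb'; nlinarith
  have hpos : ∀ r ∈ I, 0 < A * h' r := by
    rintro r ⟨h0, h1, h2, h3⟩
    refine lt_of_lt_of_le ?_ (radial_deriv_ge hAB hN.le h0 he h1 h2 h3)
    have : 0 < m := by linarith
    positivity
  have hmono : StrictMonoOn (fun r ↦ A * h r) I := by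
    refine strictMonoOn_of_deriv_pos hconv
      (fun r _ ↦ ((hd r).const_mul A).continuousAt.continuousWithinAt) fun r hr ↦ ?_
    rw [((hd r).const_mul A).deriv]
    exact hpos r (interior_subset hr)
  have hinj : InjOn h I := fun x hx y hy hxy ↦ hmono.injOn hx hy (by simp only [hxy])
  calc _ ≤ ∫⁻ r in I, ENNReal.ofReal |A|⁻¹ * (ENNReal.ofReal |h' r| * kk (τ - h r)) := by
        refine setLIntegral_mono' hIm fun r hr ↦ ?_
        obtain ⟨h0, h1, h2, h3⟩ := hr
        have hk : τ - ph A B (m + r * e₁) - ph A B (m + r * e₂) - ph A B (m - r * e₁ - r * e₂) =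
            τ - h r := by simp only [h]; ring
        rw [hk, ← mul_assoc, ← mul_assoc, ← ENNReal.ofReal_mul h0.le,
          ← ENNReal.ofReal_mul (by positivity)]
        refine mul_le_mul_left (ENNReal.ofReal_le_ofReal ?_) _
        have k1 := radial_deriv_ge hAB hN.le h0 he h1 h2 h3
        have k2 : A * h' r ≤ |A| * |h' r| := by rw [← abs_mul]; exact le_abs_self _
        have k3 := mul_mul_le_mean_pow (hN.le.trans h1) (hN.le.trans h2) (hN.le.trans h3)
        have k4 : (m + r * e₁ + (m + r * e₂) + (m - r * e₁ - r * e₂)) / 3 = m := by ring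
        rw [k4] at k3
        have hA' : 0 < |A| := abs_pos.2 hA
        rw [inv_mul_eq_div, le_div_iff₀ hA']
        refine le_of_mul_le_mul_left (a := |A|) ?_ hA'
        calc |A| * (r * ((m + r * e₁) * (m + r * e₂) * (m - r * e₁ - r * e₂)) * |A|)
            = A ^ 2 * ((m + r * e₁) * (m + r * e₂) * (m - r * e₁ - r * e₂)) * r := by
              rw [← sq_abs A]; ring
          _ ≤ A ^ 2 * m ^ 3 * r := by gcongr
          _ ≤ _ := k1.trans k2
    _ ≤ _ := by
        have hm : Measurable fun r ↦ ENNReal.ofReal |h' r| * kk (τ - h r) := by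
          have c1 : Continuous h' := by
            simp only [h']
            have := continuous_ph' A B
            fun_prop
          have c2 : Continuous h := by
            simp only [h]
            have := continuous_ph A B
            fun_prop
          exact (c1.abs.measurable.ennreal_ofReal).fun_mul
            (measurable_kk.comp (measurable_const.sub c2.measurable))
        rw [lintegral_const_mul _ hm]
        exact mul_le_mul_right (lintegral_abs_deriv_mul_kk_le hIm (fun x _ ↦ hd x) hinj τ) _

/-- The density of the cubic phase near high frequencies of equal sign. -/
theorem lintegral_high_le (hA : A ≠ 0) (hAB : |B| ≤ |A| * N ^ 2) (hN : 0 < N) (ξ τ : ℝ) :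
    ∫⁻ a, ∫⁻ b, {z : ℝ × ℝ | N ≤ z.1 ∧ N ≤ z.2 ∧ N ≤ ξ - z.1 - z.2}.indicator
      (fun z ↦ ENNReal.ofReal (z.1 * z.2 * (ξ - z.1 - z.2))) (a, b) *
        kk (τ - ph A B a - ph A B b - ph A B (ξ - a - b)) ≤
      ENNReal.ofReal (2 * Real.pi * |A|⁻¹) * ∫⁻ y, kk y := by
  set S := {z : ℝ × ℝ | N ≤ z.1 ∧ N ≤ z.2 ∧ N ≤ ξ - z.1 - z.2} with hS
  have hSm : MeasurableSet S := by
    simp only [hS, ofPred_and]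
    exact MeasurableSet.inter (measurableSet_le (by fun_prop) (by fun_prop))
      (MeasurableSet.inter (measurableSet_le (by fun_prop) (by fun_prop))
      (measurableSet_le (by fun_prop) (by fun_prop)))
  let F : ℝ × ℝ → ℝ≥0∞ := fun z ↦ S.indicator
      (fun z ↦ ENNReal.ofReal (z.1 * z.2 * (ξ - z.1 - z.2))) z *
        kk (τ - ph A B z.1 - ph A B z.2 - ph A B (ξ - z.1 - z.2))
  have hF : Measurable F := by
    refine Measurable.mul ((by fun_prop : Measurable fun z : ℝ × ℝ ↦
      ENNReal.ofReal (z.1 * z.2 * (ξ - z.1 - z.2))).indicator hSm) (measurable_kk.comp ?_)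
    have := (continuous_ph A B)
    exact Continuous.measurable (by fun_prop)
  have h1 : ∫⁻ a, ∫⁻ b, F (a, b) = ∫⁻ z, F z := by
    rw [Measure.volume_eq_prod, lintegral_prod _ hF.aemeasurable]
  change ∫⁻ a, ∫⁻ b, F (a, b) ≤ _
  set m := ξ / 3 with hm
  -- Polar coordinates about `(ξ/3, ξ/3)`, where the three frequencies coincide and the phase sum is
  -- critical. The Jacobian `r` compensates the linear vanishing of the radial derivative there.
  rw [h1, ← lintegral_add_left_eq_self F (m, m), ← lintegral_comp_polarCoord_symm]
  have hG : Measurable fun p : ℝ × ℝ ↦ ENNReal.ofReal p.1 • F ((m, m) + polarCoord.symm p) := by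
    refine (measurable_fst.ennreal_ofReal).smul (hF.comp ?_)
    exact measurable_const.add continuous_polarCoord_symm.measurable
  rw [polarCoord_target, Measure.volume_eq_prod, ← Measure.prod_restrict,
    lintegral_prod_symm _ hG.aemeasurable]
  have h2 : ∀ θ : ℝ, ∫⁻ r in Ioi (0 : ℝ), ENNReal.ofReal r • F ((m, m) + polarCoord.symm (r, θ)) ≤
      ENNReal.ofReal |A|⁻¹ * ∫⁻ y, kk y := by
    intro θ
    refine le_trans ?_ (lintegral_radial_le hA hAB hN (m := m) (τ := τ)
      (Real.cos_sq_add_sin_sq θ))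
    rw [← lintegral_indicator measurableSet_Ioi, ← lintegral_indicator]
    · refine lintegral_mono fun r ↦ ?_
      by_cases hr : 0 < r
      · rw [indicator_of_mem (mem_Ioi.2 hr)]
        simp only [F, polarCoord_symm_apply, Prod.mk_add_mk]
        have e3 : ξ - (m + r * Real.cos θ) - (m + r * Real.sin θ) =
            m - r * Real.cos θ - r * Real.sin θ := by rw [hm]; ring
        by_cases hmem : (m + r * Real.cos θ, m + r * Real.sin θ) ∈ S
        · rw [indicator_of_mem hmem, indicator_of_mem]
          · simp only [e3, smul_eq_mul, le_refl]
          · obtain ⟨k1, k2, k3⟩ := hmem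
            exact ⟨hr, k1, k2, e3 ▸ k3⟩
        · rw [indicator_of_notMem hmem]
          simp
      · rw [indicator_of_notMem (by simpa using hr)]
        exact zero_le
    · simp only [ofPred_and]
      exact MeasurableSet.inter (measurableSet_lt (by fun_prop) (by fun_prop))
        (MeasurableSet.inter (measurableSet_le (by fun_prop) (by fun_prop))
        (MeasurableSet.inter (measurableSet_le (by fun_prop) (by fun_prop))
        (measurableSet_le (by fun_prop) (by fun_prop))))
  refine (lintegral_mono h2).trans (le_of_eq ?_)
  rw [setLIntegral_const, Real.volume_Ioo, mul_comm, ← mul_assoc,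
    ← ENNReal.ofReal_mul (by linarith [Real.pi_pos])]
  congr 2
  ring

end High

/-! ### Transversal interactions -/

/-- About the midpoint `m = d/2` the odd powers of `y = x - m` cancel and the phase sum is a
constant plus `c₁y² + c₂y⁴`, with derivative `2y(c₁ + 2c₂y²)`. On each of the four sets where the
signs of `y` and `c₁ + 2c₂y²` are prescribed it is injective; this is the factor `4`. -/
theorem lintegral_pair_le (A B d τ : ℝ) :
    ∫⁻ x, ENNReal.ofReal |ph' A B x - ph' A B (d - x)| * kk (τ - (ph A B x + ph A B (d - x))) ≤
      4 * ∫⁻ y, kk y := by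
  let h : ℝ → ℝ := fun x ↦ ph A B x + ph A B (d - x)
  let h' : ℝ → ℝ := fun x ↦ ph' A B x - ph' A B (d - x)
  let m := d / 2
  let c₁ := 20 * A * m ^ 3 + 6 * B * m
  let c₂ := 10 * A * m
  have hh : ∀ x, h x = 2 * A * m ^ 5 + 2 * B * m ^ 3 + c₁ * (x - m) ^ 2 + c₂ * (x - m) ^ 4 := by
    intro x
    simp only [h, ph, c₁, c₂, m]
    ring
  have hh' : ∀ x, h' x = 2 * (x - m) * (c₁ + 2 * c₂ * (x - m) ^ 2) := by
    intro x
    simp only [h', ph', c₁, c₂, m]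
    ring
  have hd : ∀ x, HasDerivAt h (h' x) x := by
    intro x
    have l : HasDerivAt (fun x ↦ d - x) (-1) x := by simpa using (hasDerivAt_id x).const_sub d
    have := (hasDerivAt_ph A B x).add ((hasDerivAt_ph A B (d - x)).comp x l)
    refine this.congr_deriv ?_
    simp only [h']
    ring
  let S : ℝ → ℝ → Set ℝ := fun σ ρ ↦
    {x | 0 < σ * (x - m) ∧ 0 < ρ * (c₁ + 2 * c₂ * (x - m) ^ 2)}
  have hSm : ∀ σ ρ, MeasurableSet (S σ ρ) := fun σ ρ ↦ by
    simp only [S, ofPred_and]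
    exact MeasurableSet.inter (measurableSet_lt (by fun_prop) (by fun_prop))
      (measurableSet_lt (by fun_prop) (by fun_prop))
  have hinj : ∀ σ ρ, InjOn h (S σ ρ) := by
    rintro σ ρ x ⟨hx1, hx2⟩ y ⟨hy1, hy2⟩ hxy
    rw [hh, hh] at hxy
    have e1 : ((x - m) ^ 2 - (y - m) ^ 2) * (c₁ + c₂ * ((x - m) ^ 2 + (y - m) ^ 2)) = 0 := by
      linear_combination hxy
    -- This factor is the mean of `c₁ + 2c₂(x - m)²` and `c₁ + 2c₂(y - m)²`, both of which have the
    -- sign `ρ`.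
    have e2 : 0 < ρ * (c₁ + c₂ * ((x - m) ^ 2 + (y - m) ^ 2)) := by nlinarith
    have e3 : (x - m) ^ 2 - (y - m) ^ 2 = 0 := by
      rcases mul_eq_zero.1 e1 with e | e
      · exact e
      · rw [e, mul_zero] at e2
        exact absurd e2 (lt_irrefl _)
    have e4 : (x - y) * (x - m + (y - m)) = 0 := by linear_combination e3
    rcases mul_eq_zero.1 e4 with e | e
    · linarith
    · have e5 : σ * (x - m) + σ * (y - m) = 0 := by rw [← mul_add, e, mul_zero]
      linarith
  let F : ℝ → ℝ≥0∞ := fun x ↦ ENNReal.ofReal |h' x| * kk (τ - h x)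
  have hF : Measurable F := by
    have c1 : Continuous h' := by
      simp only [h']
      have := continuous_ph' A B
      fun_prop
    have c2 : Continuous h := by
      simp only [h]
      have := continuous_ph A B
      fun_prop
    exact (c1.abs.measurable.ennreal_ofReal).fun_mul
      (measurable_kk.comp (measurable_const.sub c2.measurable))
  have hpt : ∀ x, F x ≤ (S 1 1).indicator F x + (S 1 (-1)).indicator F x +
      (S (-1) 1).indicator F x + (S (-1) (-1)).indicator F x := by
    intro x
    by_cases h0 : h' x = 0
    · simp [F, h0]
    have key : ∃ σ ∈ ({1, -1} : Set ℝ), ∃ ρ ∈ ({1, -1} : Set ℝ), x ∈ S σ ρ := by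
      rw [hh'] at h0
      have n1 : x - m ≠ 0 := fun e ↦ h0 (by rw [e]; ring)
      have n2 : c₁ + 2 * c₂ * (x - m) ^ 2 ≠ 0 := fun e ↦ h0 (by rw [e]; ring)
      have sgn : ∀ y : ℝ, y ≠ 0 → ∃ σ ∈ ({1, -1} : Set ℝ), 0 < σ * y := by
        intro y hy
        rcases lt_or_gt_of_ne hy with h | h
        · exact ⟨-1, by simp, by linarith⟩
        · exact ⟨1, by simp, by linarith⟩
      obtain ⟨σ, hσ, h1⟩ := sgn _ n1
      obtain ⟨ρ, hρ, h2⟩ := sgn _ n2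
      exact ⟨σ, hσ, ρ, hρ, h1, h2⟩
    obtain ⟨σ, hσ, ρ, hρ, hx⟩ := key
    rcases hσ with rfl | rfl <;> rcases hρ with rfl | rfl
    · refine le_trans ?_ (le_self_add.trans (le_self_add.trans le_self_add))
      rw [indicator_of_mem hx]
    · refine le_trans ?_ ((le_add_self.trans le_self_add).trans le_self_add)
      rw [indicator_of_mem hx]
    · refine le_trans ?_ (le_add_self.trans le_self_add)
      rw [indicator_of_mem hx]
    · refine le_trans ?_ le_add_self
      rw [indicator_of_mem hx]
  calc ∫⁻ x, F x ≤ _ := lintegral_mono hpt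
    _ = (∫⁻ x in S 1 1, F x) + (∫⁻ x in S 1 (-1), F x) + (∫⁻ x in S (-1) 1, F x) +
        ∫⁻ x in S (-1) (-1), F x := by
      rw [lintegral_add_right _ (hF.indicator (hSm _ _)),
        lintegral_add_right _ (hF.indicator (hSm _ _)),
        lintegral_add_right _ (hF.indicator (hSm _ _)), lintegral_indicator (hSm _ _),
        lintegral_indicator (hSm _ _), lintegral_indicator (hSm _ _), lintegral_indicator (hSm _ _)]
    _ ≤ (∫⁻ y, kk y) + (∫⁻ y, kk y) + (∫⁻ y, kk y) + ∫⁻ y, kk y := by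
      have k : ∀ σ ρ, ∫⁻ x in S σ ρ, F x ≤ ∫⁻ y, kk y := fun σ ρ ↦
        lintegral_abs_deriv_mul_kk_le (hSm σ ρ) (fun x _ ↦ hd x) (hinj σ ρ) τ
      exact add_le_add (add_le_add (add_le_add (k _ _) (k _ _)) (k _ _)) (k _ _)
    _ = 4 * ∫⁻ y, kk y := by ring

/-- The weight `|ξ|⁻¹ (1 + |x / ξ|)^{-5/2}`. -/
def ww (ξ x : ℝ) : ℝ := |ξ|⁻¹ * (1 + ‖x / ξ‖) ^ (-(5 / 2) : ℝ)

theorem ww_nonneg (ξ x : ℝ) : 0 ≤ ww ξ x := by unfold ww; positivity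

theorem measurable_ww : Measurable fun z : ℝ × ℝ ↦ ww z.1 z.2 := by unfold ww; fun_prop

/-- The weight is the dilate by `ξ` of a fixed integrable function, normalised in `L¹`. At `ξ = 0`
it vanishes because `|0|⁻¹ = 0`. -/
theorem exists_lintegral_ww_le : ∃ C : ℝ≥0∞, C < ∞ ∧ ∀ ξ, ∫⁻ x, ENNReal.ofReal (ww ξ x) ≤ C := by
  have hi : Integrable (fun y : ℝ ↦ (1 + ‖y‖) ^ (-(5 / 2) : ℝ)) :=
    integrable_one_add_norm (by norm_num)
  refine ⟨ENNReal.ofReal (∫ y : ℝ, (1 + ‖y‖) ^ (-(5 / 2) : ℝ)), ENNReal.ofReal_lt_top, fun ξ ↦ ?_⟩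
  rcases eq_or_ne ξ 0 with rfl | h
  · simp [ww]
  · have h1 : Integrable (ww ξ) := (hi.comp_div h).const_mul _
    rw [← ofReal_integral_eq_lintegral_ofReal h1 (ae_of_all _ fun x ↦ ww_nonneg _ _)]
    refine ENNReal.ofReal_le_ofReal (le_of_eq ?_)
    unfold ww
    rw [integral_const_mul, Measure.integral_comp_div (fun y : ℝ ↦ (1 + ‖y‖) ^ (-(5 / 2) : ℝ)),
      smul_eq_mul, ← mul_assoc, inv_mul_cancel₀ (abs_ne_zero.2 h), one_mul]

/-- With `a` frozen, the other two frequencies have the constant sum `ξ - a`, so the estimate for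
pairs applies uniformly in `a`. -/
theorem lintegral_transversal_le (A B : ℝ) {W : ℝ → ℝ} (hW : Measurable W) (ξ τ : ℝ) :
    ∫⁻ a, ∫⁻ b, ENNReal.ofReal (W a) * ENNReal.ofReal |ph' A B b - ph' A B (ξ - a - b)| *
        kk (τ - ph A B a - ph A B b - ph A B (ξ - a - b)) ≤
      (∫⁻ a, ENNReal.ofReal (W a)) * (4 * ∫⁻ y, kk y) := by
  rw [← lintegral_mul_const _ hW.ennreal_ofReal]
  refine lintegral_mono fun a ↦ ?_
  simp_rw [mul_assoc]
  rw [lintegral_const_mul]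
  · refine mul_le_mul_right ?_ _
    refine le_trans (le_of_eq ?_) (lintegral_pair_le A B (ξ - a) (τ - ph A B a))
    refine lintegral_congr fun b ↦ ?_
    congr 2
    ring
  · have := continuous_ph A B
    have := continuous_ph' A B
    refine Measurable.fun_mul ?_ (measurable_kk.comp ?_)
    · exact (Continuous.measurable (by fun_prop)).ennreal_ofReal
    · exact Continuous.measurable (by fun_prop)

/-! ### Pointwise bounds for the multiplier of the nonlinearity -/

/-- The multiplier of `∂_x (u v w)` between weighted spaces. -/
def mult (s ξ a b c : ℝ) : ℝ := |ξ| * wt s ξ * (wt (-s) a * (wt (-s) b * wt (-s) c))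

theorem wt_add_le {σ : ℝ} (hσ : 0 ≤ σ) (a b c : ℝ) :
    wt σ (a + b + c) ≤ 4 ^ (σ / 2) * (wt σ a * (wt σ b * wt σ c)) := by
  unfold wt
  rw [← Real.mul_rpow (by positivity) (by positivity), ← Real.mul_rpow (by positivity)
    (by positivity), ← Real.mul_rpow (by norm_num) (by positivity)]
  refine Real.rpow_le_rpow (by positivity) ?_ (by linarith)
  have key : ∀ x y : ℝ, 1 + (x + y) ^ 2 ≤ 2 * ((1 + x ^ 2) * (1 + y ^ 2)) := fun x y ↦ by
    nlinarith [sq_nonneg (x - y), sq_nonneg (x * y)]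
  calc 1 + (a + b + c) ^ 2 ≤ 2 * ((1 + (a + b) ^ 2) * (1 + c ^ 2)) := key _ _
    _ ≤ 2 * ((2 * ((1 + a ^ 2) * (1 + b ^ 2))) * (1 + c ^ 2)) := by
      gcongr
      exact key a b
    _ = 4 * ((1 + a ^ 2) * ((1 + b ^ 2) * (1 + c ^ 2))) := by ring

/-- Here the threshold `-1/4` enters. The weight of order `s + 1/4 ≥ 0` is submultiplicative up to a
constant, which reduces every `s` to `s = -1/4`; there each input carries `⟨·⟩^{1/4}`, and
`|ξ|⟨ξ⟩^{-1/4} ≤ |ξ|^{3/4}`. -/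
theorem mult_le_of_le {s : ℝ} (hs : -(1 / 4) ≤ s) {ξ a b c : ℝ} (h : ξ = a + b + c) :
    mult s ξ a b c ≤ 4 ^ ((s + 1 / 4) / 2) *
      (|ξ| ^ (3 / 4 : ℝ) * ((1 + a ^ 2) * ((1 + b ^ 2) * (1 + c ^ 2))) ^ (1 / 8 : ℝ)) := by
  have h1 := wt_add_le (σ := s + 1 / 4) (by linarith) a b c
  rw [← h] at h1
  have h2 : wt s ξ = wt (s + 1 / 4) ξ * wt (-(1 / 4)) ξ := by rw [wt_mul]; ring_nf
  have h3 : ∀ x, wt (s + 1 / 4) x * wt (-s) x = wt (1 / 4) x := fun x ↦ by rw [wt_mul]; ring_nf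
  have h4 : |ξ| * wt (-(1 / 4)) ξ ≤ |ξ| ^ (3 / 4 : ℝ) := by
    rcases eq_or_ne ξ 0 with rfl | h0
    · simp
    have h0' : 0 < |ξ| := abs_pos.2 h0
    calc |ξ| * wt (-(1 / 4)) ξ ≤ |ξ| * |ξ| ^ (-(1 / 4) : ℝ) := by
          gcongr
          rw [wt, show |ξ| ^ (-(1 / 4) : ℝ) = (|ξ| ^ 2) ^ (-(1 / 4) / 2 : ℝ) by
            rw [← Real.rpow_natCast, ← Real.rpow_mul h0'.le]; norm_num, sq_abs]
          exact Real.rpow_le_rpow_of_nonpos (by positivity) (by linarith) (by norm_num)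
      _ = |ξ| ^ (3 / 4 : ℝ) := by
          nth_rewrite 1 [← Real.rpow_one |ξ|]
          rw [← Real.rpow_add h0']
          norm_num
  have h5 : wt (1 / 4) a * (wt (1 / 4) b * wt (1 / 4) c) =
      ((1 + a ^ 2) * ((1 + b ^ 2) * (1 + c ^ 2))) ^ (1 / 8 : ℝ) := by
    unfold wt
    rw [Real.mul_rpow (by positivity) (by positivity), Real.mul_rpow (by positivity)
      (by positivity)]
    norm_num
  have p1 := fun x ↦ (wt_pos (-s) x).le
  have p2 := fun x ↦ (wt_pos (s + 1 / 4) x).le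
  have p3 := (wt_pos (-(1 / 4)) ξ).le
  calc mult s ξ a b c = wt (s + 1 / 4) ξ * ((|ξ| * wt (-(1 / 4)) ξ) *
        (wt (-s) a * (wt (-s) b * wt (-s) c))) := by rw [mult, h2]; ring
    _ ≤ (4 ^ ((s + 1 / 4) / 2) * (wt (s + 1 / 4) a * (wt (s + 1 / 4) b * wt (s + 1 / 4) c))) *
        (|ξ| ^ (3 / 4 : ℝ) * (wt (-s) a * (wt (-s) b * wt (-s) c))) := by
      have q1 := p1 a
      have q2 := p1 b
      have q3 := p1 c
      have q4 := p2 a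
      have q5 := p2 b
      have q6 := p2 c
      gcongr
    _ = 4 ^ ((s + 1 / 4) / 2) * (|ξ| ^ (3 / 4 : ℝ) * ((wt (s + 1 / 4) a * wt (-s) a) *
        ((wt (s + 1 / 4) b * wt (-s) b) * (wt (s + 1 / 4) c * wt (-s) c)))) := by ring
    _ = _ := by rw [h3, h3, h3, h5]

/-- With `n = |i|` the largest frequency, the fourth root is at most `2n^{3/2}` and the velocities
differ by at least `|A| n⁴`. The remaining `|ξ|^{3/2} n^{-5/2}` is at most `32 ww ξ k`, because `|ξ|
+ |k| ≤ 4n`. The exponent in `ww` is the one left over by this count, and it exceeds `1`. -/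
theorem transversal_weight_le {A B N : ℝ} (hA : A ≠ 0) (hAB : |B| ≤ |A| * N ^ 2) (hN : 1 ≤ N)
    {ξ i k j : ℝ} (h : ξ = i + k + j) (hξ : ξ ≠ 0) (hi : N ≤ |i|) (hk : |k| ≤ |i|)
    (hj : |j| ≤ |i| / 2) :
    |ξ| ^ (3 / 2 : ℝ) * ((1 + i ^ 2) * ((1 + k ^ 2) * (1 + j ^ 2))) ^ (1 / 4 : ℝ) ≤
      64 * |A|⁻¹ * (ww ξ k * |ph' A B i - ph' A B j|) := by
  set n := |i| with hn
  have hn1 : 1 ≤ n := hN.trans hi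
  have hn0 : 0 < n := by linarith
  have hξ' : 0 < |ξ| := abs_pos.2 hξ
  have hA' : 0 < |A| := abs_pos.2 hA
  have hi2 : i ^ 2 = n ^ 2 := (sq_abs i).symm
  have hk2 : k ^ 2 ≤ n ^ 2 := sq_le_sq.2 (by rwa [abs_of_pos hn0])
  have hj2 : j ^ 2 ≤ (n / 2) ^ 2 := sq_le_sq.2 (by rwa [abs_of_pos (by positivity : 0 < n / 2)])
  have h1 : ((1 + i ^ 2) * ((1 + k ^ 2) * (1 + j ^ 2))) ^ (1 / 4 : ℝ) ≤ 2 * n ^ (3 / 2 : ℝ) := by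
    have e1 : (2 * n ^ (3 / 2 : ℝ)) = (16 * n ^ 6) ^ (1 / 4 : ℝ) := by
      rw [Real.mul_rpow (by norm_num) (by positivity), ← Real.rpow_natCast n 6,
        ← Real.rpow_mul hn0.le, show (16 : ℝ) = 2 ^ (4 : ℝ) by norm_num, ← Real.rpow_mul (by norm_num)]
      norm_num
    rw [e1]
    refine Real.rpow_le_rpow (by positivity) ?_ (by norm_num)
    calc (1 + i ^ 2) * ((1 + k ^ 2) * (1 + j ^ 2))
        ≤ (2 * n ^ 2) * ((2 * n ^ 2) * (2 * n ^ 2)) := by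
          gcongr <;> nlinarith
      _ ≤ 16 * n ^ 6 := by nlinarith [pow_pos hn0 6]
  have h2 : |ξ| ^ (3 / 2 : ℝ) * n ^ (-(5 / 2) : ℝ) / 32 ≤ ww ξ k := by
    have e2 : |ξ| ^ (3 / 2 : ℝ) * n ^ (-(5 / 2) : ℝ) / 32 =
        |ξ|⁻¹ * (4 * n / |ξ|) ^ (-(5 / 2) : ℝ) := by
      rw [Real.div_rpow (by positivity) hξ'.le, Real.mul_rpow (by norm_num) hn0.le,
        Real.rpow_neg hξ'.le, show (4 : ℝ) = 2 ^ (2 : ℝ) by norm_num, ← Real.rpow_mul (by norm_num),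
        div_inv_eq_mul, show (3 / 2 : ℝ) = 5 / 2 - 1 by norm_num, Real.rpow_sub_one hξ'.ne',
        show (2 * -(5 / 2) : ℝ) = -5 by norm_num, Real.rpow_neg (by norm_num) 5,
        show (2 : ℝ) ^ (5 : ℝ) = 32 by norm_num]
      field_simp
    rw [e2, ww, norm_div, Real.norm_eq_abs, Real.norm_eq_abs]
    refine mul_le_mul_of_nonneg_left ?_ (by positivity)
    refine Real.rpow_le_rpow_of_nonpos (by positivity) ?_ (by norm_num)
    rw [show 1 + |k| / |ξ| = (|ξ| + |k|) / |ξ| by field_simp]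
    gcongr
    have : |ξ| ≤ n + |k| + |j| := by rw [h]; exact abs_add_three _ _ _
    linarith
  have h3 : |A| * n ^ 4 ≤ |ph' A B i - ph' A B j| := by
    have e3 : ph' A B i - ph' A B j = (i ^ 2 - j ^ 2) * (5 * A * (i ^ 2 + j ^ 2) + 3 * B) := by
      simp only [ph']; ring
    rw [e3, abs_mul]
    have k1 : 3 / 4 * n ^ 2 ≤ |i ^ 2 - j ^ 2| := by
      refine le_trans ?_ (le_abs_self _)
      rw [hi2]; linarith
    have k2 : 2 * |A| * n ^ 2 ≤ |5 * A * (i ^ 2 + j ^ 2) + 3 * B| := by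
      have t1 : |5 * A * (i ^ 2 + j ^ 2)| ≤ |5 * A * (i ^ 2 + j ^ 2) + 3 * B| + |3 * B| := by
        have := abs_sub (5 * A * (i ^ 2 + j ^ 2) + 3 * B) (3 * B)
        rwa [add_sub_cancel_right] at this
      have t2 : |5 * A * (i ^ 2 + j ^ 2)| = 5 * |A| * (n ^ 2 + j ^ 2) := by
        rw [abs_mul, abs_mul, abs_of_nonneg (by positivity : 0 ≤ i ^ 2 + j ^ 2), hi2]
        norm_num
      have t3 : |3 * B| = 3 * |B| := by rw [abs_mul]; norm_num
      have t4 : |A| * N ^ 2 ≤ |A| * n ^ 2 := by gcongr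
      have t5 : 0 ≤ |A| * j ^ 2 := by positivity
      rw [t2, t3] at t1
      nlinarith
    calc |A| * n ^ 4 ≤ 3 / 4 * n ^ 2 * (2 * |A| * n ^ 2) := by
          have : 0 ≤ |A| * n ^ 4 := by positivity
          nlinarith
      _ ≤ _ := mul_le_mul k1 k2 (by positivity) (abs_nonneg _)
  calc |ξ| ^ (3 / 2 : ℝ) * ((1 + i ^ 2) * ((1 + k ^ 2) * (1 + j ^ 2))) ^ (1 / 4 : ℝ)
      ≤ |ξ| ^ (3 / 2 : ℝ) * (2 * n ^ (3 / 2 : ℝ)) := by gcongr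
    _ = 64 * |A|⁻¹ * ((|ξ| ^ (3 / 2 : ℝ) * n ^ (-(5 / 2) : ℝ) / 32) * (|A| * n ^ 4)) := by
      have e4 : n ^ (3 / 2 : ℝ) = n ^ (-(5 / 2) : ℝ) * n ^ 4 := by
        rw [← Real.rpow_natCast n 4, ← Real.rpow_add hn0]
        norm_num
      rw [e4]
      field_simp
      norm_num
    _ ≤ _ := by
      have := ww_nonneg ξ k
      gcongr

/-- The sum of the three transversal weights. -/
def trans (A B ξ a b c : ℝ) : ℝ := ww ξ a * |ph' A B b - ph' A B c| +
  (ww ξ b * |ph' A B a - ph' A B c| + ww ξ c * |ph' A B a - ph' A B b|)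

theorem trans_nonneg (A B ξ a b c : ℝ) : 0 ≤ trans A B ξ a b c := by
  have := ww_nonneg ξ
  unfold trans
  have h1 := this a
  have h2 := this b
  have h3 := this c
  positivity

/-- An output so large compared with the inputs forces transversality: `|ξ| ≤ 3|i|`, and either `|i|
< N` or `|j| > |i|/2` would bound `ξ⁶` by the left side of `hcase`. -/
theorem transversal_weight_le_of_lt {A B N : ℝ} (hA : A ≠ 0) (hAB : |B| ≤ |A| * N ^ 2) (hN : 1 ≤ N)
    {ξ i k j P : ℝ} (hξ0 : ξ ≠ 0) (h : ξ = i + k + j)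
    (hP' : P = (1 + i ^ 2) * ((1 + k ^ 2) * (1 + j ^ 2)))
    (hcase : (3 * N) ^ 6 * 64 * P < ξ ^ 6) (hk : |k| ≤ |i|) (hj : |j| ≤ |i|) (hjk : |j| ≤ |k|) :
    |ξ| ^ (3 / 2 : ℝ) * P ^ (1 / 4 : ℝ) ≤ 64 * |A|⁻¹ * (ww ξ k * |ph' A B i - ph' A B j|) := by
  have hξi : |ξ| ≤ 3 * |i| := by
    have : |ξ| ≤ |i| + |k| + |j| := by rw [h]; exact abs_add_three _ _ _
    linarith
  have hξ6 : ξ ^ 6 ≤ (3 * |i|) ^ 6 := by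
    rw [← Even.pow_abs (by decide : Even 6)]
    exact pow_le_pow_left₀ (abs_nonneg _) hξi 6
  have hP2 : |i| ^ 2 * (|k| ^ 2 * |j| ^ 2) ≤ P := by
    rw [hP', sq_abs, sq_abs, sq_abs]
    gcongr <;> linarith
  have hP3 : 1 ≤ P := by
    rw [hP']
    exact one_le_mul_of_one_le_of_one_le (by nlinarith [sq_nonneg i])
      (one_le_mul_of_one_le_of_one_le (by nlinarith [sq_nonneg k]) (by nlinarith [sq_nonneg j]))
  have hN6 : (1 : ℝ) ≤ N ^ 6 := one_le_pow₀ hN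
  have hiN : N ≤ |i| := by
    by_contra hlt
    rw [not_le] at hlt
    have h1 : (3 * |i|) ^ 6 ≤ (3 * N) ^ 6 :=
      pow_le_pow_left₀ (by positivity) (by linarith) 6
    have h2 : (3 * N) ^ 6 ≤ (3 * N) ^ 6 * 64 * P := by
      rw [mul_assoc]
      exact le_mul_of_one_le_right (by positivity) (by linarith)
    linarith
  have hj2 : |j| ≤ |i| / 2 := by
    by_contra hlt
    rw [not_le] at hlt
    have h1 : (|i| / 2) ^ 2 * (|i| / 2) ^ 2 ≤ |k| ^ 2 * |j| ^ 2 := by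
      have : |i| / 2 ≤ |k| := hlt.le.trans hjk
      gcongr
    -- `11664 = 3⁶ · 2⁴`.
    have h2 : (3 * |i|) ^ 6 = 11664 * (|i| ^ 2 * ((|i| / 2) ^ 2 * (|i| / 2) ^ 2)) := by ring
    have h3 : |i| ^ 2 * ((|i| / 2) ^ 2 * (|i| / 2) ^ 2) ≤ P :=
      (mul_le_mul_of_nonneg_left h1 (by positivity)).trans hP2
    have h4 : 11664 * P ≤ (3 * N) ^ 6 * 64 * P := by
      refine mul_le_mul_of_nonneg_right ?_ (by linarith)
      rw [mul_pow]
      linarith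
    linarith
  rw [hP']
  exact transversal_weight_le hA hAB hN h hξ0 hiN hk hj2

theorem transversal_weight_le_trans {A B N : ℝ} (hA : A ≠ 0) (hAB : |B| ≤ |A| * N ^ 2)
    (hN : 1 ≤ N) {ξ a b c P : ℝ} (hξ0 : ξ ≠ 0) (hξ : ξ = a + b + c)
    (hP : P = (1 + a ^ 2) * ((1 + b ^ 2) * (1 + c ^ 2))) (hcase : (3 * N) ^ 6 * 64 * P < ξ ^ 6) :
    |ξ| ^ (3 / 2 : ℝ) * P ^ (1 / 4 : ℝ) ≤ 64 * |A|⁻¹ * trans A B ξ a b c := by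
  have key := fun i k j h hP' ↦
    transversal_weight_le_of_lt (i := i) (k := k) (j := j) hA hAB hN hξ0 h hP' hcase
  have w := ww_nonneg ξ
  have t1 : ww ξ a * |ph' A B b - ph' A B c| ≤ trans A B ξ a b c :=
    le_add_of_nonneg_right (add_nonneg (mul_nonneg (w _) (abs_nonneg _))
      (mul_nonneg (w _) (abs_nonneg _)))
  have t2 : ww ξ b * |ph' A B a - ph' A B c| ≤ trans A B ξ a b c :=
    (le_add_of_nonneg_right (mul_nonneg (w _) (abs_nonneg _))).trans
      (le_add_of_nonneg_left (mul_nonneg (w _) (abs_nonneg _)))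
  have t3 : ww ξ c * |ph' A B a - ph' A B b| ≤ trans A B ξ a b c :=
    (le_add_of_nonneg_left (mul_nonneg (w _) (abs_nonneg _))).trans
      (le_add_of_nonneg_left (mul_nonneg (w _) (abs_nonneg _)))
  have cA : 0 ≤ 64 * |A|⁻¹ := by positivity
  -- The statement is symmetric in `a, b, c`. Each ordering selects the middle frequency as the
  -- argument of `ww` and the extreme ones for the difference of velocities.
  rcases le_total |a| |b| with hab | hab <;> rcases le_total |b| |c| with hbc | hbc <;>
    rcases le_total |a| |c| with hac | hac
  · refine (key c b a (by rw [hξ]; ring) (by rw [hP]; ring) hbc hac hab).trans ?_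
    rw [abs_sub_comm]
    exact mul_le_mul_of_nonneg_left t2 cA
  · refine (key c b a (by rw [hξ]; ring) (by rw [hP]; ring) hbc (hab.trans hbc) hab).trans ?_
    rw [abs_sub_comm]
    exact mul_le_mul_of_nonneg_left t2 cA
  · refine (key b c a (by rw [hξ]; ring) (by rw [hP]; ring) hbc hab hac).trans ?_
    exact mul_le_mul_of_nonneg_left (by rw [abs_sub_comm]; exact t3) cA
  · refine (key b a c (by rw [hξ]; ring) (by rw [hP]; ring) hab hbc hac).trans ?_
    exact mul_le_mul_of_nonneg_left t1 cA
  · refine (key c a b (by rw [hξ]; ring) (by rw [hP]; ring) hac hbc hab).trans ?_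
    exact mul_le_mul_of_nonneg_left (by rw [abs_sub_comm]; exact t1) cA
  · refine (key a c b (by rw [hξ]; ring) (by rw [hP]; ring) hac hab hbc).trans ?_
    exact mul_le_mul_of_nonneg_left t3 cA
  · refine (key a b c hξ hP hab (hbc.trans hab) hbc).trans ?_
    exact mul_le_mul_of_nonneg_left t2 cA
  · refine (key a b c hξ hP hab hac hbc).trans ?_
    exact mul_le_mul_of_nonneg_left t2 cA

theorem mult_nonneg (s ξ a b c : ℝ) : 0 ≤ mult s ξ a b c :=
  mul_nonneg (mul_nonneg (abs_nonneg _) (wt_pos _ _).le)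
    (mul_nonneg (wt_pos _ _).le (mul_nonneg (wt_pos _ _).le (wt_pos _ _).le))

/-- A dichotomy. If `ξ⁶ ≤ C₁P`, then `|ξ|^{3/4} ≤ (C₁P)^{1/8}`, and the symbol is at most a multiple
of `P^{1/4}`, as the `L⁶` bound requires. Otherwise the square of the symbol is controlled by the
transversal weights; the square root is there because Cauchy–Schwarz will square the symbol again.
-/
theorem mult_le_add {A B N : ℝ} (hA : A ≠ 0) (hAB : |B| ≤ |A| * N ^ 2) (hN : 1 ≤ N)
    {ξ a b c P C₀ C₁ C m : ℝ} (hξ : ξ = a + b + c)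
    (hP : P = (1 + a ^ 2) * ((1 + b ^ 2) * (1 + c ^ 2))) (hC₀' : 0 ≤ C₀)
    (hC₁ : C₁ = (3 * N) ^ 6 * 64) (hC : C = C₀ * C₁ ^ (1 / 8 : ℝ) + C₀ ^ 2 * (64 * |A|⁻¹))
    (hm0 : 0 ≤ m) (h0 : m ≤ C₀ * (|ξ| ^ (3 / 4 : ℝ) * P ^ (1 / 8 : ℝ))) :
    m ≤ C * P ^ (1 / 4 : ℝ) + √(C * trans A B ξ a b c) := by
  have hP1 : 0 < P := by rw [hP]; positivity
  have hC₁0 : 0 ≤ C₁ := by rw [hC₁]; positivity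
  have q1 : 0 ≤ C₀ * C₁ ^ (1 / 8 : ℝ) := by positivity
  have q2 : 0 ≤ C₀ ^ 2 * (64 * |A|⁻¹) := by positivity
  have hC0 : 0 ≤ C := by rw [hC]; linarith
  have hPr : 0 ≤ P ^ (1 / 4 : ℝ) := by positivity
  by_cases hcase : ξ ^ 6 ≤ C₁ * P
  · have h1 : |ξ| ^ (3 / 4 : ℝ) ≤ C₁ ^ (1 / 8 : ℝ) * P ^ (1 / 8 : ℝ) := by
      rw [← Real.mul_rpow hC₁0 hP1.le]
      have : |ξ| ^ (3 / 4 : ℝ) = (ξ ^ 6) ^ (1 / 8 : ℝ) := by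
        rw [← Even.pow_abs (by decide : Even 6), ← Real.rpow_natCast, ← Real.rpow_mul (abs_nonneg _)]
        norm_num
      rw [this]
      exact Real.rpow_le_rpow (by positivity) hcase (by norm_num)
    have h2 : P ^ (1 / 4 : ℝ) = P ^ (1 / 8 : ℝ) * P ^ (1 / 8 : ℝ) := by
      rw [← Real.rpow_add hP1]; norm_num
    calc m ≤ C₀ * (C₁ ^ (1 / 8 : ℝ) * P ^ (1 / 8 : ℝ) * P ^ (1 / 8 : ℝ)) :=
          h0.trans (by gcongr)
      _ = C₀ * C₁ ^ (1 / 8 : ℝ) * P ^ (1 / 4 : ℝ) := by rw [h2]; ring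
      _ ≤ C * P ^ (1 / 4 : ℝ) := mul_le_mul_of_nonneg_right (by linarith) hPr
      _ ≤ _ := le_add_of_nonneg_right (Real.sqrt_nonneg _)
  · rw [not_le] at hcase
    have hξ0 : ξ ≠ 0 := by
      rintro rfl
      have : 0 ≤ C₁ * P := by positivity
      norm_num at hcase
      linarith
    have tr := transversal_weight_le_trans hA hAB hN hξ0 hξ hP (by rwa [← hC₁])
    refine le_trans ?_ (le_add_of_nonneg_left (by positivity))
    refine Real.le_sqrt_of_sq_le ?_
    calc m ^ 2 ≤ (C₀ * (|ξ| ^ (3 / 4 : ℝ) * P ^ (1 / 8 : ℝ))) ^ 2 :=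
          pow_le_pow_left₀ hm0 h0 2
      _ = C₀ ^ 2 * (|ξ| ^ (3 / 2 : ℝ) * P ^ (1 / 4 : ℝ)) := by
        rw [mul_pow, mul_pow, ← Real.rpow_natCast (|ξ| ^ (3 / 4 : ℝ)),
          ← Real.rpow_natCast (P ^ (1 / 8 : ℝ)), ← Real.rpow_mul (abs_nonneg _),
          ← Real.rpow_mul hP1.le]
        norm_num
      _ ≤ C₀ ^ 2 * (64 * |A|⁻¹ * trans A B ξ a b c) :=
        mul_le_mul_of_nonneg_left tr (by positivity)
      _ = C₀ ^ 2 * (64 * |A|⁻¹) * trans A B ξ a b c := by ring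
      _ ≤ C * trans A B ξ a b c :=
        mul_le_mul_of_nonneg_right (by linarith) (trans_nonneg A B ξ a b c)

theorem exists_mult_le {A : ℝ} (hA : A ≠ 0) (B : ℝ) {s : ℝ} (hs : -(1 / 4) ≤ s) :
    ∃ C : ℝ, 0 ≤ C ∧ ∀ a b c, mult s (a + b + c) a b c ≤
      C * (wt (1 / 2) a * (wt (1 / 2) b * wt (1 / 2) c)) +
        √(C * trans A B (a + b + c) a b c) := by
  obtain ⟨N, hN, hAB⟩ : ∃ N : ℝ, 1 ≤ N ∧ |B| ≤ |A| * N ^ 2 := by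
    refine ⟨1 + |B| / |A|, by linarith [div_nonneg (abs_nonneg B) (abs_nonneg A)], ?_⟩
    have hA' : 0 < |A| := abs_pos.2 hA
    have h0 : 0 ≤ |B| / |A| := by positivity
    calc |B| = |A| * (|B| / |A|) := by field_simp
      _ ≤ |A| * (1 + |B| / |A|) ^ 2 := by gcongr; nlinarith
  refine ⟨4 ^ ((s + 1 / 4) / 2) * ((3 * N) ^ 6 * 64) ^ (1 / 8 : ℝ) +
    (4 ^ ((s + 1 / 4) / 2)) ^ 2 * (64 * |A|⁻¹), by positivity, fun a b c ↦ ?_⟩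
  · have hw : wt (1 / 2) a * (wt (1 / 2) b * wt (1 / 2) c) =
        ((1 + a ^ 2) * ((1 + b ^ 2) * (1 + c ^ 2))) ^ (1 / 4 : ℝ) := by
      unfold wt
      rw [Real.mul_rpow (by positivity) (by positivity), Real.mul_rpow (by positivity)
        (by positivity)]
      norm_num
    rw [hw]
    exact mult_le_add hA hAB hN rfl rfl (by positivity) rfl rfl (mult_nonneg _ _ _ _ _)
      (mult_le_of_le hs rfl)

/-! ### Densities of Bourgain functions, and the linear and trilinear estimates -/

/-- The Fourier density of the function of `X_{s,3/4}` with the coefficient `f ∈ L²`. -/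
def den (s : ℝ) (Q : ℝ → ℝ) (f : ℝ × ℝ → ℂ) (p : ℝ × ℝ) : ℂ :=
  ((wt (-s) p.1 * md (p.2 - Q p.1) : ℝ) : ℂ) * f p

theorem nice_den (s : ℝ) {Q : ℝ → ℝ} (hQ : Continuous Q) {f : ℝ × ℝ → ℂ} (hf : Nice f) :
    Nice (den s Q f) := by
  refine hf.continuous_mul (m := fun p ↦ ((wt (-s) p.1 * md (p.2 - Q p.1) : ℝ) : ℂ)) ?_
  have h1 := continuous_wt (-s)
  have h2 := continuous_md
  fun_prop

/-- The modulation weight with values in `[0, ∞]`. -/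
def mo (Q : ℝ → ℝ) (p : ℝ × ℝ) : ℝ≥0∞ := ENNReal.ofReal (md (p.2 - Q p.1))

theorem measurable_mo {Q : ℝ → ℝ} (hQ : Continuous Q) : Measurable (mo Q) := by
  have h2 := continuous_md
  have : Continuous fun p : ℝ × ℝ ↦ md (p.2 - Q p.1) := by fun_prop
  exact this.measurable.ennreal_ofReal

theorem mo_sq (Q : ℝ → ℝ) (p : ℝ × ℝ) : mo Q p ^ 2 = jj (p.2 - Q p.1) := by
  rw [mo, jj, ENNReal.ofReal_pow (md_pos _).le]

theorem enorm_den (s : ℝ) (Q : ℝ → ℝ) (f : ℝ × ℝ → ℂ) (p : ℝ × ℝ) :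
    ‖den s Q f p‖ₑ = ENNReal.ofReal (wt (-s) p.1) * (mo Q p * ‖f p‖ₑ) := by
  rw [den, enorm_mul, ← mul_assoc, mo, ← ENNReal.ofReal_mul (wt_pos _ _).le]
  congr 1
  rw [← ofReal_norm, Complex.norm_real, Real.norm_of_nonneg]
  exact (mul_pos (wt_pos _ _) (md_pos _)).le

/-- The modulation weights are put into the kernel of Cauchy–Schwarz; their squares integrate to
`kk`, so only the spatial symbol `Λ` has to be examined afterwards. -/
theorem lintegral_mo_trilinear_le {Q : ℝ → ℝ} (hQ : Continuous Q) {Λ : ℝ → ℝ → ℝ → ℝ≥0∞}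
    (hΛ : Measurable fun z : ℝ × ℝ × ℝ ↦ Λ z.1 z.2.1 z.2.2) {M : ℝ≥0∞}
    (hM : ∀ ξ τ, ∫⁻ a, ∫⁻ b, Λ ξ a b ^ 2 * kk (τ - Q a - Q b - Q (ξ - a - b)) ≤ M)
    {f g h : ℝ × ℝ → ℝ≥0∞} (hf : Measurable f) (hg : Measurable g) (hh : Measurable h) :
    ∫⁻ p, (∫⁻ q, ∫⁻ r, Λ p.1 q.1 r.1 * ((mo Q q * f q) * ((mo Q r * g r) *
        (mo Q (p - q - r) * h (p - q - r))))) ^ 2 ≤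
      M * ((∫⁻ p, f p ^ 2) * ((∫⁻ p, g p ^ 2) * ∫⁻ p, h p ^ 2)) := by
  have hmo := measurable_mo hQ
  have hκ : Measurable fun z : (ℝ × ℝ) × (ℝ × ℝ) × (ℝ × ℝ) ↦
      Λ z.1.1 z.2.1.1 z.2.2.1 * (mo Q z.2.1 * (mo Q z.2.2 * mo Q (z.1 - z.2.1 - z.2.2))) := by
    refine (hΛ.comp (by fun_prop : Measurable fun z : (ℝ × ℝ) × (ℝ × ℝ) × (ℝ × ℝ) ↦
      (z.1.1, z.2.1.1, z.2.2.1))).mul ?_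
    exact (hmo.comp (by fun_prop)).mul ((hmo.comp (by fun_prop)).mul (hmo.comp (by fun_prop)))
  refine le_trans (le_of_eq ?_) (lintegral_trilinear_sq_le (κ := fun p q r ↦
    Λ p.1 q.1 r.1 * (mo Q q * (mo Q r * mo Q (p - q - r)))) hκ hf hg hh (M := M) ?_)
  · refine lintegral_congr fun p ↦ ?_
    congr 1
    refine lintegral_congr fun q ↦ lintegral_congr fun r ↦ ?_
    ring
  · rintro ⟨ξ, τ⟩
    refine le_trans (le_of_eq ?_) (hM ξ τ)
    have hΛ2 : Measurable fun z : ℝ × ℝ ↦ Λ ξ z.1 z.2 ^ 2 :=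
      (hΛ.comp (by fun_prop : Measurable fun z : ℝ × ℝ ↦ (ξ, z))).pow_const 2
    rw [← lintegral_modulation hQ.measurable hΛ2]
    refine lintegral_congr fun q ↦ lintegral_congr fun r ↦ ?_
    simp only [mul_pow, mo_sq]
    simp

/-! ### The `L⁶` estimate of Strichartz type -/

theorem lintegral_enorm_pow_six {w : ℝ × ℝ → ℂ} : eLpNorm w 6 volume ^ 6 = ∫⁻ q, ‖w q‖ₑ ^ 6 := by
  have := eLpNorm_nnreal_pow_eq_lintegral (f := w) (μ := volume) (p := 6) (by norm_num)
  rw [show ((6 : ℝ≥0) : ℝ≥0∞) = 6 from rfl, show ((6 : ℝ≥0) : ℝ) = ((6 : ℕ) : ℝ) by norm_num] at this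
  simpa only [ENNReal.rpow_natCast] using this

/-- The sixth power of the `L⁶` norm of `w` is the square of the `L²` norm of `w³`, and `w³` is the
wave of a threefold convolution. Plancherel and the trilinear bound finish; `wt 1` in the hypothesis
is the square of the weight `wt (1 / 2)`. -/
theorem eLpNorm_wave_indicator_le {Q : ℝ → ℝ} (hQ : Continuous Q) {I : Set ℝ}
    (hI : MeasurableSet I) {M : ℝ≥0∞}
    (hM : ∀ ξ τ, ∫⁻ a, ∫⁻ b, (I.indicator (fun x ↦ ENNReal.ofReal (wt 1 x)) a *
      (I.indicator (fun x ↦ ENNReal.ofReal (wt 1 x)) b *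
        I.indicator (fun x ↦ ENNReal.ofReal (wt 1 x)) (ξ - a - b))) *
      kk (τ - Q a - Q b - Q (ξ - a - b)) ≤ M)
    {f : ℝ × ℝ → ℂ} (hf : Nice f) :
    eLpNorm (wave (den (-(1 / 2)) Q ((Prod.fst ⁻¹' I).indicator f))) 6 volume ≤
      M ^ (1 / 6 : ℝ) * eLpNorm f 2 volume := by
  set ρ : ℝ → ℝ≥0∞ := I.indicator fun x ↦ ENNReal.ofReal (wt (1 / 2) x) with hρ
  have hρm : Measurable ρ := (continuous_wt _).measurable.ennreal_ofReal.indicator hI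
  have hρ2 : ∀ x, ρ x ^ 2 = I.indicator (fun x ↦ ENNReal.ofReal (wt 1 x)) x := by
    intro x
    by_cases hx : x ∈ I
    · rw [hρ, indicator_of_mem hx, indicator_of_mem hx, ← ENNReal.ofReal_pow (wt_pos _ _).le, sq,
        wt_mul]
      norm_num
    · rw [hρ, indicator_of_notMem hx, indicator_of_notMem hx]
      simp
  set g := den (-(1 / 2)) Q ((Prod.fst ⁻¹' I).indicator f) with hg
  have hI' : MeasurableSet (Prod.fst ⁻¹' I : Set (ℝ × ℝ)) := measurable_fst hI
  have hgn : Nice g := nice_den _ hQ (hf.indicator hI')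
  have hge : ∀ q, ‖g q‖ₑ = ρ q.1 * (mo Q q * ‖f q‖ₑ) := by
    intro q
    rw [hg, enorm_den]
    by_cases hx : q.1 ∈ I
    · rw [hρ, indicator_of_mem hx, indicator_of_mem (by exact hx)]
      norm_num
    · rw [hρ, indicator_of_notMem hx, indicator_of_notMem (by exact hx)]
      simp
  have hgg : Nice (conv g g) := hgn.conv hgn
  have hggg : Nice (conv g (conv g g)) := hgn.conv hgg
  have key : ∫⁻ q, ‖wave g q‖ₑ ^ 6 ≤ M * (∫⁻ p, ‖f p‖ₑ ^ 2) ^ 3 := by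
    calc ∫⁻ q, ‖wave g q‖ₑ ^ 6 = ∫⁻ q, ‖wave (conv g (conv g g)) q‖ₑ ^ 2 := by
          refine lintegral_congr fun q ↦ ?_
          rw [wave_conv hgn.integrable hgg.integrable, wave_conv hgn.integrable hgn.integrable]
          simp only [enorm_mul]
          ring
      _ = ∫⁻ p, ‖conv g (conv g g) p‖ₑ ^ 2 :=
          lintegral_wave_sq hggg.meas hggg.integrable (hggg.memLp 2)
      _ ≤ ∫⁻ p, (∫⁻ q, ∫⁻ r, (ρ q.1 * (ρ r.1 * ρ (p.1 - q.1 - r.1))) *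
            ((mo Q q * ‖f q‖ₑ) * ((mo Q r * ‖f r‖ₑ) *
              (mo Q (p - q - r) * ‖f (p - q - r)‖ₑ)))) ^ 2 := by
          refine lintegral_mono fun p ↦ ?_
          refine pow_le_pow_left' ((enorm_conv_conv_le hgn hgn p).trans (le_of_eq ?_)) 2
          refine lintegral_congr fun q ↦ lintegral_congr fun r ↦ ?_
          rw [hge, hge, hge]
          simp only [Prod.fst_sub]
          ring
      _ ≤ M * ((∫⁻ p, ‖f p‖ₑ ^ 2) * ((∫⁻ p, ‖f p‖ₑ ^ 2) * ∫⁻ p, ‖f p‖ₑ ^ 2)) := by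
          have hfm := hf.meas.enorm
          refine lintegral_mo_trilinear_le hQ (Λ := fun ξ a b ↦ ρ a * (ρ b * ρ (ξ - a - b))) ?_ ?_
            hfm hfm hfm
          · exact (hρm.comp (by fun_prop)).mul ((hρm.comp (by fun_prop)).mul
              (hρm.comp (by fun_prop)))
          · intro ξ τ
            refine le_trans (le_of_eq ?_) (hM ξ τ)
            simp only [mul_pow, hρ2]
      _ = _ := by ring
  have h6 : eLpNorm (wave g) 6 volume ^ 6 ≤ (M ^ (1 / 6 : ℝ) * eLpNorm f 2 volume) ^ 6 := by
    rw [lintegral_enorm_pow_six, mul_pow, ← ENNReal.rpow_natCast (M ^ (1 / 6 : ℝ)),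
      ← ENNReal.rpow_mul, show eLpNorm f 2 volume ^ 6 = (eLpNorm f 2 volume ^ 2) ^ 3 by ring,
      eLpNorm_two_sq]
    simpa using key
  rw [← ENNReal.rpow_natCast, ← ENNReal.rpow_natCast] at h6
  exact (ENNReal.rpow_le_rpow_iff (by norm_num)).1 h6

theorem wt_one_le {N x : ℝ} (hN : 1 ≤ N) (hx : |x| ≤ N) : wt 1 x ≤ 2 * N := by
  rw [wt, ← Real.sqrt_eq_rpow]
  refine Real.sqrt_le_iff.2 ⟨by linarith, ?_⟩
  have := sq_le_sq' (abs_le.1 hx).1 (abs_le.1 hx).2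
  nlinarith

theorem wt_neg (s x : ℝ) : wt s (-x) = wt s x := by simp [wt]

theorem ph_neg (A B x : ℝ) : ph A B (-x) = ph (-A) (-B) x := by simp only [ph]; ring

/-- On `x ≥ N ≥ 1` the weight `wt 1 x` is at most `2x`, whence `8 = 2³`. -/
theorem lintegral_high_wt_le {A B N : ℝ} (hA : A ≠ 0) (hAB : |B| ≤ |A| * N ^ 2) (hN : 1 ≤ N)
    (ξ τ : ℝ) :
    ∫⁻ a, ∫⁻ b, ((Ici N).indicator (fun x ↦ ENNReal.ofReal (wt 1 x)) a *
      ((Ici N).indicator (fun x ↦ ENNReal.ofReal (wt 1 x)) b *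
        (Ici N).indicator (fun x ↦ ENNReal.ofReal (wt 1 x)) (ξ - a - b))) *
      kk (τ - ph A B a - ph A B b - ph A B (ξ - a - b)) ≤
      8 * (ENNReal.ofReal (2 * Real.pi * |A|⁻¹) * ∫⁻ y, kk y) := by
  have hN0 : 0 < N := by linarith
  refine le_trans ?_ (mul_le_mul' (le_refl (8 : ℝ≥0∞)) (lintegral_high_le hA hAB hN0 ξ τ))
  rw [← lintegral_const_mul' _ _ (by norm_num)]
  refine lintegral_mono fun a ↦ ?_
  simp only
  rw [← lintegral_const_mul' _ _ (by norm_num)]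
  refine lintegral_mono fun b ↦ ?_
  simp only
  rw [← mul_assoc (8 : ℝ≥0∞)]
  refine mul_le_mul' ?_ le_rfl
  by_cases h : N ≤ a ∧ N ≤ b ∧ N ≤ ξ - a - b
  · obtain ⟨h1, h2, h3⟩ := h
    rw [indicator_of_mem (by exact h1), indicator_of_mem (by exact h2),
      indicator_of_mem (by exact h3), indicator_of_mem (by exact ⟨h1, h2, h3⟩)]
    have w : ∀ x, N ≤ x → wt 1 x ≤ 2 * x := fun x hx ↦
      wt_one_le (hN.trans hx) (abs_of_nonneg (by linarith)).le
    have p := fun x ↦ (wt_pos 1 x).le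
    rw [← ENNReal.ofReal_mul (p _), ← ENNReal.ofReal_mul (p _),
      show (8 : ℝ≥0∞) = ENNReal.ofReal 8 by norm_num, ← ENNReal.ofReal_mul (by norm_num)]
    refine ENNReal.ofReal_le_ofReal ?_
    calc wt 1 a * (wt 1 b * wt 1 (ξ - a - b)) ≤ 2 * a * (2 * b * (2 * (ξ - a - b))) := by
          have ha := w a h1
          have hb := w b h2
          have hc := w _ h3
          have pb := p b
          have pc := p (ξ - a - b)
          have : 0 ≤ b := by linarith
          have : 0 ≤ a := by linarith
          gcongr
      _ = _ := by ring
  · by_cases h1 : N ≤ a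
    · by_cases h2 : N ≤ b
      · have h3 : ¬ N ≤ ξ - a - b := fun h3 ↦ h ⟨h1, h2, h3⟩
        rw [indicator_of_notMem (s := Ici N) (a := ξ - a - b) (by exact h3)]
        simp
      · rw [indicator_of_notMem (s := Ici N) (a := b) (by exact h2)]
        simp
    · rw [indicator_of_notMem (s := Ici N) (a := a) (by exact h1)]
      simp

/-- Reflection of all frequencies replaces `(A, B)` by `(-A, -B)`, and the hypotheses see only
absolute values. -/
theorem lintegral_neg_high_wt_le {A B N : ℝ} (hA : A ≠ 0) (hAB : |B| ≤ |A| * N ^ 2) (hN : 1 ≤ N)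
    (ξ τ : ℝ) :
    ∫⁻ a, ∫⁻ b, ((Iic (-N)).indicator (fun x ↦ ENNReal.ofReal (wt 1 x)) a *
      ((Iic (-N)).indicator (fun x ↦ ENNReal.ofReal (wt 1 x)) b *
        (Iic (-N)).indicator (fun x ↦ ENNReal.ofReal (wt 1 x)) (ξ - a - b))) *
      kk (τ - ph A B a - ph A B b - ph A B (ξ - a - b)) ≤
      8 * (ENNReal.ofReal (2 * Real.pi * |A|⁻¹) * ∫⁻ y, kk y) := by
  have hI : ∀ x, (Iic (-N)).indicator (fun x ↦ ENNReal.ofReal (wt 1 x)) x =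
      (Ici N).indicator (fun x ↦ ENNReal.ofReal (wt 1 x)) (-x) := by
    intro x
    by_cases h : x ≤ -N
    · rw [indicator_of_mem (by exact h), indicator_of_mem (by show N ≤ -x; linarith), wt_neg]
    · rw [indicator_of_notMem (by exact h), indicator_of_notMem (by show ¬ N ≤ -x; intro; exact h (by linarith))]
  have key := lintegral_high_wt_le (A := -A) (B := -B) (neg_ne_zero.2 hA) (by simpa using hAB) hN
    (-ξ) τ
  rw [abs_neg] at key
  refine le_trans (le_of_eq ?_) key
  rw [← lintegral_neg_eq_self]
  refine lintegral_congr fun a ↦ ?_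
  rw [← lintegral_neg_eq_self]
  refine lintegral_congr fun b ↦ ?_
  rw [hI, hI, hI, ph_neg, ph_neg, neg_neg, neg_neg,
    show ξ - -a - -b = -(-ξ - a - b) by ring, ph_neg, neg_neg]

/-- No dispersion is needed: three factors `2N` bound the weights, two are lengths of frequency
intervals, and `kk` is bounded. -/
theorem lintegral_low_wt_le (Q : ℝ → ℝ) {N : ℝ} (hN : 1 ≤ N) (ξ τ : ℝ) :
    ∫⁻ a, ∫⁻ b, ((Ioo (-N) N).indicator (fun x ↦ ENNReal.ofReal (wt 1 x)) a *
      ((Ioo (-N) N).indicator (fun x ↦ ENNReal.ofReal (wt 1 x)) b *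
        (Ioo (-N) N).indicator (fun x ↦ ENNReal.ofReal (wt 1 x)) (ξ - a - b))) *
      kk (τ - Q a - Q b - Q (ξ - a - b)) ≤
      ENNReal.ofReal (2 * N) ^ 5 * (∫⁻ y, jj y) ^ 2 := by
  set c : ℝ≥0∞ := ENNReal.ofReal (2 * N)
  have hI : ∀ x, (Ioo (-N) N).indicator (fun x ↦ ENNReal.ofReal (wt 1 x)) x ≤
      (Ioo (-N) N).indicator (fun _ ↦ c) x := by
    intro x
    refine indicator_rel_indicator le_rfl fun h ↦ ?_
    exact ENNReal.ofReal_le_ofReal (wt_one_le hN (abs_le.2 ⟨h.1.le, h.2.le⟩))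
  have hI' : ∀ x, (Ioo (-N) N).indicator (fun _ ↦ c) x ≤ c := fun x ↦
    indicator_le_self' (fun _ _ ↦ zero_le) x
  have hv : volume (Ioo (-N) N) = c := by rw [Real.volume_Ioo]; congr 1; ring
  calc _ ≤ ∫⁻ a, ∫⁻ b, ((Ioo (-N) N).indicator (fun _ ↦ c) a *
        ((Ioo (-N) N).indicator (fun _ ↦ c) b * c)) * (∫⁻ y, jj y) ^ 2 := by
        refine lintegral_mono fun a ↦ lintegral_mono fun b ↦ ?_
        exact mul_le_mul' (mul_le_mul' (hI a) (mul_le_mul' (hI b) ((hI _).trans (hI' _))))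
          (kk_le _)
    _ = ∫⁻ a, (Ioo (-N) N).indicator (fun _ ↦ c) a * (c * (c * c) * (∫⁻ y, jj y) ^ 2) := by
        refine lintegral_congr fun a ↦ ?_
        have hm : Measurable fun b ↦ (Ioo (-N) N).indicator (fun _ ↦ c) b :=
          measurable_const.indicator measurableSet_Ioo
        calc _ = ∫⁻ b, ((Ioo (-N) N).indicator (fun _ ↦ c) a * c * (∫⁻ y, jj y) ^ 2) *
              (Ioo (-N) N).indicator (fun _ ↦ c) b := by
              refine lintegral_congr fun b ↦ ?_
              ring
          _ = _ := by
              rw [lintegral_const_mul _ hm, lintegral_indicator_const measurableSet_Ioo, hv]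
              ring
    _ = _ := by
        rw [lintegral_mul_const _ (measurable_const.indicator measurableSet_Ioo),
          lintegral_indicator_const measurableSet_Ioo, hv]
        ring

theorem den_add (s : ℝ) (Q : ℝ → ℝ) (f g : ℝ × ℝ → ℂ) :
    den s Q (f + g) = den s Q f + den s Q g := by
  ext p
  simp [den, mul_add]

theorem den_const_smul (s : ℝ) (Q : ℝ → ℝ) (c : ℂ) (f : ℝ × ℝ → ℂ) :
    den s Q (c • f) = c • den s Q f := by
  ext p
  simp only [den, Pi.smul_apply, smul_eq_mul]
  ring

theorem exists_one_le_abs_le {A : ℝ} (hA : A ≠ 0) (B : ℝ) :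
    ∃ N : ℝ, 1 ≤ N ∧ |B| ≤ |A| * N ^ 2 := by
  refine ⟨1 + |B| / |A|, by linarith [div_nonneg (abs_nonneg B) (abs_nonneg A)], ?_⟩
  have hA' : 0 < |A| := abs_pos.2 hA
  have h0 : 0 ≤ |B| / |A| := by positivity
  calc |B| = |A| * (|B| / |A|) := by field_simp
    _ ≤ |A| * (1 + |B| / |A|) ^ 2 := by gcongr; nlinarith

/-- The function is cut into its frequencies above `N`, below `-N` and in between, and the triangle
inequality is applied in `L⁶`. Thus interactions of mixed sign never have to be estimated. -/
theorem exists_eLpNorm_wave_half_le {A : ℝ} (hA : A ≠ 0) (B : ℝ) : ∃ C : ℝ≥0, ∀ f, Nice f →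
    eLpNorm (wave (den (-(1 / 2)) (ph A B) f)) 6 volume ≤ C * eLpNorm f 2 volume := by
  obtain ⟨N, hN, hAB⟩ := exists_one_le_abs_le hA B
  have hQ := continuous_ph A B
  set M₁ : ℝ≥0∞ := 8 * (ENNReal.ofReal (2 * Real.pi * |A|⁻¹) * ∫⁻ y, kk y)
  set M₂ : ℝ≥0∞ := ENNReal.ofReal (2 * N) ^ 5 * (∫⁻ y, jj y) ^ 2
  have hM₁ : M₁ ≠ ∞ := ENNReal.mul_ne_top (by norm_num)
    (ENNReal.mul_ne_top ENNReal.ofReal_ne_top lintegral_kk_lt_top.ne)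
  have hM₂ : M₂ ≠ ∞ := ENNReal.mul_ne_top (ENNReal.pow_ne_top ENNReal.ofReal_ne_top)
    (ENNReal.pow_ne_top lintegral_jj_lt_top.ne)
  set C : ℝ≥0∞ := M₁ ^ (1 / 6 : ℝ) + (M₁ ^ (1 / 6 : ℝ) + M₂ ^ (1 / 6 : ℝ))
  have hC : C ≠ ∞ := ENNReal.add_ne_top.2 ⟨ENNReal.rpow_ne_top_of_nonneg (by norm_num) hM₁,
    ENNReal.add_ne_top.2 ⟨ENNReal.rpow_ne_top_of_nonneg (by norm_num) hM₁,
      ENNReal.rpow_ne_top_of_nonneg (by norm_num) hM₂⟩⟩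
  refine ⟨C.toNNReal, fun f hf ↦ ?_⟩
  rw [ENNReal.coe_toNNReal hC]
  have i1 : MeasurableSet (Prod.fst ⁻¹' Ici N : Set (ℝ × ℝ)) := measurable_fst measurableSet_Ici
  have i2 : MeasurableSet (Prod.fst ⁻¹' Iic (-N) : Set (ℝ × ℝ)) :=
    measurable_fst measurableSet_Iic
  have i3 : MeasurableSet (Prod.fst ⁻¹' Ioo (-N) N : Set (ℝ × ℝ)) :=
    measurable_fst measurableSet_Ioo
  set f1 := (Prod.fst ⁻¹' Ici N : Set (ℝ × ℝ)).indicator f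
  set f2 := (Prod.fst ⁻¹' Iic (-N) : Set (ℝ × ℝ)).indicator f
  set f3 := (Prod.fst ⁻¹' Ioo (-N) N : Set (ℝ × ℝ)).indicator f
  have hsum : f = f1 + (f2 + f3) := by
    ext ⟨x, y⟩
    simp only [f1, f2, f3, Pi.add_apply, indicator, mem_preimage, mem_Ici, mem_Iic, mem_Ioo]
    rcases le_or_gt N x with h | h
    · have : ¬ x ≤ -N := by intro; linarith
      simp [h, this, h.not_gt]
    · rcases le_or_gt x (-N) with h' | h'
      · simp [h.not_ge, h', h'.not_gt]
      · simp [h.not_ge, h'.not_ge, h', h]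
  have n1 := nice_den (-(1 / 2)) hQ (hf.indicator i1)
  have n2 := nice_den (-(1 / 2)) hQ (hf.indicator i2)
  have n3 := nice_den (-(1 / 2)) hQ (hf.indicator i3)
  have c1 := (continuous_wave n1.integrable).aestronglyMeasurable (μ := volume)
  have c2 := (continuous_wave n2.integrable).aestronglyMeasurable (μ := volume)
  have c3 := (continuous_wave n3.integrable).aestronglyMeasurable (μ := volume)
  have e1 := eLpNorm_wave_indicator_le hQ measurableSet_Ici (lintegral_high_wt_le hA hAB hN) hf
  have e2 := eLpNorm_wave_indicator_le hQ measurableSet_Iic (lintegral_neg_high_wt_le hA hAB hN) hf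
  have e3 := eLpNorm_wave_indicator_le hQ measurableSet_Ioo (lintegral_low_wt_le _ hN) hf
  have hw : wave (den (-(1 / 2)) (ph A B) f) = wave (den (-(1 / 2)) (ph A B) f1) +
      (wave (den (-(1 / 2)) (ph A B) f2) + wave (den (-(1 / 2)) (ph A B) f3)) := by
    rw [hsum, den_add, den_add, wave_add n1.integrable (n2.integrable.add n3.integrable),
      wave_add n2.integrable n3.integrable]
  rw [hw]
  refine (eLpNorm_add_le c1 (c2.add c3) (by norm_num)).trans ?_
  simp only [C, add_mul]
  exact add_le_add e1 ((eLpNorm_add_le c2 c3 (by norm_num)).trans (add_le_add e2 e3))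

theorem exists_eLpNorm_wave_le {A : ℝ} (hA : A ≠ 0) (B : ℝ) : ∃ C : ℝ≥0, ∀ s, -(1 / 2) ≤ s →
    ∀ f, Nice f → eLpNorm (wave (den s (ph A B) f)) 6 volume ≤ C * eLpNorm f 2 volume := by
  obtain ⟨C, hC⟩ := exists_eLpNorm_wave_half_le hA B
  refine ⟨C, fun s hs f hf ↦ ?_⟩
  have hw := continuous_wt (-s - 1 / 2)
  have hf' : Nice fun p : ℝ × ℝ ↦ (wt (-s - 1 / 2) p.1 : ℂ) * f p :=
    hf.continuous_mul (by fun_prop)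
  have hd : den s (ph A B) f =
      den (-(1 / 2)) (ph A B) fun p : ℝ × ℝ ↦ (wt (-s - 1 / 2) p.1 : ℂ) * f p := by
    ext p
    simp only [den]
    rw [← mul_assoc, ← Complex.ofReal_mul]
    congr 2
    rw [mul_right_comm, wt_mul]
    ring_nf
  rw [hd]
  refine (hC _ hf').trans (mul_le_mul_right (eLpNorm_mono fun p ↦ ?_) _)
  rw [norm_mul, Complex.norm_real, Real.norm_of_nonneg (wt_pos _ _).le]
  exact mul_le_of_le_one_left (norm_nonneg _) (wt_le_one (by linarith) _)

/-! ### The trilinear estimate -/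

theorem lintegral_mul_mul_sq_le {X : Type*} [MeasurableSpace X] {μ : Measure X} {u v w : X → ℂ}
    (hu : AEStronglyMeasurable u μ) (hv : AEStronglyMeasurable v μ)
    (hw : AEStronglyMeasurable w μ) :
    ∫⁻ x, ‖u x * (v x * w x)‖ₑ ^ 2 ∂μ ≤
      (eLpNorm u 6 μ * (eLpNorm v 6 μ * eLpNorm w 6 μ)) ^ 2 := by
  rw [← eLpNorm_two_sq]
  refine pow_le_pow_left' ?_ 2
  have t1 : ENNReal.HolderTriple 6 6 3 := ⟨by
    rw [← ENNReal.toReal_eq_toReal_iff' (by simp) (by simp),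
      ENNReal.toReal_add (by simp) (by simp)]
    simp; norm_num⟩
  have t2 : ENNReal.HolderTriple 6 3 2 := ⟨by
    rw [← ENNReal.toReal_eq_toReal_iff' (by simp) (by simp),
      ENNReal.toReal_add (by simp) (by simp)]
    simp; norm_num⟩
  have h1 := eLpNorm_smul_le_mul_eLpNorm (p := 6) (q := 6) (r := 3) hw hv
  have h2 := eLpNorm_smul_le_mul_eLpNorm (p := 6) (q := 3) (r := 2) (hv.mul hw) hu
  exact h2.trans (mul_le_mul_right h1 _)

theorem lintegral_swap_kk {A B : ℝ} {F : ℝ → ℝ → ℝ → ℝ≥0∞}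
    (hF : Measurable fun z : ℝ × ℝ × ℝ ↦ F z.1 z.2.1 z.2.2) (ξ τ : ℝ) :
    ∫⁻ a, ∫⁻ b, F b a (ξ - a - b) * kk (τ - ph A B a - ph A B b - ph A B (ξ - a - b)) =
      ∫⁻ a, ∫⁻ b, F a b (ξ - a - b) * kk (τ - ph A B a - ph A B b - ph A B (ξ - a - b)) := by
  have hp := (continuous_ph A B).measurable
  rw [lintegral_lintegral_swap]
  · refine lintegral_congr fun a ↦ lintegral_congr fun b ↦ ?_
    rw [show ξ - b - a = ξ - a - b by ring]
    congr 2
    ring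
  · exact ((hF.comp (by fun_prop : Measurable fun z : ℝ × ℝ ↦ (z.2, z.1, ξ - z.1 - z.2))).mul
      (measurable_kk.comp (by fun_prop))).aemeasurable

theorem lintegral_rotate_kk {A B : ℝ} {F : ℝ → ℝ → ℝ → ℝ≥0∞} (ξ τ : ℝ) :
    ∫⁻ a, ∫⁻ b, F a (ξ - a - b) b * kk (τ - ph A B a - ph A B b - ph A B (ξ - a - b)) =
      ∫⁻ a, ∫⁻ b, F a b (ξ - a - b) * kk (τ - ph A B a - ph A B b - ph A B (ξ - a - b)) := by
  refine lintegral_congr fun a ↦ ?_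
  rw [← lintegral_sub_left_eq_self _ (ξ - a)]
  refine lintegral_congr fun b ↦ ?_
  rw [sub_sub_cancel]
  congr 2
  ring

/-- The `kk` factor is invariant under all permutations of the three frequencies, and so is the
measure: exchange of `a` and `b`, and the reflection `b ↦ ξ - a - b`, give every summand the same
integral. -/
theorem lintegral_add_perm_kk_le {A B : ℝ} {F : ℝ → ℝ → ℝ → ℝ≥0∞}
    (hF : Measurable fun z : ℝ × ℝ × ℝ ↦ F z.1 z.2.1 z.2.2) {ξ τ : ℝ} {M : ℝ≥0∞}
    (h1 : ∫⁻ a, ∫⁻ b, F a b (ξ - a - b) *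
      kk (τ - ph A B a - ph A B b - ph A B (ξ - a - b)) ≤ M) :
    ∫⁻ a, ∫⁻ b, (F a b (ξ - a - b) + (F b a (ξ - a - b) + F (ξ - a - b) a b)) *
      kk (τ - ph A B a - ph A B b - ph A B (ξ - a - b)) ≤ M + (M + M) := by
  have hp := (continuous_ph A B).measurable
  have h2 := lintegral_swap_kk (A := A) (B := B) hF ξ τ
  have h3 := (lintegral_rotate_kk (A := A) (B := B) (F := fun a b c ↦ F b a c) ξ τ).trans h2
  have hk : Measurable fun z : ℝ × ℝ ↦
      kk (τ - ph A B z.1 - ph A B z.2 - ph A B (ξ - z.1 - z.2)) := measurable_kk.comp (by fun_prop)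
  have m1 : Measurable fun z : ℝ × ℝ ↦ F z.1 z.2 (ξ - z.1 - z.2) *
      kk (τ - ph A B z.1 - ph A B z.2 - ph A B (ξ - z.1 - z.2)) :=
    (hF.comp (by fun_prop : Measurable fun z : ℝ × ℝ ↦ (z.1, z.2, ξ - z.1 - z.2))).mul hk
  have m2 : Measurable fun z : ℝ × ℝ ↦ F z.2 z.1 (ξ - z.1 - z.2) *
      kk (τ - ph A B z.1 - ph A B z.2 - ph A B (ξ - z.1 - z.2)) :=
    (hF.comp (by fun_prop : Measurable fun z : ℝ × ℝ ↦ (z.2, z.1, ξ - z.1 - z.2))).mul hk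
  have f1 : ∀ a, Measurable fun b ↦ F a b (ξ - a - b) *
      kk (τ - ph A B a - ph A B b - ph A B (ξ - a - b)) := fun a ↦
    m1.comp (by fun_prop : Measurable fun b : ℝ ↦ (a, b))
  have f2 : ∀ a, Measurable fun b ↦ F b a (ξ - a - b) *
      kk (τ - ph A B a - ph A B b - ph A B (ξ - a - b)) := fun a ↦
    m2.comp (by fun_prop : Measurable fun b : ℝ ↦ (a, b))
  simp_rw [add_mul, lintegral_add_left (f1 _), lintegral_add_left (f2 _)]
  rw [lintegral_add_left m1.lintegral_prod_right', lintegral_add_left m2.lintegral_prod_right',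
    h2, h3]
  exact add_le_add h1 (add_le_add h1 h1)

theorem exists_lintegral_trans_le (A B : ℝ) : ∃ M : ℝ≥0∞, M < ∞ ∧ ∀ ξ τ,
    ∫⁻ a, ∫⁻ b, ENNReal.ofReal (trans A B ξ a b (ξ - a - b)) *
      kk (τ - ph A B a - ph A B b - ph A B (ξ - a - b)) ≤ M := by
  obtain ⟨C, hC, hW⟩ := exists_lintegral_ww_le
  have hM : C * (4 * ∫⁻ y, kk y) < ∞ := ENNReal.mul_lt_top hC
    (ENNReal.mul_lt_top (by norm_num) lintegral_kk_lt_top)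
  refine ⟨_, ENNReal.add_lt_top.2 ⟨hM, ENNReal.add_lt_top.2 ⟨hM, hM⟩⟩, fun ξ τ ↦ ?_⟩
  have hwm : Measurable (ww ξ) :=
    measurable_ww.comp (by fun_prop : Measurable fun x : ℝ ↦ (ξ, x))
  have hFm : Measurable fun z : ℝ × ℝ × ℝ ↦
      ENNReal.ofReal (ww ξ z.1) * ENNReal.ofReal |ph' A B z.2.1 - ph' A B z.2.2| := by
    refine Measurable.mul (hwm.comp measurable_fst).ennreal_ofReal ?_
    have := continuous_ph' A B
    exact (by fun_prop : Continuous fun z : ℝ × ℝ × ℝ ↦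
      |ph' A B z.2.1 - ph' A B z.2.2|).measurable.ennreal_ofReal
  refine le_trans (le_of_eq ?_) (lintegral_add_perm_kk_le (F := fun a b c ↦
    ENNReal.ofReal (ww ξ a) * ENNReal.ofReal |ph' A B b - ph' A B c|) hFm (τ := τ)
    ((lintegral_transversal_le A B hwm ξ τ).trans (mul_le_mul' (hW ξ) le_rfl)))
  refine lintegral_congr fun a ↦ lintegral_congr fun b ↦ ?_
  have w := ww_nonneg ξ
  rw [trans, ENNReal.ofReal_add (mul_nonneg (w _) (abs_nonneg _))
    (add_nonneg (mul_nonneg (w _) (abs_nonneg _)) (mul_nonneg (w _) (abs_nonneg _))),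
    ENNReal.ofReal_add (mul_nonneg (w _) (abs_nonneg _)) (mul_nonneg (w _) (abs_nonneg _)),
    ENNReal.ofReal_mul (w _), ENNReal.ofReal_mul (w _), ENNReal.ofReal_mul (w _)]

theorem measurable_trans (A B : ℝ) :
    Measurable fun z : ℝ × ℝ × ℝ ↦ trans A B z.1 z.2.1 z.2.2 (z.1 - z.2.1 - z.2.2) := by
  have h1 : ∀ {u v w : ℝ × ℝ × ℝ → ℝ}, Continuous u → Continuous v → Continuous w →
      Measurable fun z ↦ ww z.1 (u z) * |ph' A B (v z) - ph' A B (w z)| := by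
    intro u v w hu hv hw
    have hp := continuous_ph' A B
    refine (measurable_ww.comp (measurable_fst.prodMk hu.measurable)).mul ?_
    exact (by fun_prop : Continuous fun z ↦ |ph' A B (v z) - ph' A B (w z)|).measurable
  have c1 : Continuous fun z : ℝ × ℝ × ℝ ↦ z.2.1 := by fun_prop
  have c2 : Continuous fun z : ℝ × ℝ × ℝ ↦ z.2.2 := by fun_prop
  have c3 : Continuous fun z : ℝ × ℝ × ℝ ↦ z.1 - z.2.1 - z.2.2 := by fun_prop
  exact (h1 c1 c2 c3).add ((h1 c2 c1 c3).add (h1 c3 c1 c2))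

/-- The trilinear estimate for `∂_x (u v w)`, on the Fourier side. -/
theorem exists_lintegral_conv_den_le {A : ℝ} (hA : A ≠ 0) (B : ℝ) {s : ℝ} (hs : -(1 / 4) ≤ s) :
    ∃ C : ℝ≥0, ∀ f g h, Nice f → Nice g → Nice h →
      ∫⁻ p : ℝ × ℝ, (ENNReal.ofReal (|p.1| * wt s p.1) * ‖conv (den s (ph A B) f)
        (conv (den s (ph A B) g) (den s (ph A B) h)) p‖ₑ) ^ 2 ≤
      C * (eLpNorm f 2 volume * (eLpNorm g 2 volume * eLpNorm h 2 volume)) ^ 2 := by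
  obtain ⟨C, hC, hm⟩ := exists_mult_le hA B hs
  obtain ⟨D, hD⟩ := exists_eLpNorm_wave_half_le hA B
  obtain ⟨M, hMt, hM⟩ := exists_lintegral_trans_le A B
  have hQ := continuous_ph A B
  set Q := ph A B with hQdef
  set c : ℝ≥0∞ := 2 * (ENNReal.ofReal C ^ 2 * (D ^ 3) ^ 2 + ENNReal.ofReal C * M) with hc
  have hct : c ≠ ∞ := by
    refine ENNReal.mul_ne_top (by norm_num) (ENNReal.add_ne_top.2 ⟨?_, ?_⟩)
    · exact ENNReal.mul_ne_top (by simp) (by simp)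
    · exact ENNReal.mul_ne_top (by simp) hMt.ne
  refine ⟨c.toNNReal, fun f g h hf hg hh ↦ ?_⟩
  rw [ENNReal.coe_toNNReal hct]
  set Ef := eLpNorm f 2 volume
  set Eg := eLpNorm g 2 volume
  set Eh := eLpNorm h 2 volume
  -- the coefficients with the modulation weight
  set φ : (ℝ × ℝ → ℂ) → ℝ × ℝ → ℝ≥0∞ := fun f q ↦ mo Q q * ‖f q‖ₑ with hφ
  have hφm : ∀ {f}, Nice f → Measurable (φ f) := fun hf ↦ (measurable_mo hQ).mul hf.meas.enorm
  -- The moduli of densities of order `-1/2`: they carry exactly the weights `⟨·⟩^{1/2}` of the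
  -- first term of `exists_mult_le`. Their waves are still in `L⁶`, since taking moduli commutes
  -- with the positive weights.
  set N : (ℝ × ℝ → ℂ) → ℝ × ℝ → ℂ := fun f q ↦ (‖den (-(1 / 2)) Q f q‖ : ℂ)
  have hN : ∀ {f}, Nice f → Nice (N f) := fun hf ↦ (nice_den _ hQ hf).ofReal_norm
  have hNe : ∀ {f}, Nice f → eLpNorm (wave (N f)) 6 volume ≤ D * eLpNorm f 2 volume := by
    intro f hf
    have : N f = den (-(1 / 2)) Q fun q ↦ (‖f q‖ : ℂ) := by
      ext q
      simp only [N, den, norm_mul, Complex.norm_real, Complex.ofReal_mul, Real.norm_of_nonneg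
        (wt_pos _ _).le, Real.norm_of_nonneg (md_pos _).le]
    rw [this]
    refine (hD _ hf.ofReal_norm).trans (le_of_eq ?_)
    congr 1
    exact eLpNorm_congr_norm_ae (Eventually.of_forall fun q ↦ by simp)
  set I1 : ℝ × ℝ → ℝ≥0∞ := fun p ↦ ‖conv (N f) (conv (N g) (N h)) p‖ₑ
  -- The second term of `exists_mult_le`; its square is the transversal weight.
  set Λ : ℝ → ℝ → ℝ → ℝ≥0∞ := fun ξ a b ↦ ENNReal.ofReal √(C * trans A B ξ a b (ξ - a - b)) with hΛ
  have hΛm : Measurable fun z : ℝ × ℝ × ℝ ↦ Λ z.1 z.2.1 z.2.2 := by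
    have := measurable_trans A B
    exact (measurable_const.mul this).sqrt.ennreal_ofReal
  set I2 : ℝ × ℝ → ℝ≥0∞ := fun p ↦ ∫⁻ q, ∫⁻ r, Λ p.1 q.1 r.1 * (φ f q * (φ g r * φ h (p - q - r)))
  have hI1 : ∫⁻ p, I1 p ^ 2 ≤ (D ^ 3) ^ 2 * (Ef * (Eg * Eh)) ^ 2 := by
    have n1 := (hN hg).conv (hN hh)
    have n2 := (hN hf).conv n1
    rw [← lintegral_wave_sq n2.meas n2.integrable (n2.memLp 2),
      wave_conv (hN hf).integrable n1.integrable, wave_conv (hN hg).integrable (hN hh).integrable]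
    refine (lintegral_mul_mul_sq_le (continuous_wave (hN hf).integrable).aestronglyMeasurable
      (continuous_wave (hN hg).integrable).aestronglyMeasurable
      (continuous_wave (hN hh).integrable).aestronglyMeasurable).trans ?_
    rw [← mul_pow]
    refine pow_le_pow_left' ?_ 2
    refine (mul_le_mul' (hNe hf) (mul_le_mul' (hNe hg) (hNe hh))).trans (le_of_eq ?_)
    ring
  have hI2 : ∫⁻ p, I2 p ^ 2 ≤ ENNReal.ofReal C * M * (Ef * (Eg * Eh)) ^ 2 := by
    refine (lintegral_mo_trilinear_le hQ hΛm (M := ENNReal.ofReal C * M) ?_ hf.meas.enorm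
      hg.meas.enorm hh.meas.enorm).trans (le_of_eq ?_)
    · intro ξ τ
      refine le_trans (le_of_eq ?_) (mul_le_mul' (le_refl (ENNReal.ofReal C)) (hM ξ τ))
      rw [← lintegral_const_mul' _ _ (by simp)]
      refine lintegral_congr fun a ↦ ?_
      rw [← lintegral_const_mul' _ _ (by simp)]
      refine lintegral_congr fun b ↦ ?_
      rw [hΛ, ← ENNReal.ofReal_pow (Real.sqrt_nonneg _),
        Real.sq_sqrt (mul_nonneg hC (trans_nonneg _ _ _ _ _ _)), ENNReal.ofReal_mul hC, mul_assoc]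
    · rw [mul_pow, mul_pow, eLpNorm_two_sq, eLpNorm_two_sq, eLpNorm_two_sq]
  have hpt : ∀ p : ℝ × ℝ, ENNReal.ofReal (|p.1| * wt s p.1) * ‖conv (den s Q f)
      (conv (den s Q g) (den s Q h)) p‖ₑ ≤ ENNReal.ofReal C * I1 p + I2 p := by
    intro p
    have e1 : I1 p = ∫⁻ q, ∫⁻ r, ENNReal.ofReal (wt (1 / 2) q.1 * (wt (1 / 2) r.1 *
        wt (1 / 2) (p.1 - q.1 - r.1))) * (φ f q * (φ g r * φ h (p - q - r))) := by
      simp only [I1, N]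
      rw [enorm_conv_conv_ofReal_norm (nice_den _ hQ hf) (nice_den _ hQ hg) (nice_den _ hQ hh)]
      refine lintegral_congr fun q ↦ lintegral_congr fun r ↦ ?_
      rw [ENNReal.ofReal_mul (wt_pos _ _).le, ENNReal.ofReal_mul (wt_pos _ _).le]
      simp only [enorm_den, hφ, neg_neg, Prod.fst_sub]
      ring
    have mφ : ∀ q, Measurable fun r ↦ φ f q * (φ g r * φ h (p - q - r)) := fun q ↦
      measurable_const.mul ((hφm hg).mul ((hφm hh).comp (by fun_prop)))
    have mφ2 : Measurable fun z : (ℝ × ℝ) × (ℝ × ℝ) ↦ φ f z.1 * (φ g z.2 * φ h (p - z.1 - z.2)) :=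
      ((hφm hf).comp measurable_fst).mul (((hφm hg).comp measurable_snd).mul
        ((hφm hh).comp (by fun_prop)))
    have hwc := continuous_wt (1 / 2)
    have mw : Measurable fun z : (ℝ × ℝ) × (ℝ × ℝ) ↦ ENNReal.ofReal (wt (1 / 2) z.1.1 *
        (wt (1 / 2) z.2.1 * wt (1 / 2) (p.1 - z.1.1 - z.2.1))) *
        (φ f z.1 * (φ g z.2 * φ h (p - z.1 - z.2))) := by
      refine Measurable.mul ?_ mφ2
      exact (by fun_prop : Continuous fun z : (ℝ × ℝ) × (ℝ × ℝ) ↦ wt (1 / 2) z.1.1 *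
        (wt (1 / 2) z.2.1 * wt (1 / 2) (p.1 - z.1.1 - z.2.1))).measurable.ennreal_ofReal
    calc _ ≤ ENNReal.ofReal (|p.1| * wt s p.1) *
          ∫⁻ q, ∫⁻ r, ‖den s Q f q‖ₑ * (‖den s Q g r‖ₑ * ‖den s Q h (p - q - r)‖ₑ) :=
          mul_le_mul' le_rfl (enorm_conv_conv_le (nice_den _ hQ hg) (nice_den _ hQ hh) p)
      _ = ∫⁻ q, ∫⁻ r, ENNReal.ofReal (mult s p.1 q.1 r.1 (p.1 - q.1 - r.1)) *
          (φ f q * (φ g r * φ h (p - q - r))) := by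
          rw [← lintegral_const_mul' _ _ ENNReal.ofReal_ne_top]
          refine lintegral_congr fun q ↦ ?_
          rw [← lintegral_const_mul' _ _ ENNReal.ofReal_ne_top]
          refine lintegral_congr fun r ↦ ?_
          have w := fun x ↦ (wt_pos (-s) x).le
          rw [mult, ENNReal.ofReal_mul (mul_nonneg (abs_nonneg _) (wt_pos _ _).le),
            ENNReal.ofReal_mul (w _), ENNReal.ofReal_mul (w _)]
          simp only [enorm_den, hφ, Prod.fst_sub]
          ring
      _ ≤ ∫⁻ q, ∫⁻ r, (ENNReal.ofReal C * (ENNReal.ofReal (wt (1 / 2) q.1 * (wt (1 / 2) r.1 *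
            wt (1 / 2) (p.1 - q.1 - r.1))) * (φ f q * (φ g r * φ h (p - q - r)))) +
          Λ p.1 q.1 r.1 * (φ f q * (φ g r * φ h (p - q - r)))) := by
          refine lintegral_mono fun q ↦ lintegral_mono fun r ↦ ?_
          simp only
          rw [← mul_assoc (ENNReal.ofReal C), ← add_mul, hΛ, ← ENNReal.ofReal_mul hC]
          refine mul_le_mul' ?_ le_rfl
          rw [← ENNReal.ofReal_add (mul_nonneg hC ?_) (Real.sqrt_nonneg _)]
          · have := hm q.1 r.1 (p.1 - q.1 - r.1)
            rw [show q.1 + r.1 + (p.1 - q.1 - r.1) = p.1 by ring] at this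
            exact ENNReal.ofReal_le_ofReal this
          · have w := fun x ↦ (wt_pos (1 / 2) x).le
            exact mul_nonneg (w _) (mul_nonneg (w _) (w _))
      _ = ENNReal.ofReal C * I1 p + I2 p := by
          rw [e1]
          have m3 : ∀ q : ℝ × ℝ, Measurable fun r : ℝ × ℝ ↦ ENNReal.ofReal C *
            (ENNReal.ofReal (wt (1 / 2) q.1 * (wt (1 / 2) r.1 *
            wt (1 / 2) (p.1 - q.1 - r.1))) * (φ f q * (φ g r * φ h (p - q - r)))) := fun q ↦
            measurable_const.mul (mw.comp (by fun_prop : Measurable fun r : ℝ × ℝ ↦ (q, r)))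
          simp_rw [lintegral_add_left (m3 _)]
          have m4 := (mw.const_mul (ENNReal.ofReal C)).lintegral_prod_right' (ν := volume)
          rw [lintegral_add_left m4]
          congr 1
          rw [← lintegral_const_mul' _ _ (by simp)]
          refine lintegral_congr fun q ↦ ?_
          rw [lintegral_const_mul' _ _ (by simp)]
  have hsq : ∀ x y : ℝ≥0∞, (x + y) ^ 2 ≤ 2 * (x ^ 2 + y ^ 2) := fun x y ↦ by
    have := ENNReal.rpow_add_le_mul_rpow_add_rpow x y (p := 2) (by norm_num)
    norm_num at this
    exact this
  calc _ ≤ ∫⁻ p, 2 * (ENNReal.ofReal C ^ 2 * I1 p ^ 2 + I2 p ^ 2) := by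
        refine lintegral_mono fun p ↦ (pow_le_pow_left' (hpt p) 2).trans ((hsq _ _).trans ?_)
        rw [mul_pow]
    _ = 2 * (ENNReal.ofReal C ^ 2 * (∫⁻ p, I1 p ^ 2) + ∫⁻ p, I2 p ^ 2) := by
        have mI : Measurable fun p ↦ ENNReal.ofReal C ^ 2 * I1 p ^ 2 :=
          measurable_const.mul (((hN hf).conv ((hN hg).conv (hN hh))).meas.enorm.pow_const 2)
        rw [lintegral_const_mul' _ _ (by norm_num), lintegral_add_left mI,
          lintegral_const_mul' _ _ (by simp)]
    _ ≤ 2 * (ENNReal.ofReal C ^ 2 * ((D ^ 3) ^ 2 * (Ef * (Eg * Eh)) ^ 2) +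
          ENNReal.ofReal C * M * (Ef * (Eg * Eh)) ^ 2) := by
        gcongr
    _ = c * (Ef * (Eg * Eh)) ^ 2 := by rw [hc]; ring

/-! ### Operators on `L²` -/

/-- The square integrable functions on the plane. -/
abbrev L2P : Type := Lp ℂ 2 (volume : Measure (ℝ × ℝ))

/-- The square integrable functions on the line. -/
abbrev L2R : Type := Lp ℂ 2 (volume : Measure ℝ)

/-! ### Multiplication, duality pairings and Fatou's lemma in Lebesgue spaces -/

section Mul

variable {X : Type*} [MeasurableSpace X] {μ : Measure X} {p : ℝ≥0∞} [Fact (1 ≤ p)]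

theorem memLp_bdd_mul {m : X → ℂ} (hm : Measurable m) {C : ℝ} (hC : ∀ x, ‖m x‖ ≤ C)
    {p : ℝ≥0∞} {f : X → ℂ} (hf : MemLp f p μ) : MemLp (fun x ↦ m x * f x) p μ :=
  hf.of_le_mul (hm.aestronglyMeasurable.fun_mul hf.1)
    (Eventually.of_forall fun x ↦ by rw [norm_mul]; gcongr; exact hC x)

/-- Multiplication by a bounded measurable function. -/
def mulL (p : ℝ≥0∞) [Fact (1 ≤ p)] (μ : Measure X) {m : X → ℂ} (hm : Measurable m) {C : ℝ}
    (hC : ∀ x, ‖m x‖ ≤ C) : Lp ℂ p μ →L[ℂ] Lp ℂ p μ :=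
  have hmem : ∀ f : Lp ℂ p μ, MemLp (fun x ↦ m x * f x) p μ := fun f ↦
    memLp_bdd_mul hm hC (Lp.memLp f)
  LinearMap.mkContinuous
    { toFun := fun f ↦ (hmem f).toLp _
      map_add' := fun f g ↦ by
        rw [← MemLp.toLp_add, MemLp.toLp_eq_toLp_iff]
        filter_upwards [Lp.coeFn_add f g] with x hx
        rw [hx, Pi.add_apply, Pi.add_apply, mul_add]
      map_smul' := fun c f ↦ by
        rw [RingHom.id_apply, ← MemLp.toLp_const_smul, MemLp.toLp_eq_toLp_iff]
        filter_upwards [Lp.coeFn_smul c f] with x hx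
        simp only [hx, Pi.smul_apply, smul_eq_mul]
        ring } C
    fun f ↦ by
      refine Lp.norm_le_mul_norm_of_ae_le_mul ?_
      filter_upwards [(hmem f).coeFn_toLp] with x hx
      simp only [LinearMap.coe_mk, AddHom.coe_mk]
      rw [hx, norm_mul]
      gcongr
      exact hC x

theorem coeFn_mulL {m : X → ℂ} (hm : Measurable m) {C : ℝ} (hC : ∀ x, ‖m x‖ ≤ C)
    (f : Lp ℂ p μ) : mulL p μ hm hC f =ᵐ[μ] fun x ↦ m x * f x :=
  MemLp.coeFn_toLp (memLp_bdd_mul hm hC (Lp.memLp f))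

theorem norm_mulL_le {m : X → ℂ} (hm : Measurable m) {C : ℝ} (hC : ∀ x, ‖m x‖ ≤ C)
    (f : Lp ℂ p μ) : ‖mulL p μ hm hC f‖ ≤ C * ‖f‖ := by
  refine Lp.norm_le_mul_norm_of_ae_le_mul ?_
  filter_upwards [coeFn_mulL hm hC f] with x hx
  rw [hx, norm_mul]
  gcongr
  exact hC x

/-- The bilinear pairing of Lebesgue spaces with conjugate exponents. -/
def pairL (p q : ℝ≥0∞) [Fact (1 ≤ p)] [Fact (1 ≤ q)] [ENNReal.HolderConjugate p q]
    (μ : Measure X) : Lp ℂ p μ →L[ℂ] Lp ℂ q μ →L[ℂ] ℂ :=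
  ContinuousLinearMap.lpPairing μ p q (ContinuousLinearMap.mul ℂ ℂ)

theorem pairL_eq {q : ℝ≥0∞} [Fact (1 ≤ q)] [ENNReal.HolderConjugate p q] (f : Lp ℂ p μ)
    (g : Lp ℂ q μ) : pairL p q μ f g = ∫ x, f x * g x ∂μ :=
  ContinuousLinearMap.lpPairing_eq_integral _ f g

theorem pairL_toLp {q : ℝ≥0∞} [Fact (1 ≤ q)] [ENNReal.HolderConjugate p q] (f : Lp ℂ p μ)
    {g : X → ℂ} (hg : MemLp g q μ) : pairL p q μ f (hg.toLp g) = ∫ x, f x * g x ∂μ := by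
  rw [pairL_eq]
  refine integral_congr_ae ?_
  filter_upwards [hg.coeFn_toLp] with x hx
  rw [hx]

/-- Fatou's lemma along a subsequence that converges almost everywhere. In this way weighted bounds
survive `Lᵖ` limits although the weight is unbounded and the weighted norm is not continuous. -/
theorem lintegral_weight_le_of_tendsto {f : ℕ → Lp ℂ p μ} {F : Lp ℂ p μ}
    (hf : Tendsto f atTop (𝓝 F)) {m : X → ℝ≥0∞} (hm : Measurable m) (hmt : ∀ x, m x ≠ ∞)
    {c : ℕ → ℝ≥0∞}
    {c₀ : ℝ≥0∞} (hc : Tendsto c atTop (𝓝 c₀)) (h : ∀ n, ∫⁻ x, m x * ‖f n x‖ₑ ^ 2 ∂μ ≤ c n) :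
    ∫⁻ x, m x * ‖F x‖ₑ ^ 2 ∂μ ≤ c₀ := by
  obtain ⟨φ, hφ, hae⟩ := (tendstoInMeasure_of_tendsto_Lp hf).exists_seq_tendsto_ae
  calc ∫⁻ x, m x * ‖F x‖ₑ ^ 2 ∂μ = ∫⁻ x, liminf (fun n ↦ m x * ‖f (φ n) x‖ₑ ^ 2) atTop ∂μ := by
        refine lintegral_congr_ae ?_
        filter_upwards [hae] with x hx
        refine (Tendsto.liminf_eq ?_).symm
        exact ENNReal.Tendsto.const_mul (((ENNReal.continuous_pow 2).tendsto _).comp hx.enorm)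
          (Or.inr (hmt x))
    _ ≤ liminf (fun n ↦ ∫⁻ x, m x * ‖f (φ n) x‖ₑ ^ 2 ∂μ) atTop :=
        lintegral_liminf_le' fun n ↦
          hm.aemeasurable.mul ((Lp.aestronglyMeasurable _).enorm.pow_const 2)
    _ ≤ liminf (fun n ↦ c (φ n)) atTop := liminf_le_liminf (Eventually.of_forall fun n ↦ h _)
    _ = c₀ := (hc.comp hφ.tendsto_atTop).liminf_eq

end Mul

/-! ### The Fourier transform in the space variable -/

/-- The Fourier transform in the first variable. -/
def fxFun (h : ℝ × ℝ → ℂ) (p : ℝ × ℝ) : ℂ := 𝓕 (fun x ↦ h (x, p.2)) p.1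

theorem ae_fiber_left_eq {X : Type*} {f g : ℝ × ℝ → X} (h : f =ᵐ[volume] g) :
    ∀ᵐ t : ℝ, (fun x ↦ f (x, t)) =ᵐ[volume] fun x ↦ g (x, t) := by
  have := (Measure.measurePreserving_swap (μ := (volume : Measure ℝ))
    (ν := (volume : Measure ℝ))).quasiMeasurePreserving.ae h
  exact Measure.ae_ae_of_ae_prod this

theorem ae_of_ae_snd {P : ℝ × ℝ → Prop} (h : ∀ᵐ t : ℝ, ∀ x, P (x, t)) : ∀ᵐ p : ℝ × ℝ, P p := by
  have := (Measure.quasiMeasurePreserving_snd (μ := (volume : Measure ℝ))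
    (ν := (volume : Measure ℝ))).ae h
  filter_upwards [this] with p hp
  exact hp p.1

theorem ae_of_ae_fst {P : ℝ × ℝ → Prop} (h : ∀ᵐ x : ℝ, ∀ t, P (x, t)) : ∀ᵐ p : ℝ × ℝ, P p := by
  have := (Measure.quasiMeasurePreserving_fst (μ := (volume : Measure ℝ))
    (ν := (volume : Measure ℝ))).ae h
  filter_upwards [this] with p hp
  exact hp p.2

theorem fxFun_congr {f g : ℝ × ℝ → ℂ} (h : f =ᵐ[volume] g) : fxFun f =ᵐ[volume] fxFun g := by
  refine ae_of_ae_snd ?_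
  filter_upwards [ae_fiber_left_eq h] with t ht x
  exact Real.fourier_congr_ae ht x

theorem memLp_fxFun {f : ℝ × ℝ → ℂ} (hf : Integrable f) (hf2 : MemLp f 2) :
    MemLp (fxFun f) 2 ∧ eLpNorm (fxFun f) 2 volume = eLpNorm f 2 volume := by
  have hm := hf2.1.ae_eq_mk
  have hgm : Measurable (hf2.1.mk f) := hf2.1.stronglyMeasurable_mk.measurable
  set g := hf2.1.mk f
  have h1 := lintegral_fourier_fiber_sq hgm (hf.congr hm) (hf2.ae_eq hm)
  have h2 : eLpNorm (fxFun f) 2 volume = eLpNorm f 2 volume := by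
    rw [eLpNorm_congr_ae (fxFun_congr hm), eLpNorm_congr_ae hm]
    refine (ENNReal.pow_right_strictMono (n := 2) (by norm_num)).injective ?_
    simp only [eLpNorm_two_sq]
    exact h1
  refine ⟨⟨?_, h2 ▸ hf2.2⟩, h2⟩
  exact (stronglyMeasurable_fourier_fiber hgm).aestronglyMeasurable.congr (fxFun_congr hm).symm

theorem fxFun_add {f g : ℝ × ℝ → ℂ} (hf : Integrable f) (hg : Integrable g) :
    fxFun (f + g) =ᵐ[volume] fxFun f + fxFun g := by
  rw [Measure.volume_eq_prod] at hf hg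
  refine ae_of_ae_snd ?_
  filter_upwards [hf.prod_left_ae, hg.prod_left_ae] with t h1 h2 x
  simp only [fxFun, Pi.add_apply]
  exact congrFun (VectorFourier.fourierIntegral_add Real.continuous_fourierChar
    (L := innerₗ ℝ) continuous_inner h1 h2) x

theorem fxFun_mul_snd (m : ℝ → ℂ) (f : ℝ × ℝ → ℂ) :
    fxFun (fun p ↦ m p.2 * f p) = fun p ↦ m p.2 * fxFun f p := by
  ext p
  simp only [fxFun, Real.fourier_eq']
  rw [← integral_const_mul]
  congr 1 with x
  simp only [smul_eq_mul]
  ring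

/-- The classes of integrable functions in `L²`. -/
def integrableSubmodule : Submodule ℂ L2P where
  carrier := {f : L2P | Integrable (f : ℝ × ℝ → ℂ) volume}
  add_mem' := by
    intro a b ha hb
    exact (Integrable.add (f := (a : ℝ × ℝ → ℂ)) (g := (b : ℝ × ℝ → ℂ)) ha hb).congr
      (Lp.coeFn_add a b).symm
  zero_mem' := (integrable_zero _ _ _).congr (Lp.coeFn_zero _ _ _).symm
  smul_mem' := by
    intro c a ha
    exact (Integrable.smul (f := (a : ℝ × ℝ → ℂ)) c ha).congr (Lp.coeFn_smul c a).symm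

theorem denseRange_integrableSubmodule : DenseRange integrableSubmodule.subtype := by
  refine (denseRange_niceSubmodule (p := 2) (by norm_num)).mono ?_
  rintro _ ⟨⟨f, g, hg, hfg⟩, rfl⟩
  exact ⟨⟨f, hg.integrable.congr hfg.symm⟩, rfl⟩

/-- The Fourier transform in the first variable on `L¹ ∩ L²`. -/
def fxCore : integrableSubmodule →ₗ[ℂ] L2P where
  toFun f := (memLp_fxFun f.2 (Lp.memLp _)).1.toLp _
  map_add' f g := by
    rw [← MemLp.toLp_add, MemLp.toLp_eq_toLp_iff]
    exact (fxFun_congr (Lp.coeFn_add f.1 g.1)).trans (fxFun_add f.2 g.2)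
  map_smul' c f := by
    rw [RingHom.id_apply, ← MemLp.toLp_const_smul, MemLp.toLp_eq_toLp_iff]
    refine (fxFun_congr (Lp.coeFn_smul c f.1)).trans (Eventually.of_forall fun p ↦ ?_)
    exact congrFun (fxFun_mul_snd (fun _ ↦ c) f.1) p

theorem norm_fxCore (f : integrableSubmodule) : ‖fxCore f‖ = ‖integrableSubmodule.subtype f‖ := by
  change ‖(memLp_fxFun f.2 (Lp.memLp _)).1.toLp _‖ = _
  rw [Lp.norm_toLp, (memLp_fxFun f.2 (Lp.memLp _)).2]
  rfl

/-- The Fourier transform in the first variable on `L²` of the plane. -/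
def Fx : L2P →L[ℂ] L2P := fxCore.extendOfNorm integrableSubmodule.subtype

theorem Fx_toLp {f : ℝ × ℝ → ℂ} (hf : Integrable f) (hf2 : MemLp f 2) :
    Fx (hf2.toLp f) =ᵐ[volume] fxFun f := by
  have hi : hf2.toLp f ∈ integrableSubmodule := hf.congr hf2.coeFn_toLp.symm
  have h := LinearMap.extendOfNorm_eq (f := fxCore) denseRange_integrableSubmodule
    ⟨1, fun f ↦ (by rw [one_mul]; exact (norm_fxCore f).le)⟩ ⟨hf2.toLp f, hi⟩
  change Fx (hf2.toLp f) = _ at h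
  rw [h]
  exact (MemLp.coeFn_toLp (memLp_fxFun hi (Lp.memLp _)).1).trans (fxFun_congr hf2.coeFn_toLp)

theorem exists_integrable_seq (f : L2P) : ∃ g : ℕ → ℝ × ℝ → ℂ, ∃ hg2 : ∀ n, MemLp (g n) 2,
    (∀ n, Integrable (g n)) ∧ Tendsto (fun n ↦ (hg2 n).toLp (g n)) atTop (𝓝 f) := by
  obtain ⟨g, hg, h⟩ := exists_nice_seq (p := 2) (by norm_num) f
  exact ⟨g, fun n ↦ (hg n).memLp 2, fun n ↦ (hg n).integrable, h⟩

theorem Fx_mulL_snd {m : ℝ → ℂ} (hm : Measurable m) {C : ℝ} (hC : ∀ x, ‖m x‖ ≤ C) (f : L2P) :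
    Fx (mulL 2 volume (hm.comp measurable_snd) (fun p : ℝ × ℝ ↦ hC p.2) f) =
      mulL 2 volume (hm.comp measurable_snd) (fun p : ℝ × ℝ ↦ hC p.2) (Fx f) := by
  obtain ⟨g, hg2, hg, h⟩ := exists_integrable_seq f
  set M := mulL 2 volume (hm.comp measurable_snd) (fun p : ℝ × ℝ ↦ hC p.2)
  refine tendsto_nhds_unique (((Fx.continuous.comp M.continuous).tendsto _).comp h)
    ((((M.continuous.comp Fx.continuous).tendsto _).comp h).congr fun n ↦ ?_)
  simp only [Function.comp_apply]
  have hmg : Integrable (fun p : ℝ × ℝ ↦ m p.2 * g n p) :=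
    (hg n).bdd_mul (hm.comp measurable_snd).aestronglyMeasurable
      (Eventually.of_forall fun p ↦ hC p.2)
  have hmg2 : MemLp (fun p : ℝ × ℝ ↦ m p.2 * g n p) 2 :=
    memLp_bdd_mul (hm.comp measurable_snd) (fun p : ℝ × ℝ ↦ hC p.2) (hg2 n)
  have e1 : M ((hg2 n).toLp (g n)) = hmg2.toLp _ := by
    refine Lp.ext ((coeFn_mulL _ _ _).trans ?_)
    filter_upwards [(hg2 n).coeFn_toLp, hmg2.coeFn_toLp] with p h1 h2
    rw [h1, h2]
    rfl
  rw [e1]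
  refine Lp.ext ((coeFn_mulL _ _ _).trans ?_)
  filter_upwards [Fx_toLp (hg n) (hg2 n), Fx_toLp hmg hmg2] with p h1 h2
  rw [h1, h2, fxFun_mul_snd]
  rfl

/-- The transform in the first variable is local in the second one. -/
theorem Fx_eq_zero_of {f : L2P} {I : Set ℝ} (hI : MeasurableSet I)
    (hf : ∀ᵐ p : ℝ × ℝ, p.2 ∈ I → f p = 0) : ∀ᵐ p : ℝ × ℝ, p.2 ∈ I → Fx f p = 0 := by
  have hm : Measurable (I.indicator fun _ ↦ (1 : ℂ)) := measurable_const.indicator hI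
  have hC : ∀ x, ‖I.indicator (fun _ ↦ (1 : ℂ)) x‖ ≤ 1 := fun x ↦ by
    refine (norm_indicator_le_norm_self _ _).trans (by simp)
  have h0 : mulL 2 volume (hm.comp measurable_snd) (fun p : ℝ × ℝ ↦ hC p.2) f = 0 := by
    refine Lp.ext ((coeFn_mulL _ _ _).trans ?_)
    filter_upwards [hf, Lp.coeFn_zero ℂ 2 (volume : Measure (ℝ × ℝ))] with p h1 h2
    rw [h2]
    by_cases hp : p.2 ∈ I
    · simp [h1 hp]
    · simp [hp]
  have h1 := Fx_mulL_snd hm hC f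
  rw [h0, map_zero] at h1
  filter_upwards [coeFn_mulL (hm.comp measurable_snd) (fun p : ℝ × ℝ ↦ hC p.2) (Fx f),
    Lp.coeFn_zero ℂ 2 (volume : Measure (ℝ × ℝ))] with p h2 h3 hp
  rw [← h1, h3] at h2
  simpa [hp] using h2.symm

/-- The adjoint of the transform in the first variable. -/
theorem integral_Fx_mul {f : L2P} {Ψ Ψ' : ℝ × ℝ → ℂ} (hΨ : MemLp Ψ 2) (hΨ' : MemLp Ψ' 2)
    (hi : ∀ t, Integrable fun x ↦ Ψ (x, t)) (h : ∀ ξ t, Ψ' (ξ, t) = 𝓕 (fun x ↦ Ψ (x, t)) ξ) :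
    ∫ p, Fx f p * Ψ p = ∫ p, f p * Ψ' p := by
  obtain ⟨g, hg2, hg, hlim⟩ := exists_integrable_seq f
  rw [← pairL_toLp (p := 2) (Fx f) hΨ, ← pairL_toLp (p := 2) f hΨ']
  have c1 : Continuous fun f : L2P ↦ pairL 2 2 volume (Fx f) (hΨ.toLp Ψ) := by fun_prop
  have c2 : Continuous fun f : L2P ↦ pairL 2 2 volume f (hΨ'.toLp Ψ') := by fun_prop
  refine tendsto_nhds_unique ((c1.tendsto _).comp hlim)
    (((c2.tendsto _).comp hlim).congr fun n ↦ ?_)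
  simp only [Function.comp_apply]
  rw [pairL_toLp, pairL_toLp]
  have e1 : ∫ p, ((hg2 n).toLp (g n) : ℝ × ℝ → ℂ) p * Ψ' p = ∫ p, g n p * Ψ' p :=
    integral_congr_ae (by filter_upwards [(hg2 n).coeFn_toLp] with p hp; rw [hp])
  have e2 : ∫ p, (Fx ((hg2 n).toLp (g n)) : ℝ × ℝ → ℂ) p * Ψ p = ∫ p, fxFun (g n) p * Ψ p :=
    integral_congr_ae (by filter_upwards [Fx_toLp (hg n) (hg2 n)] with p hp; rw [hp])
  rw [e1, e2]
  have i1 : Integrable fun p ↦ g n p * Ψ' p := (hg2 n).integrable_mul hΨ'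
  have i2 : Integrable fun p ↦ fxFun (g n) p * Ψ p := (memLp_fxFun (hg n) (hg2 n)).1.integrable_mul hΨ
  rw [Measure.volume_eq_prod] at i1 i2 ⊢
  rw [integral_prod_symm _ i1, integral_prod_symm _ i2]
  refine integral_congr_ae ?_
  filter_upwards [ae_fiber_left (hg n) (hg2 n)] with t ht
  simp only [fxFun, h]
  exact (integral_fourier_mul_eq ht.1 (hi t)).symm

/-- On almost every time slice `wave g` is the inverse transform of a function in `L¹ ∩ L²`, and
inversion holds there. Measurability of the coincidence set turns this into an almost everywhere
statement on the plane. -/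
theorem fxFun_wave {g : ℝ × ℝ → ℂ} (hg : Nice g) (hw : Integrable (wave g)) :
    fxFun (wave g) =ᵐ[volume] fun p ↦ 𝓕⁻ (fun τ ↦ g (p.1, τ)) p.2 := by
  have hm := (stronglyMeasurable_fourierInv_fiber hg.meas).measurable
  have hwm := (continuous_wave hg.integrable).measurable
  have hfm : Measurable (fxFun (wave g)) := (stronglyMeasurable_fourier_fiber hwm).measurable
  have hS : MeasurableSet {p : ℝ × ℝ | fxFun (wave g) p = 𝓕⁻ (fun τ ↦ g (p.1, τ)) p.2} :=
    measurableSet_eq_fun hfm hm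
  have hS' := measurable_swap hS
  have key : ∀ᵐ q : ℝ × ℝ, q.swap ∈ {p : ℝ × ℝ | fxFun (wave g) p = 𝓕⁻ (fun τ ↦ g (p.1, τ)) p.2} := by
    rw [Measure.volume_eq_prod]
    rw [Measure.ae_prod_iff_ae_ae hS']
    rw [Measure.volume_eq_prod] at hw
    filter_upwards [ae_memLp_fourierInv_fiber hg.meas hg.integrable (hg.memLp 2),
      hw.prod_left_ae] with t h1 h2
    have h3 := integrable_fourierInv_fiber hg.meas hg.integrable t
    have h4 : (fun x ↦ wave g (x, t)) = 𝓕⁻ (fun ξ ↦ 𝓕⁻ (fun τ ↦ g (ξ, τ)) t) := by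
      ext x
      exact wave_eq hg.integrable x t
    rw [h4] at h2
    filter_upwards [fourier_fourierInv_ae h3 h1 h2] with ξ hξ
    simp only [Prod.swap_prod_mk, fxFun, h4]
    exact hξ
  have := (Measure.measurePreserving_swap (μ := (volume : Measure ℝ))
    (ν := (volume : Measure ℝ))).quasiMeasurePreserving.ae key
  filter_upwards [this] with p hp
  simpa using hp

/-! ### The space of coefficients -/

/-- The parameters of the equation and of the Sobolev scale. -/
structure Par where
  /-- The coefficient of the quintic term of the phase. -/
  A : ℝ
  /-- The coefficient of the cubic term of the phase. -/
  B : ℝ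
  /-- The Sobolev exponent. -/
  s : ℝ
  hA : A ≠ 0
  hs : -(1 / 4) ≤ s

namespace Par

variable (P : Par)

/-- The phase. -/
def Q : ℝ → ℝ := ph P.A P.B

theorem continuous_Q : Continuous P.Q := continuous_ph _ _

end Par

/-- This is `2b = 3/2 > 1`, the reason why functions of the Bourgain space have values at every
time. -/
theorem memLp_md (c : ℝ) : MemLp (fun τ ↦ (md (τ - c) : ℂ)) 2 := by
  have hc : Continuous fun τ ↦ (md (τ - c) : ℂ) := by
    have := continuous_md
    fun_prop
  refine (memLp_two_iff_integrable_sq_norm hc.aestronglyMeasurable).2 ?_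
  simp only [Complex.norm_real, Real.norm_of_nonneg (md_pos _).le]
  exact integrable_md_sq.comp_sub_right c

theorem enorm_ofReal_md (y : ℝ) : ‖(md y : ℂ)‖ₑ = ENNReal.ofReal (md y) := by
  rw [← ofReal_norm, Complex.norm_real, Real.norm_of_nonneg (md_pos _).le]

/-- The coefficients with the modulation weight, as a function of frequency and time. -/
def kf (P : Par) (f : ℝ × ℝ → ℂ) (p : ℝ × ℝ) : ℂ :=
  𝓕⁻ (fun τ ↦ (md (τ - P.Q p.1) : ℂ) * f (p.1, τ)) p.2

/-! ### Fibrewise bounds for the coefficients in frequency and time -/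

section Coefficients

variable (P : Par) {f g : ℝ × ℝ → ℂ}

theorem measurable_md_mul (hf : Measurable f) :
    Measurable fun p : ℝ × ℝ ↦ (md (p.2 - P.Q p.1) : ℂ) * f p := by
  refine Measurable.mul ?_ hf
  have h1 := continuous_md
  have h2 := P.continuous_Q
  exact (by fun_prop : Continuous fun p : ℝ × ℝ ↦ (md (p.2 - P.Q p.1) : ℂ)).measurable

theorem measurable_kf (hf : Measurable f) : Measurable (kf P f) :=
  (stronglyMeasurable_fourierInv_fiber (measurable_md_mul P hf)).measurable

theorem ae_memLp_fiber (hf : MemLp f 2) : ∀ᵐ ξ : ℝ, MemLp (fun τ ↦ f (ξ, τ)) 2 := by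
  rw [Measure.volume_eq_prod] at hf
  filter_upwards [(hf.integrable_norm_pow (by norm_num)).prod_right_ae, hf.1.prodMk_left]
    with x h1 h2
  exact (memLp_two_iff_integrable_sq_norm h2).2 h1

theorem integrable_md_mul {h : ℝ → ℂ} (hh : MemLp h 2) (c : ℝ) :
    Integrable fun τ ↦ (md (τ - c) : ℂ) * h τ := (memLp_md c).integrable_mul hh

theorem memLp_md_mul {h : ℝ → ℂ} (hh : MemLp h 2) (c : ℝ) :
    MemLp (fun τ ↦ (md (τ - c) : ℂ) * h τ) 2 := by
  have h1 : Continuous fun τ ↦ (md (τ - c) : ℂ) := by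
    have := continuous_md
    fun_prop
  refine memLp_bdd_mul (m := fun τ ↦ (md (τ - c) : ℂ)) (C := 1) h1.measurable (fun τ ↦ ?_) hh
  rw [Complex.norm_real, Real.norm_of_nonneg (md_pos _).le]
  exact md_le_one _

theorem ae_continuous_kf (hf : MemLp f 2) : ∀ᵐ ξ : ℝ, Continuous fun t ↦ kf P f (ξ, t) := by
  filter_upwards [ae_memLp_fiber hf] with ξ hξ
  simp only [kf]
  exact continuous_fourierInv (f := fun τ ↦ (md (τ - P.Q ξ) : ℂ) * f (ξ, τ))
    (integrable_md_mul hξ (P.Q ξ))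

/-- The exceptional set consists of frequencies only and serves all times at once, so statements at
individual times make sense for `L²` classes. -/
theorem kf_congr (h : f =ᵐ[volume] g) : ∀ᵐ ξ : ℝ, ∀ t, kf P f (ξ, t) = kf P g (ξ, t) := by
  rw [Measure.volume_eq_prod] at h
  filter_upwards [Measure.ae_ae_of_ae_prod h] with ξ hξ t
  refine Real.fourierInv_congr_ae ?_ t
  filter_upwards [hξ] with τ hτ
  rw [hτ]

theorem kf_add (hf : MemLp f 2) (hg : MemLp g 2) :
    ∀ᵐ ξ : ℝ, ∀ t, kf P (f + g) (ξ, t) = kf P f (ξ, t) + kf P g (ξ, t) := by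
  filter_upwards [ae_memLp_fiber hf, ae_memLp_fiber hg] with ξ h1 h2 t
  simp only [kf, Pi.add_apply, mul_add]
  simp only [Real.fourierInv_eq']
  rw [← integral_add]
  · simp only [smul_add]
  · exact (Real.fourierIntegral_convergent_iff (μ := volume) (-t)).2 (integrable_md_mul h1 (P.Q ξ)) |>.congr
      (Eventually.of_forall fun v ↦ by simp [Real.fourierChar_apply, Circle.smul_def])
  · exact (Real.fourierIntegral_convergent_iff (μ := volume) (-t)).2 (integrable_md_mul h2 (P.Q ξ)) |>.congr
      (Eventually.of_forall fun v ↦ by simp [Real.fourierChar_apply, Circle.smul_def])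

theorem kf_smul (c : ℂ) (f : ℝ × ℝ → ℂ) (p : ℝ × ℝ) : kf P (c • f) p = c * kf P f p := by
  simp only [kf, Real.fourierInv_eq', Pi.smul_apply, smul_eq_mul]
  rw [← integral_const_mul]
  congr 1 with τ
  ring

theorem enorm_kf_sq_le (hf : Measurable f) (ξ t : ℝ) :
    ‖kf P f (ξ, t)‖ₑ ^ 2 ≤ (∫⁻ y, jj y) * ∫⁻ τ, ‖f (ξ, τ)‖ₑ ^ 2 := by
  have h1 : ‖kf P f (ξ, t)‖ₑ ≤ ∫⁻ τ, ENNReal.ofReal (md (τ - P.Q ξ)) * ‖f (ξ, τ)‖ₑ := by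
    rw [kf, Real.fourierInv_eq']
    refine (enorm_integral_le_lintegral_enorm _).trans (le_of_eq ?_)
    refine lintegral_congr fun τ ↦ ?_
    rw [smul_eq_mul, enorm_mul, enorm_mul, enorm_ofReal_md, ← ofReal_norm,
      Complex.norm_exp_ofReal_mul_I, ENNReal.ofReal_one, one_mul]
  have hm := continuous_md
  refine (pow_le_pow_left' h1 2).trans ((lintegral_mul_sq_le volume (by fun_prop)
    (hf.comp measurable_prodMk_left).enorm.aemeasurable).trans (le_of_eq ?_))
  congr 1
  rw [← lintegral_sub_right_eq_self jj (P.Q ξ)]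
  refine lintegral_congr fun τ ↦ ?_
  rw [jj, ENNReal.ofReal_pow (md_pos _).le]

theorem lintegral_kf_sq_le (hf : Measurable f) (t : ℝ) :
    ∫⁻ ξ, ‖kf P f (ξ, t)‖ₑ ^ 2 ≤ (∫⁻ y, jj y) * ∫⁻ p, ‖f p‖ₑ ^ 2 := by
  rw [Measure.volume_eq_prod, lintegral_prod _ (hf.enorm.pow_const 2).aemeasurable,
    ← lintegral_const_mul' _ _ lintegral_jj_lt_top.ne]
  exact lintegral_mono fun ξ ↦ enorm_kf_sq_le P hf ξ t

theorem lintegral_sq_lt_top (hf : MemLp f 2) : ∫⁻ p, ‖f p‖ₑ ^ 2 < ∞ := by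
  rw [← eLpNorm_two_sq]
  exact ENNReal.pow_lt_top hf.2

theorem memLp_two_of_lintegral {X : Type*} [MeasurableSpace X] {μ : Measure X} {h : X → ℂ}
    (hm : AEStronglyMeasurable h μ) (hh : ∫⁻ x, ‖h x‖ₑ ^ 2 ∂μ < ∞) : MemLp h 2 μ := by
  refine ⟨hm, ?_⟩
  rw [← eLpNorm_two_sq] at hh
  exact (ENNReal.pow_lt_top_iff.1 hh).resolve_right (by norm_num)

theorem memLp_kf_slice (hfm : Measurable f) (hf : MemLp f 2) (t : ℝ) :
    MemLp (fun ξ ↦ kf P f (ξ, t)) 2 :=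
  memLp_two_of_lintegral ((measurable_kf P hfm).comp measurable_prodMk_right).aestronglyMeasurable
    ((lintegral_kf_sq_le P hfm t).trans_lt
      (ENNReal.mul_lt_top lintegral_jj_lt_top (lintegral_sq_lt_top hf)))

theorem lintegral_kf_sq_plane_le (hfm : Measurable f) (hf : MemLp f 2) :
    ∫⁻ p, ‖kf P f p‖ₑ ^ 2 ≤ ∫⁻ p, ‖f p‖ₑ ^ 2 := by
  rw [Measure.volume_eq_prod, lintegral_prod _ (hfm.enorm.pow_const 2).aemeasurable,
    lintegral_prod _ ((measurable_kf P hfm).enorm.pow_const 2).aemeasurable]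
  refine lintegral_mono_ae ?_
  filter_upwards [ae_memLp_fiber hf] with ξ hξ
  simp only [kf]
  rw [lintegral_fourierInv_sq (integrable_md_mul hξ _) (memLp_md_mul hξ _)]
  refine lintegral_mono fun τ ↦ pow_le_pow_left' ?_ 2
  rw [enorm_mul, enorm_ofReal_md]
  exact mul_le_of_le_one_left (zero_le) (ENNReal.ofReal_le_one.2 (md_le_one _))

theorem memLp_kf (hfm : Measurable f) (hf : MemLp f 2) : MemLp (kf P f) 2 :=
  memLp_two_of_lintegral (measurable_kf P hfm).aestronglyMeasurable
    ((lintegral_kf_sq_plane_le P hfm hf).trans_lt (lintegral_sq_lt_top hf))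

end Coefficients

theorem measurable_coe (f : L2P) : Measurable (f : ℝ × ℝ → ℂ) := (Lp.stronglyMeasurable f).measurable

theorem enorm_eq_lintegral {X : Type*} [MeasurableSpace X] {μ : Measure X} (f : Lp ℂ 2 μ) :
    ‖f‖ₑ ^ 2 = ∫⁻ x, ‖f x‖ₑ ^ 2 ∂μ := by
  rw [← eLpNorm_two_sq, Lp.enorm_def]

theorem enorm_toLp_sq {X : Type*} [MeasurableSpace X] {μ : Measure X} {h : X → ℂ}
    (hh : MemLp h 2 μ) : ‖hh.toLp h‖ₑ ^ 2 = ∫⁻ x, ‖h x‖ₑ ^ 2 ∂μ := by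
  rw [← eLpNorm_two_sq, Lp.enorm_toLp]

namespace Par

variable (P : Par)

theorem ae_kf_add (f g : L2P) : ∀ᵐ ξ : ℝ, ∀ t,
    kf P (f + g : L2P) (ξ, t) = kf P f (ξ, t) + kf P g (ξ, t) := by
  filter_upwards [kf_congr P (Lp.coeFn_add f g), kf_add P (Lp.memLp f) (Lp.memLp g)]
    with ξ h1 h2 t
  rw [h1, h2]

theorem ae_kf_smul (c : ℂ) (f : L2P) : ∀ᵐ ξ : ℝ, ∀ t,
    kf P (c • f : L2P) (ξ, t) = c * kf P f (ξ, t) := by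
  filter_upwards [kf_congr P (Lp.coeFn_smul c f)] with ξ h1 t
  rw [h1, kf_smul]

theorem ae_kf_sub (f g : L2P) : ∀ᵐ ξ : ℝ, ∀ t,
    kf P (f - g : L2P) (ξ, t) = kf P f (ξ, t) - kf P g (ξ, t) := by
  filter_upwards [P.ae_kf_add (f - g) g] with ξ h1 t
  rw [eq_sub_iff_add_eq, ← h1, sub_add_cancel]

/-- The value at time `t`, on the Fourier side and with the Sobolev weight. -/
def at_ (t : ℝ) : L2P →ₗ[ℂ] L2R where
  toFun f := (memLp_kf_slice P (measurable_coe f) (Lp.memLp f) t).toLp _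
  map_add' f g := by
    rw [← MemLp.toLp_add, MemLp.toLp_eq_toLp_iff]
    filter_upwards [P.ae_kf_add f g] with ξ h
    exact h t
  map_smul' c f := by
    rw [RingHom.id_apply, ← MemLp.toLp_const_smul, MemLp.toLp_eq_toLp_iff]
    filter_upwards [P.ae_kf_smul c f] with ξ h
    exact h t

theorem coeFn_at (t : ℝ) (f : L2P) : P.at_ t f =ᵐ[volume] fun ξ ↦ kf P f (ξ, t) :=
  MemLp.coeFn_toLp (memLp_kf_slice P (measurable_coe f) (Lp.memLp f) t)

theorem enorm_at_sq_le (t : ℝ) (f : L2P) : ‖P.at_ t f‖ₑ ^ 2 ≤ (∫⁻ y, jj y) * ‖f‖ₑ ^ 2 := by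
  rw [enorm_eq_lintegral f]
  refine le_trans (le_of_eq ?_) (lintegral_kf_sq_le P (measurable_coe f) t)
  exact enorm_toLp_sq (memLp_kf_slice P (measurable_coe f) (Lp.memLp f) t)

/-- The norm of the embedding of the Bourgain space into the space of continuous curves. -/
def embC : ℝ := √(∫⁻ y, jj y).toReal

theorem embC_nonneg : 0 ≤ embC := Real.sqrt_nonneg _

theorem norm_at_le (t : ℝ) (f : L2P) : ‖P.at_ t f‖ ≤ embC * ‖f‖ := by
  have h := ENNReal.toReal_mono (ENNReal.mul_ne_top lintegral_jj_lt_top.ne (by simp))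
    (P.enorm_at_sq_le t f)
  rw [ENNReal.toReal_mul, ENNReal.toReal_pow, ENNReal.toReal_pow, toReal_enorm, toReal_enorm] at h
  refine (pow_le_pow_iff_left₀ (norm_nonneg _) (by unfold embC; positivity) (by norm_num : 2 ≠ 0)).1 ?_
  rwa [mul_pow, embC, Real.sq_sqrt ENNReal.toReal_nonneg]

/-- Dominated convergence in the frequency: almost every fibre is continuous in time, and
`enorm_kf_sq_le` gives a majorant independent of time. -/
theorem continuous_at (f : L2P) : Continuous fun t ↦ P.at_ t f := by
  refine continuous_iff_seqContinuous.2 fun t t₀ ht ↦ ?_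
  have hfm := measurable_coe f
  rw [tendsto_iff_edist_tendsto_0]
  have e : ∀ n, edist (P.at_ (t n) f) (P.at_ t₀ f) ^ 2 =
      ∫⁻ ξ, ‖kf P f (ξ, t n) - kf P f (ξ, t₀)‖ₑ ^ 2 := fun n ↦ by
    rw [edist_eq_enorm_sub, enorm_eq_lintegral]
    refine lintegral_congr_ae ?_
    filter_upwards [Lp.coeFn_sub (P.at_ (t n) f) (P.at_ t₀ f), P.coeFn_at (t n) f, P.coeFn_at t₀ f]
      with ξ h1 h2 h3
    rw [h1, Pi.sub_apply, h2, h3]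
  have hk := measurable_kf P hfm
  have key : Tendsto (fun n ↦ ∫⁻ ξ, ‖kf P f (ξ, t n) - kf P f (ξ, t₀)‖ₑ ^ 2) atTop
      (𝓝 (∫⁻ _ : ℝ, 0)) := by
    refine tendsto_lintegral_of_dominated_convergence
      (fun ξ ↦ 4 * ((∫⁻ y, jj y) * ∫⁻ τ, ‖f (ξ, τ)‖ₑ ^ 2)) (fun n ↦ ?_) (fun n ↦ ?_) ?_ ?_
    · exact ((hk.comp measurable_prodMk_right).sub (hk.comp measurable_prodMk_right)).enorm.pow_const 2
    · refine Eventually.of_forall fun ξ ↦ ?_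
      have h1 := enorm_kf_sq_le P hfm ξ (t n)
      have h2 := enorm_kf_sq_le P hfm ξ t₀
      set a := kf P f (ξ, t n)
      set b := kf P f (ξ, t₀)
      calc ‖a - b‖ₑ ^ 2 ≤ (‖a‖ₑ + ‖b‖ₑ) ^ 2 := pow_le_pow_left' (enorm_sub_le) 2
        _ ≤ 2 * (‖a‖ₑ ^ 2 + ‖b‖ₑ ^ 2) := by
          have := ENNReal.rpow_add_le_mul_rpow_add_rpow ‖a‖ₑ ‖b‖ₑ (p := 2) (by norm_num)
          norm_num at this
          exact this
        _ ≤ 2 * ((∫⁻ y, jj y) * (∫⁻ τ, ‖f (ξ, τ)‖ₑ ^ 2) +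
              (∫⁻ y, jj y) * ∫⁻ τ, ‖f (ξ, τ)‖ₑ ^ 2) := by gcongr
        _ = _ := by ring
    · rw [lintegral_const_mul' _ _ (by norm_num), lintegral_const_mul' _ _ lintegral_jj_lt_top.ne,
        ← lintegral_prod (fun p ↦ ‖f p‖ₑ ^ 2) (hfm.enorm.pow_const 2).aemeasurable,
        ← Measure.volume_eq_prod]
      exact ENNReal.mul_ne_top (by norm_num) (ENNReal.mul_ne_top lintegral_jj_lt_top.ne
        (lintegral_sq_lt_top (Lp.memLp f)).ne)
    · filter_upwards [ae_continuous_kf P (Lp.memLp f)] with ξ hξ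
      have h1 : Tendsto (fun n ↦ kf P f (ξ, t n) - kf P f (ξ, t₀)) atTop (𝓝 0) := by
        have := ((hξ.tendsto t₀).comp ht).sub_const (kf P f (ξ, t₀))
        simpa using! this
      have h2 := ((ENNReal.continuous_pow 2).tendsto _).comp h1.enorm
      simpa using! h2
  simp_rw [← e] at key
  have := (ENNReal.continuous_rpow_const (y := 1 / 2)).tendsto _ |>.comp key
  refine (this.congr fun n ↦ ?_).trans (le_of_eq ?_)
  · simp only [Function.comp_apply]
    rw [← ENNReal.rpow_natCast, ← ENNReal.rpow_mul]
    norm_num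
  · simp

/-- The coefficients with the modulation weight, as an element of `L²` in frequency and time. -/
def K : L2P →L[ℂ] L2P :=
  LinearMap.mkContinuous
    { toFun := fun f ↦ (memLp_kf P (measurable_coe f) (Lp.memLp f)).toLp _
      map_add' := fun f g ↦ by
        rw [← MemLp.toLp_add, MemLp.toLp_eq_toLp_iff]
        refine ae_of_ae_fst ?_
        exact P.ae_kf_add f g
      map_smul' := fun c f ↦ by
        rw [RingHom.id_apply, ← MemLp.toLp_const_smul, MemLp.toLp_eq_toLp_iff]
        exact ae_of_ae_fst (P.ae_kf_smul c f) } 1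
    fun f ↦ by
      rw [one_mul]
      refine enorm_le_iff_norm_le.1 ?_
      refine (ENNReal.pow_right_strictMono (n := 2) (by norm_num)).le_iff_le.1 ?_
      change ‖(memLp_kf P (measurable_coe f) (Lp.memLp f)).toLp _‖ₑ ^ 2 ≤ ‖f‖ₑ ^ 2
      rw [enorm_eq_lintegral f]
      exact (enorm_toLp_sq _).le.trans (lintegral_kf_sq_plane_le P (measurable_coe f) (Lp.memLp f))

theorem coeFn_K (f : L2P) : P.K f =ᵐ[volume] kf P f :=
  MemLp.coeFn_toLp (memLp_kf P (measurable_coe f) (Lp.memLp f))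

/-! ### The functions of the Bourgain space -/

theorem exists_eLpNorm_wave_den_le : ∃ C : ℝ≥0, ∀ f, Nice f →
    eLpNorm (wave (den P.s P.Q f)) 6 volume ≤ C * eLpNorm f 2 volume := by
  obtain ⟨C, hC⟩ := exists_eLpNorm_wave_le P.hA P.B
  exact ⟨C, fun f hf ↦ hC P.s (by linarith [P.hs]) f hf⟩

theorem den_congr {f g : ℝ × ℝ → ℂ} (h : f =ᵐ[volume] g) :
    den P.s P.Q f =ᵐ[volume] den P.s P.Q g := by
  filter_upwards [h] with p hp
  rw [den, den, hp]

theorem wave_den_of_mem (f : niceSubmodule 2) :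
    MemLp (wave (den P.s P.Q (f : L2P))) 6 ∧
      Integrable (den P.s P.Q (f : L2P)) := by
  obtain ⟨f, g, hg, hfg⟩ := f
  have hd := nice_den P.s P.continuous_Q hg
  rw [wave_congr (P.den_congr hfg)]
  obtain ⟨C, hC⟩ := P.exists_eLpNorm_wave_den_le
  refine ⟨⟨(continuous_wave hd.integrable).aestronglyMeasurable, ?_⟩,
    hd.integrable.congr (P.den_congr hfg).symm⟩
  exact (hC g hg).trans_lt (ENNReal.mul_lt_top (by simp) (hg.memLp 2).2)

instance : Fact ((1 : ℝ≥0∞) ≤ 6) := ⟨by norm_num⟩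

/-- The function with given coefficients, for nice coefficients. -/
def WCore : niceSubmodule 2 →ₗ[ℂ] Lp ℂ 6 (volume : Measure (ℝ × ℝ)) where
  toFun f := (P.wave_den_of_mem f).1.toLp _
  map_add' f g := by
    rw [← MemLp.toLp_add, MemLp.toLp_eq_toLp_iff]
    rw [← wave_add (P.wave_den_of_mem f).2 (P.wave_den_of_mem g).2, ← den_add]
    exact (wave_congr (P.den_congr (Lp.coeFn_add f.1 g.1))).eventuallyEq
  map_smul' c f := by
    rw [RingHom.id_apply, ← MemLp.toLp_const_smul, MemLp.toLp_eq_toLp_iff]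
    rw [← wave_const_smul, ← den_const_smul]
    exact (wave_congr (P.den_congr (Lp.coeFn_smul c f.1))).eventuallyEq

theorem exists_norm_WCore_le : ∃ C : ℝ, ∀ f, ‖P.WCore f‖ ≤ C * ‖(niceSubmodule 2).subtype f‖ := by
  obtain ⟨C, hC⟩ := P.exists_eLpNorm_wave_den_le
  refine ⟨C, fun f ↦ ?_⟩
  obtain ⟨f, g, hg, hfg⟩ := f
  change ‖(P.wave_den_of_mem ⟨f, g, hg, hfg⟩).1.toLp _‖ ≤ C * ‖f‖
  rw [Lp.norm_toLp, wave_congr (P.den_congr hfg), Lp.norm_def, eLpNorm_congr_ae hfg]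
  have := ENNReal.toReal_mono (ENNReal.mul_ne_top (by simp) (hg.memLp 2).2.ne) (hC g hg)
  rwa [ENNReal.toReal_mul, ENNReal.coe_toReal] at this

/-- The function with given coefficients. -/
def W : L2P →L[ℂ] Lp ℂ 6 (volume : Measure (ℝ × ℝ)) :=
  P.WCore.extendOfNorm (niceSubmodule 2).subtype

theorem W_toLp {g : ℝ × ℝ → ℂ} (hg : Nice g) :
    P.W ((hg.memLp 2).toLp g) =ᵐ[volume] wave (den P.s P.Q g) := by
  have h := LinearMap.extendOfNorm_eq (f := P.WCore) (denseRange_niceSubmodule (p := 2)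
    (by norm_num)) P.exists_norm_WCore_le ⟨_, toLp_mem_niceSubmodule hg⟩
  change P.W ((hg.memLp 2).toLp g) = _ at h
  rw [h]
  refine (MemLp.coeFn_toLp (P.wave_den_of_mem ⟨_, toLp_mem_niceSubmodule hg⟩).1).trans ?_
  exact (wave_congr (P.den_congr (hg.memLp 2).coeFn_toLp)).eventuallyEq

end Par

/-! ### The nonlinear term -/

instance : ENNReal.HolderTriple 6 6 3 := ⟨by
  rw [← ENNReal.toReal_eq_toReal_iff' (by simp) (by simp), ENNReal.toReal_add (by simp) (by simp)]
  simp; norm_num⟩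

instance : ENNReal.HolderTriple 6 3 2 := ⟨by
  rw [← ENNReal.toReal_eq_toReal_iff' (by simp) (by simp), ENNReal.toReal_add (by simp) (by simp)]
  simp; norm_num⟩

instance : Fact ((1 : ℝ≥0∞) ≤ 3) := ⟨by norm_num⟩

/-- The functions on the plane in `L⁶`. -/
abbrev L6P : Type := Lp ℂ 6 (volume : Measure (ℝ × ℝ))

/-- The product of three functions in `L⁶`. -/
@[irreducible]
def prod3 (u v w : L6P) : L2P :=
  (ContinuousLinearMap.mul ℂ ℂ).holderL volume 6 3 2 u
    ((ContinuousLinearMap.mul ℂ ℂ).holderL volume 6 6 3 v w)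

theorem coeFn_prod3 (u v w : L6P) : prod3 u v w =ᵐ[volume] fun p ↦ u p * (v p * w p) := by
  have h1 := (ContinuousLinearMap.mul ℂ ℂ).coeFn_holder (r := 3) v w
  have h2 := (ContinuousLinearMap.mul ℂ ℂ).coeFn_holder (r := 2) u
    ((ContinuousLinearMap.mul ℂ ℂ).holder 3 v w)
  filter_upwards [h1, h2] with p e1 e2
  rw [e1] at e2
  unfold prod3
  exact e2

theorem tendsto_prod3 {ι : Type*} {l : Filter ι} {u v w : ι → L6P} {u₀ v₀ w₀ : L6P}
    (hu : Tendsto u l (𝓝 u₀)) (hv : Tendsto v l (𝓝 v₀)) (hw : Tendsto w l (𝓝 w₀)) :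
    Tendsto (fun i ↦ prod3 (u i) (v i) (w i)) l (𝓝 (prod3 u₀ v₀ w₀)) := by
  have : Continuous fun z : L6P × L6P × L6P ↦ prod3 z.1 z.2.1 z.2.2 := by
    unfold prod3
    fun_prop
  have h1 : Tendsto (fun z : L6P × L6P × L6P ↦ prod3 z.1 z.2.1 z.2.2) (𝓝 (u₀, v₀, w₀))
      (𝓝 (prod3 u₀ v₀ w₀)) := this.tendsto' _ _ rfl
  have h2 : Tendsto (fun i ↦ (u i, v i, w i)) l (𝓝 (u₀, v₀, w₀)) :=
    hu.prodMk_nhds (hv.prodMk_nhds hw)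
  exact h1.comp h2

theorem wave_triple {a b c : ℝ × ℝ → ℂ} (ha : Nice a) (hb : Nice b) (hc : Nice c) :
    wave (conv a (conv b c)) = fun q ↦ wave a q * (wave b q * wave c q) := by
  have h1 := wave_conv ha.integrable (hb.conv hc).integrable
  have h2 := wave_conv hb.integrable hc.integrable
  rw [h1, h2]

theorem memLp_wave {g : ℝ × ℝ → ℂ} (hg : Nice g) : MemLp (wave g) 2 :=
  memLp_two_of_lintegral (continuous_wave hg.integrable).aestronglyMeasurable
    ((lintegral_wave_sq hg.meas hg.integrable (hg.memLp 2)).trans_lt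
      (lintegral_sq_lt_top (hg.memLp 2)))

theorem integrable_wave_conv {a b : ℝ × ℝ → ℂ} (ha : Nice a) (hb : Nice b) :
    Integrable (wave (conv a b)) := by
  rw [wave_conv ha.integrable hb.integrable]
  exact (memLp_wave ha).integrable_mul (memLp_wave hb)

namespace Par

variable (P : Par)

/-- The product of three functions of the Bourgain space. -/
def tri (f g h : L2P) : L2P := prod3 (P.W f) (P.W g) (P.W h)

theorem coeFn_tri (f g h : L2P) :
    P.tri f g h =ᵐ[volume] fun p ↦ P.W f p * (P.W g p * P.W h p) := coeFn_prod3 _ _ _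

theorem tri_toLp {f g h : ℝ × ℝ → ℂ} (hf : Nice f) (hg : Nice g) (hh : Nice h) :
    Fx (P.tri ((hf.memLp 2).toLp f) ((hg.memLp 2).toLp g) ((hh.memLp 2).toLp h)) =ᵐ[volume]
      fun p ↦ 𝓕⁻ (fun τ ↦ conv (den P.s P.Q f) (conv (den P.s P.Q g) (den P.s P.Q h)) (p.1, τ))
        p.2 := by
  have nf := nice_den P.s P.continuous_Q hf
  have ng := nice_den P.s P.continuous_Q hg
  have nh := nice_den P.s P.continuous_Q hh
  have n2 := ng.conv nh
  have n3 := nf.conv n2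
  have hi := integrable_wave_conv nf n2
  have e : P.tri ((hf.memLp 2).toLp f) ((hg.memLp 2).toLp g) ((hh.memLp 2).toLp h) =
      (memLp_wave n3).toLp _ := by
    refine Lp.ext ((P.coeFn_tri _ _ _).trans ?_)
    filter_upwards [P.W_toLp hf, P.W_toLp hg, P.W_toLp hh, (memLp_wave n3).coeFn_toLp]
      with p h1 h2 h3 h4
    rw [h1, h2, h3, h4, wave_triple nf ng nh]
  rw [e]
  exact (Fx_toLp hi (memLp_wave n3)).trans (fxFun_wave n3 hi)

/-- The square of the multiplier of the nonlinear term. -/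
def srcWt (ξ : ℝ) : ℝ≥0∞ := ENNReal.ofReal (|ξ| * wt P.s ξ) ^ 2

theorem measurable_srcWt : Measurable P.srcWt := by
  have := continuous_wt P.s
  exact ((by fun_prop : Continuous fun ξ ↦ |ξ| * wt P.s ξ).measurable.ennreal_ofReal).pow_const 2

/-- The trilinear estimate passes from nice coefficients to all of `L²`: the product is continuous
from `L⁶` to `L²`, and the unbounded weight is handled by Fatou. -/
theorem exists_lintegral_Fx_tri_le : ∃ C : ℝ≥0, ∀ f g h : L2P,
    ∫⁻ p : ℝ × ℝ, P.srcWt p.1 * ‖Fx (P.tri f g h) p‖ₑ ^ 2 ≤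
      C * (‖f‖ₑ * (‖g‖ₑ * ‖h‖ₑ)) ^ 2 := by
  obtain ⟨C, hC⟩ := exists_lintegral_conv_den_le P.hA P.B P.hs
  refine ⟨C, fun f g h ↦ ?_⟩
  obtain ⟨f', hf, lf⟩ := exists_nice_seq (p := 2) (by norm_num) f
  obtain ⟨g', hg, lg⟩ := exists_nice_seq (p := 2) (by norm_num) g
  obtain ⟨h', hh, lh⟩ := exists_nice_seq (p := 2) (by norm_num) h
  have l1 := ((Fx.continuous.tendsto _).comp (tendsto_prod3 ((P.W.continuous.tendsto _).comp lf)
    ((P.W.continuous.tendsto _).comp lg) ((P.W.continuous.tendsto _).comp lh)))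
  have l2 : Tendsto (fun n ↦ (C : ℝ≥0∞) * (‖((hf n).memLp 2).toLp (f' n)‖ₑ *
      (‖((hg n).memLp 2).toLp (g' n)‖ₑ * ‖((hh n).memLp 2).toLp (h' n)‖ₑ)) ^ 2) atTop
      (𝓝 (C * (‖f‖ₑ * (‖g‖ₑ * ‖h‖ₑ)) ^ 2)) := by
    refine ENNReal.Tendsto.const_mul ?_ (Or.inr (by simp))
    refine ((ENNReal.continuous_pow 2).tendsto _).comp ?_
    refine ENNReal.Tendsto.mul lf.enorm (Or.inr (by finiteness)) ?_ (Or.inr (by simp))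
    exact ENNReal.Tendsto.mul lg.enorm (Or.inr (by simp)) lh.enorm (Or.inr (by simp))
  refine lintegral_weight_le_of_tendsto l1 (m := fun p ↦ P.srcWt p.1)
    (P.measurable_srcWt.comp measurable_fst) (fun p ↦ ENNReal.pow_ne_top ENNReal.ofReal_ne_top) l2 fun n ↦ ?_
  have nf := nice_den P.s P.continuous_Q (hf n)
  have ng := nice_den P.s P.continuous_Q (hg n)
  have nh := nice_den P.s P.continuous_Q (hh n)
  have n3 := nf.conv (ng.conv nh)
  calc _ = ∫⁻ p : ℝ × ℝ, P.srcWt p.1 * ‖𝓕⁻ (fun τ ↦ conv (den P.s P.Q (f' n))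
        (conv (den P.s P.Q (g' n)) (den P.s P.Q (h' n))) (p.1, τ)) p.2‖ₑ ^ 2 := by
        refine lintegral_congr_ae ?_
        filter_upwards [P.tri_toLp (hf n) (hg n) (hh n)] with p hp
        rw [← hp]
        rfl
    _ = ∫⁻ p : ℝ × ℝ, P.srcWt p.1 * ‖conv (den P.s P.Q (f' n))
        (conv (den P.s P.Q (g' n)) (den P.s P.Q (h' n))) p‖ₑ ^ 2 :=
        lintegral_fourierInv_fiber_sq n3.meas n3.integrable (n3.memLp 2) P.measurable_srcWt
    _ ≤ _ := by
        simp_rw [srcWt, ← mul_pow, Lp.enorm_toLp]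
        exact hC _ _ _ (hf n) (hg n) (hh n)

/-- The multiplier of the nonlinear term, with the linear flow factored out. -/
def srcMul (p : ℝ × ℝ) : ℂ :=
  -- The symbol of `-∂ₓ / 3`: the term `∂ₓ(u³/3)` stands on the right-hand side of the equation.
  -(2 * Real.pi * Complex.I * p.1 / 3) * wt P.s p.1 *
    Complex.exp (-(2 * Real.pi * Complex.I * P.Q p.1 * p.2))

theorem continuous_srcMul : Continuous P.srcMul := by
  have h1 := continuous_wt P.s
  have h2 := P.continuous_Q
  unfold srcMul
  fun_prop

theorem enorm_srcMul_sq (p : ℝ × ℝ) :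
    ‖P.srcMul p‖ₑ ^ 2 = ENNReal.ofReal (2 * Real.pi / 3) ^ 2 * P.srcWt p.1 := by
  rw [srcWt, ← mul_pow, ← ENNReal.ofReal_mul (by positivity), ← ofReal_norm]
  congr 2
  rw [srcMul, norm_mul, norm_mul, Complex.norm_exp]
  simp [abs_of_pos Real.pi_pos, abs_of_pos (wt_pos P.s p.1)]
  ring

theorem memLp_src (f g h : L2P) : MemLp (fun p ↦ P.srcMul p * Fx (P.tri f g h) p) 2 := by
  obtain ⟨C, hC⟩ := P.exists_lintegral_Fx_tri_le
  refine memLp_two_of_lintegral (P.continuous_srcMul.aestronglyMeasurable.fun_mul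
    (Lp.aestronglyMeasurable _)) ?_
  simp_rw [enorm_mul, mul_pow, enorm_srcMul_sq, mul_assoc]
  rw [lintegral_const_mul' _ _ (by simp)]
  exact ENNReal.mul_lt_top (by simp) ((hC f g h).trans_lt (by finiteness))

/-- The nonlinear term, with the linear flow factored out, in `L²` of frequency and time. -/
def src (f g h : L2P) : L2P := (P.memLp_src f g h).toLp _

theorem coeFn_src (f g h : L2P) :
    P.src f g h =ᵐ[volume] fun p ↦ P.srcMul p * Fx (P.tri f g h) p :=
  (P.memLp_src f g h).coeFn_toLp

theorem exists_norm_src_le : ∃ C : ℝ, 0 ≤ C ∧ ∀ f g h : L2P,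
    ‖P.src f g h‖ ≤ C * (‖f‖ * (‖g‖ * ‖h‖)) := by
  obtain ⟨C, hC⟩ := P.exists_lintegral_Fx_tri_le
  refine ⟨2 * Real.pi / 3 * √C, by positivity, fun f g h ↦ ?_⟩
  have h0 : 0 ≤ 2 * Real.pi / 3 * √C * (‖f‖ * (‖g‖ * ‖h‖)) := by positivity
  suffices h : ‖P.src f g h‖ₑ ≤ ENNReal.ofReal (2 * Real.pi / 3 * √C * (‖f‖ * (‖g‖ * ‖h‖))) by
    rwa [← ofReal_norm, ENNReal.ofReal_le_ofReal_iff h0] at h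
  refine (ENNReal.pow_right_strictMono (n := 2) (by norm_num)).le_iff_le.1 ?_
  rw [src, enorm_toLp_sq]
  simp_rw [enorm_mul, mul_pow, enorm_srcMul_sq, mul_assoc]
  rw [lintegral_const_mul' _ _ (by simp)]
  refine (mul_le_mul' le_rfl (hC f g h)).trans (le_of_eq ?_)
  rw [ENNReal.ofReal_mul (by positivity), ENNReal.ofReal_mul (by positivity),
    ENNReal.ofReal_mul (norm_nonneg _), ENNReal.ofReal_mul (norm_nonneg _), ofReal_norm, ofReal_norm, ofReal_norm]
  have hs : (ENNReal.ofReal √C) ^ 2 = C := by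
    rw [← ENNReal.ofReal_pow (Real.sqrt_nonneg _), Real.sq_sqrt C.coe_nonneg, ENNReal.ofReal_coe_nnreal]
  simp only [mul_pow, hs]

/-- The nonlinear term is local in time. -/
theorem src_sub_src_ae {f g h : L2P} {I : Set ℝ} (hI : MeasurableSet I)
    (hW : ∀ᵐ p : ℝ × ℝ, p.2 ∈ I → P.W f p - P.W g p = P.W h p) :
    ∀ᵐ p : ℝ × ℝ, p.2 ∈ I → P.src f f f p - P.src g g g p =
      (P.src h f f + P.src h f g + P.src h g g : L2P) p := by
  -- The factorisation `x³ - y³ = (x - y)(x² + xy + y²)` on the slab; the transform in `x` then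
  -- preserves vanishing on the slab.
  have h0 : ∀ᵐ p : ℝ × ℝ, p.2 ∈ I →
      (P.tri f f f - P.tri g g g - (P.tri h f f + P.tri h f g + P.tri h g g) : L2P) p = 0 := by
    filter_upwards [hW, P.coeFn_tri f f f, P.coeFn_tri g g g, P.coeFn_tri h f f, P.coeFn_tri h f g,
      P.coeFn_tri h g g, Lp.coeFn_sub (P.tri f f f - P.tri g g g)
        (P.tri h f f + P.tri h f g + P.tri h g g), Lp.coeFn_sub (P.tri f f f) (P.tri g g g),
      Lp.coeFn_add (P.tri h f f + P.tri h f g) (P.tri h g g),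
      Lp.coeFn_add (P.tri h f f) (P.tri h f g)] with p h1 h2 h3 h4 h5 h6 h7 h8 h9 h10 hp
    rw [h7, Pi.sub_apply, h8, Pi.sub_apply, h9, Pi.add_apply, h10, Pi.add_apply, h2, h3, h4, h5, h6,
      ← h1 hp]
    ring
  have h1 := Fx_eq_zero_of hI h0
  rw [map_sub, map_sub, map_add, map_add] at h1
  filter_upwards [h1, P.coeFn_src f f f, P.coeFn_src g g g, P.coeFn_src h f f, P.coeFn_src h f g,
    P.coeFn_src h g g, Lp.coeFn_sub (Fx (P.tri f f f) - Fx (P.tri g g g))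
      (Fx (P.tri h f f) + Fx (P.tri h f g) + Fx (P.tri h g g)),
    Lp.coeFn_sub (Fx (P.tri f f f)) (Fx (P.tri g g g)),
    Lp.coeFn_add (Fx (P.tri h f f) + Fx (P.tri h f g)) (Fx (P.tri h g g)),
    Lp.coeFn_add (Fx (P.tri h f f)) (Fx (P.tri h f g)),
    Lp.coeFn_add (P.src h f f + P.src h f g) (P.src h g g),
    Lp.coeFn_add (P.src h f f) (P.src h f g)] with p h1 h2 h3 h4 h5 h6 h7 h8 h9 h10 h11 h12 hp
  have h := h1 hp
  rw [h7, Pi.sub_apply, h8, Pi.sub_apply, h9, Pi.add_apply, h10, Pi.add_apply] at h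
  rw [h11, Pi.add_apply, h12, Pi.add_apply, h2, h3, h4, h5, h6, ← mul_sub, sub_eq_zero.1 h]
  ring

end Par

/-! ### Test functions -/

section Test

variable {Φ : 𝓢(SpaceTime, ℂ)}

theorem hasDerivAt_slice_fst (Φ : 𝓢(SpaceTime, ℂ)) (x t : ℝ) :
    HasDerivAt (fun x : ℝ ↦ Φ !₂[x, t]) ((∂_{dirX} Φ) !₂[x, t]) x := by
  have h1 : HasDerivAt (fun x : ℝ ↦ (!₂[x, t] : SpaceTime)) dirX x := by
    have e : (fun x : ℝ ↦ (!₂[x, t] : SpaceTime)) = fun x ↦ x • dirX + !₂[0, t] := by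
      ext x i
      fin_cases i <;> simp [dirX]
    rw [e]
    simpa using ((hasDerivAt_id x).smul_const dirX).add_const (!₂[0, t] : SpaceTime)
  rw [SchwartzMap.lineDerivOp_apply_eq_fderiv]
  exact (Φ.differentiableAt).hasFDerivAt.comp_hasDerivAt x h1

theorem hasDerivAt_slice_snd (Φ : 𝓢(SpaceTime, ℂ)) (x t : ℝ) :
    HasDerivAt (fun t : ℝ ↦ Φ !₂[x, t]) ((∂_{dirT} Φ) !₂[x, t]) t := by
  have h1 : HasDerivAt (fun t : ℝ ↦ (!₂[x, t] : SpaceTime)) dirT t := by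
    have e : (fun t : ℝ ↦ (!₂[x, t] : SpaceTime)) = fun t ↦ t • dirT + !₂[x, 0] := by
      ext t i
      fin_cases i <;> simp [dirT]
    rw [e]
    simpa using ((hasDerivAt_id t).smul_const dirT).add_const (!₂[x, 0] : SpaceTime)
  rw [SchwartzMap.lineDerivOp_apply_eq_fderiv]
  exact (Φ.differentiableAt).hasFDerivAt.comp_hasDerivAt t h1

theorem hasCompactSupport_lineDeriv (hΦ : HasCompactSupport Φ) (m : SpaceTime) :
    HasCompactSupport (∂_{m} Φ : 𝓢(SpaceTime, ℂ)) :=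
  IsCompact.of_isClosed_subset hΦ (isClosed_tsupport _) (SchwartzMap.tsupport_lineDerivOp_subset m Φ)

theorem continuous_pair : Continuous fun p : ℝ × ℝ ↦ (!₂[p.1, p.2] : SpaceTime) := by
  refine (PiLp.continuous_toLp 2 _).comp (continuous_pi fun i ↦ ?_)
  fin_cases i
  · exact continuous_fst
  · exact continuous_snd

theorem exists_support_bound (hΦ : HasCompactSupport Φ) :
    ∃ R : ℝ, 0 < R ∧ ∀ x t : ℝ, Φ !₂[x, t] ≠ 0 → |x| ≤ R ∧ |t| ≤ R := by
  obtain ⟨R, hR⟩ := (IsCompact.isBounded (s := tsupport Φ) hΦ).subset_closedBall 0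
  refine ⟨max R 1, by positivity, fun x t h ↦ ?_⟩
  have h1 : ‖(!₂[x, t] : SpaceTime)‖ ≤ R := by
    simpa using hR (subset_tsupport _ h)
  have h2 := PiLp.norm_apply_le (!₂[x, t] : SpaceTime) 0
  have h3 := PiLp.norm_apply_le (!₂[x, t] : SpaceTime) 1
  simp only [Real.norm_eq_abs] at h2 h3
  exact ⟨(h2.trans h1).trans (le_max_left _ _), (h3.trans h1).trans (le_max_left _ _)⟩

theorem exists_norm_le (Φ : 𝓢(SpaceTime, ℂ)) : ∃ C : ℝ, 0 ≤ C ∧ ∀ p, ‖Φ p‖ ≤ C := by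
  obtain ⟨C, hC⟩ := Φ.decay 0 0
  refine ⟨C, hC.1.le, fun p ↦ ?_⟩
  simpa using hC.2 p

/-- The inverse Fourier transform of a test function in the space variable. -/
def pT (Φ : 𝓢(SpaceTime, ℂ)) (p : ℝ × ℝ) : ℂ := 𝓕⁻ (fun x ↦ Φ !₂[x, p.2]) p.1

theorem continuous_slice_fst (Φ : 𝓢(SpaceTime, ℂ)) (t : ℝ) : Continuous fun x : ℝ ↦ Φ !₂[x, t] :=
  Φ.continuous.comp (continuous_pair.comp (by fun_prop : Continuous fun x : ℝ ↦ (x, t)))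

theorem integrable_slice_fst (Φ : 𝓢(SpaceTime, ℂ)) (t : ℝ) :
    Integrable fun x : ℝ ↦ Φ !₂[x, t] := (slice t Φ).integrable

theorem pT_eq_slice (Φ : 𝓢(SpaceTime, ℂ)) (ξ t : ℝ) : pT Φ (ξ, t) = (𝓕⁻ (slice t Φ)) ξ := by
  rw [SchwartzMap.fourierInv_coe]
  rfl

theorem measurable_fourierInv_fst {f : ℝ × ℝ → ℂ} (hf : Measurable f) :
    Measurable fun p : ℝ × ℝ ↦ 𝓕⁻ (fun x ↦ f (x, p.2)) p.1 := by
  have h := (stronglyMeasurable_fourier_fiber hf).measurable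
  have e : (fun p : ℝ × ℝ ↦ 𝓕⁻ (fun x ↦ f (x, p.2)) p.1) =
      (fun q : ℝ × ℝ ↦ 𝓕 (fun x ↦ f (x, q.2)) q.1) ∘ fun p : ℝ × ℝ ↦ (-p.1, p.2) :=
    funext fun p ↦ Real.fourierInv_eq_fourier_neg _ _
  rw [e]
  exact Measurable.comp (g := fun q : ℝ × ℝ ↦ 𝓕 (fun x ↦ f (x, q.2)) q.1) h (by fun_prop)

theorem measurable_pT (Φ : 𝓢(SpaceTime, ℂ)) : Measurable (pT Φ) :=
  measurable_fourierInv_fst (f := fun p : ℝ × ℝ ↦ Φ !₂[p.1, p.2])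
    (Φ.continuous.comp continuous_pair).measurable

theorem pT_dirX (Φ : 𝓢(SpaceTime, ℂ)) (p : ℝ × ℝ) :
    pT (∂_{dirX} Φ) p = -(2 * Real.pi * Complex.I * p.1) * pT Φ p := by
  have hd : deriv (fun x : ℝ ↦ Φ !₂[x, p.2]) = fun x ↦ (∂_{dirX} Φ) !₂[x, p.2] :=
    funext fun x ↦ (hasDerivAt_slice_fst Φ x p.2).deriv
  have h := Real.fourier_deriv (integrable_slice_fst Φ p.2)
    (fun x ↦ (hasDerivAt_slice_fst Φ x p.2).differentiableAt)
    (by rw [hd]; exact integrable_slice_fst _ _)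
  rw [hd] at h
  rw [pT, pT, Real.fourierInv_eq_fourier_neg, Real.fourierInv_eq_fourier_neg, h]
  simp only [smul_eq_mul, Complex.ofReal_neg]
  ring

theorem exists_norm_pT_le (hΦ : HasCompactSupport Φ) : ∃ C R : ℝ, 0 ≤ C ∧ 0 < R ∧
    ∀ p, ‖pT Φ p‖ ≤ (Icc (-R) R).indicator (fun _ ↦ C) p.2 := by
  obtain ⟨C, hC, hb⟩ := exists_norm_le Φ
  obtain ⟨R, hR, hs⟩ := exists_support_bound hΦ
  refine ⟨C * (2 * R), R, by positivity, hR, fun p ↦ ?_⟩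
  by_cases hp : p.2 ∈ Icc (-R) R
  · rw [indicator_of_mem hp]
    refine (norm_fourierInv_le _ _).trans ?_
    have : ∀ x : ℝ, ‖Φ !₂[x, p.2]‖ ≤ (Icc (-R) R).indicator (fun _ ↦ C) x := fun x ↦ by
      by_cases hx : x ∈ Icc (-R) R
      · rw [indicator_of_mem hx]; exact hb _
      · rw [indicator_of_notMem hx, norm_le_zero_iff]
        by_contra h
        exact hx (abs_le.1 (hs x p.2 h).1)
    refine (integral_mono (integrable_slice_fst Φ p.2).norm
      ((integrable_indicator_iff measurableSet_Icc).2 (integrableOn_const (by simp))) this).trans ?_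
    rw [integral_indicator measurableSet_Icc, setIntegral_const, measureReal_def, Real.volume_Icc,
      ENNReal.toReal_ofReal (by linarith), smul_eq_mul]
    linarith
  · rw [indicator_of_notMem hp, norm_le_zero_iff]
    have : ∀ x : ℝ, Φ !₂[x, p.2] = 0 := fun x ↦ by
      by_contra h
      exact hp (abs_le.1 (hs x p.2 h).2)
    simp [pT, this, Real.fourierInv_eq']

theorem exists_pow_mul_norm_pT_le (hΦ : HasCompactSupport Φ) (n : ℕ) : ∃ C : ℝ, 0 ≤ C ∧
    ∀ p, |p.1| ^ n * ‖pT Φ p‖ ≤ C := by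
  induction n generalizing Φ with
  | zero =>
    obtain ⟨C, R, hC, -, h⟩ := exists_norm_pT_le hΦ
    refine ⟨C, hC, fun p ↦ ?_⟩
    rw [pow_zero, one_mul]
    exact (h p).trans (indicator_le_self' (fun _ _ ↦ hC) _)
  | succ n ih =>
    obtain ⟨C, hC, h⟩ := ih (hasCompactSupport_lineDeriv hΦ dirX)
    refine ⟨C, hC, fun p ↦ ?_⟩
    refine le_trans ?_ (h p)
    rw [pT_dirX, norm_mul, norm_neg]
    have : |p.1| ≤ ‖(2 * Real.pi * Complex.I * p.1 : ℂ)‖ := by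
      simp only [norm_mul, Complex.norm_I, Complex.norm_real, Real.norm_eq_abs, mul_one,
        Complex.norm_ofNat, abs_of_pos Real.pi_pos]
      have := Real.pi_gt_three
      nlinarith [abs_nonneg p.1]
    rw [pow_succ, mul_assoc]
    gcongr

theorem exists_wt_mul_norm_pT_le (hΦ : HasCompactSupport Φ) (σ : ℝ) : ∃ C R : ℝ, 0 ≤ C ∧ 0 < R ∧
    ∀ p, wt σ p.1 * ‖pT Φ p‖ ≤ wt (-2) p.1 * (Icc (-R) R).indicator (fun _ ↦ C) p.2 := by
  -- With this `m` the polynomial `(1 + ξ²)^m` dominates `wt (σ + 2)`, which leaves the integrable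
  -- factor `wt (-2) = 1/(1 + ξ²)`.
  obtain ⟨m, hm⟩ := exists_nat_ge ((σ + 2) / 2)
  obtain ⟨C₁, R, hC₁, hR, h1⟩ := exists_norm_pT_le hΦ
  obtain ⟨C₂, hC₂, h2⟩ := exists_pow_mul_norm_pT_le hΦ (2 * m)
  refine ⟨2 ^ m * (C₁ + C₂), R, by positivity, hR, fun p ↦ ?_⟩
  by_cases hp : p.2 ∈ Icc (-R) R
  · have h1' := h1 p
    rw [indicator_of_mem hp] at h1' ⊢
    have h3 : wt (σ + 2) p.1 ≤ 2 ^ m * (1 + |p.1| ^ (2 * m)) := by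
      have e1 : wt (σ + 2) p.1 ≤ (1 + p.1 ^ 2) ^ m := by
        rw [wt, ← Real.rpow_natCast (1 + p.1 ^ 2)]
        exact Real.rpow_le_rpow_of_exponent_le (le_add_of_nonneg_right (sq_nonneg p.1)) hm
      refine e1.trans ?_
      rw [pow_mul, sq_abs]
      have := add_pow_le (zero_le_one) (sq_nonneg p.1) m
      rw [one_pow] at this
      refine this.trans ?_
      gcongr
      · norm_num
      · omega
    have h4 : wt σ p.1 = wt (-2) p.1 * wt (σ + 2) p.1 := by rw [wt_mul]; ring_nf
    rw [h4, mul_assoc]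
    refine mul_le_mul_of_nonneg_left ?_ (wt_pos _ _).le
    calc wt (σ + 2) p.1 * ‖pT Φ p‖ ≤ 2 ^ m * (1 + |p.1| ^ (2 * m)) * ‖pT Φ p‖ := by gcongr
      _ = 2 ^ m * (‖pT Φ p‖ + |p.1| ^ (2 * m) * ‖pT Φ p‖) := by ring
      _ ≤ _ := by
        have := h2 p
        gcongr
  · have h1' := h1 p
    rw [indicator_of_notMem hp] at h1' ⊢
    rw [norm_le_zero_iff.1 h1', norm_zero, mul_zero, mul_zero]

/-- The transform of a test function with a Sobolev weight. -/
def wpT (σ : ℝ) (Φ : 𝓢(SpaceTime, ℂ)) (p : ℝ × ℝ) : ℂ := wt σ p.1 * pT Φ p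

theorem measurable_wpT (σ : ℝ) (Φ : 𝓢(SpaceTime, ℂ)) : Measurable (wpT σ Φ) := by
  have := continuous_wt σ
  exact (by fun_prop : Continuous fun p : ℝ × ℝ ↦ (wt σ p.1 : ℂ)).measurable.mul (measurable_pT Φ)

theorem integrable_wt_neg_two : Integrable (wt (-2)) := by
  refine integrable_inv_one_add_sq.congr (Eventually.of_forall fun x ↦ ?_)
  rw [wt, show (-2 / 2 : ℝ) = -1 by norm_num, Real.rpow_neg_one]

theorem integrable_wpT (hΦ : HasCompactSupport Φ) (σ : ℝ) : Integrable (wpT σ Φ) := by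
  obtain ⟨C, R, hC, hR, h⟩ := exists_wt_mul_norm_pT_le hΦ σ
  have h1 : Integrable fun p : ℝ × ℝ ↦ wt (-2) p.1 * (Icc (-R) R).indicator (fun _ ↦ C) p.2 :=
    Integrable.mul_prod integrable_wt_neg_two (g := (Icc (-R) R).indicator (fun _ ↦ C))
      ((integrable_indicator_iff measurableSet_Icc).2 (integrableOn_const (by simp)))
  refine h1.mono' (measurable_wpT σ Φ).aestronglyMeasurable (Eventually.of_forall fun p ↦ ?_)
  rw [wpT, norm_mul, Complex.norm_real, Real.norm_of_nonneg (wt_pos _ _).le]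
  exact h p

theorem exists_norm_wpT_le (hΦ : HasCompactSupport Φ) (σ : ℝ) :
    ∃ C : ℝ, ∀ p, ‖wpT σ Φ p‖ ≤ C := by
  obtain ⟨C, R, hC, hR, h⟩ := exists_wt_mul_norm_pT_le hΦ σ
  refine ⟨C, fun p ↦ ?_⟩
  rw [wpT, norm_mul, Complex.norm_real, Real.norm_of_nonneg (wt_pos _ _).le]
  refine (h p).trans ?_
  calc _ ≤ 1 * C := mul_le_mul (wt_le_one (by norm_num) _)
        (indicator_le_self' (fun _ _ ↦ hC) _) (indicator_nonneg (fun _ _ ↦ hC) _) zero_le_one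
    _ = C := one_mul C

theorem memLp_wpT (hΦ : HasCompactSupport Φ) (σ : ℝ) : MemLp (wpT σ Φ) 2 := by
  obtain ⟨C, h⟩ := exists_norm_wpT_le hΦ σ
  have h1 := integrable_wpT hΦ σ
  refine (memLp_two_iff_integrable_sq_norm h1.1).2 ?_
  refine (h1.norm.const_mul C).mono' (h1.1.norm.pow 2) (Eventually.of_forall fun p ↦ ?_)
  rw [norm_pow, norm_norm, sq]
  exact mul_le_mul_of_nonneg_right (h p) (norm_nonneg _)

end Test

/-! ### Pairings with test functions -/

theorem measurePreserving_pair :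
    MeasurePreserving (fun p : ℝ × ℝ ↦ (!₂[p.1, p.2] : SpaceTime)) volume volume := by
  have h := (PiLp.volume_preserving_toLp (Fin 2)).comp
    (volume_preserving_finTwoArrow ℝ).symm
  exact h

theorem integral_plane {F : ℝ × ℝ → ℂ} (hF : Integrable F) :
    ∫ p, F p = ∫ ξ, ∫ t, F (ξ, t) := by
  rw [Measure.volume_eq_prod] at hF ⊢
  exact integral_prod _ hF

theorem integral_plane_symm {F : ℝ × ℝ → ℂ} (hF : Integrable F) :
    ∫ p, F p = ∫ t, ∫ ξ, F (ξ, t) := by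
  rw [Measure.volume_eq_prod] at hF ⊢
  exact integral_prod_symm _ hF

/-- The identification of the plane with the product of two lines. -/
def pairEquiv : ℝ × ℝ ≃ᵐ SpaceTime :=
  MeasurableEquiv.finTwoArrow.symm.trans (MeasurableEquiv.toLp 2 (Fin 2 → ℝ))

theorem pairEquiv_apply (p : ℝ × ℝ) : pairEquiv p = !₂[p.1, p.2] := rfl

theorem measurePreserving_pairEquiv : MeasurePreserving pairEquiv volume volume :=
  measurePreserving_pair

theorem pairEquiv_symm_apply (η : SpaceTime) : pairEquiv.symm η = (η 0, η 1) := rfl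

theorem integral_spaceTime (F : SpaceTime → ℂ) : ∫ η, F η = ∫ p : ℝ × ℝ, F !₂[p.1, p.2] :=
  (measurePreserving_pairEquiv.integral_comp pairEquiv.measurableEmbedding F).symm

theorem lintegral_spaceTime (F : SpaceTime → ℝ≥0∞) :
    ∫⁻ η, F η = ∫⁻ p : ℝ × ℝ, F !₂[p.1, p.2] :=
  (measurePreserving_pairEquiv.lintegral_comp_emb pairEquiv.measurableEmbedding F).symm

/-- A test function in product coordinates. -/
def tst (Φ : 𝓢(SpaceTime, ℂ)) (p : ℝ × ℝ) : ℂ := Φ !₂[p.1, p.2]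

theorem continuous_tst (Φ : 𝓢(SpaceTime, ℂ)) : Continuous (tst Φ) :=
  Φ.continuous.comp continuous_pair

theorem nice_tst {Φ : 𝓢(SpaceTime, ℂ)} (hΦ : HasCompactSupport Φ) : Nice (tst Φ) := by
  obtain ⟨C, -, hC⟩ := exists_norm_le Φ
  obtain ⟨R, -, hR⟩ := exists_support_bound hΦ
  refine ⟨(continuous_tst Φ).measurable, ⟨C, fun p ↦ hC _⟩, R, fun p hp ↦ ?_⟩
  by_contra h
  have := hR p.1 p.2 h
  rw [Prod.norm_def, lt_max_iff, Real.norm_eq_abs, Real.norm_eq_abs] at hp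
  rcases hp with hp | hp <;> linarith [this.1, this.2]

instance : ENNReal.HolderTriple 6 (6 / 5) 1 := ⟨by
  rw [← ENNReal.toReal_eq_toReal_iff' (by simp) (by simp), ENNReal.toReal_add (by simp) (by simp)]
  simp; norm_num⟩

instance : Fact ((1 : ℝ≥0∞) ≤ 6 / 5) :=
  ⟨(ENNReal.le_div_iff_mul_le (by simp) (by simp)).2 (by norm_num)⟩

theorem integral_wave_mul (P : Par) {g : ℝ × ℝ → ℂ} (hg : Nice g) {Φ : 𝓢(SpaceTime, ℂ)}
    (hΦ : HasCompactSupport Φ) :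
    ∫ p, wave (den P.s P.Q g) p * tst Φ p = ∫ p, kf P g p * wpT (-P.s) Φ p := by
  have nd := nice_den P.s P.continuous_Q hg
  have hden : ∀ ξ t, 𝓕⁻ (fun τ ↦ den P.s P.Q g (ξ, τ)) t = wt (-P.s) ξ * kf P g (ξ, t) := by
    intro ξ t
    rw [kf, Real.fourierInv_eq', Real.fourierInv_eq', ← integral_const_mul]
    congr 1 with τ
    simp only [den, smul_eq_mul]
    push_cast
    ring
  have i1 : Integrable fun p ↦ wave (den P.s P.Q g) p * tst Φ p :=
    (memLp_wave nd).integrable_mul ((nice_tst hΦ).memLp 2)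
  have i2 : Integrable fun p ↦ kf P g p * wpT (-P.s) Φ p :=
    (memLp_kf P hg.meas (hg.memLp 2)).integrable_mul (memLp_wpT hΦ _)
  rw [integral_plane_symm i1, integral_plane_symm i2]
  congr 1 with t
  have h := integral_fourierInv_mul_eq (integrable_fourierInv_fiber nd.meas nd.integrable t)
    (integrable_slice_fst Φ t)
  calc _ = ∫ x, 𝓕⁻ (fun ξ ↦ 𝓕⁻ (fun τ ↦ den P.s P.Q g (ξ, τ)) t) x * Φ !₂[x, t] := by
        congr 1 with x
        rw [wave_eq nd.integrable]
        rfl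
    _ = _ := by
        rw [h]
        congr 1 with ξ
        rw [hden, wpT, pT]
        ring

theorem Par.K_toLp (P : Par) {g : ℝ × ℝ → ℂ} (hg : MemLp g 2) :
    P.K (hg.toLp g) =ᵐ[volume] kf P g := by
  refine (P.coeFn_K _).trans (ae_of_ae_fst ?_)
  exact kf_congr P hg.coeFn_toLp

/-- The function with given coefficients, tested in the space variables or in frequency. -/
theorem Par.integral_W_mul (P : Par) (f : L2P) {Φ : 𝓢(SpaceTime, ℂ)} (hΦ : HasCompactSupport Φ) :
    ∫ p, P.W f p * tst Φ p = ∫ p, P.K f p * wpT (-P.s) Φ p := by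
  obtain ⟨g, hg, hlim⟩ := exists_nice_seq (p := 2) (by norm_num) f
  rw [← pairL_toLp (p := 6) (P.W f) ((nice_tst hΦ).memLp (6 / 5)),
    ← pairL_toLp (p := 2) (P.K f) (memLp_wpT hΦ _)]
  have c1 : Continuous fun f : L2P ↦
      pairL 6 (6 / 5) volume (P.W f) (((nice_tst hΦ).memLp (6 / 5)).toLp _) := by fun_prop
  have c2 : Continuous fun f : L2P ↦
      pairL 2 2 volume (P.K f) ((memLp_wpT hΦ (-P.s)).toLp _) := by fun_prop
  refine tendsto_nhds_unique ((c1.tendsto _).comp hlim)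
    (((c2.tendsto _).comp hlim).congr fun n ↦ ?_)
  simp only [Function.comp_apply]
  rw [pairL_toLp, pairL_toLp]
  have e1 : ∫ p, P.W (((hg n).memLp 2).toLp (g n)) p * tst Φ p =
      ∫ p, wave (den P.s P.Q (g n)) p * tst Φ p := by
    refine integral_congr_ae ?_
    filter_upwards [P.W_toLp (hg n)] with p hp
    rw [hp]
  have e2 : ∫ p, P.K (((hg n).memLp 2).toLp (g n)) p * wpT (-P.s) Φ p =
      ∫ p, kf P (g n) p * wpT (-P.s) Φ p := by
    refine integral_congr_ae ?_
    filter_upwards [P.K_toLp ((hg n).memLp 2)] with p hp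
    rw [hp]
  rw [e1, e2, integral_wave_mul P (hg n) hΦ]

/-! ### Sobolev distributions -/

theorem hasTemperateGrowth_wt (σ : ℝ) : (fun x : ℝ ↦ (wt σ x : ℂ)).HasTemperateGrowth := by
  have : (fun x : ℝ ↦ (wt σ x : ℂ)) = fun x : ℝ ↦ (((1 + ‖x‖ ^ 2) ^ (σ / 2) : ℝ) : ℂ) := by
    ext x
    rw [wt, Real.norm_eq_abs, sq_abs]
  rw [this]
  fun_prop

/-- The distribution with the Fourier transform `(1 + ξ²)^{-σ/2} A`. -/
def dst (σ : ℝ) : L2R →ₗ[ℂ] 𝓢'(ℝ, ℂ) where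
  toFun A := TemperedDistribution.besselPotential ℝ ℂ (-σ) (𝓕⁻ (A : 𝓢'(ℝ, ℂ)))
  map_add' A B := by
    rw [← Lp.toTemperedDistributionCLM_apply, map_add, FourierTransform.fourierInv_add, map_add]
    rfl
  map_smul' c A := by
    rw [← Lp.toTemperedDistributionCLM_apply, map_smul, FourierTransform.fourierInv_smul, map_smul]
    rfl

theorem dst_apply (σ : ℝ) (A : L2R) (φ : 𝓢(ℝ, ℂ)) :
    dst σ A φ = ∫ ξ, A ξ * (wt (-σ) ξ * (𝓕⁻ φ) ξ) := by
  change TemperedDistribution.besselPotential ℝ ℂ (-σ) (𝓕⁻ (A : 𝓢'(ℝ, ℂ))) φ = _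
  rw [TemperedDistribution.besselPotential, TemperedDistribution.fourierMultiplierCLM_apply_apply,
    TemperedDistribution.fourierInv_apply, FourierTransform.fourierInv_fourier_eq,
    Lp.toTemperedDistribution_apply]
  have e : (fun x : ℝ ↦ (((1 + ‖x‖ ^ 2) ^ (-σ / 2) : ℝ) : ℂ)) = fun x : ℝ ↦ (wt (-σ) x : ℂ) := by
    ext x
    rw [wt, Real.norm_eq_abs, sq_abs]
  congr 1 with ξ
  rw [e, SchwartzMap.smulLeftCLM_apply_apply (hasTemperateGrowth_wt _)]
  simp only [smul_eq_mul]
  ring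

theorem besselPotential_dst (σ : ℝ) (A : L2R) :
    TemperedDistribution.besselPotential ℝ ℂ σ (dst σ A) = ((𝓕⁻ A : L2R) : 𝓢'(ℝ, ℂ)) := by
  change TemperedDistribution.besselPotential ℝ ℂ σ
    (TemperedDistribution.besselPotential ℝ ℂ (-σ) (𝓕⁻ (A : 𝓢'(ℝ, ℂ)))) = _
  rw [TemperedDistribution.besselPotential_besselPotential_apply, neg_add_cancel,
    TemperedDistribution.besselPotential_zero, ContinuousLinearMap.id_apply,
    Lp.fourierInv_toTemperedDistribution_eq]

theorem toTemperedDistribution_injective {f g : L2R} (h : (f : 𝓢'(ℝ, ℂ)) = g) : f = g := by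
  have h1 := Lp.ker_toTemperedDistributionCLM_eq_bot (F := ℂ) (μ := (volume : Measure ℝ)) (p := 2)
  exact LinearMap.ker_eq_bot.1 h1 h

/-- The function in the definition of `hsNorm` is unique, because `L²` embeds injectively into the
tempered distributions; here it is the inverse transform of `A`, and Plancherel gives its norm. -/
theorem hsNorm_dst (σ : ℝ) (A : L2R) : hsNorm σ (dst σ A) = ‖A‖ₑ := by
  have hn : ‖(𝓕⁻ A : L2R)‖ₑ = ‖A‖ₑ := by
    rw [← ofReal_norm, ← ofReal_norm, ← Lp.norm_fourier_eq,
      FourierTransform.fourier_fourierInv_eq]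
  refine le_antisymm ?_ ?_
  · refine (iInf₂_le (𝓕⁻ A : L2R) (besselPotential_dst σ A)).trans hn.le
  · refine le_iInf₂ fun g hg ↦ ?_
    rw [besselPotential_dst] at hg
    rw [← toTemperedDistribution_injective hg, hn]

theorem exists_dst {σ : ℝ} {f : 𝓢'(ℝ, ℂ)} (hf : TemperedDistribution.MemSobolev σ 2 f) :
    ∃ A : L2R, dst σ A = f := by
  obtain ⟨g, hg⟩ := hf
  refine ⟨𝓕 g, ?_⟩
  change TemperedDistribution.besselPotential ℝ ℂ (-σ) (𝓕⁻ (((𝓕 g : L2R)) : 𝓢'(ℝ, ℂ))) = f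
  rw [Lp.fourierInv_toTemperedDistribution_eq, FourierTransform.fourierInv_fourier_eq,
    TemperedDistribution.besselPotential_neg_apply_eq_iff, hg]

theorem dst_injective (σ : ℝ) : Function.Injective (dst σ) := by
  refine (injective_iff_map_eq_zero _).2 fun A hA ↦ ?_
  have h := hsNorm_dst σ A
  rw [hA, ← map_zero (dst σ), hsNorm_dst, enorm_zero] at h
  simpa using h.symm

theorem memSobolev_dst (σ : ℝ) (A : L2R) : TemperedDistribution.MemSobolev σ 2 (dst σ A) :=
  ⟨_, besselPotential_dst σ A⟩

/-! ### The curves -/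

theorem integral_K_mul (P : Par) (f : L2P) {Φ : 𝓢(SpaceTime, ℂ)} (hΦ : HasCompactSupport Φ) :
    ∫ p, P.K f p * wpT (-P.s) Φ p = ∫ t, dst P.s (P.at_ t f) (slice t Φ) := by
  have i : Integrable fun p ↦ P.K f p * wpT (-P.s) Φ p :=
    (Lp.memLp _).integrable_mul (memLp_wpT hΦ _)
  have e : ∫ p, P.K f p * wpT (-P.s) Φ p = ∫ p, kf P f p * wpT (-P.s) Φ p := by
    refine integral_congr_ae ?_
    filter_upwards [P.coeFn_K f] with p hp
    rw [hp]
  have i2 : Integrable fun p ↦ kf P f p * wpT (-P.s) Φ p := by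
    refine i.congr ?_
    filter_upwards [P.coeFn_K f] with p hp
    rw [hp]
  rw [e, integral_plane_symm i2]
  congr 1 with t
  rw [dst_apply]
  refine integral_congr_ae ?_
  filter_upwards [P.coeFn_at t f] with ξ h
  rw [h, wpT, pT_eq_slice]

theorem slice_eq_zero {T : ℝ} {Φ : 𝓢(SpaceTime, ℂ)} (hΦ : IsTest T Φ) {t : ℝ}
    (ht : t ∉ Ioo 0 T) : slice t Φ = 0 := by
  ext x
  rw [slice_apply]
  by_contra h
  have := hΦ.2 (subset_tsupport _ h)
  exact ht this

theorem curvePairing_eq {T : ℝ} {Φ : 𝓢(SpaceTime, ℂ)} (hΦ : IsTest T Φ) (u : ℝ → 𝓢'(ℝ, ℂ)) :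
    curvePairing T u Φ = ∫ t, u t (slice t Φ) := by
  refine setIntegral_eq_integral_of_forall_compl_eq_zero fun t ht ↦ ?_
  rw [slice_eq_zero hΦ ht, map_zero]

theorem curvePairing_congr {T : ℝ} {u v : ℝ → 𝓢'(ℝ, ℂ)} (h : EqOn u v (Ioo 0 T))
    (Φ : 𝓢(SpaceTime, ℂ)) : curvePairing T u Φ = curvePairing T v Φ := by
  refine setIntegral_congr_fun measurableSet_Ioo fun t ht ↦ ?_
  rw [h ht]

/-! ### Density of the test functions -/

section Density

variable {E : Type*} [NormedAddCommGroup E] [InnerProductSpace ℝ E] [FiniteDimensional ℝ E]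

/-- The truncation of a Schwartz function to a ball. -/
theorem exists_truncation (φ : 𝓢(E, ℂ)) (k l : ℕ) : ∃ M : ℝ, 0 ≤ M ∧ ∀ a : ℝ, 0 < a → a ≤ 1 →
    ∀ x, ‖x‖ ^ k * ‖iteratedFDeriv ℝ l
      (fun y ↦ (1 - (⟨1, 2, by norm_num, by norm_num⟩ : ContDiffBump (0 : E)) (a • y)) • φ y) x‖
        ≤ a * M := by
  set χ : ContDiffBump (0 : E) := ⟨1, 2, by norm_num, by norm_num⟩ with hχ
  have hb : ∀ i : ℕ, ∃ C, ∀ x, ‖iteratedFDeriv ℝ i χ x‖ ≤ C := fun i ↦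
    (χ.hasCompactSupport.iteratedFDeriv i).exists_bound_of_continuous
      ((χ.contDiff (n := i)).continuous_iteratedFDeriv le_rfl)
  choose C hC using hb
  have hC0 : ∀ i, 0 ≤ C i := fun i ↦ (norm_nonneg _).trans (hC i 0)
  refine ⟨∑ i ∈ Finset.range (l + 1), (l.choose i : ℝ) *
    (C i * SchwartzMap.seminorm ℝ k (l - i) φ + SchwartzMap.seminorm ℝ (k + 1) (l - i) φ),
    Finset.sum_nonneg fun i _ ↦ mul_nonneg (by positivity) (add_nonneg
      (mul_nonneg (hC0 i) (apply_nonneg _ _)) (apply_nonneg _ _)), fun a ha ha1 x ↦ ?_⟩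
  have hm : ContDiff ℝ l fun y : E ↦ 1 - χ (a • y) :=
    contDiff_const.sub (χ.contDiff.comp (contDiff_id.const_smul a))
  have hφ : ContDiff ℝ l φ := φ.smooth l
  refine (mul_le_mul_of_nonneg_left (norm_iteratedFDeriv_smul_le hm hφ x le_rfl)
    (by positivity)).trans ?_
  rw [Finset.mul_sum, Finset.mul_sum]
  refine Finset.sum_le_sum fun i hi ↦ ?_
  have h1 := φ.le_seminorm ℝ k (l - i) x
  have h2 := φ.le_seminorm ℝ (k + 1) (l - i) x
  -- Where `1 - χ(a·)` does not vanish, `a‖x‖` exceeds `1`; its derivatives of order `i ≥ 1` carry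
  -- `aⁱ ≤ a`. So a factor `a` is gained at the price of one more power of `‖x‖`.
  have key : ‖iteratedFDeriv ℝ i (fun y : E ↦ 1 - χ (a • y)) x‖ ≤ a * (C i + ‖x‖) := by
    rcases Nat.eq_zero_or_pos i with rfl | hi0
    · rw [norm_iteratedFDeriv_zero]
      by_cases hx : ‖a • x‖ ≤ 1
      · rw [χ.one_of_mem_closedBall (by simpa [hχ] using hx), sub_self, norm_zero]
        have := hC0 0
        positivity
      · rw [Real.norm_of_nonneg (sub_nonneg.2 χ.le_one)]
        rw [norm_smul, Real.norm_of_nonneg ha.le] at hx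
        have := χ.nonneg (x := a • x)
        have := mul_nonneg ha.le (hC0 0)
        nlinarith
    · have e : iteratedFDeriv ℝ i (fun y : E ↦ 1 - χ (a • y)) x =
          -iteratedFDeriv ℝ i (fun y : E ↦ χ (a • y)) x := by
        have := iteratedFDeriv_sub_apply (𝕜 := ℝ) (i := i) (f := fun _ : E ↦ (1 : ℝ))
          (g := fun y : E ↦ χ (a • y)) (x := x) contDiff_const.contDiffAt
          (χ.contDiff.comp (contDiff_id.const_smul a)).contDiffAt
        rw [iteratedFDeriv_const_of_ne hi0.ne'] at this
        simpa [Pi.sub_def] using this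
      rw [e, norm_neg, iteratedFDeriv_comp_const_smul a χ.contDiff, norm_smul, norm_pow,
        Real.norm_of_nonneg ha.le]
      have h3 : a ^ i ≤ a := pow_le_of_le_one ha.le ha1 hi0.ne'
      calc a ^ i * ‖iteratedFDeriv ℝ i χ (a • x)‖ ≤ a * C i :=
            mul_le_mul h3 (hC i _) (norm_nonneg _) ha.le
        _ ≤ _ := by gcongr; linarith [norm_nonneg x]
  set D := ‖iteratedFDeriv ℝ (l - i) φ x‖
  calc ‖x‖ ^ k * (l.choose i * ‖iteratedFDeriv ℝ i (fun y : E ↦ 1 - χ (a • y)) x‖ * D)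
      ≤ ‖x‖ ^ k * (l.choose i * (a * (C i + ‖x‖)) * D) := by gcongr
    _ = l.choose i * (a * (C i * (‖x‖ ^ k * D) + ‖x‖ ^ (k + 1) * D)) := by ring
    _ ≤ l.choose i * (a * (C i * SchwartzMap.seminorm ℝ k (l - i) φ +
        SchwartzMap.seminorm ℝ (k + 1) (l - i) φ)) := by
        have := hC0 i
        gcongr
    _ = _ := by ring

theorem exists_test_tendsto (φ : 𝓢(E, ℂ)) : ∃ ψ : ℕ → 𝓢(E, ℂ),
    (∀ n, HasCompactSupport (ψ n)) ∧ Tendsto ψ atTop (𝓝 φ) := by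
  set χ : ContDiffBump (0 : E) := ⟨1, 2, by norm_num, by norm_num⟩ with hχ
  set a : ℕ → ℝ := fun n ↦ 1 / ((n : ℝ) + 1) with ha
  have ha0 : ∀ n, 0 < a n := fun n ↦ by simp only [ha]; positivity
  have ha1 : ∀ n, a n ≤ 1 := fun n ↦ by
    simp only [ha]
    rw [div_le_one (by positivity)]
    linarith [(Nat.cast_nonneg n : (0 : ℝ) ≤ n)]
  have hs : ∀ n, HasCompactSupport fun y ↦ χ (a n • y) • φ y := fun n ↦
    (χ.hasCompactSupport.comp_homeomorph (Homeomorph.smulOfNeZero (a n) (ha0 n).ne')).smul_right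
  have hd : ∀ n, ContDiff ℝ ((⊤ : ℕ∞) : WithTop ℕ∞) fun y ↦ χ (a n • y) • φ y := fun n ↦
    (χ.contDiff.comp (contDiff_id.const_smul (a n))).smul (φ.smooth _)
  refine ⟨fun n ↦ (hs n).toSchwartzMap (hd n), fun n ↦ hs n, ?_⟩
  rw [(schwartz_withSeminorms ℝ E ℂ).tendsto_nhds]
  rintro ⟨k, l⟩ ε hε
  obtain ⟨M, hM, h⟩ := exists_truncation φ k l
  have ht : Tendsto (fun n ↦ a n * M) atTop (𝓝 0) := by
    rw [← zero_mul M]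
    exact (tendsto_one_div_add_atTop_nhds_zero_nat (𝕜 := ℝ)).mul_const M
  filter_upwards [ht.eventually (gt_mem_nhds hε)] with n hn
  refine lt_of_le_of_lt ?_ hn
  refine SchwartzMap.seminorm_le_bound ℝ k l _ (mul_nonneg (ha0 n).le hM) fun x ↦ ?_
  refine le_trans (le_of_eq ?_) (h (a n) (ha0 n) (ha1 n) x)
  have e : (((hs n).toSchwartzMap (hd n) - φ : 𝓢(E, ℂ)) : E → ℂ) =
      -fun y ↦ (1 - χ (a n • y)) • φ y := by
    ext y
    simp only [sub_apply, Pi.neg_apply, sub_smul, one_smul, neg_sub]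
    rfl
  rw [e, iteratedFDeriv_neg_apply, norm_neg]

/-- A tempered distribution is determined by the test functions. -/
theorem tempered_ext {U V : 𝓢'(E, ℂ)} (h : ∀ φ : 𝓢(E, ℂ), HasCompactSupport φ → U φ = V φ) :
    U = V := by
  ext φ
  obtain ⟨ψ, hψ, hlim⟩ := exists_test_tendsto φ
  have h1 := ((map_continuous U).tendsto φ).comp hlim
  have h2 := ((map_continuous V).tendsto φ).comp hlim
  refine tendsto_nhds_unique h1 (h2.congr fun n ↦ ?_)
  exact (h _ (hψ n)).symm

end Density

/-! ### Bourgain distributions -/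

theorem hasTemperateGrowth_wt_fst (σ : ℝ) :
    (fun η : SpaceTime ↦ (wt σ (η 0) : ℂ)).HasTemperateGrowth :=
  (hasTemperateGrowth_wt σ).comp
    (EuclideanSpace.proj 0 : SpaceTime →L[ℝ] ℝ).hasTemperateGrowth

theorem fourierInv_eq_wave (Φ : 𝓢(SpaceTime, ℂ)) (p : ℝ × ℝ) :
    (𝓕⁻ Φ) !₂[p.1, p.2] = wave (tst Φ) p := by
  rw [SchwartzMap.fourierInv_coe, Real.fourierInv_eq', integral_spaceTime, wave]
  congr 1 with q
  rw [expChar, smul_eq_mul]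
  congr 4
  simp [PiLp.inner_apply, Fin.sum_univ_two, mul_comm]

theorem integrable_pT_snd {Φ : 𝓢(SpaceTime, ℂ)} (hΦ : HasCompactSupport Φ) (ξ : ℝ) :
    Integrable fun t ↦ pT Φ (ξ, t) := by
  obtain ⟨C, R, hC, hR, h⟩ := exists_norm_pT_le hΦ
  have h1 : Integrable ((Icc (-R) R).indicator fun _ ↦ C) :=
    (integrable_indicator_iff measurableSet_Icc).2 (integrableOn_const (by simp))
  exact h1.mono' ((measurable_pT Φ).comp measurable_prodMk_left).aestronglyMeasurable
    (Eventually.of_forall fun t ↦ h (ξ, t))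

theorem wave_tst_eq {Φ : 𝓢(SpaceTime, ℂ)} (hΦ : HasCompactSupport Φ) (ξ τ : ℝ) :
    wave (tst Φ) (ξ, τ) = 𝓕⁻ (fun t ↦ pT Φ (ξ, t)) τ := by
  rw [wave, integral_plane_symm (integrable_expChar_mul (nice_tst hΦ).integrable (ξ, τ)),
    Real.fourierInv_eq']
  congr 1 with t
  rw [pT, Real.fourierInv_eq', ← integral_smul]
  congr 1 with x
  rw [expChar, tst, smul_smul, ← Complex.exp_add, smul_eq_mul]
  congr 2
  simp only [RCLike.inner_apply, conj_trivial]
  push_cast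
  ring

theorem memLp_comp_coord {F : ℝ × ℝ → ℂ} (hF : MemLp F 2) :
    MemLp (fun η : SpaceTime ↦ F (η 0, η 1)) 2 :=
  hF.comp_measurePreserving (MeasurePreserving.symm pairEquiv measurePreserving_pairEquiv)

namespace Par

variable (P : Par)

theorem measurable_md_Q : Measurable fun p : ℝ × ℝ ↦ (md (p.2 - P.Q p.1) : ℂ) := by
  have h1 := continuous_md
  have h2 := P.continuous_Q
  exact (by fun_prop : Continuous fun p : ℝ × ℝ ↦ (md (p.2 - P.Q p.1) : ℂ)).measurable

theorem memLp_md_coe (f : L2P) : MemLp (fun p : ℝ × ℝ ↦ (md (p.2 - P.Q p.1) : ℂ) * f p) 2 :=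
  memLp_bdd_mul P.measurable_md_Q (C := 1) (fun p ↦ by
    rw [Complex.norm_real, Real.norm_of_nonneg (md_pos _).le]
    exact md_le_one _) (Lp.memLp f)

theorem memLp_md_spaceTime (f : L2P) :
    MemLp (fun η : SpaceTime ↦ (md (η 1 - P.Q (η 0)) : ℂ) * f (η 0, η 1)) 2 :=
  memLp_comp_coord (F := fun p : ℝ × ℝ ↦ (md (p.2 - P.Q p.1) : ℂ) * f p) (P.memLp_md_coe f)

/-- The Fourier transform of the distribution with given coefficients. -/
def bspHat (f : L2P) : 𝓢'(SpaceTime, ℂ) :=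
  TemperedDistribution.smulLeftCLM ℂ (fun η : SpaceTime ↦ (wt (-P.s) (η 0) : ℂ))
    (((P.memLp_md_spaceTime f).toLp _ : Lp ℂ 2 (volume : Measure SpaceTime)) : 𝓢'(SpaceTime, ℂ))

/-- The distribution with given coefficients. -/
def bsp (f : L2P) : 𝓢'(SpaceTime, ℂ) := 𝓕⁻ (P.bspHat f)

theorem bspHat_apply (f : L2P) (φ : 𝓢(SpaceTime, ℂ)) :
    P.bspHat f φ = ∫ η : SpaceTime, den P.s P.Q f (η 0, η 1) * φ η := by
  rw [bspHat, TemperedDistribution.smulLeftCLM_apply_apply, Lp.toTemperedDistribution_apply]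
  refine integral_congr_ae ?_
  filter_upwards [(P.memLp_md_spaceTime f).coeFn_toLp] with η h
  rw [h, SchwartzMap.smulLeftCLM_apply_apply (hasTemperateGrowth_wt_fst _), den]
  simp only [smul_eq_mul]
  push_cast
  ring

theorem locallyIntegrable_den (f : L2P) :
    LocallyIntegrable fun η : SpaceTime ↦ den P.s P.Q f (η 0, η 1) := by
  have h1 := (P.memLp_md_spaceTime f).locallyIntegrable (by norm_num)
  have h2 := continuous_wt (-P.s)
  have h3 : Continuous fun η : SpaceTime ↦ (wt (-P.s) (η 0) : ℂ) := by fun_prop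
  rw [← locallyIntegrableOn_univ] at h1 ⊢
  refine (h1.continuousOn_mul h3.continuousOn isClosed_univ.isLocallyClosed).congr
    (Eventually.of_forall fun η ↦ ?_)
  simp only [den]
  push_cast
  ring

theorem hasFourierDensity_bsp (f : L2P) :
    HasFourierDensity (P.bsp f) fun η ↦ den P.s P.Q f (η 0, η 1) := by
  refine ⟨P.locallyIntegrable_den f, fun φ _ ↦ ?_⟩
  rw [bsp, FourierTransform.fourier_fourierInv_eq, bspHat_apply]

/-- Parseval in the time variable on almost every frequency fibre, where the density is integrable
in `τ`. -/
theorem bsp_apply (f : L2P) {Φ : 𝓢(SpaceTime, ℂ)} (hΦ : HasCompactSupport Φ) :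
    P.bsp f Φ = ∫ p, P.K f p * wpT (-P.s) Φ p := by
  have hF := P.memLp_md_coe f
  have e : P.bsp f Φ = ∫ p : ℝ × ℝ, (md (p.2 - P.Q p.1) : ℂ) * f p *
      (wt (-P.s) p.1 * wave (tst Φ) p) := by
    rw [bsp, TemperedDistribution.fourierInv_apply, bspHat_apply, integral_spaceTime]
    congr 1 with p
    rw [fourierInv_eq_wave, den]
    simp only [Matrix.cons_val_zero, Matrix.cons_val_one]
    push_cast
    ring
  have m2 : MemLp (fun p : ℝ × ℝ ↦ (wt (-P.s) p.1 : ℂ) * wave (tst Φ) p) 2 := by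
    have h := ((SchwartzMap.smulLeftCLM ℂ (fun η : SpaceTime ↦ (wt (-P.s) (η 0) : ℂ))
      (𝓕⁻ Φ)).memLp 2).comp_measurePreserving measurePreserving_pairEquiv
    refine h.ae_eq (Eventually.of_forall fun p ↦ ?_)
    rw [Function.comp_apply, SchwartzMap.smulLeftCLM_apply_apply (hasTemperateGrowth_wt_fst _),
      pairEquiv_apply, fourierInv_eq_wave]
    simp
  have i1 := hF.integrable_mul m2
  have i2 : Integrable fun p ↦ kf P f p * wpT (-P.s) Φ p :=
    (memLp_kf P (measurable_coe f) (Lp.memLp f)).integrable_mul (memLp_wpT hΦ _)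
  have e2 : ∫ p, P.K f p * wpT (-P.s) Φ p = ∫ p, kf P f p * wpT (-P.s) Φ p := by
    refine integral_congr_ae ?_
    filter_upwards [P.coeFn_K f] with p hp
    rw [hp]
  rw [e, e2, integral_plane i2, integral_plane (F := fun p : ℝ × ℝ ↦
    (md (p.2 - P.Q p.1) : ℂ) * f p * (wt (-P.s) p.1 * wave (tst Φ) p)) i1]
  refine integral_congr_ae ?_
  filter_upwards [ae_memLp_fiber (Lp.memLp f)] with ξ hξ
  have h := integral_fourierInv_mul_eq (integrable_pT_snd hΦ ξ) (integrable_md_mul hξ (P.Q ξ))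
  simp_rw [wave_tst_eq hΦ]
  calc _ = wt (-P.s) ξ * ∫ τ, 𝓕⁻ (fun t ↦ pT Φ (ξ, t)) τ * ((md (τ - P.Q ξ) : ℂ) * f (ξ, τ)) := by
        rw [← integral_const_mul]
        congr 1 with τ
        ring
    _ = _ := by
        rw [h, ← integral_const_mul]
        congr 1 with t
        rw [kf, wpT]
        ring

end Par

/-! ### The Bourgain norm -/

/-- The quotient of `(1 + |2πξ|)²` by `1 + ξ²` lies between `1` and `8π²`. The exponent `|s|` in the
constant covers both signs of `s`. -/
theorem exists_weight_le (s : ℝ) : ∃ c : ℝ, 0 < c ∧ ∀ ξ : ℝ,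
    (1 + |2 * Real.pi * ξ|) ^ (2 * s) ≤ c * wt s ξ ^ 2 ∧
      wt s ξ ^ 2 ≤ c * (1 + |2 * Real.pi * ξ|) ^ (2 * s) := by
  have hp := Real.pi_gt_three
  have hw : ∀ ξ, wt s ξ ^ 2 = (1 + ξ ^ 2) ^ s := fun ξ ↦ by
    rw [wt, ← Real.rpow_natCast, ← Real.rpow_mul (by positivity)]
    congr 1
    push_cast
    ring
  have hv : ∀ ξ : ℝ, (1 + |2 * Real.pi * ξ|) ^ (2 * s) = ((1 + |2 * Real.pi * ξ|) ^ 2) ^ s :=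
    fun ξ ↦ by rw [Real.rpow_mul (by positivity), Real.rpow_two]
  have h1 : ∀ ξ : ℝ, 1 + ξ ^ 2 ≤ (1 + |2 * Real.pi * ξ|) ^ 2 := fun ξ ↦ by
    rw [abs_mul, abs_of_pos (by positivity), ← sq_abs ξ]
    nlinarith [abs_nonneg ξ, sq_nonneg |ξ|, mul_nonneg (sub_nonneg.2 hp.le) (sq_nonneg |ξ|),
      mul_nonneg Real.pi_pos.le (abs_nonneg ξ), mul_nonneg (sub_nonneg.2 hp.le)
        (mul_nonneg Real.pi_pos.le (sq_nonneg |ξ|))]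
  have h2 : ∀ ξ : ℝ, (1 + |2 * Real.pi * ξ|) ^ 2 ≤ (8 * Real.pi ^ 2) * (1 + ξ ^ 2) := fun ξ ↦ by
    have e := sq_abs (2 * Real.pi * ξ)
    have : (1 + |2 * Real.pi * ξ|) ^ 2 ≤ 2 * (1 + |2 * Real.pi * ξ| ^ 2) := by
      nlinarith [sq_nonneg (1 - |2 * Real.pi * ξ|)]
    rw [e] at this
    nlinarith
  have h8 : 1 ≤ 8 * Real.pi ^ 2 := by nlinarith
  refine ⟨(8 * Real.pi ^ 2) ^ |s|, by positivity, fun ξ ↦ ?_⟩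
  have hc : 1 ≤ (8 * Real.pi ^ 2) ^ |s| := Real.one_le_rpow h8 (abs_nonneg s)
  rw [hw, hv]
  rcases le_total 0 s with hs | hs
  · constructor
    · rw [abs_of_nonneg hs, ← Real.mul_rpow (by positivity) (by positivity)]
      exact Real.rpow_le_rpow (by positivity) (h2 ξ) hs
    · exact (Real.rpow_le_rpow (by positivity) (h1 ξ) hs).trans
        (le_mul_of_one_le_left (by positivity) hc)
  · constructor
    · exact (Real.rpow_le_rpow_of_nonpos (by positivity) (h1 ξ) hs).trans
        (le_mul_of_one_le_left (by positivity) hc)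
    · have := Real.rpow_le_rpow_of_nonpos (by positivity) (h2 ξ) hs
      rw [Real.mul_rpow (by positivity) (by positivity)] at this
      rw [abs_of_nonpos hs, Real.rpow_neg (by positivity), ← div_eq_inv_mul,
        le_div_iff₀ (by positivity), mul_comm]
      exact this

/-- The parameters that belong to the equation. -/
def prm (α β s : ℝ) (hβ : β ≠ 0) (hs : -(1 / 4) ≤ s) : Par where
  -- The powers of `2π` are such that `2πQ(ξ)` is the phase at the angular frequency `2πξ`.
  A := -β * (2 * Real.pi) ^ 4
  B := α * (2 * Real.pi) ^ 2
  s := s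
  hA := mul_ne_zero (neg_ne_zero.2 hβ) (by positivity)
  hs := hs

section Norm

variable {α β s : ℝ} {hβ : β ≠ 0} {hs : -(1 / 4) ≤ s}

theorem two_pi_Q (ξ : ℝ) : 2 * Real.pi * (prm α β s hβ hs).Q ξ = phase α β (2 * Real.pi * ξ) := by
  simp only [Par.Q, ph, prm, phase]
  ring

theorem xsbWeight_eq (η : SpaceTime) : xsbWeight α β s (3 / 4) η * md (η 1 -
    (prm α β s hβ hs).Q (η 0)) ^ 2 = (1 + |2 * Real.pi * η 0|) ^ (2 * s) := by
  rw [xsbWeight, md_sq, mul_sub, two_pi_Q, mul_assoc, ← Real.rpow_add (by positivity)]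
  norm_num

theorem exists_xsbNorm_bsp_le (α β s : ℝ) (hβ : β ≠ 0) (hs : -(1 / 4) ≤ s) :
    ∃ C : ℝ≥0, ∀ f : L2P, xsbNorm α β s (3 / 4) ((prm α β s hβ hs).bsp f) ≤ C * ‖f‖ₑ := by
  obtain ⟨c, hc, h⟩ := exists_weight_le s
  set P := prm α β s hβ hs with hP
  refine ⟨NNReal.sqrt c.toNNReal, fun f ↦ (iInf₂_le _ (P.hasFourierDensity_bsp f)).trans ?_⟩
  rw [← ENNReal.rpow_le_rpow_iff (z := 2) (by norm_num), ← ENNReal.rpow_mul]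
  norm_num
  rw [mul_pow, enorm_eq_lintegral, ← ENNReal.coe_pow, NNReal.sq_sqrt, lintegral_spaceTime,
    ← lintegral_const_mul' _ _ ENNReal.coe_ne_top]
  refine lintegral_mono fun p ↦ ?_
  simp only [Matrix.cons_val_zero, Matrix.cons_val_one]
  rw [den, enorm_mul, mul_pow, ← mul_assoc]
  refine mul_le_mul' ?_ le_rfl
  rw [← ofReal_norm, Complex.norm_real, Real.norm_of_nonneg
    (mul_nonneg (wt_pos _ _).le (md_pos _).le), ← ENNReal.ofReal_pow (mul_nonneg (wt_pos _ _).le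
    (md_pos _).le), ← ENNReal.ofReal_mul (by unfold xsbWeight; positivity)]
  refine ENNReal.ofReal_le_ofReal ?_
  have e := xsbWeight_eq (α := α) (β := β) (s := s) (hβ := hβ) (hs := hs) !₂[p.1, p.2]
  simp only [Matrix.cons_val_zero, Matrix.cons_val_one] at e
  rw [mul_pow, mul_left_comm, hP, e]
  have hw : wt (-s) p.1 * wt s p.1 = 1 := wt_neg_mul s p.1
  calc wt (-s) p.1 ^ 2 * (1 + |2 * Real.pi * p.1|) ^ (2 * s)
      ≤ wt (-s) p.1 ^ 2 * (c * wt s p.1 ^ 2) := by gcongr; exact (h p.1).1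
    _ = c * (wt (-s) p.1 * wt s p.1) ^ 2 := by ring
    _ = c := by rw [hw]; ring

/-- Dividing the density by the weights yields an `L²` coefficient. The two Fourier transforms are
compared on compactly supported test functions only, which is all that `HasFourierDensity` provides
and is enough by `tempered_ext`. -/
theorem exists_bsp_eq (hβ : β ≠ 0) (hs : -(1 / 4) ≤ s) {U : 𝓢'(SpaceTime, ℂ)}
    (hU : xsbNorm α β s (3 / 4) U < ∞) : ∃ f : L2P, (prm α β s hβ hs).bsp f = U := by
  obtain ⟨c, hc, h⟩ := exists_weight_le s
  set P := prm α β s hβ hs with hP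
  simp only [xsbNorm, iInf_lt_iff] at hU
  obtain ⟨g, ⟨hg, hgU⟩, hlt⟩ := hU
  have hlt' : ∫⁻ η, ENNReal.ofReal (xsbWeight α β s (3 / 4) η) * ‖g η‖ₑ ^ 2 < ∞ :=
    (ENNReal.rpow_lt_top_iff_of_pos (by norm_num)).1 hlt
  set m : SpaceTime → ℝ := fun η ↦ wt s (η 0) * (md (η 1 - P.Q (η 0)))⁻¹ with hm
  have hm0 : ∀ η, 0 < m η := fun η ↦ mul_pos (wt_pos _ _) (inv_pos.2 (md_pos _))
  have hmc : Continuous m := by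
    have h1 := continuous_wt s
    have h2 := continuous_md
    have h3 := P.continuous_Q
    have h4 : ∀ η : SpaceTime, md (η 1 - P.Q (η 0)) ≠ 0 := fun η ↦ (md_pos _).ne'
    simp only [hm]
    fun_prop (disch := assumption)
  have hF : MemLp (fun η ↦ (m η : ℂ) * g η) 2 := by
    have hmm : AEStronglyMeasurable (fun η ↦ (m η : ℂ)) (volume : Measure SpaceTime) :=
      (Complex.continuous_ofReal.comp hmc).aestronglyMeasurable
    refine memLp_two_of_lintegral (hmm.fun_mul hg.aestronglyMeasurable) ?_
    refine lt_of_le_of_lt ?_ (ENNReal.mul_lt_top (ENNReal.ofReal_lt_top (r := c)) hlt')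
    rw [← lintegral_const_mul' _ _ ENNReal.ofReal_ne_top]
    refine lintegral_mono fun η ↦ ?_
    rw [enorm_mul, mul_pow, ← mul_assoc]
    refine mul_le_mul' ?_ le_rfl
    rw [← ofReal_norm, Complex.norm_real, Real.norm_of_nonneg (hm0 η).le,
      ← ENNReal.ofReal_pow (hm0 η).le, ← ENNReal.ofReal_mul hc.le]
    refine ENNReal.ofReal_le_ofReal ?_
    have e := xsbWeight_eq (α := α) (β := β) (s := s) (hβ := hβ) (hs := hs) η
    have hd := md_pos (η 1 - P.Q (η 0))
    simp only [hm]
    rw [mul_pow, inv_pow, ← div_eq_mul_inv, div_le_iff₀ (by positivity), mul_assoc, hP, e]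
    exact (h _).2
  have hF' := hF.comp_measurePreserving measurePreserving_pairEquiv
  refine ⟨hF'.toLp _, ?_⟩
  have key : P.bspHat (hF'.toLp _) = 𝓕 U := by
    refine tempered_ext fun φ hφ ↦ ?_
    rw [P.bspHat_apply, hgU φ hφ]
    refine integral_congr_ae ?_
    have h1 := (MeasurePreserving.symm pairEquiv
      measurePreserving_pairEquiv).quasiMeasurePreserving.ae hF'.coeFn_toLp
    filter_upwards [h1] with η hη
    rw [pairEquiv_symm_apply] at hη
    rw [den, hη, Function.comp_apply, ← pairEquiv_symm_apply, pairEquiv.apply_symm_apply]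
    congr 1
    have hd := (md_pos (η 1 - P.Q (η 0))).ne'
    have hw : wt (-s) (η 0) * wt s (η 0) = 1 := wt_neg_mul s (η 0)
    rw [← mul_assoc, ← Complex.ofReal_mul]
    have : wt (-P.s) (pairEquiv.symm η).1 * md ((pairEquiv.symm η).2 -
        P.Q (pairEquiv.symm η).1) * m η = 1 := by
      simp only [pairEquiv_symm_apply, hm]
      calc _ = (wt (-s) (η 0) * wt s (η 0)) *
            (md (η 1 - P.Q (η 0)) * (md (η 1 - P.Q (η 0)))⁻¹) := by
            simp only [hP, prm]; ring
        _ = 1 := by rw [hw, mul_inv_cancel₀ hd, one_mul]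
    rw [this]
    simp
  rw [Par.bsp, key, FourierTransform.fourierInv_fourier_eq]

end Norm

/-! ### Primitives of square integrable functions -/

/-- Integration by parts for the primitive of an integrable function. -/
theorem integral_deriv_mul_primitive {D φ φ' : ℝ → ℂ} {p q : ℝ} (hpq : p ≤ q)
    (hD : IntegrableOn D (Ioc p q)) (hφ : ∀ t, HasDerivAt φ (φ' t) t) (hφ' : Continuous φ') :
    ∫ t in p..q, φ' t * (∫ r in p..t, D r) =
      φ q * (∫ r in p..q, D r) - ∫ t in p..q, φ t * D t := by
  have hφc : Continuous φ := continuous_iff_continuousAt.2 fun t ↦ (hφ t).continuousAt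
  set μ := (volume : Measure ℝ).restrict (Ioc p q) with hμ
  have hi1 : Integrable φ' μ := (hφ'.integrableOn_Icc (a := p) (b := q)).mono_set Ioc_subset_Icc_self
  -- The integrand on the triangle `r ≤ t`; the identity is Fubini's theorem on it.
  set F : ℝ × ℝ → ℂ := {z : ℝ × ℝ | z.2 ≤ z.1}.indicator fun z ↦ φ' z.1 * D z.2 with hF
  have hFi : Integrable F (μ.prod μ) :=
    (hi1.mul_prod hD).indicator (measurableSet_le measurable_snd measurable_fst)
  have h1 : ∫ t, ∫ r, F (t, r) ∂μ ∂μ = ∫ t in p..q, φ' t * (∫ r in p..t, D r) := by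
    rw [intervalIntegral.integral_of_le hpq]
    refine setIntegral_congr_fun measurableSet_Ioc fun t ht ↦ ?_
    have e : ∀ r, F (t, r) = (Iic t).indicator (fun r ↦ φ' t * D r) r := fun r ↦ by
      by_cases hr : r ≤ t
      · rw [indicator_of_mem (by exact hr), hF, indicator_of_mem (by exact hr)]
      · rw [indicator_of_notMem (by exact hr), hF, indicator_of_notMem (by exact hr)]
    simp_rw [e]
    rw [integral_indicator measurableSet_Iic, hμ, Measure.restrict_restrict measurableSet_Iic,
      integral_const_mul, intervalIntegral.integral_of_le ht.1.le]
    congr 3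
    ext r
    simp only [mem_inter_iff, mem_Iic, mem_Ioc]
    constructor
    · rintro ⟨h, h', -⟩; exact ⟨h', h⟩
    · rintro ⟨h, h'⟩; exact ⟨h', h, h'.trans ht.2⟩
  have h2 : ∫ r, ∫ t, F (t, r) ∂μ ∂μ = ∫ r in p..q, (φ q * D r - φ r * D r) := by
    rw [intervalIntegral.integral_of_le hpq]
    refine setIntegral_congr_fun measurableSet_Ioc fun r hr ↦ ?_
    have e : ∀ t, F (t, r) = (Ici r).indicator (fun t ↦ φ' t * D r) t := fun t ↦ by
      by_cases hr : r ≤ t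
      · rw [indicator_of_mem (by exact hr), hF, indicator_of_mem (by exact hr)]
      · rw [indicator_of_notMem (by exact hr), hF, indicator_of_notMem (by exact hr)]
    simp_rw [e]
    rw [integral_indicator measurableSet_Ici, hμ, Measure.restrict_restrict measurableSet_Ici]
    have es : Ici r ∩ Ioc p q = Icc r q := by
      ext t
      simp only [mem_inter_iff, mem_Ici, mem_Ioc, mem_Icc]
      constructor
      · rintro ⟨h, -, h'⟩; exact ⟨h, h'⟩
      · rintro ⟨h, h'⟩; exact ⟨h, hr.1.trans_le h, h'⟩
    rw [es, integral_Icc_eq_integral_Ioc, ← intervalIntegral.integral_of_le hr.2,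
      intervalIntegral.integral_mul_const,
      intervalIntegral.integral_eq_sub_of_hasDerivAt (fun t _ ↦ hφ t) (hφ'.intervalIntegrable _ _)]
    ring
  have hDI : IntervalIntegrable D volume p q := (intervalIntegrable_iff_integrableOn_Ioc_of_le hpq).2 hD
  rw [← h1, integral_integral_swap (f := fun t r ↦ F (t, r)) hFi, h2,
    intervalIntegral.integral_sub (hDI.const_mul _) (hDI.continuousOn_mul hφc.continuousOn),
    intervalIntegral.integral_const_mul]

theorem enorm_integral_sq_le {D : ℝ → ℂ} {p q : ℝ} (hm : AEStronglyMeasurable D)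
    {t : ℝ} (ht : t ∈ Icc p q) :
    ‖∫ r in p..t, D r‖ₑ ^ 2 ≤ ENNReal.ofReal (q - p) * ∫⁻ r, ‖D r‖ₑ ^ 2 := by
  rw [intervalIntegral.integral_of_le ht.1]
  have h := lintegral_mul_sq_le (volume.restrict (Ioc p t)) (f := fun _ ↦ 1)
    (g := fun r ↦ ‖D r‖ₑ) aemeasurable_const hm.enorm.restrict
  simp only [one_mul, one_pow, lintegral_const, Measure.restrict_apply MeasurableSet.univ,
    univ_inter, Real.volume_Ioc] at h
  calc ‖∫ r in Ioc p t, D r‖ₑ ^ 2 ≤ (∫⁻ r in Ioc p t, ‖D r‖ₑ) ^ 2 :=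
        pow_le_pow_left' (enorm_integral_le_lintegral_enorm _) 2
    _ ≤ _ := h
    _ ≤ _ := mul_le_mul' (ENNReal.ofReal_le_ofReal (by linarith [ht.2])) (setLIntegral_le_lintegral _ _)

section Primitive

variable {D : ℝ → ℂ} {p q : ℝ}

theorem integrable_of_support (hD : MemLp D 2) (hs : ∀ t, t ∉ Ioc p q → D t = 0) :
    Integrable D := by
  have h1 : IntegrableOn D (Ioc p q) := by
    have := (hD.restrict (Ioc p q)).mono_exponent (p := 1) (by norm_num)
    exact memLp_one_iff_integrable.1 this
  refine (integrableOn_iff_integrable_of_support_subset fun t ht ↦ ?_).1 h1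
  by_contra h
  exact ht (hs t h)

theorem primitive_eq_zero (hs : ∀ t, t ∉ Ioc p q → D t = 0)
    (hi : Integrable D) (h0 : ∫ r in p..q, D r = 0) {t : ℝ} (ht : t ∉ Icc p q) :
    ∫ r in p..t, D r = 0 := by
  rcases lt_or_ge t p with h | h
  · rw [intervalIntegral.integral_of_ge h.le, neg_eq_zero]
    refine setIntegral_eq_zero_of_forall_eq_zero fun r hr ↦ hs r fun h' ↦ ?_
    exact absurd hr.2 (not_le.2 h'.1)
  · have hq : q < t := by
      by_contra hq
      exact ht ⟨h, not_lt.1 hq⟩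
    rw [← intervalIntegral.integral_add_adjacent_intervals (b := q) hi.intervalIntegrable
      hi.intervalIntegrable, h0, zero_add, intervalIntegral.integral_of_le hq.le]
    refine setIntegral_eq_zero_of_forall_eq_zero fun r hr ↦ hs r fun h' ↦ ?_
    exact absurd h'.2 (not_le.2 hr.1)

theorem memLp_primitive (hpq : p ≤ q) (hD : MemLp D 2) (hs : ∀ t, t ∉ Ioc p q → D t = 0)
    (h0 : ∫ r in p..q, D r = 0) : MemLp (fun t ↦ ∫ r in p..t, D r) 2 ∧
      ∫⁻ t, ‖∫ r in p..t, D r‖ₑ ^ 2 ≤ ENNReal.ofReal ((q - p) ^ 2) * ∫⁻ r, ‖D r‖ₑ ^ 2 := by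
  have hi := integrable_of_support hD hs
  have hc : Continuous fun t ↦ ∫ r in p..t, D r :=
    intervalIntegral.continuous_primitive (fun _ _ ↦ hi.intervalIntegrable) p
  have h : ∫⁻ t, ‖∫ r in p..t, D r‖ₑ ^ 2 ≤
      ENNReal.ofReal ((q - p) ^ 2) * ∫⁻ r, ‖D r‖ₑ ^ 2 := by
    calc ∫⁻ t, ‖∫ r in p..t, D r‖ₑ ^ 2 ≤ ∫⁻ t, (Icc p q).indicator
          (fun _ ↦ ENNReal.ofReal (q - p) * ∫⁻ r, ‖D r‖ₑ ^ 2) t := by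
          refine lintegral_mono fun t ↦ ?_
          by_cases ht : t ∈ Icc p q
          · rw [indicator_of_mem ht]
            exact enorm_integral_sq_le hD.1 ht
          · rw [indicator_of_notMem ht, primitive_eq_zero hs hi h0 ht]
            simp
      _ = _ := by
          rw [lintegral_indicator measurableSet_Icc, setLIntegral_const, Real.volume_Icc, mul_right_comm,
            ← ENNReal.ofReal_mul (sub_nonneg.2 hpq), sq]
  have hfin : ∫⁻ r, ‖D r‖ₑ ^ 2 < ∞ := by
    rw [← eLpNorm_two_sq]
    exact ENNReal.pow_lt_top hD.2
  exact ⟨memLp_two_of_lintegral hc.aestronglyMeasurable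
    (h.trans_lt (ENNReal.mul_lt_top ENNReal.ofReal_lt_top hfin)), h⟩

theorem integrable_primitive (hD : MemLp D 2) (hs : ∀ t, t ∉ Ioc p q → D t = 0)
    (h0 : ∫ r in p..q, D r = 0) : Integrable fun t ↦ ∫ r in p..t, D r := by
  have hi := integrable_of_support hD hs
  refine (integrableOn_iff_integrable_of_support_subset (s := Icc p q) fun t ht ↦ ?_).1
    (intervalIntegral.continuous_primitive (fun _ _ ↦ hi.intervalIntegrable) p).integrableOn_Icc
  by_contra h
  exact ht (primitive_eq_zero hs hi h0 h)

/-- Since `D` has mean zero its primitive has compact support, and integration by parts leaves no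
boundary term. -/
theorem fourier_primitive (hpq : p ≤ q) (hD : MemLp D 2) (hs : ∀ t, t ∉ Ioc p q → D t = 0)
    (h0 : ∫ r in p..q, D r = 0) (l : ℝ) :
    (2 * Real.pi * Complex.I * l) * 𝓕 (fun t ↦ ∫ r in p..t, D r) l = 𝓕 D l := by
  have hi := integrable_of_support hD hs
  set c : ℂ := -(2 * Real.pi * Complex.I * l) with hc
  have hexp : ∀ t : ℝ, HasDerivAt (fun t : ℝ ↦ Complex.exp (c * t)) (c * Complex.exp (c * t)) t := by
    intro t
    have := ((hasDerivAt_id (t : ℂ)).const_mul c).cexp.comp_ofReal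
    simpa [mul_comm] using this
  have hcont : Continuous fun t : ℝ ↦ c * Complex.exp (c * t) := by fun_prop
  have h := integral_deriv_mul_primitive hpq hi.integrableOn hexp hcont
  rw [h0, mul_zero, zero_sub] at h
  have e1 : 𝓕 D l = ∫ t in p..q, Complex.exp (c * t) * D t := by
    rw [Real.fourier_eq', intervalIntegral.integral_of_le hpq]
    rw [setIntegral_eq_integral_of_forall_compl_eq_zero fun t ht ↦ by rw [hs t ht, mul_zero]]
    congr 1 with t
    rw [smul_eq_mul]
    congr 2
    simp [hc]
    ring
  have e2 : 𝓕 (fun t ↦ ∫ r in p..t, D r) l =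
      ∫ t in p..q, Complex.exp (c * t) * ∫ r in p..t, D r := by
    rw [Real.fourier_eq', intervalIntegral.integral_of_le hpq, ← integral_Icc_eq_integral_Ioc]
    rw [setIntegral_eq_integral_of_forall_compl_eq_zero fun t ht ↦ by
      rw [primitive_eq_zero hs hi h0 ht, mul_zero]]
    congr 1 with t
    rw [smul_eq_mul]
    congr 2
    simp [hc]
    ring
  rw [e1, e2, ← intervalIntegral.integral_const_mul, ← neg_neg (∫ t in p..q, Complex.exp (c * t) * D t),
    ← h, ← intervalIntegral.integral_neg]
  congr 1 with t
  rw [hc]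
  ring

/-- With `r = (1 + y)^{1/2}`, either `r ≥ 1/ε` and `r³ ≤ εr⁴`, or `r³ ≤ ε⁻³`. The coefficient of
`y²` can be made small because `3/2 < 2`, that is, `b < 1`; this is the source of smallness on short
intervals. -/
theorem weight_le {ε : ℝ} (hε : 0 < ε) (y : ℝ) (hy : 0 ≤ y) :
    (1 + y) ^ (3 / 2 : ℝ) ≤ 2 * ε * y ^ 2 + (2 * ε + ε⁻¹ ^ 3) := by
  have h1 : (1 + y) ^ (3 / 2 : ℝ) ≤ ε * (1 + y) ^ 2 + ε⁻¹ ^ 3 := by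
    set r := (1 + y) ^ (1 / 2 : ℝ) with hr
    have hr0 : 0 < r := by positivity
    have e1 : (1 + y) ^ (3 / 2 : ℝ) = r ^ 3 := by
      rw [hr, ← Real.rpow_natCast, ← Real.rpow_mul (by positivity)]
      norm_num
    have e2 : (1 + y) ^ 2 = r ^ 4 := by
      rw [hr, ← Real.rpow_natCast, ← Real.rpow_natCast, ← Real.rpow_mul (by positivity)]
      norm_num
    rw [e1, e2]
    rcases le_total r ε⁻¹ with h | h
    · have : r ^ 3 ≤ ε⁻¹ ^ 3 := by gcongr
      have : 0 ≤ ε * r ^ 4 := by positivity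
      linarith
    · have : 1 ≤ ε * r := by
        calc 1 = ε * ε⁻¹ := (mul_inv_cancel₀ hε.ne').symm
          _ ≤ ε * r := by gcongr
      have h3 : r ^ 3 ≤ ε * r ^ 4 := by
        calc r ^ 3 = 1 * r ^ 3 := (one_mul _).symm
          _ ≤ (ε * r) * r ^ 3 := by gcongr
          _ = ε * r ^ 4 := by ring
      have : 0 ≤ ε⁻¹ ^ 3 := by positivity
      linarith
  nlinarith [mul_nonneg hε.le (sq_nonneg (1 - y))]

/-- The modulation norm of a primitive. -/
theorem lintegral_fourier_primitive_le (hpq : p ≤ q) (hD : MemLp D 2)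
    (hs : ∀ t, t ∉ Ioc p q → D t = 0) (h0 : ∫ r in p..q, D r = 0) {ε : ℝ} (hε : 0 < ε) :
    ∫⁻ l, ENNReal.ofReal ((md l)⁻¹ ^ 2) * ‖𝓕 (fun t ↦ ∫ r in p..t, D r) l‖ₑ ^ 2 ≤
      ENNReal.ofReal (2 * ε + (2 * ε + ε⁻¹ ^ 3) * (q - p) ^ 2) * ∫⁻ r, ‖D r‖ₑ ^ 2 := by
  have hi := integrable_of_support hD hs
  set V : ℝ → ℂ := fun t ↦ ∫ r in p..t, D r with hV
  have hVi : Integrable V := integrable_primitive hD hs h0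
  obtain ⟨hV2, hVle⟩ := memLp_primitive hpq hD hs h0
  have hpt : ∀ l, ENNReal.ofReal ((md l)⁻¹ ^ 2) * ‖𝓕 V l‖ₑ ^ 2 ≤
      ENNReal.ofReal (2 * ε) * ‖𝓕 D l‖ₑ ^ 2 + ENNReal.ofReal (2 * ε + ε⁻¹ ^ 3) * ‖𝓕 V l‖ₑ ^ 2 := by
    intro l
    have e : ‖𝓕 D l‖ₑ = ENNReal.ofReal |2 * Real.pi * l| * ‖𝓕 V l‖ₑ := by
      rw [← fourier_primitive hpq hD hs h0 l, enorm_mul]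
      congr 1
      rw [← ofReal_norm]
      congr 1
      simp [abs_of_pos Real.pi_pos, abs_mul]
    rw [e, mul_pow, ← mul_assoc, ← add_mul, ← ENNReal.ofReal_pow (abs_nonneg _),
      ← ENNReal.ofReal_mul (by positivity), ← ENNReal.ofReal_add (by positivity) (by positivity)]
    refine mul_le_mul' (ENNReal.ofReal_le_ofReal ?_) le_rfl
    rw [inv_pow, md_sq, ← Real.rpow_neg (by positivity), neg_neg]
    exact weight_le hε _ (abs_nonneg _)
  calc _ ≤ ∫⁻ l, (ENNReal.ofReal (2 * ε) * ‖𝓕 D l‖ₑ ^ 2 +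
        ENNReal.ofReal (2 * ε + ε⁻¹ ^ 3) * ‖𝓕 V l‖ₑ ^ 2) := lintegral_mono hpt
    _ = ENNReal.ofReal (2 * ε) * (∫⁻ r, ‖D r‖ₑ ^ 2) +
        ENNReal.ofReal (2 * ε + ε⁻¹ ^ 3) * ∫⁻ r, ‖V r‖ₑ ^ 2 := by
        rw [lintegral_add_left' (((continuous_fourier hi).measurable.enorm.pow_const 2).const_mul
          _).aemeasurable, lintegral_const_mul' _ _ ENNReal.ofReal_ne_top,
          lintegral_const_mul' _ _ ENNReal.ofReal_ne_top, lintegral_fourier_sq hi hD,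
          lintegral_fourier_sq hVi hV2]
    _ ≤ ENNReal.ofReal (2 * ε) * (∫⁻ r, ‖D r‖ₑ ^ 2) +
        ENNReal.ofReal (2 * ε + ε⁻¹ ^ 3) * (ENNReal.ofReal ((q - p) ^ 2) * ∫⁻ r, ‖D r‖ₑ ^ 2) := by
        gcongr
    _ = _ := by
        rw [← mul_assoc, ← add_mul, ← ENNReal.ofReal_mul (by positivity),
          ← ENNReal.ofReal_add (by positivity) (by positivity)]

end Primitive

/-! ### Extension of solutions of the linear equation -/

/-- The character `e^{2πitQ(ξ)}` of the linear group. -/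
def Par.ep (P : Par) (p : ℝ × ℝ) : ℂ := Complex.exp (2 * Real.pi * Complex.I * P.Q p.1 * p.2)

theorem Par.norm_ep (P : Par) (p : ℝ × ℝ) : ‖P.ep p‖ = 1 := by
  rw [Par.ep, Complex.norm_exp]
  simp

theorem Par.continuous_ep (P : Par) : Continuous P.ep := by
  have := P.continuous_Q
  unfold Par.ep
  fun_prop

theorem fourierInv_comp_sub (h : ℝ → ℂ) (c t : ℝ) :
    𝓕⁻ (fun τ ↦ h (τ - c)) t = Complex.exp (2 * Real.pi * Complex.I * c * t) * 𝓕⁻ h t := by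
  rw [Real.fourierInv_eq', Real.fourierInv_eq', ← integral_const_mul,
    ← integral_sub_right_eq_self (fun τ ↦ Complex.exp (2 * Real.pi * Complex.I * c * t) *
      (Complex.exp (↑(2 * Real.pi * inner ℝ τ t) * Complex.I) • h τ)) c]
  congr 1 with τ
  rw [smul_eq_mul, smul_eq_mul, ← mul_assoc, ← Complex.exp_add]
  congr 2
  simp only [RCLike.inner_apply, conj_trivial]
  push_cast
  ring

theorem measurable_primitive_snd {D : ℝ × ℝ → ℂ} (hD : Measurable D) (p : ℝ) :
    Measurable fun z : ℝ × ℝ ↦ ∫ r in p..z.2, D (z.1, r) := by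
  simp only [intervalIntegral]
  have h : ∀ S : Set ((ℝ × ℝ) × ℝ), MeasurableSet S →
      Measurable fun z : ℝ × ℝ ↦ ∫ r, S.indicator (fun w ↦ D (w.1.1, w.2)) (z, r) := by
    intro S hS
    refine (StronglyMeasurable.integral_prod_right (f := fun (z : ℝ × ℝ) (r : ℝ) ↦
      S.indicator (fun w ↦ D (w.1.1, w.2)) (z, r)) ?_).measurable
    refine Measurable.stronglyMeasurable (Measurable.indicator ?_ hS)
    exact hD.comp (by fun_prop)
  have e1 : ∀ z : ℝ × ℝ, ∫ r in Ioc p z.2, D (z.1, r) =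
      ∫ r, {w : (ℝ × ℝ) × ℝ | p < w.2 ∧ w.2 ≤ w.1.2}.indicator (fun w ↦ D (w.1.1, w.2)) (z, r) :=
    fun z ↦ by rw [← integral_indicator measurableSet_Ioc]; rfl
  have e2 : ∀ z : ℝ × ℝ, ∫ r in Ioc z.2 p, D (z.1, r) =
      ∫ r, {w : (ℝ × ℝ) × ℝ | w.1.2 < w.2 ∧ w.2 ≤ p}.indicator (fun w ↦ D (w.1.1, w.2)) (z, r) :=
    fun z ↦ by rw [← integral_indicator measurableSet_Ioc]; rfl
  simp_rw [e1, e2]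
  refine (h _ ?_).sub (h _ ?_)
  · exact (measurableSet_lt measurable_const measurable_snd).inter
      (measurableSet_le measurable_snd (by fun_prop))
  · exact (measurableSet_lt (by fun_prop) measurable_snd).inter
      (measurableSet_le measurable_snd measurable_const)

/-- The coefficients whose curve is the primitive of a given source, carried by the linear group. -/
theorem exists_primitive (P : Par) {D : ℝ × ℝ → ℂ} (hDm : Measurable D) (hD : MemLp D 2)
    {p q : ℝ} (hpq : p ≤ q) (hs : ∀ ξ t, t ∉ Ioc p q → D (ξ, t) = 0)
    (h0 : ∀ᵐ ξ : ℝ, ∫ r in p..q, D (ξ, r) = 0) {ε : ℝ} (hε : 0 < ε) :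
    ∃ f : L2P, ‖f‖ₑ ^ 2 ≤ ENNReal.ofReal (2 * ε + (2 * ε + ε⁻¹ ^ 3) * (q - p) ^ 2) *
        ∫⁻ z, ‖D z‖ₑ ^ 2 ∧
      ∀ᵐ ξ : ℝ, ∀ t, kf P f (ξ, t) = P.ep (ξ, t) * ∫ r in p..t, D (ξ, r) := by
  set V : ℝ × ℝ → ℂ := fun z ↦ ∫ r in p..z.2, D (z.1, r) with hV
  have hVm : Measurable V := measurable_primitive_snd hDm p
  set Vh : ℝ × ℝ → ℂ := fun z ↦ 𝓕 (fun t ↦ V (z.1, t)) z.2 with hVh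
  have hVhm : Measurable Vh := by
    have h := (stronglyMeasurable_fourierInv_fiber hVm).measurable
    have e : Vh = (fun w : ℝ × ℝ ↦ 𝓕⁻ (fun t ↦ V (w.1, t)) w.2) ∘ fun w : ℝ × ℝ ↦ (w.1, -w.2) := by
      funext z
      simp only [hVh, Function.comp_apply, Real.fourierInv_eq_fourier_neg, neg_neg]
    rw [e]
    exact Measurable.comp (g := fun w : ℝ × ℝ ↦ 𝓕⁻ (fun t ↦ V (w.1, t)) w.2) h (by fun_prop)
  -- The time transform of the primitive, moved to the curve `τ = Q(ξ)` and divided by the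
  -- modulation weight that `kf` multiplies back.
  set f : ℝ × ℝ → ℂ := fun z ↦ ((md (z.2 - P.Q z.1))⁻¹ : ℝ) * Vh (z.1, z.2 - P.Q z.1) with hf
  have hsh : Measurable fun z : ℝ × ℝ ↦ (z.1, z.2 - P.Q z.1) := by
    have := P.continuous_Q
    exact (by fun_prop : Continuous fun z : ℝ × ℝ ↦ (z.1, z.2 - P.Q z.1)).measurable
  have hfm : Measurable f := by
    have h1 : Measurable fun z : ℝ × ℝ ↦ (((md (z.2 - P.Q z.1))⁻¹ : ℝ) : ℂ) :=
      (continuous_md.measurable.comp (measurable_snd.comp hsh)).inv.complex_ofReal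
    exact h1.mul (hVhm.comp hsh)
  have hfib := ae_memLp_fiber hD
  have hle : ∫⁻ z, ‖f z‖ₑ ^ 2 ≤ ENNReal.ofReal (2 * ε + (2 * ε + ε⁻¹ ^ 3) * (q - p) ^ 2) *
      ∫⁻ z, ‖D z‖ₑ ^ 2 := by
    rw [Measure.volume_eq_prod, lintegral_prod _ (hfm.enorm.pow_const 2).aemeasurable,
      lintegral_prod _ (hDm.enorm.pow_const 2).aemeasurable,
      ← lintegral_const_mul' _ _ ENNReal.ofReal_ne_top]
    refine lintegral_mono_ae ?_
    filter_upwards [hfib, h0] with ξ h1 h2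
    refine le_trans (le_of_eq ?_) (lintegral_fourier_primitive_le hpq h1 (hs ξ) h2 hε)
    rw [← lintegral_sub_right_eq_self (fun l ↦ ENNReal.ofReal ((md l)⁻¹ ^ 2) *
      ‖𝓕 (fun t ↦ ∫ r in p..t, D (ξ, r)) l‖ₑ ^ 2) (P.Q ξ)]
    refine lintegral_congr fun τ ↦ ?_
    simp only [hf, hVh, hV]
    rw [enorm_mul, mul_pow, ← ofReal_norm (((md (τ - P.Q ξ))⁻¹ : ℝ) : ℂ), Complex.norm_real,
      Real.norm_of_nonneg (inv_pos.2 (md_pos _)).le, ENNReal.ofReal_pow (inv_pos.2 (md_pos _)).le]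
  have hf2 : MemLp f 2 := memLp_two_of_lintegral hfm.aestronglyMeasurable
    (hle.trans_lt (ENNReal.mul_lt_top ENNReal.ofReal_lt_top (lintegral_sq_lt_top hD)))
  refine ⟨hf2.toLp f, by rwa [enorm_toLp_sq hf2], ?_⟩
  filter_upwards [kf_congr P hf2.coeFn_toLp, hfib, h0, ae_memLp_fiber hf2] with ξ h1 h2 h3 h4 t
  rw [h1, kf]
  have e : (fun τ ↦ (md (τ - P.Q ξ) : ℂ) * f (ξ, τ)) =
      fun τ ↦ 𝓕 (fun t ↦ V (ξ, t)) (τ - P.Q ξ) := by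
    funext τ
    have := (md_pos (τ - P.Q ξ)).ne'
    simp only [hf, hVh]
    rw [← mul_assoc, ← Complex.ofReal_mul, mul_inv_cancel₀ this, Complex.ofReal_one, one_mul]
  have hint : Integrable (𝓕 (fun t ↦ V (ξ, t))) := by
    have := integrable_md_mul h4 (P.Q ξ)
    rw [e] at this
    simpa using this.comp_add_right (P.Q ξ)
  have hVc : Continuous fun t ↦ V (ξ, t) := intervalIntegral.continuous_primitive
    (fun _ _ ↦ (integrable_of_support h2 (hs ξ)).intervalIntegrable) p
  rw [e, fourierInv_comp_sub, hVc.fourierInv_fourier_eq (integrable_primitive h2 (hs ξ) h3) hint]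
  rfl

/-- The curve of `f` solves the linear equation on `[a, b]` with the data `B` and the source `G`, in
the interaction picture. -/
def Mild (P : Par) (f : L2P) (B : L2R) (G : ℝ × ℝ → ℂ) (a b : ℝ) : Prop :=
  ∀ᵐ ξ : ℝ, ∀ t ∈ Icc a b, kf P f (ξ, t) = P.ep (ξ, t) * (B ξ + ∫ r in a..t, G (ξ, r))

theorem Mild.congr {P : Par} {f : L2P} {B : L2R} {G G' : ℝ × ℝ → ℂ} {a b : ℝ}
    (h : Mild P f B G a b) (hG : ∀ᵐ p : ℝ × ℝ, p.2 ∈ Ioo a b → G p = G' p) :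
    Mild P f B G' a b := by
  rw [Measure.volume_eq_prod] at hG
  filter_upwards [h, Measure.ae_ae_of_ae_prod hG] with ξ h1 h2 t ht
  rw [h1 t ht]
  congr 2
  rw [intervalIntegral.integral_of_le ht.1, intervalIntegral.integral_of_le ht.1]
  refine setIntegral_congr_ae measurableSet_Ioc ?_
  have hb : ∀ᵐ r : ℝ, r ≠ b := by simp [ae_iff]
  filter_upwards [h2, hb] with r hr hrb hrt
  exact hr ⟨hrt.1, lt_of_le_of_ne (hrt.2.trans ht.2) hrb⟩

theorem norm_le_of_enorm_sq_le {E F : Type*} [NormedAddCommGroup E] [NormedAddCommGroup F] {f : E}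
    {g : F} {c : ℝ} (hc : 0 ≤ c) (h : ‖f‖ₑ ^ 2 ≤ ENNReal.ofReal (c ^ 2) * ‖g‖ₑ ^ 2) :
    ‖f‖ ≤ c * ‖g‖ := by
  have h2 := ENNReal.toReal_mono (ENNReal.mul_ne_top ENNReal.ofReal_ne_top (by simp)) h
  rw [ENNReal.toReal_mul, ENNReal.toReal_pow, ENNReal.toReal_pow, toReal_enorm, toReal_enorm,
    ENNReal.toReal_ofReal (by positivity), ← mul_pow] at h2
  exact (pow_le_pow_iff_left₀ (norm_nonneg _) (by positivity) two_ne_zero).1 h2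

/-! ### Extension from an interval to the Bourgain space -/

section Extension

variable (P : Par)

/-- The data are multiplied by a trapezoid in time that equals `1` on `[a, a + 1]`, obtained as the
primitive of a step function `e` with values `1` and `-1` on its two flanks. -/
theorem exists_extension_data (a : ℝ) (B : L2R) : ∃ f : L2P, ‖f‖ ≤ 10 * ‖B‖ ∧
    ∀ᵐ ξ : ℝ, ∀ t ∈ Icc a (a + 1), kf P f (ξ, t) = P.ep (ξ, t) * B ξ := by
  set e : ℝ → ℂ := fun t ↦ (Ioc (a - 1) a).indicator (fun _ ↦ 1) t -
    (Ioc (a + 1) (a + 2)).indicator (fun _ ↦ 1) t with he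
  set D : ℝ × ℝ → ℂ := fun z ↦ e z.2 * B z.1 with hDdef
  have hBm : Measurable (B : ℝ → ℂ) := (Lp.stronglyMeasurable B).measurable
  have hem : Measurable e :=
    (measurable_const.indicator measurableSet_Ioc).sub (measurable_const.indicator measurableSet_Ioc)
  have hDm : Measurable D := (hem.comp measurable_snd).mul (hBm.comp measurable_fst)
  have he0 : ∀ t, t ∉ Ioc (a - 1) (a + 2) → e t = 0 := by
    intro t ht
    simp only [he]
    rw [indicator_of_notMem fun h ↦ ht ⟨h.1, by linarith [h.2]⟩,
      indicator_of_notMem fun h ↦ ht ⟨by linarith [h.1], h.2⟩, sub_zero]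
  have he1 : ∀ t, ‖e t‖ₑ ^ 2 ≤ (Ioc (a - 1) (a + 2)).indicator (fun _ ↦ 1) t := by
    intro t
    by_cases ht : t ∈ Ioc (a - 1) (a + 2)
    · rw [indicator_of_mem ht]
      refine pow_le_one₀ zero_le ?_
      simp only [he]
      by_cases h1 : t ∈ Ioc (a - 1) a
      · rw [indicator_of_mem h1, indicator_of_notMem fun h ↦ by linarith [h.1, h1.2]]
        simp
      · rw [indicator_of_notMem h1]
        by_cases h2 : t ∈ Ioc (a + 1) (a + 2)
        · rw [indicator_of_mem h2]; simp
        · rw [indicator_of_notMem h2]; simp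
    · rw [he0 t ht]
      simp
  have hle : ∫⁻ z, ‖D z‖ₑ ^ 2 ≤ 3 * ‖B‖ₑ ^ 2 := by
    rw [Measure.volume_eq_prod, lintegral_prod_symm _ (hDm.enorm.pow_const 2).aemeasurable]
    calc ∫⁻ t, ∫⁻ ξ, ‖D (ξ, t)‖ₑ ^ 2 = ∫⁻ t, ‖e t‖ₑ ^ 2 * ‖B‖ₑ ^ 2 := by
          refine lintegral_congr fun t ↦ ?_
          rw [enorm_eq_lintegral, ← lintegral_const_mul _ (hBm.enorm.pow_const 2)]
          refine lintegral_congr fun ξ ↦ ?_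
          rw [hDdef, enorm_mul, mul_pow]
      _ = (∫⁻ t, ‖e t‖ₑ ^ 2) * ‖B‖ₑ ^ 2 := lintegral_mul_const _ (hem.enorm.pow_const 2)
      _ ≤ (∫⁻ t, (Ioc (a - 1) (a + 2)).indicator (fun _ ↦ 1) t) * ‖B‖ₑ ^ 2 :=
          mul_le_mul' (lintegral_mono he1) le_rfl
      _ = _ := by
          rw [lintegral_indicator measurableSet_Ioc, setLIntegral_const, Real.volume_Ioc, one_mul]
          congr 1
          rw [show a + 2 - (a - 1) = 3 by ring]
          simp
  have hD2 : MemLp D 2 := memLp_two_of_lintegral hDm.aestronglyMeasurable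
    (hle.trans_lt (ENNReal.mul_lt_top (by simp) (by simp [ENNReal.pow_lt_top_iff])))
  have hei : ∀ u v : ℝ, IntervalIntegrable e volume u v := fun u v ↦ by
    have h : ∀ x y : ℝ, Integrable ((Ioc x y).indicator fun _ ↦ (1 : ℂ)) := fun x y ↦
      (integrable_indicator_iff measurableSet_Ioc).2 (integrableOn_const (by simp))
    exact ((h _ _).sub (h _ _)).intervalIntegrable
  have hprim : ∀ t ∈ Icc a (a + 1), ∫ r in (a - 1)..t, e r = 1 := by
    intro t ht
    rw [← intervalIntegral.integral_add_adjacent_intervals (hei (a - 1) a) (hei a t)]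
    have h1 : ∫ r in (a - 1)..a, e r = 1 := by
      rw [intervalIntegral.integral_of_le (by linarith), setIntegral_congr_fun (g := fun _ ↦ 1)
        measurableSet_Ioc fun r hr ↦ by
          simp only [he]
          rw [indicator_of_mem hr, indicator_of_notMem fun h ↦ by linarith [h.1, hr.2], sub_zero]]
      simp
    have h2 : ∫ r in a..t, e r = 0 := by
      rw [intervalIntegral.integral_of_le ht.1]
      refine setIntegral_eq_zero_of_forall_eq_zero fun r hr ↦ ?_
      simp only [he]
      rw [indicator_of_notMem fun h ↦ by linarith [h.2, hr.1],
        indicator_of_notMem fun h ↦ by linarith [h.1, hr.2, ht.2], sub_zero]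
    rw [h1, h2, add_zero]
  have hfull : ∫ r in (a - 1)..(a + 2), e r = 0 := by
    rw [← intervalIntegral.integral_add_adjacent_intervals (hei (a - 1) (a + 1)) (hei _ _),
      hprim (a + 1) ⟨by linarith, le_rfl⟩, intervalIntegral.integral_of_le (by linarith),
      setIntegral_congr_fun (g := fun _ ↦ -1) measurableSet_Ioc fun r hr ↦ by
          simp only [he]
          rw [indicator_of_mem hr, indicator_of_notMem fun h ↦ by linarith [h.2, hr.1], zero_sub]]
    simp
    norm_num
  obtain ⟨f, hf, hk⟩ := exists_primitive P hDm hD2 (p := a - 1) (q := a + 2) (by linarith)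
    (fun ξ t ht ↦ by simp only [hDdef]; rw [he0 t ht, zero_mul])
    (Eventually.of_forall fun ξ ↦ by
      simp only [hDdef]
      rw [intervalIntegral.integral_mul_const, hfull, zero_mul]) one_pos
  -- With `ε = 1`, `q - p = 3` and the bound `3‖B‖²` for the source, the constant is `(2 + 3·9)·3 =
  -- 87 ≤ 10²`.
  refine ⟨f, norm_le_of_enorm_sq_le (by norm_num) ?_, ?_⟩
  · refine hf.trans ((mul_le_mul' le_rfl hle).trans ?_)
    rw [← mul_assoc]
    refine mul_le_mul' ?_ le_rfl
    rw [show (3 : ℝ≥0∞) = ENNReal.ofReal 3 by simp, ← ENNReal.ofReal_mul (by positivity)]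
    refine ENNReal.ofReal_le_ofReal ?_
    ring_nf
    norm_num
  · filter_upwards [hk] with ξ h t ht
    rw [h t]
    simp only [hDdef]
    rw [intervalIntegral.integral_mul_const, hprim t ht, one_mul]

/-- The source on `(a, a + δ]` is followed by its negative on `(a + δ, a + 2δ]`. The total has mean
zero, so its primitive has compact support and no smooth cutoff is needed. -/
theorem exists_extension_source {ε : ℝ} (hε : 0 < ε) : ∃ δ₀ : ℝ, 0 < δ₀ ∧ ∀ (a : ℝ) (δ : ℝ),
    0 < δ → δ ≤ δ₀ → ∀ G : L2P, ∃ f : L2P, ‖f‖ ≤ ε * ‖G‖ ∧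
      ∀ᵐ ξ : ℝ, ∀ t ∈ Icc a (a + δ), kf P f (ξ, t) = P.ep (ξ, t) * ∫ r in a..t, G (ξ, r) := by
  -- Half of `ε²` is spent on `4 · 2η`; the other half is `Mδ² ≤ Mδ ≤ ε²/2`. The `4` comes from the
  -- bound of `D` by `G`, and the `16` in `M` is this `4` times the square of `2` from the length
  -- `2δ`.
  set η : ℝ := ε ^ 2 / 16 with hη
  have hη0 : 0 < η := by positivity
  set M : ℝ := (2 * η + η⁻¹ ^ 3) * 16 with hM
  have hM0 : 0 < M := by positivity
  refine ⟨min 1 (ε ^ 2 / (2 * M)), by positivity, fun a δ hδ hδ' G ↦ ?_⟩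
  have hconst : (2 * η + (2 * η + η⁻¹ ^ 3) * (a + 2 * δ - a) ^ 2) * 4 ≤ ε ^ 2 := by
    have h1 : δ ≤ 1 := hδ'.trans (min_le_left _ _)
    have h2 : δ ≤ ε ^ 2 / (2 * M) := hδ'.trans (min_le_right _ _)
    rw [le_div_iff₀ (by positivity)] at h2
    have h3 : δ ^ 2 * M ≤ δ * M := by
      refine mul_le_mul_of_nonneg_right ?_ hM0.le
      nlinarith
    have e : (2 * η + (2 * η + η⁻¹ ^ 3) * (a + 2 * δ - a) ^ 2) * 4 = 8 * η + δ ^ 2 * M := by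
      rw [hM]; ring
    rw [e, hη]
    linarith
  have hGm := measurable_coe G
  set D₁ : ℝ × ℝ → ℂ := (Prod.snd ⁻¹' Ioc a (a + δ)).indicator G with hD₁
  set sh : ℝ × ℝ → ℝ × ℝ := fun z ↦ (z.1, z.2 - δ) with hsh
  have hshm : Measurable sh := by fun_prop
  set D : ℝ × ℝ → ℂ := fun z ↦ D₁ z - D₁ (sh z) with hDdef
  have hm1 : Measurable D₁ := hGm.indicator (measurable_snd measurableSet_Ioc)
  have hDm : Measurable D := hm1.sub (hm1.comp hshm)
  have hmp : MeasurePreserving sh volume volume :=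
    (MeasurePreserving.id (volume : Measure ℝ)).prod (measurePreserving_sub_right volume δ)
  have hle : ∫⁻ z, ‖D z‖ₑ ^ 2 ≤ 4 * ‖G‖ₑ ^ 2 := by
    have hsq : ∀ x y : ℂ, ‖x - y‖ₑ ^ 2 ≤ 2 * (‖x‖ₑ ^ 2 + ‖y‖ₑ ^ 2) := fun x y ↦ by
      refine (pow_le_pow_left' enorm_sub_le 2).trans ?_
      have : (‖x‖₊ + ‖y‖₊) ^ 2 ≤ 2 * (‖x‖₊ ^ 2 + ‖y‖₊ ^ 2) := add_sq_le
      rw [enorm_eq_nnnorm, enorm_eq_nnnorm]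
      exact_mod_cast this
    have h1 : ∫⁻ z, ‖D₁ z‖ₑ ^ 2 ≤ ‖G‖ₑ ^ 2 := by
      rw [enorm_eq_lintegral]
      refine lintegral_mono fun z ↦ pow_le_pow_left' ?_ 2
      exact enorm_indicator_le_enorm_self _ _
    have h2 : ∫⁻ z, ‖D₁ (sh z)‖ₑ ^ 2 = ∫⁻ z, ‖D₁ z‖ₑ ^ 2 :=
      hmp.lintegral_comp (hm1.enorm.pow_const 2)
    calc ∫⁻ z, ‖D z‖ₑ ^ 2 ≤ ∫⁻ z, 2 * (‖D₁ z‖ₑ ^ 2 + ‖D₁ (sh z)‖ₑ ^ 2) :=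
          lintegral_mono fun z ↦ hsq _ _
      _ = 2 * ((∫⁻ z, ‖D₁ z‖ₑ ^ 2) + ∫⁻ z, ‖D₁ (sh z)‖ₑ ^ 2) := by
          rw [lintegral_const_mul' _ _ (by simp), lintegral_add_left (hm1.enorm.pow_const 2)]
      _ ≤ 2 * (‖G‖ₑ ^ 2 + ‖G‖ₑ ^ 2) := by rw [h2]; gcongr
      _ = 4 * ‖G‖ₑ ^ 2 := by ring
  have hD2 : MemLp D 2 := memLp_two_of_lintegral hDm.aestronglyMeasurable
    (hle.trans_lt (ENNReal.mul_lt_top (by simp) (by simp [ENNReal.pow_lt_top_iff])))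
  have hv1 : ∀ ξ t, t ∈ Ioc a (a + δ) → D (ξ, t) = G (ξ, t) := by
    intro ξ t ht
    simp only [hDdef, hD₁, hsh]
    rw [indicator_of_mem (by exact ht), indicator_of_notMem fun h ↦ by
      have := h.1; simp only at this; linarith [ht.2], sub_zero]
  have hv2 : ∀ ξ t, t ∈ Ioc (a + δ) (a + 2 * δ) → D (ξ, t) = -G (ξ, t - δ) := by
    intro ξ t ht
    simp only [hDdef, hD₁, hsh]
    rw [indicator_of_notMem fun h ↦ by
      have := h.2; simp only at this; linarith [ht.1], indicator_of_mem (by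
        exact ⟨by simp only; linarith [ht.1], by simp only; linarith [ht.2]⟩), zero_sub]
  have hv3 : ∀ ξ t, t ∉ Ioc a (a + 2 * δ) → D (ξ, t) = 0 := by
    intro ξ t ht
    simp only [hDdef, hD₁, hsh]
    rw [indicator_of_notMem fun h ↦ ht ⟨h.1, by have := h.2; simp only at this; linarith⟩,
      indicator_of_notMem fun h ↦ ht ⟨by have := h.1; simp only at this; linarith,
        by have := h.2; simp only at this; linarith⟩, sub_zero]
  have hfull : ∀ᵐ ξ : ℝ, ∫ r in a..(a + 2 * δ), D (ξ, r) = 0 := by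
    filter_upwards [ae_memLp_fiber hD2] with ξ hξ
    have hi := integrable_of_support hξ (hv3 ξ)
    rw [← intervalIntegral.integral_add_adjacent_intervals (b := a + δ) hi.intervalIntegrable
      hi.intervalIntegrable, intervalIntegral.integral_of_le (by linarith),
      intervalIntegral.integral_of_le (by linarith),
      setIntegral_congr_fun measurableSet_Ioc fun r hr ↦ hv1 ξ r hr,
      setIntegral_congr_fun measurableSet_Ioc fun r hr ↦ hv2 ξ r hr, integral_neg,
      ← intervalIntegral.integral_of_le (by linarith), ← intervalIntegral.integral_of_le (by linarith),
      intervalIntegral.integral_comp_sub_right (fun r ↦ G (ξ, r)) δ]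
    rw [add_sub_cancel_right, show a + 2 * δ - δ = a + δ by ring, add_neg_cancel]
  obtain ⟨f, hf, hk⟩ := exists_primitive P hDm hD2 (p := a) (q := a + 2 * δ) (by linarith) hv3 hfull hη0
  refine ⟨f, norm_le_of_enorm_sq_le hε.le ?_, ?_⟩
  · refine hf.trans ((mul_le_mul' le_rfl hle).trans ?_)
    rw [← mul_assoc]
    refine mul_le_mul' ?_ le_rfl
    rw [show (4 : ℝ≥0∞) = ENNReal.ofReal 4 by simp, ← ENNReal.ofReal_mul (by positivity)]
    exact ENNReal.ofReal_le_ofReal hconst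
  · filter_upwards [hk] with ξ h t ht
    rw [h t, intervalIntegral.integral_of_le ht.1, intervalIntegral.integral_of_le ht.1]
    congr 1
    exact setIntegral_congr_fun measurableSet_Ioc fun r hr ↦ hv1 ξ r ⟨hr.1, hr.2.trans ht.2⟩

/-- Solutions of the linear equation on short intervals extend to the Bourgain space, with a small
constant for the source. -/
theorem exists_extension {ε : ℝ} (hε : 0 < ε) : ∃ δ₀ : ℝ, 0 < δ₀ ∧ ∀ (a : ℝ) (δ : ℝ),
    0 < δ → δ ≤ δ₀ → ∀ (B : L2R) (G : L2P), ∃ f : L2P, ‖f‖ ≤ 10 * ‖B‖ + ε * ‖G‖ ∧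
      Mild P f B G a (a + δ) := by
  obtain ⟨δ₀, h0, h⟩ := exists_extension_source P hε
  refine ⟨min 1 δ₀, by positivity, fun a δ hδ hδ' B G ↦ ?_⟩
  obtain ⟨f, hf, hfk⟩ := exists_extension_data P a B
  obtain ⟨g, hg, hgk⟩ := h a δ hδ (hδ'.trans (min_le_right _ _)) G
  refine ⟨f + g, (norm_add_le _ _).trans (add_le_add hf hg), ?_⟩
  filter_upwards [hfk, hgk, P.ae_kf_add f g] with ξ h1 h2 h3 t ht
  rw [h3, h1 t ⟨ht.1, ht.2.trans (by linarith [hδ'.trans (min_le_left _ _)])⟩, h2 t ht, mul_add]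

end Extension

/-! ### Locality -/

theorem exists_tst_eq {g : ℝ × ℝ → ℂ} (hg : ContDiff ℝ ((⊤ : ℕ∞) : WithTop ℕ∞) g)
    (hc : HasCompactSupport g) : ∃ Φ : 𝓢(SpaceTime, ℂ), HasCompactSupport Φ ∧
      (∀ η, Φ η = g (η 0, η 1)) ∧ tsupport Φ ⊆ {η | (η 0, η 1) ∈ tsupport g} := by
  set L : SpaceTime → ℝ × ℝ := fun η ↦ (η 0, η 1) with hL
  have hLc : Continuous L := by fun_prop
  have hcs : tsupport (fun η ↦ g (L η)) ⊆ {η | L η ∈ tsupport g} :=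
    closure_minimal (fun η hη ↦ subset_tsupport g hη) ((isClosed_tsupport g).preimage hLc)
  have hcomp : HasCompactSupport fun η ↦ g (L η) := by
    refine IsCompact.of_isClosed_subset (hc.isCompact.image continuous_pair) (isClosed_tsupport _) ?_
    refine hcs.trans fun η hη ↦ ⟨L η, hη, ?_⟩
    ext i
    fin_cases i <;> rfl
  have hsm : ContDiff ℝ ((⊤ : ℕ∞) : WithTop ℕ∞) fun η ↦ g (L η) := by
    refine hg.comp (ContDiff.prodMk ?_ ?_)
    · exact (EuclideanSpace.proj 0 : SpaceTime →L[ℝ] ℝ).contDiff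
    · exact (EuclideanSpace.proj 1 : SpaceTime →L[ℝ] ℝ).contDiff
  exact ⟨hcomp.toSchwartzMap hsm, hcomp, fun η ↦ rfl, hcs⟩

theorem ae_eq_zero_of_tst {F : ℝ × ℝ → ℂ} {a b : ℝ}
    (hF : LocallyIntegrableOn F {p | p.2 ∈ Ioo a b})
    (h : ∀ Φ : 𝓢(SpaceTime, ℂ), HasCompactSupport Φ → tsupport Φ ⊆ {p | p 1 ∈ Ioo a b} →
      ∫ p, F p * tst Φ p = 0) : ∀ᵐ p : ℝ × ℝ, p.2 ∈ Ioo a b → F p = 0 := by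
  have hU : IsOpen {p : ℝ × ℝ | p.2 ∈ Ioo a b} := isOpen_Ioo.preimage continuous_snd
  refine hU.ae_eq_zero_of_integral_contDiff_smul_eq_zero hF fun g hg hgc hgs ↦ ?_
  obtain ⟨Φ, hΦ, hΦg, hΦs⟩ := exists_tst_eq (g := fun p ↦ (g p : ℂ))
    (Complex.ofRealCLM.contDiff.comp hg) (hgc.comp_left (g := ((↑) : ℝ → ℂ)) Complex.ofReal_zero)
  have hsupp : tsupport (fun p ↦ (g p : ℂ)) ⊆ tsupport g :=
    closure_mono fun p hp h0 ↦ hp (by simp [h0])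
  rw [← h Φ hΦ (hΦs.trans fun η hη ↦ hgs (hsupp hη))]
  congr 1 with p
  rw [tst, hΦg, Complex.real_smul, mul_comm]
  rfl

theorem pT_eq_zero {Φ : 𝓢(SpaceTime, ℂ)} {I : Set ℝ} (hΦ : tsupport Φ ⊆ {p | p 1 ∈ I})
    {t : ℝ} (ht : t ∉ I) (ξ : ℝ) : pT Φ (ξ, t) = 0 := by
  have : ∀ x : ℝ, Φ !₂[x, t] = 0 := fun x ↦ by
    by_contra h
    exact ht (hΦ (subset_tsupport _ h))
  simp [pT, this, Real.fourierInv_eq']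

/-- The `L⁶` function `W h` and the curve of `h` are the same distribution. If the curve vanishes on
the slab, so does the pairing of `W h` with every test function supported there. -/
theorem Par.W_eq_zero (P : Par) {h : L2P} {a b : ℝ}
    (hk : ∀ᵐ ξ : ℝ, ∀ t ∈ Ioo a b, kf P h (ξ, t) = 0) :
    ∀ᵐ p : ℝ × ℝ, p.2 ∈ Ioo a b → P.W h p = 0 := by
  refine ae_eq_zero_of_tst (((Lp.memLp (P.W h)).locallyIntegrable
    (by norm_num)).locallyIntegrableOn _) fun Φ hΦ hΦs ↦ ?_
  rw [P.integral_W_mul h hΦ]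
  refine integral_eq_zero_of_ae ?_
  have hk' : ∀ᵐ p : ℝ × ℝ, p.2 ∈ Ioo a b → kf P h p = 0 :=
    ae_of_ae_fst (P := fun p ↦ p.2 ∈ Ioo a b → kf P h p = 0) hk
  filter_upwards [P.coeFn_K h, hk'] with p h1 h2
  rw [h1, Pi.zero_apply]
  by_cases hp : p.2 ∈ Ioo a b
  · rw [h2 hp, zero_mul]
  · rw [wpT, show p = (p.1, p.2) from rfl, pT_eq_zero hΦs hp, mul_zero, mul_zero]

theorem Par.W_sub_ae (P : Par) {f g h : L2P} {a b : ℝ}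
    (hk : ∀ᵐ ξ : ℝ, ∀ t ∈ Ioo a b, kf P f (ξ, t) - kf P g (ξ, t) = kf P h (ξ, t)) :
    ∀ᵐ p : ℝ × ℝ, p.2 ∈ Ioo a b → P.W f p - P.W g p = P.W h p := by
  have h1 : ∀ᵐ ξ : ℝ, ∀ t ∈ Ioo a b, kf P (f - g - h : L2P) (ξ, t) = 0 := by
    filter_upwards [hk, P.ae_kf_sub f g, P.ae_kf_sub (f - g) h] with ξ e1 e2 e3 t ht
    rw [e3, e2, e1 t ht, sub_self]
  have e : P.W (f - g - h) = P.W f - P.W g - P.W h := by rw [map_sub, map_sub]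
  filter_upwards [P.W_eq_zero h1, Lp.coeFn_sub (P.W f - P.W g) (P.W h),
    Lp.coeFn_sub (P.W f) (P.W g)] with p e1 e2 e3 hp
  have := e1 hp
  rw [e, e2, Pi.sub_apply, e3, Pi.sub_apply] at this
  exact sub_eq_zero.1 this

/-! ### The nonlinear equation -/

/-- The restriction of a source to a time interval. -/
def timeCut (a b : ℝ) : L2P →L[ℂ] L2P :=
  mulL 2 volume (m := fun p : ℝ × ℝ ↦ (Ioo a b).indicator (fun _ ↦ (1 : ℂ)) p.2)
    ((measurable_const.indicator measurableSet_Ioo).comp measurable_snd) (C := 1)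
    (fun p ↦ (norm_indicator_le_norm_self _ _).trans (by simp))

theorem coeFn_timeCut (a b : ℝ) (G : L2P) : timeCut a b G =ᵐ[volume]
    fun p ↦ (Ioo a b).indicator (fun _ ↦ (1 : ℂ)) p.2 * G p := coeFn_mulL _ _ G

theorem norm_timeCut_le (a b : ℝ) (G : L2P) : ‖timeCut a b G‖ ≤ ‖G‖ := by
  have := norm_mulL_le (p := 2) (μ := volume)
    (m := fun p : ℝ × ℝ ↦ (Ioo a b).indicator (fun _ ↦ (1 : ℂ)) p.2)
    ((measurable_const.indicator measurableSet_Ioo).comp measurable_snd) (C := 1)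
    (fun p ↦ (norm_indicator_le_norm_self _ _).trans (by simp)) G
  rwa [one_mul] at this

theorem timeCut_ae (a b : ℝ) (G : L2P) :
    ∀ᵐ p : ℝ × ℝ, p.2 ∈ Ioo a b → timeCut a b G p = G p := by
  filter_upwards [coeFn_timeCut a b G] with p h hp
  rw [h, indicator_of_mem hp, one_mul]

theorem timeCut_congr {a b : ℝ} {G G' : L2P} (h : ∀ᵐ p : ℝ × ℝ, p.2 ∈ Ioo a b → G p = G' p) :
    timeCut a b G = timeCut a b G' := by
  refine Lp.ext ?_
  filter_upwards [coeFn_timeCut a b G, coeFn_timeCut a b G', h] with p h1 h2 h3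
  rw [h1, h2]
  by_cases hp : p.2 ∈ Ioo a b
  · rw [h3 hp]
  · rw [indicator_of_notMem hp, zero_mul, zero_mul]

theorem ae_intervalIntegrable (G : L2P) :
    ∀ᵐ ξ : ℝ, ∀ a b : ℝ, IntervalIntegrable (fun r ↦ G (ξ, r)) volume a b := by
  filter_upwards [ae_memLp_fiber (Lp.memLp G)] with ξ h a b
  exact (intervalIntegrable_iff' (by simp)).2
    ((h.locallyIntegrable (by norm_num)).integrableOn_isCompact isCompact_uIcc)

theorem ae_ae_of_ae_plane {p : ℝ × ℝ → Prop} (h : ∀ᵐ z, p z) : ∀ᵐ ξ : ℝ, ∀ᵐ t : ℝ, p (ξ, t) := by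
  rw [Measure.volume_eq_prod] at h
  exact Measure.ae_ae_of_ae_prod h

namespace Par

variable (P : Par)

theorem sub_eq_of_mild {f g h : L2P} {B B' : L2R} {G G' : L2P} {a b : ℝ} (hf : Mild P f B G a b)
    (hg : Mild P g B' G' a b) (hh : Mild P h (B - B') (G - G' : L2P) a b) :
    ∀ᵐ ξ : ℝ, ∀ t ∈ Icc a b, kf P f (ξ, t) - kf P g (ξ, t) = kf P h (ξ, t) := by
  filter_upwards [hf, hg, hh, Lp.coeFn_sub B B', ae_ae_of_ae_plane (Lp.coeFn_sub G G'),
    ae_intervalIntegrable G, ae_intervalIntegrable G'] with ξ h1 h2 h3 h4 h5 h6 h7 t ht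
  have e : ∫ r in a..t, (G - G' : L2P) (ξ, r) = (∫ r in a..t, G (ξ, r)) - ∫ r in a..t, G' (ξ, r) := by
    rw [← intervalIntegral.integral_sub (h6 a t) (h7 a t)]
    refine intervalIntegral.integral_congr_ae ?_
    filter_upwards [h5] with r hr _
    rw [hr, Pi.sub_apply]
  rw [h1 t ht, h2 t ht, h3 t ht, h4, Pi.sub_apply, e]
  ring

/-- Only values on the interval enter, so `f - g` may be replaced by any `h` with the same curve
there. The gain is that `h` can be taken much smaller than the difference of two arbitrary
extensions. -/
theorem norm_timeCut_src_sub_le {C : ℝ} (hC : 0 ≤ C)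
    (hsrc : ∀ f g h : L2P, ‖P.src f g h‖ ≤ C * (‖f‖ * (‖g‖ * ‖h‖))) {M : ℝ} {f g h : L2P}
    (hf : ‖f‖ ≤ M) (hg : ‖g‖ ≤ M) {a b : ℝ}
    (hk : ∀ᵐ ξ : ℝ, ∀ t ∈ Icc a b, kf P f (ξ, t) - kf P g (ξ, t) = kf P h (ξ, t)) :
    ‖timeCut a b (P.src f f f) - timeCut a b (P.src g g g)‖ ≤ 3 * C * M ^ 2 * ‖h‖ := by
  have hM : 0 ≤ M := (norm_nonneg _).trans hf
  have hW := P.W_sub_ae (a := a) (b := b) (f := f) (g := g) (h := h) (by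
    filter_upwards [hk] with ξ hξ t ht
    exact hξ t (Ioo_subset_Icc_self ht))
  have h1 := P.src_sub_src_ae measurableSet_Ioo hW
  have h2 : timeCut a b (P.src f f f) - timeCut a b (P.src g g g) =
      timeCut a b (P.src h f f + P.src h f g + P.src h g g) := by
    rw [← map_sub]
    refine timeCut_congr ?_
    filter_upwards [h1, Lp.coeFn_sub (P.src f f f) (P.src g g g)] with p e1 e2 hp
    rw [e2, Pi.sub_apply, e1 hp]
  rw [h2]
  refine (norm_timeCut_le _ _ _).trans ((norm_add₃_le).trans ?_)
  have b1 : ‖P.src h f f‖ ≤ C * (‖h‖ * (M * M)) := (hsrc h f f).trans (by gcongr)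
  have b2 : ‖P.src h f g‖ ≤ C * (‖h‖ * (M * M)) := (hsrc h f g).trans (by gcongr)
  have b3 : ‖P.src h g g‖ ≤ C * (‖h‖ * (M * M)) := (hsrc h g g).trans (by gcongr)
  calc _ ≤ C * (‖h‖ * (M * M)) + C * (‖h‖ * (M * M)) + C * (‖h‖ * (M * M)) := by gcongr
    _ = _ := by ring

theorem mild_timeCut_iff {f : L2P} {B : L2R} {G : L2P} {a b : ℝ} :
    Mild P f B (timeCut a b G) a b ↔ Mild P f B G a b := by
  have h := timeCut_ae a b G
  constructor
  · intro hm
    exact hm.congr h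
  · intro hm
    refine hm.congr ?_
    filter_upwards [h] with p hp hp2
    exact (hp hp2).symm

/-- Local existence for the equation in the interaction picture. -/
theorem exists_mild {R : ℝ} (hR : 0 ≤ R) : ∃ δ₀ : ℝ, 0 < δ₀ ∧ ∀ (a δ : ℝ), 0 < δ → δ ≤ δ₀ →
    ∀ B : L2R, ‖B‖ ≤ R → ∃ f : L2P, ‖f‖ ≤ 10 * R + 1 ∧ Mild P f B (P.src f f f) a (a + δ) := by
  obtain ⟨C, hC, hsrc⟩ := P.exists_norm_src_le
  set M : ℝ := 10 * R + 1 with hM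
  have hM0 : 0 < M := by positivity
  set ρ : ℝ := C * M ^ 3 with hρ
  have hρ0 : 0 ≤ ρ := by positivity
  -- Small enough for `ερ ≤ 1`, which keeps the ball invariant, and for `3CM²ε ≤ 1/2`, which makes
  -- the map a contraction.
  set ε : ℝ := 1 / (6 * C * M ^ 2 + ρ + 1) with hε
  have hden : 0 < 6 * C * M ^ 2 + ρ + 1 := by positivity
  have hε0 : 0 < ε := by positivity
  have hε1 : ε * ρ ≤ 1 := by
    rw [hε, div_mul_eq_mul_div, one_mul, div_le_one hden]
    have : 0 ≤ 6 * C * M ^ 2 := by positivity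
    linarith
  have hε2 : 3 * C * M ^ 2 * ε ≤ 1 / 2 := by
    rw [hε, mul_one_div, div_le_iff₀ hden]
    linarith
  obtain ⟨δ₀, h0, hext⟩ := exists_extension P hε0
  refine ⟨δ₀, h0, fun a δ hδ hδ' B hB ↦ ?_⟩
  -- The unknown of the fixed point problem is the source `G`; `F G` is some extension of the linear
  -- solution, and nothing is assumed on how it depends on `G`.
  choose F hF hFm using hext a δ hδ hδ' B
  -- Extensions with zero data. On the interval `H (G - G')` has the curve of `F G - F G'`, and its
  -- norm is at most `ε‖G - G'‖`.
  choose H hH hHm using hext a δ hδ hδ' (B - B)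
  set Γ : L2P → L2P := fun G ↦ timeCut a (a + δ) (P.src (F G) (F G) (F G)) with hΓ
  have hFM : ∀ G ∈ Metric.closedBall (0 : L2P) ρ, ‖F G‖ ≤ M := fun G hG ↦ by
    rw [mem_closedBall_zero_iff] at hG
    calc ‖F G‖ ≤ 10 * ‖B‖ + ε * ‖G‖ := hF G
      _ ≤ 10 * R + ε * ρ := by gcongr
      _ ≤ M := by rw [hM]; gcongr
  have hmaps : MapsTo Γ (Metric.closedBall 0 ρ) (Metric.closedBall 0 ρ) := fun G hG ↦ by
    rw [mem_closedBall_zero_iff]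
    refine (norm_timeCut_le _ _ _).trans ((hsrc _ _ _).trans ?_)
    have := hFM G hG
    calc C * (‖F G‖ * (‖F G‖ * ‖F G‖)) ≤ C * (M * (M * M)) := by gcongr
      _ = ρ := by rw [hρ]; ring
  have hcontr : ContractingWith (1 / 2 : ℝ≥0) (hmaps.restrict Γ _ _) := by
    refine ⟨by rw [← NNReal.coe_lt_coe]; norm_num, LipschitzWith.of_dist_le_mul fun G G' ↦ ?_⟩
    rw [Subtype.dist_eq, Subtype.dist_eq, dist_eq_norm, dist_eq_norm]
    have hd := P.sub_eq_of_mild (hFm G) (hFm G') (hHm (G - G'))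
    have h1 := P.norm_timeCut_src_sub_le hC hsrc (hFM G G.2) (hFM G' G'.2) hd
    have h2 : ‖H (G - G' : L2P)‖ ≤ ε * ‖(G - G' : L2P)‖ := by
      refine (hH _).trans (le_of_eq ?_)
      rw [sub_self, norm_zero, mul_zero, zero_add]
    refine h1.trans ?_
    calc 3 * C * M ^ 2 * ‖H (G - G' : L2P)‖ ≤ 3 * C * M ^ 2 * (ε * ‖(G - G' : L2P)‖) := by gcongr
      _ = (3 * C * M ^ 2 * ε) * ‖(G - G' : L2P)‖ := by ring
      _ ≤ 1 / 2 * ‖(G - G' : L2P)‖ := by gcongr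
      _ = _ := by norm_num
  obtain ⟨G, hG, hfix, -⟩ := hcontr.exists_fixedPoint' Metric.isClosed_closedBall.isComplete hmaps
    (Metric.mem_closedBall_self hρ0) (edist_ne_top _ _)
  refine ⟨F G, hFM G hG, ?_⟩
  have h := hFm G
  rw [← show Γ G = G from hfix] at h
  have h' := P.mild_timeCut_iff.1 h
  rwa [show Γ G = G from hfix] at h'

/-- Two solutions of the equation in the interaction picture depend on the data in a Lipschitz way
on short intervals. -/
theorem exists_mild_sub (M : ℝ) : ∃ δ₀ : ℝ, 0 < δ₀ ∧ ∀ (a δ : ℝ), 0 < δ → δ ≤ δ₀ →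
    ∀ (f g : L2P) (B B' : L2R), ‖f‖ ≤ M → ‖g‖ ≤ M → Mild P f B (P.src f f f) a (a + δ) →
      Mild P g B' (P.src g g g) a (a + δ) → ∃ h : L2P, ‖h‖ ≤ 20 * ‖B - B'‖ ∧
        ∀ᵐ ξ : ℝ, ∀ t ∈ Icc a (a + δ), kf P f (ξ, t) - kf P g (ξ, t) = kf P h (ξ, t) := by
  obtain ⟨C, hC, hsrc⟩ := P.exists_norm_src_le
  set ε : ℝ := 1 / (6 * C * M ^ 2 + 1) with hε
  have hden : 0 < 6 * C * M ^ 2 + 1 := by positivity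
  have hε0 : 0 < ε := by positivity
  have hε2 : 3 * C * M ^ 2 * ε ≤ 1 / 2 := by
    rw [hε, mul_one_div, div_le_iff₀ hden]
    linarith
  obtain ⟨δ₀, h0, hext⟩ := exists_extension P hε0
  refine ⟨δ₀, h0, fun a δ hδ hδ' f g B B' hf hg hfm hgm ↦ ?_⟩
  rw [← P.mild_timeCut_iff] at hfm hgm
  obtain ⟨h, hh, hhm⟩ := hext a δ hδ hδ' (B - B')
    (timeCut a (a + δ) (P.src f f f) - timeCut a (a + δ) (P.src g g g))
  have hd := P.sub_eq_of_mild hfm hgm hhm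
  have h1 := P.norm_timeCut_src_sub_le hC hsrc hf hg hd
  refine ⟨h, ?_, hd⟩
  -- The contribution of the sources is absorbed by `‖h‖ / 2`, which turns the constant `10` of the
  -- extension into `20`.
  have h2 : ε * ‖timeCut a (a + δ) (P.src f f f) - timeCut a (a + δ) (P.src g g g)‖ ≤
      1 / 2 * ‖h‖ := by
    calc _ ≤ ε * (3 * C * M ^ 2 * ‖h‖) := by gcongr
      _ = (3 * C * M ^ 2 * ε) * ‖h‖ := by ring
      _ ≤ 1 / 2 * ‖h‖ := by gcongr
  linarith

/-! ### Restarting, and uniqueness on intervals of any length -/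

/-- The data at a later time in the interaction picture. -/
theorem exists_restart (f : L2P) (a : ℝ) :
    ∃ B : L2R, ∀ᵐ ξ : ℝ, P.ep (ξ, a) * B ξ = kf P f (ξ, a) := by
  have hm : Measurable fun ξ : ℝ ↦ (P.ep (ξ, a))⁻¹ :=
    (P.continuous_ep.measurable.comp measurable_prodMk_right).inv
  have hb : ∀ ξ : ℝ, ‖(P.ep (ξ, a))⁻¹‖ ≤ 1 := fun ξ ↦ by rw [norm_inv, P.norm_ep, inv_one]
  refine ⟨mulL 2 volume hm hb (P.at_ a f), ?_⟩
  filter_upwards [coeFn_mulL hm hb (P.at_ a f), P.coeFn_at a f] with ξ h1 h2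
  have hne : P.ep (ξ, a) ≠ 0 := by
    rw [← norm_ne_zero_iff, P.norm_ep]
    exact one_ne_zero
  rw [h1, h2, mul_inv_cancel_left₀ hne]

theorem mild_restart {f : L2P} {B B' : L2R} {G : L2P} {a b c : ℝ} (hab : a ≤ b)
    (h : Mild P f B G a c) (hB : ∀ᵐ ξ : ℝ, P.ep (ξ, b) * B' ξ = kf P f (ξ, b)) {d : ℝ}
    (hbd : b ≤ d) (hd : d ≤ c) : Mild P f B' G b d := by
  filter_upwards [h, hB, ae_intervalIntegrable G] with ξ h1 h2 h3 t ht
  have hne : P.ep (ξ, b) ≠ 0 := by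
    rw [← norm_ne_zero_iff, P.norm_ep]
    exact one_ne_zero
  rw [h1 b ⟨hab, hbd.trans hd⟩] at h2
  rw [h1 t ⟨hab.trans ht.1, ht.2.trans hd⟩, mul_left_cancel₀ hne h2,
    ← intervalIntegral.integral_add_adjacent_intervals (h3 a b) (h3 b t), add_assoc]

theorem ae_kf_eq_of_sub_eq_zero {f g h : L2P} {a b : ℝ} (hh : h = 0)
    (hk : ∀ᵐ ξ : ℝ, ∀ t ∈ Icc a b, kf P f (ξ, t) - kf P g (ξ, t) = kf P h (ξ, t)) :
    ∀ᵐ ξ : ℝ, ∀ t ∈ Icc a b, kf P f (ξ, t) = kf P g (ξ, t) := by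
  have h0 : ∀ᵐ ξ : ℝ, ∀ t, kf P h (ξ, t) = 0 := by
    filter_upwards [P.ae_kf_sub f f] with ξ h1 t
    rw [hh, ← sub_self f, h1, sub_self]
  filter_upwards [hk, h0] with ξ h1 h2 t ht
  rw [← sub_eq_zero, h1 t ht, h2]

/-- Uniqueness for the equation in the interaction picture. -/
theorem mild_unique {f g : L2P} {B : L2R} {T : ℝ} (hT : 0 < T) (hf : Mild P f B (P.src f f f) 0 T)
    (hg : Mild P g B (P.src g g g) 0 T) :
    ∀ᵐ ξ : ℝ, ∀ t ∈ Icc 0 T, kf P f (ξ, t) = kf P g (ξ, t) := by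
  -- The step length depends on the norms of both coefficients, which the data do not control. Hence
  -- `[0, T]` is covered by finitely many short intervals, with a restart at each.
  obtain ⟨δ₀, h0, hloc⟩ := P.exists_mild_sub (max ‖f‖ ‖g‖)
  obtain ⟨N, hN⟩ := exists_nat_gt (T / δ₀)
  have hN0 : (0 : ℝ) < N := (by positivity : 0 < T / δ₀).trans hN
  set δ : ℝ := T / N with hδ
  have hδ0 : 0 < δ := by positivity
  have hδ1 : δ ≤ δ₀ := by
    rw [hδ, div_le_iff₀ hN0]
    rw [div_lt_iff₀ h0] at hN
    linarith
  have hNδ : N * δ = T := by rw [hδ]; field_simp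
  have key : ∀ n : ℕ, n ≤ N → ∀ᵐ ξ : ℝ, ∀ t ∈ Icc 0 (n * δ), kf P f (ξ, t) = kf P g (ξ, t) := by
    intro n
    induction n with
    | zero =>
      intro _
      filter_upwards [hf, hg] with ξ h1 h2 t ht
      have hi : t ∈ Icc 0 T := ⟨ht.1, ht.2.trans (by simpa using hT.le)⟩
      have ht0 : t = 0 := le_antisymm (by simpa using ht.2) ht.1
      rw [h1 t hi, h2 t hi, ht0]
      simp
    | succ n ih =>
      intro hn
      have ih' := ih (by omega)
      have hnT : n * δ + δ ≤ T := by
        rw [← hNδ]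
        have : ((n + 1 : ℕ) : ℝ) ≤ N := by exact_mod_cast hn
        push_cast at this
        nlinarith
      have hn0 : 0 ≤ n * δ := by positivity
      obtain ⟨B', hB'⟩ := P.exists_restart f (n * δ)
      have hB'' : ∀ᵐ ξ : ℝ, P.ep (ξ, n * δ) * B' ξ = kf P g (ξ, n * δ) := by
        filter_upwards [hB', ih'] with ξ h1 h2
        rw [h1, h2 _ ⟨hn0, le_rfl⟩]
      obtain ⟨h, hh, hk⟩ := hloc (n * δ) δ hδ0 hδ1 f g B' B' (le_max_left _ _) (le_max_right _ _)
        (P.mild_restart hn0 hf hB' (by linarith) hnT) (P.mild_restart hn0 hg hB'' (by linarith) hnT)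
      rw [sub_self, norm_zero, mul_zero] at hh
      have := P.ae_kf_eq_of_sub_eq_zero (norm_le_zero_iff.1 hh) hk
      filter_upwards [ih', this] with ξ h1 h2 t ht
      rcases le_total t (n * δ) with hle | hle
      · exact h1 t ⟨ht.1, hle⟩
      · refine h2 t ⟨hle, ht.2.trans (le_of_eq ?_)⟩
        push_cast
        ring
  have := key N le_rfl
  rwa [hNδ] at this

end Par

/-! ### The weak form of the linear equation -/

section Weak

variable {Φ Ψ : 𝓢(SpaceTime, ℂ)}

theorem pT_add (Φ Ψ : 𝓢(SpaceTime, ℂ)) (p : ℝ × ℝ) : pT (Φ + Ψ) p = pT Φ p + pT Ψ p := by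
  obtain ⟨ξ, t⟩ := p
  rw [pT_eq_slice, pT_eq_slice, pT_eq_slice, slice, map_add, FourierTransform.fourierInv_add]
  rfl

theorem pT_smul (c : ℂ) (Φ : 𝓢(SpaceTime, ℂ)) (p : ℝ × ℝ) : pT (c • Φ) p = c * pT Φ p := by
  obtain ⟨ξ, t⟩ := p
  rw [pT_eq_slice, pT_eq_slice, slice, map_smul, FourierTransform.fourierInv_smul]
  rfl

theorem pT_iterated_dirX (Φ : 𝓢(SpaceTime, ℂ)) (n : ℕ) (p : ℝ × ℝ) :
    pT (∂^{fun _ : Fin n ↦ dirX} Φ) p = (-(2 * Real.pi * Complex.I * p.1)) ^ n * pT Φ p := by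
  induction n with
  | zero => simp [LineDeriv.iteratedLineDerivOp_fin_zero]
  | succ n ih =>
    rw [LineDeriv.iteratedLineDerivOp_succ_left, pT_dirX]
    change _ * pT (∂^{fun _ : Fin n ↦ dirX} Φ) p = _
    rw [ih]
    ring

theorem tsupport_iterated_dirX (Φ : 𝓢(SpaceTime, ℂ)) (n : ℕ) :
    tsupport (∂^{fun _ : Fin n ↦ dirX} Φ : 𝓢(SpaceTime, ℂ)) ⊆ tsupport Φ := by
  induction n with
  | zero => simp [LineDeriv.iteratedLineDerivOp_fin_zero]
  | succ n ih =>
    rw [LineDeriv.iteratedLineDerivOp_succ_left]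
    exact (SchwartzMap.tsupport_lineDerivOp_subset _ _).trans ih

/-- The adjoint of the linear operator of the equation, up to sign. -/
def lin (α β : ℝ) (Φ : 𝓢(SpaceTime, ℂ)) : 𝓢(SpaceTime, ℂ) :=
  ∂_{dirT} Φ + ((α : ℂ) • ∂^{fun _ : Fin 3 ↦ dirX} Φ + (β : ℂ) • ∂^{fun _ : Fin 5 ↦ dirX} Φ)

theorem tsupport_lin (α β : ℝ) (Φ : 𝓢(SpaceTime, ℂ)) : tsupport (lin α β Φ) ⊆ tsupport Φ := by
  refine (tsupport_add (∂_{dirT} Φ : 𝓢(SpaceTime, ℂ)) ((α : ℂ) • ∂^{fun _ : Fin 3 ↦ dirX} Φ +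
    (β : ℂ) • ∂^{fun _ : Fin 5 ↦ dirX} Φ : 𝓢(SpaceTime, ℂ))).trans
    (union_subset (SchwartzMap.tsupport_lineDerivOp_subset _ _) ?_)
  refine (tsupport_add ((α : ℂ) • ∂^{fun _ : Fin 3 ↦ dirX} Φ : 𝓢(SpaceTime, ℂ))
    ((β : ℂ) • ∂^{fun _ : Fin 5 ↦ dirX} Φ : 𝓢(SpaceTime, ℂ))).trans (union_subset ?_ ?_)
  · exact (tsupport_smul_subset_right (fun _ ↦ (α : ℂ)) _).trans (tsupport_iterated_dirX Φ 3)
  · exact (tsupport_smul_subset_right (fun _ ↦ (β : ℂ)) _).trans (tsupport_iterated_dirX Φ 5)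

theorem isTest_of_tsupport_subset {T : ℝ} (hΦ : IsTest T Φ) (h : tsupport Ψ ⊆ tsupport Φ) :
    IsTest T Ψ :=
  ⟨IsCompact.of_isClosed_subset hΦ.1 (isClosed_tsupport _) h, h.trans hΦ.2⟩

/-- On the transformed side `α(-2πiξ)³ + β(-2πiξ)⁵ = 2πi Q(ξ)`, so dispersion becomes multiplication
by an imaginary symbol. -/
theorem pT_lin {α β s : ℝ} {hβ : β ≠ 0} {hs : -(1 / 4) ≤ s} (Φ : 𝓢(SpaceTime, ℂ)) (p : ℝ × ℝ) :
    pT (lin α β Φ) p = pT (∂_{dirT} Φ) p +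
      2 * Real.pi * Complex.I * (prm α β s hβ hs).Q p.1 * pT Φ p := by
  rw [lin, pT_add, pT_add, pT_smul, pT_smul, pT_iterated_dirX, pT_iterated_dirX]
  have h3 : Complex.I ^ 3 = -Complex.I := by rw [pow_succ, Complex.I_sq]; ring
  have h5 : Complex.I ^ 5 = Complex.I := by
    rw [show 5 = 3 + 2 by norm_num, pow_add, h3, Complex.I_sq]; ring
  simp only [Par.Q, ph, prm]
  push_cast
  ring_nf
  rw [h3, h5]
  ring

/-- The transform of a test function is differentiable in time. -/
theorem hasDerivAt_pT (hΦ : HasCompactSupport Φ) (ξ t : ℝ) :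
    HasDerivAt (fun t ↦ pT Φ (ξ, t)) (pT (∂_{dirT} Φ) (ξ, t)) t := by
  have hΦ' := hasCompactSupport_lineDeriv hΦ dirT
  obtain ⟨C, hC, hb⟩ := exists_norm_le (∂_{dirT} Φ)
  obtain ⟨R, hR, hs⟩ := exists_support_bound hΦ'
  simp only [pT, Real.fourierInv_eq']
  set k : ℝ → ℂ := fun x ↦ Complex.exp (↑(2 * Real.pi * inner ℝ x ξ) * Complex.I) with hk
  have hkc : Continuous k := by simp only [hk]; fun_prop
  have hkn : ∀ x, ‖k x‖ = 1 := fun x ↦ Complex.norm_exp_ofReal_mul_I _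
  refine (hasDerivAt_integral_of_dominated_loc_of_deriv_le (bound := (Icc (-R) R).indicator fun _ ↦ C)
    (F := fun t x ↦ k x • Φ !₂[x, t]) (F' := fun t x ↦ k x • (∂_{dirT} Φ) !₂[x, t])
    (s := univ) Filter.univ_mem ?_ ?_ ?_ ?_ ?_ ?_).2
  · exact Eventually.of_forall fun t ↦ (hkc.smul (continuous_slice_fst Φ t)).aestronglyMeasurable
  · refine (integrable_slice_fst Φ t).norm.mono' (hkc.smul
      (continuous_slice_fst Φ t)).aestronglyMeasurable (Eventually.of_forall fun x ↦ ?_)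
    rw [norm_smul, hkn, one_mul]
  · exact (hkc.smul (continuous_slice_fst (∂_{dirT} Φ) t)).aestronglyMeasurable
  · refine Eventually.of_forall fun x t _ ↦ ?_
    rw [norm_smul, hkn, one_mul]
    by_cases hx : x ∈ Icc (-R) R
    · rw [indicator_of_mem hx]; exact hb _
    · rw [indicator_of_notMem hx, norm_le_zero_iff]
      by_contra h
      exact hx (abs_le.1 (hs x t h).1)
  · exact (integrable_indicator_iff measurableSet_Icc).2 (integrableOn_const (by simp))
  · exact Eventually.of_forall fun x t _ ↦ (hasDerivAt_slice_snd Φ x t).const_smul (k x)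

theorem continuous_pT_snd (hΦ : HasCompactSupport Φ) (ξ : ℝ) : Continuous fun t ↦ pT Φ (ξ, t) :=
  continuous_iff_continuousAt.2 fun t ↦ (hasDerivAt_pT hΦ ξ t).continuousAt

theorem integrable_pT_fst (Φ : 𝓢(SpaceTime, ℂ)) (t : ℝ) : Integrable fun ξ ↦ pT Φ (ξ, t) := by
  simp_rw [pT_eq_slice]
  exact (𝓕⁻ (slice t Φ)).integrable

theorem fourier_pT (Φ : 𝓢(SpaceTime, ℂ)) (x t : ℝ) : 𝓕 (fun ξ ↦ pT Φ (ξ, t)) x = Φ !₂[x, t] := by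
  have e : (fun ξ ↦ pT Φ (ξ, t)) = (𝓕⁻ (slice t Φ) : 𝓢(ℝ, ℂ)) := funext fun ξ ↦ pT_eq_slice Φ ξ t
  rw [e, ← SchwartzMap.fourier_coe, FourierTransform.fourier_fourierInv_eq, slice_apply]

theorem ofReal_wt_neg_mul (s ξ : ℝ) : (wt s ξ : ℂ) * wt (-s) ξ = 1 := by
  rw [← Complex.ofReal_mul, mul_comm, wt_neg_mul, Complex.ofReal_one]

theorem Par.srcMul_mul_ep (P : Par) (p : ℝ × ℝ) :
    P.srcMul p * (P.ep p * wt (-P.s) p.1) = -(2 * Real.pi * Complex.I * p.1) / 3 := by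
  have h1 := ofReal_wt_neg_mul P.s p.1
  have h2 : Complex.exp (-(2 * Real.pi * Complex.I * P.Q p.1 * p.2)) * P.ep p = 1 := by
    rw [Par.ep, ← Complex.exp_add, neg_add_cancel, Complex.exp_zero]
  rw [Par.srcMul]
  calc _ = -(2 * Real.pi * Complex.I * p.1 / 3) * ((wt P.s p.1 : ℂ) * wt (-P.s) p.1) *
        (Complex.exp (-(2 * Real.pi * Complex.I * P.Q p.1 * p.2)) * P.ep p) := by ring
    _ = _ := by rw [h1, h2]; ring

/-- The nonlinear term, tested in the space variables or in frequency. -/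
theorem Par.integral_tri_mul (P : Par) (f : L2P) (hΦ : HasCompactSupport Φ) :
    ∫ p, P.tri f f f p / 3 * tst (∂_{dirX} Φ) p =
      ∫ p, P.src f f f p * (P.ep p * wpT (-P.s) Φ p) := by
  have hΦ' := hasCompactSupport_lineDeriv hΦ dirX
  have h0 : MemLp (pT (∂_{dirX} Φ)) 2 := by
    have := memLp_wpT hΦ' 0
    refine this.ae_eq (Eventually.of_forall fun p ↦ ?_)
    rw [wpT, wt_zero, Complex.ofReal_one, one_mul]
  have h := integral_Fx_mul (f := P.tri f f f) (Ψ := pT (∂_{dirX} Φ)) (Ψ' := tst (∂_{dirX} Φ))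
    h0 ((nice_tst hΦ').memLp 2) (fun t ↦ integrable_pT_fst _ t)
    (fun ξ t ↦ (fourier_pT (∂_{dirX} Φ) ξ t).symm)
  calc ∫ p, P.tri f f f p / 3 * tst (∂_{dirX} Φ) p
      = (1 / 3 : ℂ) * ∫ p, P.tri f f f p * tst (∂_{dirX} Φ) p := by
        rw [← integral_const_mul]
        congr 1 with p
        ring
    _ = ∫ p, (1 / 3 : ℂ) * (Fx (P.tri f f f) p * pT (∂_{dirX} Φ) p) := by
        rw [← h, integral_const_mul]
    _ = _ := by
        refine integral_congr_ae ?_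
        filter_upwards [P.coeFn_src f f f] with p hp
        have e := P.srcMul_mul_ep p
        rw [hp, wpT, pT_dirX]
        calc _ = Fx (P.tri f f f) p * pT Φ p * (-(2 * Real.pi * Complex.I * p.1) / 3) := by ring
          _ = _ := by rw [← e]; ring

theorem memLp_ep_wpT (P : Par) (hΦ : HasCompactSupport Φ) :
    MemLp (fun p ↦ P.ep p * wpT (-P.s) Φ p) 2 :=
  memLp_bdd_mul P.continuous_ep.measurable (C := 1) (fun p ↦ (P.norm_ep p).le) (memLp_wpT hΦ _)

variable {α β s T : ℝ} {hβ : β ≠ 0} {hs : -(1 / 4) ≤ s}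

theorem hasDerivAt_ep_mul_pT (hΦ : HasCompactSupport Φ) (ξ t : ℝ) :
    HasDerivAt (fun t ↦ (prm α β s hβ hs).ep (ξ, t) * pT Φ (ξ, t))
      ((prm α β s hβ hs).ep (ξ, t) * pT (lin α β Φ) (ξ, t)) t := by
  set P := prm α β s hβ hs with hP
  have h1 : HasDerivAt (fun t : ℝ ↦ P.ep (ξ, t))
      (P.ep (ξ, t) * (2 * Real.pi * Complex.I * P.Q ξ)) t := by
    have := ((hasDerivAt_id (t : ℂ)).const_mul (2 * Real.pi * Complex.I * P.Q ξ)).cexp.comp_ofReal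
    simpa [Par.ep] using this
  refine (h1.mul (hasDerivAt_pT hΦ ξ t)).congr_deriv ?_
  rw [pT_lin (s := s) (hβ := hβ) (hs := hs)]
  simp only
  rw [← hP]
  ring

/-- A mild solution of the linear equation is a weak solution. -/
theorem Mild.weak {f : L2P} {B : L2R} {G : L2P} (h : Mild (prm α β s hβ hs) f B G 0 T)
    (hΦ : IsTest T Φ) :
    (∫ p, (prm α β s hβ hs).K f p * wpT (-s) (lin α β Φ) p) +
      ∫ p, G p * ((prm α β s hβ hs).ep p * wpT (-s) Φ p) = 0 := by
  set P := prm α β s hβ hs with hP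
  have hL := isTest_of_tsupport_subset hΦ (tsupport_lin α β Φ)
  have i1 : Integrable fun p ↦ P.K f p * wpT (-s) (lin α β Φ) p :=
    (Lp.memLp _).integrable_mul (memLp_wpT hL.1 _)
  have i2 : Integrable fun p ↦ G p * (P.ep p * wpT (-s) Φ p) :=
    (Lp.memLp _).integrable_mul (memLp_ep_wpT P hΦ.1)
  rw [← integral_add i1 i2, integral_plane
    (F := fun p ↦ P.K f p * wpT (-s) (lin α β Φ) p + G p * (P.ep p * wpT (-s) Φ p)) (i1.add i2)]
  refine integral_eq_zero_of_ae ?_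
  filter_upwards [h, ae_ae_of_ae_plane (P.coeFn_K f), ae_intervalIntegrable G] with ξ h1 h2 h3
  rw [Pi.zero_apply]
  rcases le_or_gt T 0 with hT | hT
  · have hE : ∀ t, t ∉ Ioo 0 T := fun t ht ↦ by linarith [ht.1, ht.2]
    refine integral_eq_zero_of_ae (Eventually.of_forall fun t ↦ ?_)
    simp only [Pi.zero_apply, wpT]
    rw [pT_eq_zero hΦ.2 (hE t), pT_eq_zero hL.2 (hE t)]
    ring
  -- Multiplication by the group turns `lin` into a time derivative: `ψ' = ep · pT (lin Φ)`. At
  -- fixed frequency the claim is then an integration by parts in time.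
  set ψ : ℝ → ℂ := fun t ↦ P.ep (ξ, t) * pT Φ (ξ, t) with hψ
  set ψ' : ℝ → ℂ := fun t ↦ P.ep (ξ, t) * pT (lin α β Φ) (ξ, t) with hψ'
  have hd : ∀ t, HasDerivAt ψ (ψ' t) t := fun t ↦ hasDerivAt_ep_mul_pT hΦ.1 ξ t
  have hepc : Continuous fun t ↦ P.ep (ξ, t) := P.continuous_ep.comp (by fun_prop)
  have hcont : Continuous ψ' := hepc.mul (continuous_pT_snd hL.1 ξ)
  have hψc : Continuous ψ := hepc.mul (continuous_pT_snd hΦ.1 ξ)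
  have hψ0 : ψ 0 = 0 := by simp only [hψ]; rw [pT_eq_zero hΦ.2 (by simp), mul_zero]
  have hψT : ψ T = 0 := by simp only [hψ]; rw [pT_eq_zero hΦ.2 (by simp), mul_zero]
  have hparts := integral_deriv_mul_primitive hT.le (h3 0 T).1 hd hcont
  rw [hψT, zero_mul, zero_sub] at hparts
  have hfund : ∫ t in (0 : ℝ)..T, ψ' t = 0 := by
    rw [intervalIntegral.integral_eq_sub_of_hasDerivAt (fun t _ ↦ hd t)
      (hcont.intervalIntegrable _ _), hψ0, hψT, sub_zero]
  have hprim : ContinuousOn (fun t ↦ ∫ r in (0 : ℝ)..t, G (ξ, r)) (uIcc 0 T) :=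
    (intervalIntegral.continuous_primitive (fun a b ↦ h3 a b) 0).continuousOn
  calc ∫ t, P.K f (ξ, t) * wpT (-s) (lin α β Φ) (ξ, t) + G (ξ, t) * (P.ep (ξ, t) * wpT (-s) Φ (ξ, t))
      = ∫ t in Ioc 0 T, P.K f (ξ, t) * wpT (-s) (lin α β Φ) (ξ, t) +
          G (ξ, t) * (P.ep (ξ, t) * wpT (-s) Φ (ξ, t)) := by
        refine (setIntegral_eq_integral_of_forall_compl_eq_zero fun t ht ↦ ?_).symm
        have hE : t ∉ Ioo 0 T := fun h' ↦ ht (Ioo_subset_Ioc_self h')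
        simp only [wpT]
        rw [pT_eq_zero hΦ.2 hE, pT_eq_zero hL.2 hE]
        ring
    _ = ∫ t in (0 : ℝ)..T, wt (-s) ξ * (B ξ * ψ' t + ψ' t * (∫ r in (0 : ℝ)..t, G (ξ, r)) +
          ψ t * G (ξ, t)) := by
        rw [intervalIntegral.integral_of_le hT.le]
        refine setIntegral_congr_ae measurableSet_Ioc ?_
        filter_upwards [h2] with t h2t ht
        rw [h2t, h1 t (Ioc_subset_Icc_self ht)]
        simp only [wpT, hψ, hψ']
        ring
    _ = 0 := by
        rw [intervalIntegral.integral_const_mul, intervalIntegral.integral_add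
          (((hcont.intervalIntegrable _ _).const_mul _).add
            ((hcont.intervalIntegrable _ _).mul_continuousOn hprim))
          ((h3 0 T).continuousOn_mul hψc.continuousOn), intervalIntegral.integral_add
          ((hcont.intervalIntegrable _ _).const_mul _)
            ((hcont.intervalIntegrable _ _).mul_continuousOn hprim), hparts,
          intervalIntegral.integral_const_mul, hfund]
        ring

end Weak

/-! ### Time-dependent test functions -/

section TimeTest

variable {T : ℝ}

theorem integral_deriv_smul_add {θ : ℝ → ℝ} {n : ℝ → ℂ} (hθ : ContDiff ℝ ((⊤ : ℕ∞) : WithTop ℕ∞) θ)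
    (hc : HasCompactSupport θ) (hn : Continuous n) :
    ∫ t, deriv θ t • (∫ r in (0 : ℝ)..t, n r) + θ t • n t = 0 := by
  have hd : ∀ t, HasDerivAt θ (deriv θ t) t := fun t ↦
    (hθ.differentiable (by simp) t).hasDerivAt
  have hN : ∀ t, HasDerivAt (fun t ↦ ∫ r in (0 : ℝ)..t, n r) (n t) t := fun t ↦
    hn.integral_hasStrictDerivAt 0 t |>.hasDerivAt
  have hNc : Continuous fun t ↦ ∫ r in (0 : ℝ)..t, n r :=
    continuous_iff_continuousAt.2 fun t ↦ (hN t).continuousAt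
  have hd' : Continuous (deriv θ) := hθ.continuous_deriv (by simp)
  refine integral_eq_zero_of_hasDerivAt_of_integrable
    (f := fun t ↦ θ t • ∫ r in (0 : ℝ)..t, n r) (fun t ↦ ?_) ?_ ?_
  · exact ((hd t).smul (hN t)).congr_deriv (by ring)
  · exact ((hd'.smul hNc).integrable_of_hasCompactSupport hc.deriv.smul_right).add
      ((hθ.continuous.smul hn).integrable_of_hasCompactSupport hc.smul_right)
  · exact (hθ.continuous.smul hNc).integrable_of_hasCompactSupport hc.smul_right

/-- A smooth function of mean zero with compact support in an interval is the derivative of a smooth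
function with compact support in the interval. -/
theorem exists_primitive_compactSupport {k : ℝ → ℝ} (hk : ContDiff ℝ ((⊤ : ℕ∞) : WithTop ℕ∞) k)
    (hc : HasCompactSupport k) (hs : tsupport k ⊆ Ioo 0 T) (hT : 0 < T) (h0 : ∫ t, k t = 0) :
    ∃ θ : ℝ → ℝ, ContDiff ℝ ((⊤ : ℕ∞) : WithTop ℕ∞) θ ∧ HasCompactSupport θ ∧ tsupport θ ⊆ Ioo 0 T ∧
      deriv θ = k := by
  -- The point `T / 2` only ensures that the set is nonempty when `k` vanishes identically.
  set S : Set ℝ := insert (T / 2) (tsupport k) with hS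
  have hSc : IsCompact S := hc.isCompact.insert _
  have hSs : S ⊆ Ioo 0 T := insert_subset ⟨by linarith, by linarith⟩ hs
  obtain ⟨a, ha⟩ := hSc.exists_isLeast (insert_nonempty _ _)
  obtain ⟨b, hb⟩ := hSc.exists_isGreatest (insert_nonempty _ _)
  have hz : ∀ t, t ∉ Icc a b → k t = 0 := fun t ht ↦ by
    by_contra h
    have : t ∈ S := mem_insert_of_mem _ (subset_tsupport k h)
    exact ht ⟨ha.2 this, hb.2 this⟩
  have hd : ∀ t, HasDerivAt (fun t ↦ ∫ r in (0 : ℝ)..t, k r) (k t) t := fun t ↦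
    hk.continuous.integral_hasStrictDerivAt 0 t |>.hasDerivAt
  have hderiv : deriv (fun t ↦ ∫ r in (0 : ℝ)..t, k r) = k := funext fun t ↦ (hd t).deriv
  have hsub : tsupport (fun t ↦ ∫ r in (0 : ℝ)..t, k r) ⊆ Icc a b := by
    refine closure_minimal (fun t ht ↦ ?_) isClosed_Icc
    by_contra hab
    refine ht ?_
    rw [mem_Icc, not_and_or, not_le, not_le] at hab
    have ha0 := (hSs ha.1).1
    rcases hab with hab | hab
    · refine intervalIntegral.integral_zero_ae (Eventually.of_forall fun r hr ↦ hz r fun h ↦ ?_)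
      have := hr.2
      rcases le_max_iff.1 this with h1 | h1 <;> linarith [h.1]
    · have hab' : a ≤ b := ha.2 hb.1
      simp only
      rw [intervalIntegral.integral_of_le (by linarith), ← h0]
      refine setIntegral_eq_integral_of_forall_compl_eq_zero fun r hr ↦ hz r fun h ↦ hr ?_
      exact ⟨by linarith [h.1], by linarith [h.2]⟩
  refine ⟨fun t ↦ ∫ r in (0 : ℝ)..t, k r, ?_, ?_, ?_, hderiv⟩
  · rw [contDiff_infty_iff_deriv, hderiv]
    exact ⟨fun t ↦ (hd t).differentiableAt, hk⟩
  · exact IsCompact.of_isClosed_subset isCompact_Icc (isClosed_tsupport _) hsub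
  · exact hsub.trans fun t ht ↦ ⟨(hSs ha.1).1.trans_le ht.1, ht.2.trans_lt (hSs hb.1).2⟩

theorem eqOn_zero_of_integral_smul {q : ℝ → ℂ} (hq : ContinuousOn q (Icc 0 T)) (hT : 0 < T)
    (h : ∀ θ : ℝ → ℝ, ContDiff ℝ ((⊤ : ℕ∞) : WithTop ℕ∞) θ → HasCompactSupport θ →
      tsupport θ ⊆ Ioo 0 T → ∫ t, θ t • q t = 0) : EqOn q 0 (Icc 0 T) := by
  have hae := isOpen_Ioo.ae_eq_zero_of_integral_contDiff_smul_eq_zero (μ := volume)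
    ((hq.mono Ioo_subset_Icc_self).locallyIntegrableOn measurableSet_Ioo) h
  refine Measure.eqOn_Icc_of_ae_eq volume hT.ne ?_ hq continuousOn_const
  rw [← restrict_Ioo_eq_restrict_Icc]
  exact (ae_restrict_iff' measurableSet_Ioo).2 hae

/-- The fundamental lemma of the calculus of variations, for a first-order equation. -/
theorem eq_add_integral_of_integral_deriv_smul {m n : ℝ → ℂ} (hm : Continuous m) (hn : Continuous n)
    (hT : 0 < T) (h : ∀ θ : ℝ → ℝ, ContDiff ℝ ((⊤ : ℕ∞) : WithTop ℕ∞) θ → HasCompactSupport θ →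
      tsupport θ ⊆ Ioo 0 T → ∫ t, deriv θ t • m t + θ t • n t = 0) {t : ℝ} (ht : t ∈ Icc 0 T) :
    m t = m 0 + ∫ r in (0 : ℝ)..t, n r := by
  set q : ℝ → ℂ := fun t ↦ m t - ∫ r in (0 : ℝ)..t, n r with hq
  have hNc : Continuous fun t ↦ ∫ r in (0 : ℝ)..t, n r :=
    continuous_iff_continuousAt.2 fun t ↦ (hn.integral_hasStrictDerivAt 0 t).hasDerivAt.continuousAt
  have hqc : Continuous q := hm.sub hNc
  have hq0 : ∀ θ : ℝ → ℝ, ContDiff ℝ ((⊤ : ℕ∞) : WithTop ℕ∞) θ → HasCompactSupport θ →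
      tsupport θ ⊆ Ioo 0 T → ∫ t, deriv θ t • q t = 0 := fun θ hθ hc hs ↦ by
    have h1 := h θ hθ hc hs
    have h2 := integral_deriv_smul_add hθ hc hn
    have hd' : Continuous (deriv θ) := hθ.continuous_deriv (by simp)
    have i1 : Integrable fun t ↦ deriv θ t • m t + θ t • n t :=
      ((hd'.smul hm).integrable_of_hasCompactSupport hc.deriv.smul_right).add
        ((hθ.continuous.smul hn).integrable_of_hasCompactSupport hc.smul_right)
    have i2 : Integrable fun t ↦ deriv θ t • (∫ r in (0 : ℝ)..t, n r) + θ t • n t :=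
      ((hd'.smul hNc).integrable_of_hasCompactSupport hc.deriv.smul_right).add
        ((hθ.continuous.smul hn).integrable_of_hasCompactSupport hc.smul_right)
    rw [← sub_self (0 : ℂ)]
    nth_rewrite 1 [← h1]
    rw [← h2, ← integral_sub i1 i2]
    congr 1 with t
    simp only [hq, smul_sub]
    ring
  -- A bump of positive integral: a test function minus the right multiple of `ρ₀` has mean zero,
  -- hence is some `deriv θ`. So `q` is weakly, and by continuity pointwise, the constant `c`.
  obtain ⟨ρ₀, hρs, hρc, hρ, hρ0, hρ1⟩ := exists_contDiff_tsupport_subset (n := ⊤) (x := T / 2)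
    (isOpen_Ioo.mem_nhds (⟨by linarith, by linarith⟩ : T / 2 ∈ Ioo 0 T))
  have hρI : 0 < ∫ t, ρ₀ t :=
    hρ.continuous.integral_pos_of_hasCompactSupport_nonneg_nonzero hρc
      (fun t ↦ (hρ0 (mem_range_self t)).1) (x := T / 2) (by rw [hρ1]; norm_num)
  set I := ∫ t, ρ₀ t with hI
  set c : ℂ := I⁻¹ • ∫ t, ρ₀ t • q t with hc'
  have iρ : Integrable fun t ↦ ρ₀ t := hρ.continuous.integrable_of_hasCompactSupport hρc
  have key : EqOn (fun t ↦ q t - c) 0 (Icc 0 T) := by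
    refine eqOn_zero_of_integral_smul (hqc.sub continuous_const).continuousOn hT
      fun g hg hgc hgs ↦ ?_
    have ig : Integrable g := hg.continuous.integrable_of_hasCompactSupport hgc
    set a : ℝ := (∫ t, g t) * I⁻¹ with ha
    have hks : tsupport (fun t ↦ g t - a * ρ₀ t) ⊆ Ioo 0 T := by
      refine (tsupport_sub g fun t ↦ a * ρ₀ t).trans (union_subset hgs ?_)
      exact (closure_mono (Function.support_mul_subset_right _ _)).trans hρs
    have hk0 : ∫ t, (g t - a * ρ₀ t) = 0 := by
      rw [integral_sub ig (iρ.const_mul a), integral_const_mul, ← hI, ha,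
        inv_mul_cancel_right₀ hρI.ne', sub_self]
    obtain ⟨θ, hθ, hθc, hθs, hθd⟩ := exists_primitive_compactSupport (hg.sub (contDiff_const.mul hρ))
      (hgc.sub hρc.mul_left) hks hT hk0
    have := hq0 θ hθ hθc hθs
    rw [hθd] at this
    have i1 : Integrable fun t ↦ g t • q t :=
      (hg.continuous.smul hqc).integrable_of_hasCompactSupport hgc.smul_right
    have i2 : Integrable fun t ↦ ρ₀ t • q t :=
      (hρ.continuous.smul hqc).integrable_of_hasCompactSupport hρc.smul_right
    have i3 : Integrable fun t ↦ g t • c := ig.smul_const c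
    have i4 : Integrable fun t ↦ a • ρ₀ t • q t := i2.smul a
    simp_rw [sub_smul, mul_smul] at this
    rw [integral_sub i1 i4, integral_smul] at this
    simp_rw [smul_sub]
    rw [integral_sub i1 i3, integral_smul_const, hc', smul_smul, ← ha]
    exact this
  have k1 := key ht
  have k0 := key (left_mem_Icc.2 hT.le)
  simp only [hq, Pi.zero_apply, intervalIntegral.integral_same, sub_zero, sub_eq_zero] at k1 k0
  rw [k0, ← k1]
  ring

/-! ### Uniqueness for the linear equation -/

theorem exists_tensor {θ : ℝ → ℝ} (hθ : ContDiff ℝ ((⊤ : ℕ∞) : WithTop ℕ∞) θ)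
    (hc : HasCompactSupport θ) (χ : 𝓢(ℝ, ℂ)) (hχ : HasCompactSupport χ) :
    ∃ Φ : 𝓢(SpaceTime, ℂ), (tsupport θ ⊆ Ioo 0 T → IsTest T Φ) ∧ HasCompactSupport Φ ∧
      ∀ t, slice t Φ = (θ t : ℂ) • χ := by
  have hcs : HasCompactSupport fun p : ℝ × ℝ ↦ (θ p.2 : ℂ) * χ p.1 := by
    refine HasCompactSupport.intro (hχ.isCompact.prod hc.isCompact) fun p hp ↦ ?_
    rw [mem_prod, not_and_or] at hp
    rcases hp with hp | hp
    · rw [image_eq_zero_of_notMem_tsupport hp, mul_zero]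
    · rw [image_eq_zero_of_notMem_tsupport hp, Complex.ofReal_zero, zero_mul]
  obtain ⟨Φ, h1, h2, h3⟩ := exists_tst_eq (((Complex.ofRealCLM.contDiff.comp hθ).comp
    contDiff_snd).mul ((χ.smooth ⊤).comp contDiff_fst)) hcs
  refine ⟨Φ, fun hs ↦ ⟨h1, h3.trans fun η hη ↦ hs ?_⟩, h1, fun t ↦ ?_⟩
  · have : tsupport (fun p : ℝ × ℝ ↦ (θ p.2 : ℂ) * χ p.1) ⊆ {p | p.2 ∈ tsupport θ} :=
      closure_minimal (fun p hp ↦ subset_tsupport θ fun h0 ↦ hp (by simp [h0]))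
        ((isClosed_tsupport θ).preimage continuous_snd)
    exact this hη
  · ext x
    rw [slice_apply, h2]
    rfl

theorem memLp_wt_mul (σ : ℝ) (φ : 𝓢(ℝ, ℂ)) : MemLp (fun ξ ↦ (wt σ ξ : ℂ) * φ ξ) 2 := by
  refine ((SchwartzMap.smulLeftCLM ℂ (fun ξ ↦ (wt σ ξ : ℂ)) φ).memLp 2 (volume : Measure ℝ)).ae_eq
    (Eventually.of_forall fun ξ ↦ ?_)
  rw [SchwartzMap.smulLeftCLM_apply_apply (hasTemperateGrowth_wt _), smul_eq_mul]

theorem dst_eq_pairL (σ : ℝ) (A : L2R) (χ : 𝓢(ℝ, ℂ)) :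
    dst σ A χ = pairL 2 2 volume A (memLp_wt_mul (-σ) (𝓕⁻ χ)).toLp := by
  rw [dst_apply, pairL_toLp]

/-- Two continuous curves in `H^σ` that agree as distributions on the slab are equal. -/
theorem eqOn_of_integral_slice_eq {σ : ℝ} {A A' : ℝ → L2R} (hA : ContinuousOn A (Icc 0 T))
    (hA' : ContinuousOn A' (Icc 0 T)) (hT : 0 < T)
    (h : ∀ Φ, IsTest T Φ → ∫ t, dst σ (A t) (slice t Φ) = ∫ t, dst σ (A' t) (slice t Φ)) :
    EqOn A A' (Icc 0 T) := by
  intro t ht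
  refine dst_injective σ (tempered_ext fun χ hχ ↦ ?_)
  set a := (memLp_wt_mul (-σ) (𝓕⁻ χ)).toLp with ha
  rw [dst_eq_pairL, dst_eq_pairL, ← ha, ← sub_eq_zero]
  have hc : ∀ {D : ℝ → L2R}, ContinuousOn D (Icc 0 T) →
      ContinuousOn (fun t ↦ pairL 2 2 volume (D t) a) (Icc 0 T) := fun hD ↦
    ((pairL 2 2 (volume : Measure ℝ)).flip a).continuous.comp_continuousOn hD
  refine eqOn_zero_of_integral_smul (q := fun t ↦ pairL 2 2 volume (A t) a -
    pairL 2 2 volume (A' t) a) ((hc hA).sub (hc hA')) hT (fun θ hθ hθc hθs ↦ ?_) ht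
  have hi : ∀ {D : ℝ → L2R}, ContinuousOn D (Icc 0 T) →
      Integrable fun t ↦ θ t • pairL 2 2 volume (D t) a := fun hD ↦ by
    refine (integrableOn_iff_integrable_of_support_subset fun t ht ↦ ?_).1
      ((hθ.continuous.continuousOn.smul (hc hD)).integrableOn_compact isCompact_Icc)
    by_contra hn
    refine ht ?_
    simp only
    rw [image_eq_zero_of_notMem_tsupport fun h' ↦ hn (Ioo_subset_Icc_self (hθs h')), zero_smul]
  obtain ⟨Φ, h1, -, h2⟩ := exists_tensor (T := T) hθ hθc χ hχ
  have hp : ∀ D : ℝ → L2R, ∀ t, dst σ (D t) (slice t Φ) = θ t • pairL 2 2 volume (D t) a :=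
    fun D t ↦ by rw [h2, map_smul, dst_eq_pairL, Complex.real_smul, smul_eq_mul]
  simp_rw [smul_sub]
  rw [integral_sub (hi hA) (hi hA'), sub_eq_zero]
  have := h Φ (h1 hθs)
  simp_rw [hp] at this
  exact this

/-- The phase has order five, so five negative derivatives make its product with the weight a
bounded multiplier. -/
theorem exists_norm_Q_mul_wt_le (P : Par) :
    ∃ C, ∀ ξ, ‖2 * Real.pi * Complex.I * P.Q ξ * (wt (-5) ξ : ℂ)‖ ≤ C := by
  have hw : ∀ ξ : ℝ, |ξ| ^ 5 * wt (-5) ξ ≤ 1 ∧ |ξ| ^ 3 * wt (-5) ξ ≤ 1 := fun ξ ↦ by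
    have hp := wt_pos (-5) ξ
    have hb : 1 ≤ √(1 + ξ ^ 2) := Real.one_le_sqrt.2 (by nlinarith [sq_nonneg ξ])
    have hx : |ξ| ≤ √(1 + ξ ^ 2) := Real.abs_le_sqrt (by linarith)
    have h5 : √(1 + ξ ^ 2) ^ 5 * wt (-5) ξ = 1 := by
      have : √(1 + ξ ^ 2) ^ 5 = wt 5 ξ := by
        rw [wt, Real.sqrt_eq_rpow, ← Real.rpow_natCast, ← Real.rpow_mul (by positivity)]
        norm_num
      rw [this, mul_comm, wt_neg_mul]
    constructor
    · rw [← h5]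
      gcongr
    · rw [← h5]
      refine mul_le_mul_of_nonneg_right ?_ hp.le
      calc |ξ| ^ 3 ≤ √(1 + ξ ^ 2) ^ 3 := by gcongr
        _ ≤ _ := pow_le_pow_right₀ hb (by norm_num)
  refine ⟨2 * Real.pi * (|P.A| + |P.B|), fun ξ ↦ ?_⟩
  have hp := wt_pos (-5) ξ
  rw [norm_mul, norm_mul, norm_mul, norm_mul, Complex.norm_I, Complex.norm_real, Complex.norm_real,
    Complex.norm_real, Real.norm_of_nonneg Real.pi_pos.le, Real.norm_of_nonneg hp.le, Real.norm_eq_abs]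
  simp only [Complex.norm_ofNat, mul_one]
  rw [mul_assoc]
  gcongr
  calc |P.Q ξ| * wt (-5) ξ ≤ (|P.A| * |ξ| ^ 5 + |P.B| * |ξ| ^ 3) * wt (-5) ξ := by
        gcongr
        rw [Par.Q, ph]
        refine (abs_add_le _ _).trans (le_of_eq ?_)
        rw [abs_mul, abs_mul, abs_pow, abs_pow]
    _ = |P.A| * (|ξ| ^ 5 * wt (-5) ξ) + |P.B| * (|ξ| ^ 3 * wt (-5) ξ) := by ring
    _ ≤ |P.A| * 1 + |P.B| * 1 := by gcongr; exacts [(hw ξ).1, (hw ξ).2]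
    _ = _ := by ring

variable {α β s : ℝ} {hβ : β ≠ 0} {hs : -(1 / 4) ≤ s}

theorem memLp_Q_mul_wt_mul (P : Par) (σ : ℝ) (φ : 𝓢(ℝ, ℂ)) :
    MemLp (fun ξ ↦ 2 * Real.pi * Complex.I * P.Q ξ * ((wt σ ξ : ℂ) * φ ξ)) 2 := by
  obtain ⟨C, hC⟩ := exists_norm_Q_mul_wt_le P
  have hm : Measurable fun ξ : ℝ ↦ 2 * Real.pi * Complex.I * P.Q ξ * (wt (-5) ξ : ℂ) := by
    have := (hasTemperateGrowth_wt (-5)).1.continuous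
    have := P.continuous_Q
    fun_prop
  refine (memLp_bdd_mul hm hC (memLp_wt_mul (5 + σ) φ)).ae_eq (Eventually.of_forall fun ξ ↦ ?_)
  have e : (wt (-5) ξ : ℂ) * wt (5 + σ) ξ = wt σ ξ := by
    rw [← Complex.ofReal_mul, wt_mul, neg_add_cancel_left]
  simp only
  rw [← e]
  ring

theorem integral_slice_lin {A : ℝ → L2R} {θ : ℝ → ℝ} (hθ : ContDiff ℝ ((⊤ : ℕ∞) : WithTop ℕ∞) θ)
    {χ : 𝓢(ℝ, ℂ)} {Φ : 𝓢(SpaceTime, ℂ)} (hΦ : HasCompactSupport Φ)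
    (h : ∀ t, slice t Φ = (θ t : ℂ) • χ) (t : ℝ) :
    dst s (A t) (slice t (lin α β Φ)) =
      deriv θ t • pairL 2 2 volume (A t) (memLp_wt_mul (-s) (𝓕⁻ χ)).toLp +
        θ t • pairL 2 2 volume (A t)
          (memLp_Q_mul_wt_mul (prm α β s hβ hs) (-s) (𝓕⁻ χ)).toLp := by
  have hpT : ∀ ξ t, pT Φ (ξ, t) = θ t * (𝓕⁻ χ) ξ := fun ξ t ↦ by
    rw [pT_eq_slice, h, FourierTransform.fourierInv_smul]
    rfl
  have hpT' : ∀ ξ t, pT (∂_{dirT} Φ) (ξ, t) = deriv θ t * (𝓕⁻ χ) ξ := fun ξ t ↦ by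
    refine (hasDerivAt_pT hΦ ξ t).unique ?_
    simp_rw [hpT]
    exact ((hθ.differentiable (by simp) t).hasDerivAt.ofReal_comp).mul_const _
  have e : (𝓕⁻ (slice t (lin α β Φ)) : 𝓢(ℝ, ℂ)) = fun ξ ↦ deriv θ t * (𝓕⁻ χ) ξ +
      2 * Real.pi * Complex.I * (prm α β s hβ hs).Q ξ * (θ t * (𝓕⁻ χ) ξ) := funext fun ξ ↦ by
    rw [← pT_eq_slice, pT_lin (s := s) (hβ := hβ) (hs := hs), hpT, hpT']
  rw [dst_apply, pairL_toLp, pairL_toLp, Complex.real_smul, Complex.real_smul,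
    ← integral_const_mul, ← integral_const_mul, ← integral_add]
  · congr 1 with ξ
    rw [congrFun e ξ]
    ring
  · exact ((Lp.memLp _).integrable_mul (memLp_wt_mul (-s) (𝓕⁻ χ))).const_mul _
  · exact ((Lp.memLp _).integrable_mul (memLp_Q_mul_wt_mul _ (-s) (𝓕⁻ χ))).const_mul _

/-- Uniqueness of weak solutions of the linear equation in the class of continuous curves
in `H^s`. -/
theorem eqOn_zero_of_integral_slice_lin {A : ℝ → L2R} (hA : Continuous A) (hT : 0 < T) (hA0 : A 0 = 0)
    (h : ∀ Φ, IsTest T Φ → ∫ t, dst s (A t) (slice t (lin α β Φ)) = 0) (hβ : β ≠ 0)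
    (hs : -(1 / 4) ≤ s) {t : ℝ} (ht : t ∈ Icc 0 T) : A t = 0 := by
  set P := prm α β s hβ hs with hP
  -- The weak equation does not place `A` in the domain of multiplication by `Q`. Its primitive `Z`
  -- is in that domain on `[0, T]`, since there `2πi Q Z = A` is square integrable, so the energy
  -- identity for `Z` needs no regularisation.
  set Z : ℝ → L2R := fun t ↦ ∫ r in (0 : ℝ)..t, A r with hZ
  have hZd : ∀ t, HasDerivAt Z (A t) t := fun t ↦ (hA.integral_hasStrictDerivAt 0 t).hasDerivAt
  have hAZ : ∀ t ∈ Icc 0 T, A t =ᵐ[volume] fun ξ ↦ 2 * Real.pi * Complex.I * P.Q ξ * Z t ξ := by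
    intro t ht
    obtain ⟨C, hC⟩ := exists_norm_Q_mul_wt_le P
    have hw := (hasTemperateGrowth_wt (-5)).1.continuous
    have hm : Measurable fun ξ : ℝ ↦ 2 * Real.pi * Complex.I * P.Q ξ * (wt (-5) ξ : ℂ) := by
      have := P.continuous_Q
      fun_prop
    have hw1 : ∀ ξ, ‖(wt (-5) ξ : ℂ)‖ ≤ 1 := fun ξ ↦ by
      rw [Complex.norm_real, Real.norm_of_nonneg (wt_pos _ _).le]
      exact wt_le_one (by norm_num) ξ
    -- Multiplication by `wt (-5)` turns both sides of `A = 2πi Q Z` into elements of `L²`, which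
    -- can be compared by testing at regularity `s - 5`.
    have key : mulL 2 volume hw.measurable hw1 (A t) = mulL 2 volume hm hC (Z t) := by
      refine dst_injective (s - 5) (tempered_ext fun χ hχ ↦ ?_)
      set a := (memLp_wt_mul (-s) (𝓕⁻ χ)).toLp with ha
      set b := (memLp_Q_mul_wt_mul P (-s) (𝓕⁻ χ)).toLp with hb
      have hab : pairL 2 2 volume (A t) a = pairL 2 2 volume (Z t) b := by
        have hca := (((pairL 2 2 (volume : Measure ℝ)).flip a).continuous.comp hA)
        have hcb := (((pairL 2 2 (volume : Measure ℝ)).flip b).continuous.comp hA)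
        have := eq_add_integral_of_integral_deriv_smul hca hcb hT (fun θ hθ hθc hθs ↦ ?_) ht
        · simp only [Function.comp_apply, hA0, map_zero, zero_add] at this
          rw [hZ]
          simp only
          have e := ((pairL 2 2 (volume : Measure ℝ)).flip b).intervalIntegral_comp_comm
            (hA.intervalIntegrable (μ := volume) 0 t)
          rw [e] at this
          exact this
        · obtain ⟨Φ, h1, h2, h3⟩ := exists_tensor (T := T) hθ hθc χ hχ
          rw [← h Φ (h1 hθs)]
          congr 1 with t
          rw [integral_slice_lin hθ h2 h3 (hβ := hβ) (hs := hs)]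
          rfl
      have e5 : ∀ ξ, (wt (-5) ξ : ℂ) * wt (-(s - 5)) ξ = wt (-s) ξ := fun ξ ↦ by
        rw [← Complex.ofReal_mul, wt_mul]
        ring_nf
      rw [ha, hb, pairL_toLp, pairL_toLp] at hab
      rw [dst_apply, dst_apply]
      convert hab using 1
      · refine integral_congr_ae ?_
        filter_upwards [coeFn_mulL (p := 2) hw.measurable hw1 (A t)] with ξ hξ
        rw [hξ, ← e5]
        ring
      · refine integral_congr_ae ?_
        filter_upwards [coeFn_mulL (p := 2) hm hC (Z t)] with ξ hξ
        rw [hξ, ← e5]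
        ring
    filter_upwards [coeFn_mulL (p := 2) hw.measurable hw1 (A t), coeFn_mulL (p := 2) hm hC (Z t)]
      with ξ h1 h2
    rw [key, h2] at h1
    refine mul_left_cancel₀ (wt_ne_zero (-5) ξ) ?_
    rw [← h1]
    ring
  -- `A` is pointwise an imaginary multiple of `Z`, so the two inner products cancel and `‖Z‖²` has
  -- zero derivative.
  have hre : ∀ t ∈ Icc 0 T, inner ℂ (Z t) (A t) + inner ℂ (A t) (Z t) = 0 := fun t ht ↦ by
    rw [L2.inner_def, L2.inner_def, ← integral_add (L2.integrable_inner _ _)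
      (L2.integrable_inner _ _)]
    refine integral_eq_zero_of_ae ?_
    filter_upwards [hAZ t ht] with ξ hξ
    rw [hξ]
    simp only [RCLike.inner_apply, map_mul, Complex.conj_I, Complex.conj_ofReal, map_ofNat,
      Pi.zero_apply]
    ring
  have hz : ∀ t ∈ Icc 0 T, inner ℂ (Z t) (Z t) = 0 := fun t ht ↦ by
    have hd : ∀ t, HasDerivAt (fun t ↦ inner ℂ (Z t) (Z t))
        (inner ℂ (Z t) (A t) + inner ℂ (A t) (Z t)) t := fun t ↦ (hZd t).inner ℂ (hZd t)
    rw [constant_of_has_deriv_right_zero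
      (fun t _ ↦ (hd t).continuousAt.continuousWithinAt) (fun t ht ↦ ?_) t ht]
    · simp [hZ]
    · rw [← hre t (Ico_subset_Icc_self ht)]
      exact (hd t).hasDerivWithinAt
  refine Lp.eq_zero_iff_ae_eq_zero.2 ?_
  have hZ0 : Z t =ᵐ[volume] 0 := Lp.eq_zero_iff_ae_eq_zero.1 (inner_self_eq_zero.1 (hz t ht))
  filter_upwards [hAZ t ht, hZ0] with ξ h1 h2
  rw [h1, h2, Pi.zero_apply, mul_zero]

end TimeTest

/-! ### Weak solutions and mild solutions -/

section Solutions

variable {α β s T : ℝ} {hβ : β ≠ 0} {hs : -(1 / 4) ≤ s}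

theorem Par.at_eq_of_ae (P : Par) {f g : L2P} {t : ℝ}
    (h : ∀ᵐ ξ : ℝ, kf P f (ξ, t) = kf P g (ξ, t)) : P.at_ t f = P.at_ t g := by
  refine Lp.ext ?_
  filter_upwards [h, P.coeFn_at t f, P.coeFn_at t g] with ξ h1 h2 h3
  rw [h2, h3, h1]

theorem Par.at_eq_of_restart (P : Par) {f : L2P} {B : L2R}
    (h : ∀ᵐ ξ : ℝ, P.ep (ξ, 0) * B ξ = kf P f (ξ, 0)) : P.at_ 0 f = B := by
  refine Lp.ext ?_
  filter_upwards [h, P.coeFn_at 0 f] with ξ h1 h2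
  rw [h2, ← h1, Par.ep]
  simp

/-- The null set of frequencies given by `at_` depends on the time. Rational times and continuity of
the fibres in time make it uniform. -/
theorem Par.ae_kf_eq_zero (P : Par) {h : L2P} (hT : 0 < T) (h0 : ∀ t ∈ Icc 0 T, P.at_ t h = 0) :
    ∀ᵐ ξ : ℝ, ∀ t ∈ Icc 0 T, kf P h (ξ, t) = 0 := by
  have hq : ∀ᵐ ξ : ℝ, ∀ q : ℚ, (q : ℝ) ∈ Icc 0 T → kf P h (ξ, q) = 0 := by
    refine ae_all_iff.2 fun q ↦ ?_
    by_cases hq : (q : ℝ) ∈ Icc 0 T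
    · have := P.coeFn_at q h
      rw [h0 q hq] at this
      filter_upwards [this, Lp.coeFn_zero ℂ 2 (volume : Measure ℝ)] with ξ h1 h2 _
      rw [← h1, h2, Pi.zero_apply]
    · exact Eventually.of_forall fun ξ h' ↦ absurd h' hq
  filter_upwards [hq, ae_continuous_kf P (Lp.memLp h)] with ξ h1 h2 t ht
  have hd : Dense (range ((↑) : ℚ → ℝ)) := Rat.denseRange_cast
  have hcl : Icc 0 T ⊆ closure (Ioo 0 T ∩ range ((↑) : ℚ → ℝ)) := by
    rw [← closure_Ioo hT.ne]
    exact closure_minimal (hd.open_subset_closure_inter isOpen_Ioo) isClosed_closure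
  refine closure_minimal (t := {t | kf P h (ξ, t) = 0}) ?_ (isClosed_singleton.preimage h2) (hcl ht)
  rintro _ ⟨hr, q, rfl⟩
  exact h1 q (Ioo_subset_Icc_self hr)

theorem integrable_K_mul (P : Par) (f : L2P) {Ψ : 𝓢(SpaceTime, ℂ)} (hΨ : HasCompactSupport Ψ)
    (σ : ℝ) : Integrable fun p ↦ P.K f p * wpT σ Ψ p :=
  (Lp.memLp _).integrable_mul (memLp_wpT hΨ _)

/-- On short time intervals, weak solutions of the linear equation are mild solutions. -/
theorem exists_mild_of_weak (α β s : ℝ) (hβ : β ≠ 0) (hs : -(1 / 4) ≤ s) : ∃ δ₀ : ℝ, 0 < δ₀ ∧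
    ∀ T, 0 < T → T ≤ δ₀ → ∀ f G : L2P, (∀ Φ, IsTest T Φ →
      (∫ p, (prm α β s hβ hs).K f p * wpT (-s) (lin α β Φ) p) +
        ∫ p, G p * ((prm α β s hβ hs).ep p * wpT (-s) Φ p) = 0) →
      Mild (prm α β s hβ hs) f ((prm α β s hβ hs).at_ 0 f) G 0 T := by
  set P := prm α β s hβ hs with hP
  obtain ⟨δ₀, hδ₀, hδ⟩ := exists_extension P one_pos
  refine ⟨δ₀, hδ₀, fun T hT hTδ f G hw ↦ ?_⟩
  obtain ⟨B, hB⟩ := P.exists_restart f 0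
  have hfB := P.at_eq_of_restart hB
  -- `g` solves the linear problem mildly, hence weakly, with the data and the source of `f`. So `f
  -- - g` is a weak solution of the homogeneous equation with zero data.
  obtain ⟨g, -, hg⟩ := hδ 0 T hT hTδ B G
  rw [zero_add] at hg
  have hgB : P.at_ 0 g = B := P.at_eq_of_restart <| by
    filter_upwards [hg] with ξ h
    rw [h 0 (left_mem_Icc.2 hT.le), intervalIntegral.integral_same, add_zero]
  have h0 : ∀ t ∈ Icc 0 T, P.at_ t (f - g) = 0 := fun t ht ↦ by
    refine eqOn_zero_of_integral_slice_lin (α := α) (P.continuous_at (f - g)) hT ?_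
      (fun Φ hΦ ↦ ?_) hβ hs ht
    · rw [map_sub, hfB, hgB, sub_self]
    · have hL := isTest_of_tsupport_subset hΦ (tsupport_lin α β Φ)
      have h1 := hw Φ hΦ
      have h2 := hg.weak hΦ
      rw [← hP] at h2
      have h3 : ∫ p, P.K (f - g) p * wpT (-s) (lin α β Φ) p =
          (∫ p, P.K f p * wpT (-s) (lin α β Φ) p) - ∫ p, P.K g p * wpT (-s) (lin α β Φ) p := by
        rw [← integral_sub (integrable_K_mul P f hL.1 _) (integrable_K_mul P g hL.1 _), map_sub]
        refine integral_congr_ae ?_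
        filter_upwards [Lp.coeFn_sub (P.K f) (P.K g)] with p hp
        rw [hp, Pi.sub_apply, sub_mul]
      have h4 := integral_K_mul P (f - g) hL.1
      change ∫ t, dst P.s (P.at_ t (f - g)) (slice t (lin α β Φ)) = 0
      rw [← h4]
      change ∫ p, P.K (f - g) p * wpT (-s) (lin α β Φ) p = 0
      rw [h3]
      linear_combination h1 - h2
  rw [hfB]
  filter_upwards [P.ae_kf_eq_zero hT h0, P.ae_kf_sub f g, hg] with ξ h1 h2 h3 t ht
  rw [← h3 t ht, ← sub_eq_zero, ← h2, h1 t ht]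

/-! ### Solutions of the initial-value problem -/

theorem bsp_eq_curvePairing (P : Par) (f : L2P) {Φ : 𝓢(SpaceTime, ℂ)} (hΦ : IsTest T Φ) :
    P.bsp f Φ = curvePairing T (fun t ↦ dst P.s (P.at_ t f)) Φ := by
  rw [P.bsp_apply f hΦ.1, integral_K_mul P f hΦ.1, curvePairing_eq hΦ]

theorem xsbNormOn_le {f : L2P} {u : ℝ → 𝓢'(ℝ, ℂ)}
    (h : EqOn u (fun t ↦ dst s ((prm α β s hβ hs).at_ t f)) (Ioo 0 T)) :
    xsbNormOn α β s (3 / 4) T u ≤ xsbNorm α β s (3 / 4) ((prm α β s hβ hs).bsp f) := by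
  refine iInf₂_le _ fun Φ hΦ ↦ ?_
  rw [bsp_eq_curvePairing _ f hΦ]
  exact curvePairing_congr h.symm Φ

theorem hsNorm_dst_sub (σ : ℝ) (A B : L2R) : hsNorm σ (dst σ A - dst σ B) = ‖A - B‖ₑ := by
  rw [← map_sub, hsNorm_dst]

theorem tst_eq_zero {Φ : 𝓢(SpaceTime, ℂ)} (hΦ : IsTest T Φ) {p : ℝ × ℝ} (hp : p.2 ∉ Ioo 0 T) :
    tst Φ p = 0 :=
  image_eq_zero_of_notMem_tsupport (f := Φ) (x := !₂[p.1, p.2]) fun h ↦ hp (hΦ.2 h)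

/-- The wave function on the plane. -/
def wfun (P : Par) (f : L2P) (η : SpaceTime) : ℂ := P.W f (η 0, η 1)

theorem integral_wfun_mul (P : Par) (f : L2P) {Φ : 𝓢(SpaceTime, ℂ)} (hΦ : HasCompactSupport Φ) :
    ∫ η, wfun P f η * Φ η = P.bsp f Φ := by
  rw [P.bsp_apply f hΦ, ← P.integral_W_mul f hΦ, integral_spaceTime]
  rfl

theorem memLp_wfun (P : Par) (f : L2P) : MemLp (wfun P f) 6 :=
  (Lp.memLp (P.W f)).comp_measurePreserving
    (MeasurePreserving.symm pairEquiv measurePreserving_pairEquiv)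

theorem tst_lin (α β : ℝ) (Φ : 𝓢(SpaceTime, ℂ)) (p : ℝ × ℝ) :
    tst (lin α β Φ) p = (∂_{dirT} Φ) !₂[p.1, p.2] + α * (∂^{fun _ : Fin 3 ↦ dirX} Φ) !₂[p.1, p.2]
      + β * (∂^{fun _ : Fin 5 ↦ dirX} Φ) !₂[p.1, p.2] := by
  rw [add_assoc]
  rfl

/-- The distributional equation, read in frequency and in the interaction picture. Both directions
of the equivalence with `Mild` pass through this identity. -/
theorem integral_W_mul_lin {Φ : 𝓢(SpaceTime, ℂ)} (hΦ : HasCompactSupport Φ) (f : L2P) :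
    ∫ p, ((prm α β s hβ hs).W f p * tst (lin α β Φ) p +
        (prm α β s hβ hs).W f p ^ 3 / 3 * tst (∂_{dirX} Φ) p) =
      (∫ p, (prm α β s hβ hs).K f p * wpT (-s) (lin α β Φ) p) +
        ∫ p, (prm α β s hβ hs).src f f f p * ((prm α β s hβ hs).ep p * wpT (-s) Φ p) := by
  set P := prm α β s hβ hs with hP
  have hL : HasCompactSupport (lin α β Φ) :=
    IsCompact.of_isClosed_subset hΦ (isClosed_tsupport _) (tsupport_lin α β Φ)
  have hX := hasCompactSupport_lineDeriv hΦ dirX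
  have i1 : Integrable fun p ↦ P.W f p * tst (lin α β Φ) p :=
    (Lp.memLp (P.W f)).integrable_mul ((nice_tst hL).memLp (6 / 5))
  have i2 : Integrable fun p ↦ P.tri f f f p / 3 * tst (∂_{dirX} Φ) p := by
    have := ((Lp.memLp (P.tri f f f)).integrable_mul ((nice_tst hX).memLp 2)).const_mul (1 / 3)
    refine this.congr (Eventually.of_forall fun p ↦ ?_)
    simp only [Pi.mul_apply]
    ring
  have e1 := P.integral_W_mul f hL
  have e2 := P.integral_tri_mul f hΦ
  change _ = (∫ p, P.K f p * wpT (-P.s) (lin α β Φ) p) +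
    ∫ p, P.src f f f p * (P.ep p * wpT (-P.s) Φ p)
  rw [← e1, ← e2, ← integral_add i1 i2]
  refine integral_congr_ae ?_
  filter_upwards [P.coeFn_tri f f f] with p hp
  rw [hp]
  ring

/-- Mild solutions are solutions. -/
theorem Mild.isSolution {f : L2P} {B : L2R} (hT : 0 < T)
    (h : Mild (prm α β s hβ hs) f B ((prm α β s hβ hs).src f f f) 0 T) :
    IsSolution α β s (3 / 4) T (dst s B) fun t ↦ dst s ((prm α β s hβ hs).at_ t f) := by
  set P := prm α β s hβ hs with hP
  refine ⟨fun t _ ↦ ⟨memSobolev_dst _ _, ?_⟩, ?_, ?_, wfun P f, fun K hK _ ↦ ?_, fun Φ hΦ ↦ ?_,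
    fun Φ hΦ ↦ ?_⟩
  · simp_rw [hsNorm_dst_sub]
    have h1 := tendsto_iff_edist_tendsto_0.1 ((P.continuous_at f).tendsto t)
    simp only [edist_eq_enorm_sub] at h1
    exact h1.mono_left nhdsWithin_le_nhds
  · obtain ⟨C, hC⟩ := exists_xsbNorm_bsp_le α β s hβ hs
    exact (xsbNormOn_le fun _ _ ↦ rfl).trans_lt ((hC f).trans_lt
      (ENNReal.mul_lt_top ENNReal.coe_lt_top enorm_lt_top))
  · rw [P.at_eq_of_restart]
    filter_upwards [h] with ξ h
    rw [h 0 (left_mem_Icc.2 hT.le), intervalIntegral.integral_same, add_zero]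
  · have : IsFiniteMeasure (volume.restrict K) := ⟨by simpa using hK.measure_lt_top⟩
    exact ((memLp_wfun P f).restrict K).mono_exponent (by norm_num)
  · rw [integral_wfun_mul P f hΦ.1, bsp_eq_curvePairing P f hΦ]
    rfl
  · rw [integral_spaceTime]
    simp_rw [← tst_lin]
    refine Eq.trans ?_ (h.weak hΦ)
    rw [← integral_W_mul_lin hΦ.1 f]
    rfl

/-- On short time intervals, solutions are mild solutions. -/
theorem exists_mild_of_isSolution (α β s : ℝ) (hβ : β ≠ 0) (hs : -(1 / 4) ≤ s) : ∃ δ₀ : ℝ, 0 < δ₀ ∧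
    ∀ T, 0 < T → T ≤ δ₀ → ∀ (u₀ : 𝓢'(ℝ, ℂ)) (v : ℝ → 𝓢'(ℝ, ℂ)), IsSolution α β s (3 / 4) T u₀ v →
      ∃ (f : L2P) (B : L2R), Mild (prm α β s hβ hs) f B ((prm α β s hβ hs).src f f f) 0 T ∧
        dst s B = u₀ ∧ EqOn v (fun t ↦ dst s ((prm α β s hβ hs).at_ t f)) (Icc 0 T) := by
  set P := prm α β s hβ hs with hP
  obtain ⟨δ₀, hδ₀, hδ⟩ := exists_mild_of_weak α β s hβ hs
  refine ⟨δ₀, hδ₀, fun T hT hTδ u₀ v hv ↦ ?_⟩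
  obtain ⟨U, hU, hUf⟩ : ∃ U : 𝓢'(SpaceTime, ℂ), (∀ Φ, IsTest T Φ → U Φ = curvePairing T v Φ) ∧
      xsbNorm α β s (3 / 4) U < ∞ := by
    simpa only [xsbNormOn, iInf_lt_iff, exists_prop] using hv.mem_xsb
  -- The coefficients of an extension of the curve `v`. On the slab they must be matched with the
  -- values of `v`, by continuity in `H^s`, and with the function `w`, as distributions.
  obtain ⟨f, rfl⟩ := exists_bsp_eq hβ hs hUf
  rw [← hP] at hU
  have hA : ∀ t, ∃ A, t ∈ Icc 0 T → dst s A = v t := fun t ↦ by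
    by_cases ht : t ∈ Icc 0 T
    · obtain ⟨A, hA⟩ := exists_dst (hv.continuousInHs t ht).1
      exact ⟨A, fun _ ↦ hA⟩
    · exact ⟨0, fun h ↦ absurd h ht⟩
  choose A hA using hA
  have hAc : ContinuousOn A (Icc 0 T) := fun t ht ↦ by
    refine tendsto_iff_edist_tendsto_0.2 (((hv.continuousInHs t ht).2).congr' ?_)
    filter_upwards [self_mem_nhdsWithin] with r hr
    rw [edist_eq_enorm_sub, ← hA r hr, ← hA t ht, hsNorm_dst_sub]
  have hAf : EqOn A (fun t ↦ P.at_ t f) (Icc 0 T) := by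
    refine eqOn_of_integral_slice_eq (σ := s) hAc (P.continuous_at f).continuousOn hT fun Φ hΦ ↦ ?_
    have h1 := hU Φ hΦ
    rw [bsp_eq_curvePairing P f hΦ, curvePairing_congr (v := fun t ↦ dst s (A t))
      (fun t ht ↦ (hA t (Ioo_subset_Icc_self ht)).symm), curvePairing_eq hΦ, curvePairing_eq hΦ] at h1
    exact h1.symm
  have hvf : EqOn v (fun t ↦ dst s (P.at_ t f)) (Icc 0 T) := fun t ht ↦ by
    rw [← hA t ht, hAf ht]
  obtain ⟨w, hwL, hwc, hwe⟩ := hv.equation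
  set F : ℝ × ℝ → ℂ := fun p ↦ w !₂[p.1, p.2] - P.W f p with hF
  have hWloc : LocallyIntegrable (P.W f) :=
    (Lp.memLp (P.W f)).locallyIntegrable (by norm_num)
  have hwint : ∀ K : Set SpaceTime, IsCompact K → K ⊆ {p | p 1 ∈ Ioo 0 T} → IntegrableOn w K :=
    fun K hK hKs ↦ by
      have : IsFiniteMeasure (volume.restrict K) := ⟨by simpa using hK.measure_lt_top⟩
      exact (hwL K hK hKs).integrable (by norm_num)
  have hU : IsOpen {p : ℝ × ℝ | p.2 ∈ Ioo 0 T} := isOpen_Ioo.preimage continuous_snd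
  have hFl : LocallyIntegrableOn F {p | p.2 ∈ Ioo 0 T} := by
    refine LocallyIntegrableOn.sub ?_ (hWloc.locallyIntegrableOn _)
    refine (locallyIntegrableOn_iff hU.isLocallyClosed).2 fun K hKs hK ↦ ?_
    have hK' := hwint _ (hK.image continuous_pair) (by rintro _ ⟨p, hp, rfl⟩; exact hKs hp)
    have := (measurePreserving_pairEquiv.integrableOn_comp_preimage
      pairEquiv.measurableEmbedding).2 hK'
    refine IntegrableOn.mono_set this fun p hp ↦ ⟨p, hp, rfl⟩
  -- Both `w` and `W f` represent the curve as a distribution on the slab, so they agree almost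
  -- everywhere there. In particular the cube in the equation is that of an `L⁶` function.
  have hFz : ∀ᵐ p : ℝ × ℝ, p.2 ∈ Ioo 0 T → F p = 0 := by
    refine ae_eq_zero_of_tst hFl fun Φ hΦc hΦs ↦ ?_
    have hΦ : IsTest T Φ := ⟨hΦc, hΦs⟩
    have i1 : Integrable fun η ↦ w η * Φ η := by
      obtain ⟨C, hC, hb⟩ := exists_norm_le Φ
      refine (integrableOn_iff_integrable_of_support_subset fun η hη ↦ ?_).1
        ((hwint _ hΦc hΦs).mul_bdd Φ.continuous.aestronglyMeasurable (Eventually.of_forall hb))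
      exact subset_tsupport Φ fun h0 ↦ hη (by simp [h0])
    have i1' : Integrable fun p : ℝ × ℝ ↦ w !₂[p.1, p.2] * tst Φ p :=
      measurePreserving_pairEquiv.integrable_comp_of_integrable i1
    have i2 : Integrable fun p ↦ P.W f p * tst Φ p :=
      (Lp.memLp (P.W f)).integrable_mul ((nice_tst hΦc).memLp (6 / 5))
    simp only [hF, sub_mul]
    rw [integral_sub i1' i2, P.integral_W_mul f hΦc, ← P.bsp_apply f hΦc, sub_eq_zero,
      bsp_eq_curvePairing P f hΦ]
    have h1 := hwc Φ hΦ
    rw [integral_spaceTime] at h1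
    refine h1.symm.trans (curvePairing_congr (hvf.mono Ioo_subset_Icc_self) Φ)
  refine ⟨f, P.at_ 0 f, hδ T hT hTδ f (P.src f f f) fun Φ hΦ ↦ ?_, ?_, hvf⟩
  · rw [← integral_W_mul_lin hΦ.1 f]
    have h1 := hwe Φ hΦ
    rw [integral_spaceTime] at h1
    simp_rw [← tst_lin] at h1
    refine Eq.trans (integral_congr_ae ?_) h1
    have hL := isTest_of_tsupport_subset hΦ (tsupport_lin α β Φ)
    have hX := isTest_of_tsupport_subset hΦ (SchwartzMap.tsupport_lineDerivOp_subset dirX Φ)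
    filter_upwards [hFz] with p hp
    by_cases hpI : p.2 ∈ Ioo 0 T
    · rw [sub_eq_zero.1 (hp hpI)]
      rfl
    · have e2 : (∂_{dirX} Φ) !₂[p.1, p.2] = 0 := tst_eq_zero hX hpI
      rw [tst_eq_zero hL hpI, tst_eq_zero hX hpI, e2]
      ring
  · rw [← hv.initial, hvf (left_mem_Icc.2 hT.le)]

end Solutions

end Kawahara

end

/-! ### Well-posedness -/

theorem theorem1p2 (s : ℝ) (hs : -(1 / 4 : ℝ) ≤ s) :
    ∃ b ∈ Set.Ioo (1 / 2 : ℝ) 1, ∀ α β : ℝ, β ≠ 0 → ∀ R : ℝ≥0, ∃ T > (0 : ℝ), ∃ C : ℝ≥0,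
      (∀ u₀ : 𝓢'(ℝ, ℂ), Kawahara.hsNorm s u₀ ≤ R →
        ∃ u : ℝ → 𝓢'(ℝ, ℂ), Kawahara.IsSolution α β s b T u₀ u ∧
          ∀ v : ℝ → 𝓢'(ℝ, ℂ), Kawahara.IsSolution α β s b T u₀ v → Set.EqOn v u (Set.Icc 0 T)) ∧
      (∀ (u₀ v₀ : 𝓢'(ℝ, ℂ)) (u v : ℝ → 𝓢'(ℝ, ℂ)),
        Kawahara.hsNorm s u₀ ≤ R → Kawahara.hsNorm s v₀ ≤ R →
        Kawahara.IsSolution α β s b T u₀ u → Kawahara.IsSolution α β s b T v₀ v →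
          (∀ t ∈ Set.Icc 0 T,
            Kawahara.hsNorm s (u t - v t) ≤ C * Kawahara.hsNorm s (u₀ - v₀)) ∧
          Kawahara.xsbNormOn α β s b T (u - v) ≤ C * Kawahara.hsNorm s (u₀ - v₀)) := by
  -- One `b` serves all `s`: `2b > 1` gives values at each time, and `b < 1` gives smallness on
  -- short intervals.
  refine ⟨3 / 4, by norm_num, fun α β hβ R ↦ ?_⟩
  set P := Kawahara.prm α β s hβ hs with hP
  obtain ⟨δ₁, hδ₁, hex⟩ := P.exists_mild R.2
  -- `10R + 1` is the bound of `Par.exists_mild` for the constructed coefficients, so this step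
  -- length depends on the data only through `R`.
  obtain ⟨δ₂, hδ₂, hsub⟩ := P.exists_mild_sub (10 * R + 1)
  obtain ⟨δ₃, hδ₃, hmild⟩ := Kawahara.exists_mild_of_isSolution α β s hβ hs
  obtain ⟨C, hC⟩ := Kawahara.exists_xsbNorm_bsp_le α β s hβ hs
  set T := min δ₁ (min δ₂ δ₃) with hT'
  have hT : 0 < T := lt_min hδ₁ (lt_min hδ₂ hδ₃)
  have hT1 : T ≤ δ₁ := min_le_left _ _
  have hT2 : T ≤ δ₂ := (min_le_right _ _).trans (min_le_left _ _)
  have hT3 : T ≤ δ₃ := (min_le_right _ _).trans (min_le_right _ _)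
  have hdata : ∀ u₀ : 𝓢'(ℝ, ℂ), Kawahara.hsNorm s u₀ ≤ R →
      ∃ B : Kawahara.L2R, Kawahara.dst s B = u₀ ∧ ‖B‖ ≤ R := fun u₀ hu ↦ by
    obtain ⟨B, hB⟩ := Kawahara.exists_dst
      ((Kawahara.hsNorm_lt_top_iff s u₀).1 (hu.trans_lt ENNReal.coe_lt_top))
    refine ⟨B, hB, ?_⟩
    rw [← hB, Kawahara.hsNorm_dst, enorm_eq_nnnorm, ENNReal.coe_le_coe] at hu
    exact_mod_cast hu
  have hsol : ∀ u₀ : 𝓢'(ℝ, ℂ), Kawahara.hsNorm s u₀ ≤ R → ∃ (B : Kawahara.L2R)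
      (f : Kawahara.L2P), Kawahara.dst s B = u₀ ∧ ‖f‖ ≤ 10 * R + 1 ∧
        Kawahara.Mild P f B (P.src f f f) 0 T ∧
        ∀ v, Kawahara.IsSolution α β s (3 / 4) T u₀ v →
          Set.EqOn v (fun t ↦ Kawahara.dst s (P.at_ t f)) (Set.Icc 0 T) := fun u₀ hu ↦ by
    obtain ⟨B, hB, hBR⟩ := hdata u₀ hu
    obtain ⟨f, hf, hfm⟩ := hex 0 T hT hT1 B hBR
    rw [zero_add] at hfm
    refine ⟨B, f, hB, hf, hfm, fun v hv t ht ↦ ?_⟩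
    -- The coefficient `g` of an arbitrary solution has no bound in terms of `R`, so uniqueness is
    -- taken from `mild_unique`, which allows any norm.
    obtain ⟨g, B', hgm, hB', hvg⟩ := hmild T hT hT3 u₀ v hv
    obtain rfl : B' = B := Kawahara.dst_injective s (hB'.trans hB.symm)
    rw [hvg ht]
    simp only
    rw [P.at_eq_of_ae]
    filter_upwards [P.mild_unique hT hgm hfm] with ξ h using h t ht
  refine ⟨T, hT, 20 * (C + Kawahara.Par.embC.toNNReal), fun u₀ hu ↦ ?_,
    fun u₀ v₀ u v hu₀ hv₀ hu hv ↦ ?_⟩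
  · obtain ⟨B, f, rfl, -, hfm, huniq⟩ := hsol u₀ hu
    exact ⟨_, hfm.isSolution hT, huniq⟩
  · obtain ⟨B, f, rfl, hf, hfm, hfu⟩ := hsol u₀ hu₀
    obtain ⟨B', g, rfl, hg, hgm, hgu⟩ := hsol v₀ hv₀
    -- By uniqueness `u` and `v` are the curves of `f` and `g`, whose norms are at most `10R + 1`;
    -- the local Lipschitz estimate therefore covers the whole of `[0, T]`.
    obtain ⟨h, hh, hfg⟩ := hsub 0 T hT hT2 f g B B' hf hg (by rwa [zero_add]) (by rwa [zero_add])
    rw [zero_add] at hfg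
    have huv : Set.EqOn (u - v) (fun t ↦ Kawahara.dst s (P.at_ t h)) (Set.Icc 0 T) := fun t ht ↦ by
      rw [Pi.sub_apply, hfu u hu ht, hgu v hv ht]
      simp only
      rw [← map_sub, ← map_sub, P.at_eq_of_ae (f := f - g) (g := h)]
      filter_upwards [hfg, P.ae_kf_sub f g] with ξ h1 h2
      rw [h2, h1 t ht]
    have hh' : ‖h‖ₑ ≤ 20 * ‖B - B'‖ₑ := by
      simp only [enorm_eq_nnnorm]
      exact_mod_cast hh
    rw [Kawahara.hsNorm_dst_sub]
    refine ⟨fun t ht ↦ ?_, ?_⟩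
    · have ha : ‖P.at_ t h‖ₑ ≤ Kawahara.Par.embC.toNNReal * ‖h‖ₑ := by
        simp only [enorm_eq_nnnorm]
        have := P.norm_at_le t h
        rw [← Real.coe_toNNReal _ Kawahara.Par.embC_nonneg] at this
        exact_mod_cast this
      have := huv ht
      rw [Pi.sub_apply] at this
      rw [this, Kawahara.hsNorm_dst]
      calc ‖P.at_ t h‖ₑ ≤ Kawahara.Par.embC.toNNReal * (20 * ‖B - B'‖ₑ) := by
            refine ha.trans ?_
            gcongr
        _ ≤ (C + Kawahara.Par.embC.toNNReal) * (20 * ‖B - B'‖ₑ) := by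
            gcongr
            exact le_add_self
        _ = _ := by push_cast; ring
    · refine (Kawahara.xsbNormOn_le (hβ := hβ) (hs := hs)
        (huv.mono Set.Ioo_subset_Icc_self)).trans ((hC h).trans ?_)
      calc C * ‖h‖ₑ ≤ (C + Kawahara.Par.embC.toNNReal) * (20 * ‖B - B'‖ₑ) := by
            gcongr
            exact le_self_add
        _ = _ := by push_cast; ring
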